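/- **Setting.** Let $G$ be a finite planar graph (multiple edges allowed) with vertex set $V$ and edge set $E$. Draw $G$ in the plane $\mathbb{R}^2\subset S^2$ with each vertex $v$ replaced by a round closed disk $D(v)$, the disks being pairwise disjoint, and each edge $e=(v_1,v_2)$ drawn as a smooth embedded arc $C(e)$ from an interior point of $D(v_1)$ to an interior point of $D(v_2)$, the arcs being pairwise disjoint; each arc meets the disks exactly in an initial segment in $D(v_1)$ and a final segment in $D(v_2)$ and crosses the two boundary circles transversally there, so that shrinking each disk to a point gives back the embedded graph $G$. Decompose $S^3$ into two balls $B_+$, $B_-$ with common boundary $S^2$, and let $C_\pm(e)\subset B_\pm$ be the arc obtained from $C(e)$ by pushing its interior vertically into the interior of $B_\pm$. The *flat fully augmented chainmail link* of $G$ is $$L=\bigcup_{v\in V}\partial D(v)\ \cup\ \bigcup_{e\in E}\bigl(C_+(e)\cup C_-(e)\bigr)\subset S^3 .$$ The components $\partial D(v)$ are the *vertex loops*. The components $C_+(e)\cup C_-(e)=\partial D(e)$, where $D(e)$ is the vertical disk over and under $C(e)$, are the *edge loops*. A *meridian–longitude pair* $(\mu,\lambda)$ of a component $K$ of $L$ consists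 of the elements of $\pi_1(S^3\setminus L)$ given by the meridian and the (null-homologous in $S^3\setminus K$) longitude on the boundary of a small tubular neighbourhood of $K$, based at a common point and joined to the base point by one and the same path; the longitude is parallel to $K$ with its orientation and the meridian has linking number $+1$ with $K$. The pair is determined by $K$ up to simultaneous conjugation and simultaneous inversion. A *left total preorder* on a group $\Gamma$ is a reflexive, transitive and total relation $\le$ with $x\le y\Rightarrow gx\le gy$ for all $g,x,y\in\Gamma$. Its *residue group* is $\{g: 1\le g\le 1\}$, and $\le$ is *proper* if its residue group is not all of $\Gamma$. Let $\mu,\lambda\in\Gamma$ commute. A slope $[x:y]\in\mathbb{RP}^1$ is *weakly $\le$-detected* with respect to $(\mu,\lambda)$ if $\mu^{p_2}\lambda^{q_2}\ge 1$ for all integers $p_1,q_1,p_2,q_2$ with $\mu^{p_1}\lambda^{q_1}\ge 1$ and $(p_1y-q_1x)(p_2y-q_2x)>0$. For coprime integers $p,q$, the slope $[p:q]$ is *strongly $\le$-detected* with respect to $(\mu,\lambda)$ if every conjugate of $\mu^p\lambda^q$ lies in the residue group of $\le$. The slope $[x:y]$ is *positive* (*negative*) if $xy>0$ ($xy<0$),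 and the slope $0$ is $[0:1]$. **Theorem.** Let $G$, $V$, $E$ and $L$ be as above, let $V_+\subseteq V$ be a set of vertices that meets every connected component of $G$, and let $v_o\in V_+$. Then there is no proper left total preorder $\le$ on $\pi_1(S^3\setminus L)$ such that all of the following hold: (a) for every edge $e\in E$ and every conjugate of a meridian–longitude pair of the edge loop $\partial D(e)$, a negative slope is weakly $\le$-detected; (b) for every vertex $v\in V\setminus V_+$ and a meridian–longitude pair of $\partial D(v)$, the slope $0$ is strongly $\le$-detected; (c) for every vertex $v\in V_+\setminus\{v_o\}$ and every conjugate of a meridian–longitude pair of $\partial D(v)$, a positive slope is weakly $\le$-detected; (d) with respect to a meridian–longitude pair of $\partial D(v_o)$, a positive slope is weakly $\le$-detected. (In (a) and (c) the detected slope may depend on the conjugate.) -/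

import Mathlib

open scoped ContDiff unitInterval

noncomputable section

/-! ### Left total preorders and detection of slopes -/

/-- A left total preorder on a group: a reflexive, transitive and total relation (antisymmetry is
not required) which is invariant under left multiplication. -/
structure IsLeftTotalPreorder {Γ : Type*} [Group Γ] (le : Γ → Γ → Prop) : Prop where
  refl : ∀ x, le x x
  trans : ∀ x y z, le x y → le y z → le x z
  total : ∀ x y, le x y ∨ le y x
  mul_left : ∀ g x y, le x y → le (g * x) (g * y)

/-- The residue group of a left total preorder (as a set): the elements equivalent to `1`. -/
def residueSet {Γ : Type*} [Group Γ] (le : Γ → Γ → Prop) : Set Γ :=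
  {g | le 1 g ∧ le g 1}

/-- A left total preorder is proper if it is not the trivial relation, that is, if its residue
group is not the whole group. -/
def IsProperRel {Γ : Type*} [Group Γ] (le : Γ → Γ → Prop) : Prop :=
  residueSet le ≠ Set.univ

/-- The slope with real homogeneous coordinates `[x : y]` (not both zero) is weakly detected by
`le` with respect to `(m, l)`. -/
def WeaklyDetects {Γ : Type*} [Group Γ] (le : Γ → Γ → Prop) (m l : Γ) (x y : ℝ) : Prop :=
  ∀ p₁ q₁ p₂ q₂ : ℤ, le 1 (m ^ p₁ * l ^ q₁) →
    0 < ((p₁ : ℝ) * y - (q₁ : ℝ) * x) * ((p₂ : ℝ) * y - (q₂ : ℝ) * x) →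
    le 1 (m ^ p₂ * l ^ q₂)

/-- Some positive slope is weakly detected: `[x : y]` is positive if `x / y > 0`. -/
def WeaklyDetectsPositive {Γ : Type*} [Group Γ] (le : Γ → Γ → Prop) (m l : Γ) : Prop :=
  ∃ x y : ℝ, 0 < x * y ∧ WeaklyDetects le m l x y

/-- Some negative slope is weakly detected: `[x : y]` is negative if `x / y < 0`. -/
def WeaklyDetectsNegative {Γ : Type*} [Group Γ] (le : Γ → Γ → Prop) (m l : Γ) : Prop :=
  ∃ x y : ℝ, x * y < 0 ∧ WeaklyDetects le m l x y

/-- The slope `[p : q]`, for coprime integers `p` and `q`, is strongly detected by `le` with respect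
to `(m, l)`: all conjugates of `m ^ p * l ^ q` lie in the residue group. -/
def StronglyDetects {Γ : Type*} [Group Γ] (le : Γ → Γ → Prop) (m l : Γ) (p q : ℤ) : Prop :=
  ∀ g : Γ, g * (m ^ p * l ^ q) * g⁻¹ ∈ residueSet le

/-! ### The three-sphere -/

/-- The three-sphere as the one-point compactification of `ℝ³ = ℂ × ℝ`. The plane of projection is
`ℂ × {0}` and the orientation is the standard one (`1`, `i`, upwards). -/
abbrev ThreeSphere : Type := OnePoint (ℂ × ℝ)

/-- `ThreeSphere` is the standard unit sphere of `ℝ⁴`. -/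
theorem threeSphere_homeomorph :
    Nonempty (ThreeSphere ≃ₜ Metric.sphere (0 : EuclideanSpace ℝ (Fin 4)) 1) := by
  have h1 : Module.finrank ℝ (EuclideanSpace ℝ (Fin 3)) = Module.finrank ℝ (ℂ × ℝ) := by
    simp
  let e : EuclideanSpace ℝ (Fin 3) ≃L[ℝ] (ℂ × ℝ) := ContinuousLinearEquiv.ofFinrankEq h1
  let f : EuclideanSpace ℝ (Fin 3) ≃L[ℝ] (Fin 3 → ℝ) := EuclideanSpace.equiv (Fin 3) ℝ
  have h2 : Module.finrank ℝ (Fin 3 → ℝ) + 1 = Fintype.card (Fin 4) := by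
    simp
  exact ⟨((e.symm.trans f).toHomeomorph.onePointCongr).trans
    (onePointEquivSphereOfFinrankEq h2)⟩

/-! ### Plane graphs and their flat fully augmented chainmail links -/

/-- A drawing in the plane `ℂ` of a planar graph with vertex set `V` and edge set `E` (multiple
edges are allowed; the edges are given arbitrary orientations). Every vertex `v` is drawn as a round
closed disk `D(v)`; these disks are pairwise disjoint. Every edge `e` is drawn as a smooth embedded
arc `C(e)`, the image of `[0, 1]` under `curve e`, from a point in the interior of `D(source e)` to
a point in the interior of `D(target e)`; these arcs are pairwise disjoint. The arc `C(e)` meets the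
vertex disks exactly in an initial segment contained in `D(source e)` and a final segment contained
in `D(target e)`, and it crosses their boundary circles transversally, so that shrinking every disk
to a point turns the disks and arcs into an embedding of the graph in the plane. -/
structure PlaneDrawing (V E : Type*) where
  source : E → V
  target : E → V
  center : V → ℂ
  radius : V → ℝ
  radius_pos : ∀ v, 0 < radius v
  disk_disjoint : ∀ v w, v ≠ w →
    Disjoint (Metric.closedBall (center v) (radius v)) (Metric.closedBall (center w) (radius w))
  curve : E → ℝ → ℂ
  curve_smooth : ∀ e, ContDiff ℝ ∞ (curve e)
  curve_deriv_ne_zero : ∀ e, ∀ t ∈ I, deriv (curve e) t ≠ 0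
  curve_injOn : ∀ e, Set.InjOn (curve e) I
  curve_disjoint : ∀ e f, e ≠ f → Disjoint (curve e '' I) (curve f '' I)
  /-- the time at which `C(e)` leaves the disk of its source -/
  exitTime : E → ℝ
  /-- the time at which `C(e)` enters the disk of its target -/
  enterTime : E → ℝ
  exitTime_pos : ∀ e, 0 < exitTime e
  exitTime_lt_enterTime : ∀ e, exitTime e < enterTime e
  enterTime_lt_one : ∀ e, enterTime e < 1
  mem_closedBall_iff : ∀ e v, ∀ t ∈ I,
    (curve e t ∈ Metric.closedBall (center v) (radius v) ↔
      (v = source e ∧ t ≤ exitTime e) ∨ (v = target e ∧ enterTime e ≤ t))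
  mem_ball_iff : ∀ e v, ∀ t ∈ I,
    (curve e t ∈ Metric.ball (center v) (radius v) ↔
      (v = source e ∧ t < exitTime e) ∨ (v = target e ∧ enterTime e < t))
  transverse_exit : ∀ e,
    0 < inner ℝ (curve e (exitTime e) - center (source e)) (deriv (curve e) (exitTime e))
  transverse_enter : ∀ e,
    inner ℝ (curve e (enterTime e) - center (target e)) (deriv (curve e) (enterTime e)) < 0

namespace PlaneDrawing

variable {V E : Type*} (D : PlaneDrawing V E)

/-- The relation of being joined by an edge, as a simple graph; it has the same connected
components as the (multi)graph that is drawn. -/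
def graph : SimpleGraph V :=
  SimpleGraph.fromRel fun v w => ∃ e, D.source e = v ∧ D.target e = w

/-- The vertex loop `∂D(v)`, in the plane of projection. -/
def vertexLoop (v : V) : Set (ℂ × ℝ) :=
  Metric.sphere (D.center v) (D.radius v) ×ˢ {0}

/-- The edge loop `∂D(e) = C₊(e) ∪ C₋(e)`: the arcs `C₊(e)` and `C₋(e)` are obtained by pushing the
interior of the arc `C(e)` vertically above and below the plane of projection. -/
def edgeLoop (e : E) : Set (ℂ × ℝ) :=
  (fun t : ℝ => (D.curve e t, √(t * (1 - t)))) '' I ∪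
    (fun t : ℝ => (D.curve e t, -√(t * (1 - t)))) '' I

/-- The flat fully augmented chainmail link, as a subset of `ℂ × ℝ = ℝ³`. -/
def link : Set (ℂ × ℝ) :=
  (⋃ v, D.vertexLoop v) ∪ ⋃ e, D.edgeLoop e

/-- The complement of the link in the three-sphere. -/
def exterior : Set ThreeSphere :=
  ((fun p : ℂ × ℝ => (p : ThreeSphere)) '' D.link)ᶜ

/-- Tubes around the components of the link. For a vertex `v` (`Sum.inl v`) or an edge `e`
(`Sum.inr e`), `D.tube c δ s θ` is a point of the boundary torus of the tube of radius `δ` around the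
component, where `s` (along the meridians) and `θ` (along the longitudes) are angles measured in full
turns. At `δ = 0` it parametrizes the component, in the direction of increasing `θ`.

Vertex loops run counterclockwise and bound the flat disk `D(v)`. Edge loops run so that they cross
`D(source e)` upwards, and they bound the vertical disk `D(e)` above and below `C(e)`; the vector
`I * deriv (D.curve e) t` is normal to `D(e)`, on the left of `C(e)`. For `s = 0` the point lies on
this disk, so the curve `s = 0` is the longitude (the parallel along a spanning disk); a curve of
constant `θ` is a meridian, which for `s = 0` crosses the disk in the direction of its positive
normal, so it has linking number `+1` with the component. -/
def tube : V ⊕ E → ℝ → ℝ → ℝ → ℂ × ℝ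
  | Sum.inl v, δ, s, θ =>
      (D.center v + ((D.radius v - δ * Real.cos (2 * Real.pi * s) : ℝ) : ℂ) *
          ((Real.cos (2 * Real.pi * θ) : ℂ) + (Real.sin (2 * Real.pi * θ) : ℂ) * Complex.I),
        δ * Real.sin (2 * Real.pi * s))
  | Sum.inr e, δ, s, θ =>
      let ρ : ℝ := 1 / 2 - δ * Real.cos (2 * Real.pi * s)
      let t : ℝ := 1 / 2 + ρ * Real.cos (2 * Real.pi * θ)
      (D.curve e t + ((δ * Real.sin (2 * Real.pi * s) : ℝ) : ℂ) *
          (Complex.I * deriv (D.curve e) t),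
        -(ρ * Real.sin (2 * Real.pi * θ)))

theorem continuous_tube (c : V ⊕ E) (δ : ℝ) :
    Continuous fun z : ℝ × ℝ => D.tube c δ z.1 z.2 := by
  cases c with
  | inl v =>
    simp only [tube]
    fun_prop
  | inr e =>
    have h1 : Continuous (D.curve e) := (D.curve_smooth e).continuous
    have h2 : Continuous (deriv (D.curve e)) :=
      (D.curve_smooth e).continuous_deriv (by simp)
    simp only [tube]
    fun_prop

theorem tube_one_left (c : V ⊕ E) (δ θ : ℝ) : D.tube c δ 1 θ = D.tube c δ 0 θ := by
  cases c <;> simp [tube]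

theorem tube_one_right (c : V ⊕ E) (δ s : ℝ) : D.tube c δ s 1 = D.tube c δ s 0 := by
  cases c <;> simp [tube]

/-- The tube of radius `δ` around the component `c` meets the link only in its core. -/
def IsTubeRadius (c : V ⊕ E) (δ : ℝ) : Prop :=
  0 < δ ∧ ∀ ε, 0 < ε → ε ≤ δ → ∀ s θ, D.tube c ε s θ ∉ D.link

variable {D}

theorem IsTubeRadius.mem_exterior {c : V ⊕ E} {δ : ℝ} (h : D.IsTubeRadius c δ) (s θ : ℝ) :
    ((D.tube c δ s θ : ℂ × ℝ) : ThreeSphere) ∈ D.exterior := by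
  rintro ⟨p, hp, hpe⟩
  have hq : p = D.tube c δ s θ := OnePoint.coe_injective hpe
  exact h.2 δ h.1 le_rfl s θ (hq ▸ hp)

/-- The boundary torus of a tube, as a map to the link exterior. -/
def IsTubeRadius.torus {c : V ⊕ E} {δ : ℝ} (h : D.IsTubeRadius c δ) (s θ : ℝ) : D.exterior :=
  ⟨((D.tube c δ s θ : ℂ × ℝ) : ThreeSphere), h.mem_exterior s θ⟩

theorem IsTubeRadius.continuous_torus {c : V ⊕ E} {δ : ℝ} (h : D.IsTubeRadius c δ) :
    Continuous fun z : ℝ × ℝ => h.torus z.1 z.2 :=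
  (OnePoint.continuous_coe.comp (D.continuous_tube c δ)).subtype_mk _

/-- The meridian on the boundary torus of a tube. -/
def IsTubeRadius.meridian {c : V ⊕ E} {δ : ℝ} (h : D.IsTubeRadius c δ) :
    Path (h.torus 0 0) (h.torus 0 0) where
  toFun s := h.torus s 0
  continuous_toFun :=
    h.continuous_torus.comp (f := fun s : I => ((s : ℝ), (0 : ℝ))) (by fun_prop)
  source' := rfl
  target' := by simp [IsTubeRadius.torus, tube_one_left]

/-- The longitude on the boundary torus of a tube. -/
def IsTubeRadius.longitude {c : V ⊕ E} {δ : ℝ} (h : D.IsTubeRadius c δ) :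
    Path (h.torus 0 0) (h.torus 0 0) where
  toFun θ := h.torus 0 θ
  continuous_toFun :=
    h.continuous_torus.comp (f := fun θ : I => ((0 : ℝ), (θ : ℝ))) (by fun_prop)
  source' := rfl
  target' := by simp [IsTubeRadius.torus, tube_one_right]

variable (D)

/-- `(m, l)` is a meridian-longitude pair of the component `c` in the group of the link: the meridian
and the longitude on the boundary torus of a tube around `c`, both joined to the base point by the
same path `w`. -/
def IsMeridianLongitudePair (c : V ⊕ E) (x₀ : D.exterior)
    (m l : FundamentalGroup D.exterior x₀) : Prop :=
  ∃ (δ : ℝ) (h : D.IsTubeRadius c δ) (w : Path x₀ (h.torus 0 0)),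
    m = FundamentalGroup.fromPath
      (Path.Homotopic.Quotient.mk ((w.trans h.meridian).trans w.symm)) ∧
    l = FundamentalGroup.fromPath
      (Path.Homotopic.Quotient.mk ((w.trans h.longitude).trans w.symm))

end PlaneDrawing

end

/-! All loops are based at infinity. The objects compared are the arrows `h` from infinity to the
base point in the fundamental groupoid, called states below, with `h ≤ k` when `1 ≤ Groupoid.inv h ≫
k` (`homPreorder`). This preorder is total, and composition on the side of infinity preserves it.
Two kinds of loops at infinity generate the group (`IsStab.all`): `cross b` passes between the upper
and the lower arc of the edge of the dart `b`, and `drop z` passes vertically through the plane at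
`z`, so that it depends only on the component of `z` in the complement of the projection. The
meridian of an edge loop is a crossing, and its longitude is the quotient of the drops through the
disks at its two ends. The meridian of a vertex loop is the quotient of the drops just outside and
just inside the disk, and its longitude is the product of the crossings of all darts at the vertex.

Moving a state through the disk of a vertex gives the potential of the vertex, and moving it through
a face gives the level of a corner. A negative slope on an edge loop then says that crossing a dart
does not lower the state exactly when the potential of the head is at most that of the tail. A
positive slope on a vertex loop says that the level of a corner is at least the potential exactly
when a full clockwise turn does not lower the state. A strongly detected slope 0 says that full
turns do nothing. The relation `cross_comp_drop` carries the comparison of level and potential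
across a dart. `ActingMap` records this structure; its planarity axiom is a separation statement in
the manner of Jordan (`not_cornerLinked`).

The combinatorial heart is `fill`. Take a closed contour along which one crosses darts with the
corner above the vertex, and along which the state may otherwise only go down. If every crossing is
strictly decreasing, the contour cannot close up unless it is empty. Otherwise some crossing does
not lower the state, so the potential at the other end of that edge is not larger, and the contour
can be pushed across that end (`fill_of_mem`); if it already crosses the edge from the other side,
planarity cuts it into two contours (`fill_of_chord`). By induction every inequality is an
equivalence, and the states define a function on the faces compatible with all crossings.

Applied to the circle around a root vertex this gives `rigid`. On a face of maximal state the
potentials cannot increase from one dart to the next; since the face closes up they are all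
equivalent, so all neighbouring faces are maximal too. Hence one state is fixed by every crossing of
the component. With the vertex condition at the root, all potentials and levels agree at this state
(`rigid_of_balanced`, where the opposite order treats the case of a level below the potential).

The state `h₀` supplied by the vertex `vo` is therefore fixed by all crossings in its component. In
the other components a vertex of `Vplus` serves as root for the same `h₀`, because there the slope
condition holds for every conjugate. Crossing arcs and circles does not change the effect of a drop
on `h₀` (`eq_of_sides`), and far away a drop is trivial; so all generators fix the class of `h₀`.
The residue group is then everything, against properness. -/

/-- Two elements of a preorder are equivalent. -/
def OrdEquiv {O : Type*} [Preorder O] (a b : O) : Prop := a ≤ b ∧ b ≤ a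

namespace OrdEquiv

variable {O : Type*} [Preorder O] {a b c : O}

theorem refl (a : O) : OrdEquiv a a := ⟨le_rfl, le_rfl⟩
theorem symm (h : OrdEquiv a b) : OrdEquiv b a := ⟨h.2, h.1⟩
theorem trans (h : OrdEquiv a b) (h' : OrdEquiv b c) : OrdEquiv a c := ⟨h.1.trans h'.1, h'.2.trans h.2⟩
theorem map {O' : Type*} [Preorder O'] {f : O → O'} (hf : Monotone f) (h : OrdEquiv a b) :
    OrdEquiv (f a) (f b) := ⟨hf h.1, hf h.2⟩

end OrdEquiv

/-! ### Planar rotation systems acting on a preorder -/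

/-- Vertices `u` and `v` are joined by a walk along the darts of `S`. -/
def DartLinked {V B : Type*} (α : B → B) (vtx : B → V) (S : Set B) : V → V → Prop :=
  Relation.EqvGen fun u v => ∃ x ∈ S, vtx x = u ∧ vtx (α x) = v

/-- The corners `x` and `y` are joined by moving inside faces and around vertices, without crossing
the darts of `S` or the edge of `b`. -/
def CornerLinked {B : Type*} (ν : Equiv.Perm B) (α : B → B) (S : Set B) (b : B) : B → B → Prop :=
  Relation.EqvGen fun x y => y = ν (α x) ∨ (y = ν x ∧ x ∉ S ∧ x ≠ b ∧ x ≠ α b)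

/-- A planar rotation system acting on a preorder `O`: crossing the dart `b` clockwise is the order
automorphism `X b`; the potentials of the vertices and the levels of the corners have values in
`O'`. The corner with index `b` lies between `ν⁻¹ b` and `b`. -/
structure ActingMap (V B O O' : Type*) [Preorder O] [Preorder O'] where
  ν : Equiv.Perm B
  α : B → B
  vtx : B → V
  X : B → O ≃o O
  pot : V → O → O'
  lev : B → O → O'
  α_α : ∀ b, α (α b) = b
  α_ne : ∀ b, α b ≠ b
  vtx_ν : ∀ b, vtx (ν b) = vtx b
  exists_iterate : ∀ x y, vtx x = vtx y → ∃ k : ℕ, ν^[k] x = y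
  X_α : ∀ b, X (α b) = (X b).symm
  lev_face : ∀ b, lev (ν (α b)) = lev b
  pot_mono : ∀ v, Monotone (pot v)
  lev_mono : ∀ b, Monotone (lev b)
  transport : ∀ b h, pot (vtx b) h ≤ lev (ν b) h ↔ pot (vtx b) (X b h) ≤ lev b (X b h)
  transport_ge : ∀ b h, lev (ν b) h ≤ pot (vtx b) h ↔ lev b (X b h) ≤ pot (vtx b) (X b h)
  edge : ∀ b h, h ≤ X b h ↔ pot (vtx (α b)) h ≤ pot (vtx b) h
  planar : ∀ (S : Set B) (b : B), (∀ x ∈ S, α x ∈ S) → b ∉ S →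
    DartLinked α vtx S (vtx b) (vtx (α b)) → ¬ CornerLinked ν α S b b (ν b)

namespace ActingMap

variable {V B O O' : Type*} [Preorder O] [Preorder O'] (M : ActingMap V B O O')

/-- The vertex potential is at most the level of the corner. -/
def Up (b : B) (h : O) : Prop := M.pot (M.vtx b) h ≤ M.lev b h

/-- Equality of faces of corners. -/
def SameFace : B → B → Prop := Relation.EqvGen fun x y => y = M.ν (M.α x)

variable {M} in
theorem SameFace.eq {β : Type*} {f : B → β} (hf : ∀ x, f (M.ν (M.α x)) = f x) {x y : B}
    (h : M.SameFace x y) : f x = f y := by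
  induction h with
  | rel x y h => rw [h, hf]
  | refl => rfl
  | symm _ _ _ ih => exact ih.symm
  | trans _ _ _ _ _ ih ih' => exact ih.trans ih'

variable {M} in
theorem SameFace.symm {x y : B} (h : M.SameFace x y) : M.SameFace y x := Relation.EqvGen.symm _ _ h

variable {M} in
theorem SameFace.trans {x y z : B} (h : M.SameFace x y) (h' : M.SameFace y z) : M.SameFace x z :=
  Relation.EqvGen.trans _ _ _ h h'

theorem sameFace_refl (x : B) : M.SameFace x x := Relation.EqvGen.refl x

theorem sameFace_next (x : B) : M.SameFace x (M.ν (M.α x)) := Relation.EqvGen.rel _ _ rfl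

theorem sameFace_α (x : B) : M.SameFace (M.α x) (M.ν x) := by
  have := M.sameFace_next (M.α x)
  rwa [M.α_α] at this

/-! ### Contours -/

/-- A contour: from the state `t` in the face of the corner `x`, one crosses the darts of the list
clockwise, in states where the corner lies above the vertex; between the crossings the state may
only go down. -/
def Chain : B → O → List (B × O) → B → O → Prop
  | x, t, [], y, t' => M.SameFace x y ∧ t' ≤ t
  | x, t, p :: l, y, t' => M.SameFace x (M.ν p.1) ∧ p.2 ≤ t ∧ M.Up (M.ν p.1) p.2 ∧
      Chain p.1 (M.X p.1 p.2) l y t'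

variable {M}

theorem Chain.append {x y z : B} {t u w : O} {l l' : List (B × O)} (h : M.Chain x t l y u)
    (h' : M.Chain y u l' z w) : M.Chain x t (l ++ l') z w := by
  induction l generalizing x t with
  | nil =>
    cases l' with
    | nil => exact ⟨h.1.trans h'.1, h'.2.trans h.2⟩
    | cons p l' => exact ⟨h.1.trans h'.1, h'.2.1.trans h.2, h'.2.2⟩
  | cons p l ih => exact ⟨h.1, h.2.1, h.2.2.1, ih h.2.2.2⟩

theorem Chain.split {x z : B} {t w : O} {l l' : List (B × O)} (h : M.Chain x t (l ++ l') z w) :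
    ∃ y u, M.Chain x t l y u ∧ M.Chain y u l' z w := by
  induction l generalizing x t with
  | nil => exact ⟨x, t, ⟨M.sameFace_refl x, le_rfl⟩, h⟩
  | cons p l ih =>
    obtain ⟨y, u, h1, h2⟩ := ih h.2.2.2
    exact ⟨y, u, ⟨h.1, h.2.1, h.2.2.1, h1⟩, h2⟩

theorem Chain.weaken {x y y' : B} {t u u' : O} {l : List (B × O)} (h : M.Chain x t l y u)
    (hy : M.SameFace y y') (hu : u' ≤ u) : M.Chain x t l y' u' := by
  have := h.append (l' := []) (z := y') (w := u') ⟨hy, hu⟩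
  simpa using this

/-- Between crossings the state never rises, so strict drops accumulate. For a closed contour this
forces the list to be empty. -/
theorem Chain.lt_of_forall {x y : B} {t u : O} {l : List (B × O)} (h : M.Chain x t l y u)
    (hl : ∀ p ∈ l, M.X p.1 p.2 < p.2) : u ≤ t ∧ (l ≠ [] → u < t) := by
  induction l generalizing x t with
  | nil => exact ⟨h.2, fun h => (h rfl).elim⟩
  | cons p l ih =>
    have h1 := ih h.2.2.2 fun q hq => hl q (List.mem_cons_of_mem _ hq)
    have h2 := (h1.1.trans_lt (hl p List.mem_cons_self)).trans_le h.2.1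
    exact ⟨h2.le, fun _ => h2⟩

/-- The values of `s` at the ends of the darts of the list agree with the states of the list. -/
def Matches (M : ActingMap V B O O') (s : B → O) (l : List (B × O)) : Prop :=
  ∀ p ∈ l, OrdEquiv (s (M.ν p.1)) p.2 ∧ OrdEquiv (s p.1) (M.X p.1 p.2)

/-- The end of a contour is compared with `s` through its last crossing; the assumption on the start
matters only if there is none. `Chain.first_le` is the mirror image at the first crossing. Together
they turn the inequalities between consecutive contours into equivalences. -/
theorem Chain.le_last {x y : B} {t u : O} {l : List (B × O)} {s : B → O}
    (hs : ∀ x, s (M.ν (M.α x)) = s x) (h : M.Chain x t l y u) (hm : M.Matches s l)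
    (ht : t ≤ s x) : u ≤ s y := by
  induction l generalizing x t with
  | nil => rw [← h.1.eq hs]; exact h.2.trans ht
  | cons p l ih =>
    exact ih h.2.2.2 (fun q hq => hm q (List.mem_cons_of_mem _ hq)) (hm p List.mem_cons_self).2.2

theorem Chain.first_le {x y : B} {t u : O} {l : List (B × O)} {s : B → O}
    (hs : ∀ x, s (M.ν (M.α x)) = s x) (h : M.Chain x t l y u) (hm : M.Matches s l)
    (hu : s y ≤ u) : s x ≤ t := by
  cases l with
  | nil => rw [h.1.eq hs]; exact hu.trans h.2
  | cons p l =>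
    rw [h.1.eq hs]
    exact (hm p List.mem_cons_self).1.1.trans h.2.1

/-- A property of faces that no crossed dart changes is constant along the contour. It places each
half of a cut contour on one side of the cut. -/
theorem Chain.forall_iff {x y : B} {t u : O} {l : List (B × O)} {Q : B → Prop}
    (hQ : ∀ x, Q (M.ν (M.α x)) = Q x) (h : M.Chain x t l y u)
    (hl : ∀ p ∈ l, Q (M.ν p.1) = Q p.1) : (∀ p ∈ l, Q p.1 = Q x) ∧ Q y = Q x := by
  induction l generalizing x t with
  | nil => exact ⟨by simp, (h.1.eq hQ).symm⟩
  | cons p l ih =>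
    have h1 : Q p.1 = Q x := by rw [← hl p List.mem_cons_self, ← h.1.eq hQ]
    obtain ⟨h2, h3⟩ := ih h.2.2.2 fun q hq => hl q (List.mem_cons_of_mem _ hq)
    refine ⟨fun q hq => ?_, h3.trans h1⟩
    rcases List.mem_cons.1 hq with rfl | hq
    · exact h1
    · exact (h2 q hq).trans h1

/-! ### Turning around a vertex -/

variable (M)

/-- The darts crossed by turning clockwise `n` times around the vertex, with the states. -/
def turns : ℕ → B → O → List (B × O)
  | 0, _, _ => []
  | n + 1, b, h => (M.ν.symm b, h) :: turns n (M.ν.symm b) (M.X (M.ν.symm b) h)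

/-- The state after turning clockwise `n` times around the vertex. -/
def turnState : ℕ → B → O → O
  | 0, _, h => h
  | n + 1, b, h => turnState n (M.ν.symm b) (M.X (M.ν.symm b) h)

theorem turnState_succ (n : ℕ) (b : B) (h : O) :
    M.turnState (n + 1) b h = M.X (M.ν.symm^[n + 1] b) (M.turnState n b h) := by
  induction n generalizing b h with
  | zero => rfl
  | succ n ih =>
    change M.turnState (n + 1) (M.ν.symm b) (M.X (M.ν.symm b) h) = _
    rw [ih]
    rfl

theorem map_turns (n : ℕ) (b : B) (h : O) :
    (M.turns n b h).map Prod.fst = (List.range n).map fun k => M.ν.symm^[k + 1] b := by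
  induction n generalizing b h with
  | zero => rfl
  | succ n ih =>
    rw [List.range_succ_eq_map]
    simp [turns, ih, Function.comp_def]

-- The axiom `transport` compares the corner before and the corner after a crossing with the same
-- vertex, so being up survives every step of a turn.
variable {M} in
theorem Up.turn {b : B} {h : O} (hu : M.Up b h) :
    M.Up (M.ν.symm b) (M.X (M.ν.symm b) h) := by
  have := M.transport (M.ν.symm b) h
  rw [Equiv.apply_symm_apply, ← M.vtx_ν, Equiv.apply_symm_apply] at this
  rw [Up, ← M.vtx_ν, Equiv.apply_symm_apply]
  exact this.1 hu

variable {M} in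
theorem Up.chain_turns {b : B} {h : O} (hu : M.Up b h) (n : ℕ) :
    M.Chain b h (M.turns n b h) (M.ν.symm^[n] b) (M.turnState n b h) := by
  induction n generalizing b h with
  | zero => exact ⟨M.sameFace_refl _, le_rfl⟩
  | succ n ih =>
    refine ⟨?_, le_rfl, ?_, ih hu.turn⟩
    · rw [Equiv.apply_symm_apply]; exact M.sameFace_refl _
    · simpa using hu

/-- The number of darts at the vertex of `b`. -/
noncomputable def deg (b : B) : ℕ := Function.minimalPeriod M.ν.symm b

/-- The effect of a full clockwise turn around the vertex of `b`, starting at the corner `b`. -/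
noncomputable def fullTurn (b : B) (h : O) : O := M.turnState (M.deg b) b h

theorem deg_pos [Finite B] (b : B) : 0 < M.deg b :=
  Function.minimalPeriod_pos_of_mem_periodicPts
    (Function.Injective.mem_periodicPts M.ν.symm.injective b)

theorem iterate_deg (b : B) : M.ν.symm^[M.deg b] b = b := Function.iterate_minimalPeriod

theorem vtx_iterate (n : ℕ) (b : B) : M.vtx (M.ν.symm^[n] b) = M.vtx b := by
  induction n generalizing b with
  | zero => rfl
  | succ n ih =>
    rw [Function.iterate_succ_apply, ih, ← M.vtx_ν, Equiv.apply_symm_apply]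

/-- The exponents run from 1 to the degree, as in `map_turns`: a turn starting at the corner `x`
first crosses the dart before `x` and crosses `x` itself last. -/
theorem exists_iterate_lt [Finite B] {x y : B} (h : M.vtx x = M.vtx y) :
    ∃ k < M.deg x, M.ν.symm^[k + 1] x = y := by
  obtain ⟨k, hk⟩ := M.exists_iterate y x h.symm
  have h1 : M.ν.symm^[k] x = y := by
    rw [← hk]
    exact Function.LeftInverse.iterate M.ν.symm_apply_apply k y
  have h0 := M.deg_pos x
  rw [← Function.iterate_mod_minimalPeriod_eq] at h1
  have hlt := Nat.mod_lt k h0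
  rcases Nat.eq_zero_or_pos (k % M.deg x) with h2 | h2
  · refine ⟨M.deg x - 1, by omega, ?_⟩
    rw [show M.deg x - 1 + 1 = M.deg x by omega, M.iterate_deg]
    change M.ν.symm^[k % M.deg x] x = y at h1
    rwa [h2] at h1
  · refine ⟨k % M.deg x - 1, by omega, ?_⟩
    rwa [Nat.sub_add_cancel h2]

theorem nodup_turns {n : ℕ} {b : B} (hn : n ≤ M.deg b) (h : O) :
    ((M.turns n b h).map Prod.fst).Nodup := by
  rw [map_turns]
  refine List.Nodup.map_on (fun i hi j hj hij => ?_) List.nodup_range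
  rw [List.mem_range] at hi hj
  have hij' : M.ν.symm^[i] b = M.ν.symm^[j] b := by
    rw [Function.iterate_succ_apply', Function.iterate_succ_apply'] at hij
    exact M.ν.symm.injective hij
  exact Function.iterate_injOn_Iio_minimalPeriod (Set.mem_Iio.2 (lt_of_lt_of_le hi hn))
    (Set.mem_Iio.2 (lt_of_lt_of_le hj hn)) hij'

theorem mem_turns_deg [Finite B] {b x : B} (h : O) :
    x ∈ (M.turns (M.deg b) b h).map Prod.fst ↔ M.vtx x = M.vtx b := by
  rw [map_turns]
  simp only [List.mem_map, List.mem_range]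
  constructor
  · rintro ⟨k, -, rfl⟩; exact M.vtx_iterate _ _
  · intro hx; exact M.exists_iterate_lt hx.symm

/-- Since `b` is the last dart of a full turn, stopping one step short omits exactly `b`. This is
the detour around the far end of an edge that replaces a crossing of the edge. -/
theorem mem_turns_pred [Finite B] {b x : B} (h : O) :
    x ∈ (M.turns (M.deg b - 1) b h).map Prod.fst ↔ M.vtx x = M.vtx b ∧ x ≠ b := by
  have h0 := M.deg_pos b
  rw [map_turns]
  simp only [List.mem_map, List.mem_range]
  constructor
  · rintro ⟨k, hk, rfl⟩
    refine ⟨M.vtx_iterate _ _, fun hb => ?_⟩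
    have h2 : k + 1 < M.deg b := by omega
    have := Function.IsPeriodicPt.minimalPeriod_le (f := M.ν.symm) (x := b) (n := k + 1)
      (Nat.succ_pos k) hb
    exact absurd this (not_le.2 h2)
  · rintro ⟨hx, hne⟩
    obtain ⟨k, hk, rfl⟩ := M.exists_iterate_lt hx.symm
    refine ⟨k, ?_, rfl⟩
    by_contra hk'
    have : k + 1 = M.deg b := by omega
    rw [this, M.iterate_deg] at hne
    exact hne rfl

theorem iterate_pred [Finite B] (b : B) : M.ν.symm^[M.deg b - 1] b = M.ν b := by
  have h0 := M.deg_pos b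
  apply M.ν.symm.injective
  rw [← Function.iterate_succ_apply' M.ν.symm, Nat.succ_eq_add_one, Nat.sub_add_cancel h0,
    M.iterate_deg, Equiv.symm_apply_apply]

theorem fullTurn_eq [Finite B] (b : B) (h : O) :
    M.fullTurn b h = M.X b (M.turnState (M.deg b - 1) b h) := by
  have h0 := M.deg_pos b
  have := M.turnState_succ (M.deg b - 1) b h
  rw [Nat.sub_add_cancel h0, M.iterate_deg] at this
  exact this

end ActingMap

/-! ### Regions bounded by contours -/

theorem DartLinked.mono {V B : Type*} {α : B → B} {vtx : B → V} {S S' : Set B} (h : S ⊆ S')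
    {u v : V} (hl : DartLinked α vtx S u v) : DartLinked α vtx S' u v :=
  Relation.EqvGen.mono (fun _ _ ⟨x, hx, h1⟩ => ⟨x, h hx, h1⟩) _ _ hl

namespace ActingMap

variable {V B O O' : Type*} [Preorder O] [Preorder O'] (M : ActingMap V B O O')

/-- Elementary moves between darts of the same component. -/
def Step (x y : B) : Prop := y = M.ν x ∨ x = M.ν y ∨ y = M.α x

/-- A region of the map: the darts `L` on its contour, and the darts `U` inside. -/
structure Region (L : List B) (U : Set B) : Prop where
  mem_ν : ∀ x, M.ν x ∈ U ↔ x ∈ U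
  mem_α : ∀ x, (x ∈ L ∨ x ∈ U) → (M.α x ∈ L ∨ M.α x ∈ U)
  nodup : L.Nodup
  notMem : ∀ x ∈ L, x ∉ U
  linked : ∀ x ∈ L, ∀ y ∈ L,
    DartLinked M.α M.vtx {z | z ∉ L ∧ z ∉ U} (M.vtx x) (M.vtx y)
  reach : ∀ x ∈ U, ∃ y ∈ L, Relation.ReflTransGen (fun x y => x ∈ U ∧ M.Step x y) x y

variable {M}

theorem mem_of_vtx_eq {U : Set B} (hI : ∀ x, M.ν x ∈ U ↔ x ∈ U) {x y : B}
    (h : M.vtx x = M.vtx y) (hx : x ∈ U) : y ∈ U := by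
  obtain ⟨k, rfl⟩ := M.exists_iterate x y h
  clear h
  induction k generalizing x with
  | zero => exact hx
  | succ k ih => rw [Function.iterate_succ_apply]; exact ih ((hI x).2 hx)

theorem Region.of_perm {L L' : List B} {U : Set B} (h : M.Region L U) (hp : L.Perm L') :
    M.Region L' U := by
  have hm : ∀ x, x ∈ L' ↔ x ∈ L := fun x => hp.mem_iff.symm
  refine ⟨h.mem_ν, ?_, hp.nodup_iff.1 h.nodup, ?_, ?_, ?_⟩
  · simpa only [hm] using h.mem_α
  · simpa only [hm] using h.notMem
  · simpa only [hm] using h.linked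
  · simpa only [hm] using h.reach

/-- Follow the old walk from `x` to the old contour: a step that leaves `U'` must land on `L'`, and
it must leave at some time because the old contour is disjoint from `U`. -/
theorem Region.reach_restrict {L L' : List B} {U U' : Set B} (h : M.Region L U)
    (h1 : U' ⊆ U) (h2 : ∀ x ∈ U', ∀ y, M.Step x y → (y ∈ L ∨ y ∈ U) → y ∈ L' ∨ y ∈ U') :
    ∀ x ∈ U', ∃ y ∈ L', Relation.ReflTransGen (fun x y => x ∈ U' ∧ M.Step x y) x y := by
  intro x hx
  obtain ⟨y, hy, hxy⟩ := h.reach x (h1 hx)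
  induction hxy using Relation.ReflTransGen.head_induction_on with
  | refl => exact (h.notMem y hy (h1 hx)).elim
  | @head x z hxz hzy ih =>
    have hz : z ∈ L ∨ z ∈ U := by
      rcases hxz.2 with h3 | h3 | h3
      · right; rw [h3, h.mem_ν]; exact hxz.1
      · right; rw [← h.mem_ν, ← h3]; exact hxz.1
      · rw [h3]; exact h.mem_α x (Or.inr hxz.1)
    rcases h2 x hx z hxz.2 hz with h4 | h4
    · exact ⟨z, h4, .single ⟨hx, hxz.2⟩⟩
    · obtain ⟨w, hw, hzw⟩ := ih h4
      exact ⟨w, hw, hzw.head ⟨hx, hxz.2⟩⟩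

/-- Cutting along the edge of `b`: since `Q` changes at most across this edge, the part of the
region where `Q` holds is bounded by the part of the contour where `Q` holds. Links between contour
vertices survive because more darts are now outside. It is applied to both sides of the cut. -/
theorem Region.restrict {L m : List B} {U : Set B} (h : M.Region L U) {b : B} (hb : b ∈ L)
    (hc : M.α b ∈ L) {Q : B → Prop}
    (hν : ∀ x, (x ∈ L ∨ x ∈ U) → x ≠ b → x ≠ M.α b → (Q (M.ν x) ↔ Q x))
    (hα : ∀ x, (x ∈ L ∨ x ∈ U) → x ≠ b → x ≠ M.α b → (Q (M.α x) ↔ Q x))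
    (hm : ∀ x, x ∈ m ↔ x ∈ L ∧ Q x ∧ x ≠ b ∧ x ≠ M.α b) (hnd : m.Nodup) :
    M.Region m {x | x ∈ U ∧ Q x} := by
  have hIb : ∀ x ∈ U, x ≠ b := fun x hx e => h.notMem b hb (e ▸ hx)
  have hIc : ∀ x ∈ U, x ≠ M.α b := fun x hx e => h.notMem _ hc (e ▸ hx)
  have key : ∀ x, (x ∈ m ∨ x ∈ {x | x ∈ U ∧ Q x}) ↔
      (x ∈ L ∨ x ∈ U) ∧ Q x ∧ x ≠ b ∧ x ≠ M.α b := by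
    intro x
    have := hIb x
    have := hIc x
    simp only [hm, Set.mem_ofPred_eq]
    tauto
  have hαkey : ∀ x, (x ∈ m ∨ x ∈ {x | x ∈ U ∧ Q x}) →
      (M.α x ∈ m ∨ M.α x ∈ {x | x ∈ U ∧ Q x}) := by
    intro x hx
    rw [key] at hx ⊢
    refine ⟨h.mem_α x hx.1, (hα x hx.1 hx.2.2.1 hx.2.2.2).2 hx.2.1, fun e => hx.2.2.2 ?_,
      fun e => hx.2.2.1 ?_⟩
    · rw [← e, M.α_α]
    · rw [← M.α_α x, e, M.α_α]
  have hνU : ∀ x, (M.ν x ∈ U ∧ Q (M.ν x)) ↔ (x ∈ U ∧ Q x) := by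
    intro x
    rw [h.mem_ν]
    exact and_congr_right fun hx => hν x (Or.inr hx) (hIb x hx) (hIc x hx)
  refine ⟨hνU, hαkey, hnd, fun x hx hxI => h.notMem x ((hm x).1 hx).1 hxI.1,
    fun x hx y hy => ?_, ?_⟩
  · refine (h.linked x ((hm x).1 hx).1 y ((hm y).1 hy).1).mono ?_
    rintro z ⟨h1, h2⟩
    exact ⟨fun h3 => h1 ((hm z).1 h3).1, fun h3 => h2 h3.1⟩
  · refine h.reach_restrict (fun x hx => hx.1) fun x hx y hxy _ => ?_
    rcases hxy with h3 | h3 | h3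
    · right; rw [h3]; exact (hνU x).2 hx
    · right; rw [h3] at hx; exact (hνU y).1 hx
    · rw [h3]; exact hαkey x (Or.inr hx)

theorem Step.symm {x y : B} (h : M.Step x y) : M.Step y x := by
  rcases h with h | h | h
  · exact Or.inr (Or.inl h)
  · exact Or.inl h
  · exact Or.inr (Or.inr (by rw [h, M.α_α]))

variable (M) in
/-- The darts of the component of `b`. -/
def component (b : B) : Set B := {x | Relation.ReflTransGen M.Step b x}

theorem mem_component_self (b : B) : b ∈ M.component b := Relation.ReflTransGen.refl

theorem mem_component_of_step {b x y : B} (hx : x ∈ M.component b) (h : M.Step x y) :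
    y ∈ M.component b := Relation.ReflTransGen.tail hx h

theorem mem_component_symm {b x : B} (hx : x ∈ M.component b) :
    Relation.ReflTransGen M.Step x b := by
  have : Std.Symm M.Step := ⟨fun _ _ => Step.symm⟩
  exact Relation.ReflTransGen.stdSymm.symm _ _ hx

theorem mem_component_of_vtx_eq {b x y : B} (hx : x ∈ M.component b) (h : M.vtx x = M.vtx y) :
    y ∈ M.component b :=
  mem_of_vtx_eq (fun _ => ⟨fun h => mem_component_of_step h (Or.inr (Or.inl rfl)),
    fun h => mem_component_of_step h (Or.inl rfl)⟩) h hx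

/-! ### Filling a contour -/

variable [Finite B]

/-- The far end of `b` is inside, and crossing `b` does not lower `h`. The contour is then pushed
over that far vertex: instead of `b` it crosses all other darts there. The new contour is allowed
because the full turn at the far vertex does not lower up states, and the region has lost the edge
of `b`. -/
theorem fill_of_mem {b : B} {h : O} {R : List (B × O)} {U : Set B} {n : ℕ}
    (ih : ∀ (L : List (B × O)) (U : Set B) (x₀ : B) (t₀ : O), M.Region (L.map Prod.fst) U →
      {x | x ∈ L.map Prod.fst ∨ x ∈ U}.ncard < n → M.Chain x₀ t₀ L x₀ t₀ →
      (∀ x ∈ U, ∀ h, M.Up x h → h ≤ M.fullTurn x h) →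
      ∃ s : B → O, (∀ x, s (M.ν (M.α x)) = s x) ∧ OrdEquiv (s x₀) t₀ ∧ M.Matches s L ∧
        ∀ x ∈ U, OrdEquiv (s x) (M.X x (s (M.ν x))))
    (hR : M.Region (((b, h) :: R).map Prod.fst) U)
    (hn : {x | x ∈ ((b, h) :: R).map Prod.fst ∨ x ∈ U}.ncard = n)
    (hup : M.Up (M.ν b) h) (hc : M.Chain b (M.X b h) R (M.α b) h) (hbh : h ≤ M.X b h)
    (hI : ∀ x ∈ U, ∀ h, M.Up x h → h ≤ M.fullTurn x h) (hαU : M.α b ∈ U) :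
    ∃ s : B → O, (∀ x, s (M.ν (M.α x)) = s x) ∧ M.Matches s ((b, h) :: R) ∧
        ∀ x ∈ U, OrdEquiv (s x) (M.X x (s (M.ν x))) := by
  obtain ⟨c, rfl⟩ : ∃ c, b = M.α c := ⟨M.α b, (M.α_α b).symm⟩
  rw [M.α_α] at hc hαU
  have hL : ∀ x, x ∈ ((M.α c, h) :: R).map Prod.fst ↔ x = M.α c ∨ x ∈ R.map Prod.fst := by
    intro x; simp only [List.map_cons, List.mem_cons]
  have hXc : ∀ t, M.X c (M.X (M.α c) t) = t := fun t => by rw [M.X_α]; simp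
  -- The corners `M.ν (M.α c)` and `c` lie in one face and have the same level, while by `edge` the
  -- potential at the vertex of `c` is at most the one at the other end.
  have hupc : M.Up c h := by
    have h1 := (M.edge (M.α c) h).1 hbh
    rw [M.α_α] at h1
    rw [Up, M.vtx_ν, M.lev_face] at hup
    exact h1.trans hup
  set Lq := M.turns (M.deg c - 1) c h with hLq
  have hLqm : ∀ x, x ∈ Lq.map Prod.fst ↔ M.vtx x = M.vtx c ∧ x ≠ c := fun x =>
    M.mem_turns_pred h
  have hft := hI c hαU h hupc
  rw [fullTurn_eq] at hft
  -- One step before closing, the turn reaches the corner `M.ν c`, in the face of `M.α c`. Undoing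
  -- the missing crossing of `c` in `h ≤ fullTurn` shows that its state is still at least `M.X (M.α
  -- c) h`.
  have hcq : M.Chain c h Lq (M.α c) (M.X (M.α c) h) := by
    have h1 := hupc.chain_turns (M.deg c - 1)
    rw [iterate_pred] at h1
    refine h1.weaken (M.sameFace_α c).symm ?_
    have := (M.X (M.α c)).monotone hft
    rwa [M.X_α, OrderIso.symm_apply_apply, ← M.X_α] at this
  have hvc : ∀ x, M.vtx x = M.vtx c → x ∈ U := fun x hx => mem_of_vtx_eq hR.mem_ν hx.symm hαU
  have hbL : M.α c ∉ U := hR.notMem _ ((hL _).2 (Or.inl rfl))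
  have hnd := hR.nodup
  simp only [List.map_cons, List.nodup_cons] at hnd
  have hRI : ∀ x ∈ R.map Prod.fst, x ∉ U := fun x hx => hR.notMem _ ((hL _).2 (Or.inr hx))
  have key : ∀ x, (x ∈ (R ++ Lq).map Prod.fst ∨ x ∈ {x | x ∈ U ∧ M.vtx x ≠ M.vtx c}) ↔
      (x ∈ ((M.α c, h) :: R).map Prod.fst ∨ x ∈ U) ∧ x ≠ M.α c ∧ x ≠ c := by
    intro x
    rw [List.map_append, List.mem_append, hL, hLqm]
    have h1 := hvc x
    have h2 := hRI x
    have h3 : x = M.α c → x ∉ R.map Prod.fst := fun e => e ▸ hnd.1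
    have h4 : x = c → x ∈ U := fun e => e ▸ hαU
    have h5 : x = M.α c → x ∉ U := fun e => e ▸ hbL
    have h6 : x = c → M.vtx x = M.vtx c := fun e => e ▸ rfl
    simp only [Set.mem_ofPred_eq]
    tauto
  have hαkey : ∀ x, (x ∈ (R ++ Lq).map Prod.fst ∨ x ∈ {x | x ∈ U ∧ M.vtx x ≠ M.vtx c}) →
      (M.α x ∈ (R ++ Lq).map Prod.fst ∨ M.α x ∈ {x | x ∈ U ∧ M.vtx x ≠ M.vtx c}) := by
    intro x hx
    rw [key] at hx ⊢
    refine ⟨hR.mem_α x hx.1, fun e => hx.2.2 ?_, fun e => hx.2.1 ?_⟩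
    · rw [← M.α_α x, e, M.α_α]
    · rw [← e, M.α_α]
  have hS : ∀ z, (z ∉ ((M.α c, h) :: R).map Prod.fst ∧ z ∉ U) →
      (z ∉ (R ++ Lq).map Prod.fst ∧ z ∉ {x | x ∈ U ∧ M.vtx x ≠ M.vtx c}) := by
    intro z hz
    have := key z
    tauto
  have hlk : ∀ x ∈ (R ++ Lq).map Prod.fst, DartLinked M.α M.vtx
      {z | z ∉ (R ++ Lq).map Prod.fst ∧ z ∉ {x | x ∈ U ∧ M.vtx x ≠ M.vtx c}}
      (M.vtx (M.α c)) (M.vtx x) := by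
    intro x hx
    rw [List.map_append, List.mem_append] at hx
    rcases hx with hx | hx
    · exact (hR.linked _ ((hL _).2 (Or.inl rfl)) x ((hL _).2 (Or.inr hx))).mono hS
    · rw [((hLqm x).1 hx).1]
      -- The edge of `c` is now outside the region and links the newly exposed vertex to the old
      -- contour.
      refine Relation.EqvGen.rel _ _ ⟨M.α c, ?_, rfl, by rw [M.α_α]⟩
      have := key (M.α c)
      simp only [Set.mem_ofPred_eq] at this ⊢
      tauto
  have hreg : M.Region ((R ++ Lq).map Prod.fst) {x | x ∈ U ∧ M.vtx x ≠ M.vtx c} := by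
    refine ⟨fun x => ?_, hαkey, ?_, fun x hx hxI => ?_, fun x hx y hy => ?_, ?_⟩
    · simp only [Set.mem_ofPred_eq, hR.mem_ν, M.vtx_ν]
    · rw [List.map_append, List.nodup_append]
      refine ⟨hnd.2, M.nodup_turns (Nat.sub_le _ _) h, fun x hx y hy e => ?_⟩
      subst e
      exact hRI x hx (hvc x ((hLqm x).1 hy).1)
    · rw [List.map_append, List.mem_append] at hx
      rcases hx with hx | hx
      · exact hRI x hx hxI.1
      · exact hxI.2 ((hLqm x).1 hx).1
    · exact (Relation.EqvGen.symm _ _ (hlk x hx)).trans _ _ _ (hlk y hy)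
    · refine hR.reach_restrict (fun x hx => hx.1) fun x hx y hxy _ => ?_
      rcases hxy with h3 | h3 | h3
      · right; rw [h3]; simpa only [Set.mem_ofPred_eq, hR.mem_ν, M.vtx_ν] using hx
      · right; rw [h3] at hx; simpa only [Set.mem_ofPred_eq, hR.mem_ν, M.vtx_ν] using hx
      · rw [h3]; exact hαkey x (Or.inr hx)
  obtain ⟨s, hs, hs0, hsL, hsI⟩ := ih (R ++ Lq) _ (M.α c) (M.X (M.α c) h) hreg (by
    rw [← hn]
    refine Set.ncard_lt_ncard ?_ (Set.toFinite _)
    refine ⟨fun x hx => ((key x).1 hx).1, fun hsub => ?_⟩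
    exact ((key _).1 (hsub (Or.inr hαU))).2.2 rfl) (hc.append hcq) fun x hx => hI x hx.1
  have hsR : M.Matches s R := fun p hp => hsL p (List.mem_append_left _ hp)
  have hsq : M.Matches s Lq := fun p hp => hsL p (List.mem_append_right _ hp)
  -- The two pieces meet in the face of `c` with state `h`: the detour bounds `s c` from above, the
  -- rest of the contour from below.
  have hsc : OrdEquiv (s c) h := ⟨hcq.first_le hs hsq hs0.1, hc.le_last hs hsR hs0.2⟩
  have hsν : s (M.ν (M.α c)) = s c := hs c
  have hsνc : s (M.ν c) = s (M.α c) := by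
    have := hs (M.α c); rwa [M.α_α] at this
  refine ⟨s, hs, fun p hp => ?_, fun x hx => ?_⟩
  · rcases List.mem_cons.1 hp with rfl | hp
    · exact ⟨hsν ▸ hsc, hs0⟩
    · exact hsR p hp
  · by_cases hxc : x = c
    · subst hxc
      rw [hsνc]
      have := hs0.map (M.X x).monotone
      rw [hXc] at this
      exact hsc.trans this.symm
    · by_cases hv : M.vtx x = M.vtx c
      · obtain ⟨p, hp, rfl⟩ := List.mem_map.1 ((hLqm x).2 ⟨hv, hxc⟩)
        exact (hsq p hp).2.trans ((hsq p hp).1.symm.map (M.X p.1).monotone)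
      · exact hsI x ⟨hx, hv⟩

/-- The contour crosses the edge of `b` twice, in opposite directions. Since the ends of the edge
are linked outside the region, planarity separates its two sides, and the contour falls into `m₁` on
the side of `b` and `m₂` on the other, each bounding a smaller region. One of them closes up by
totality; its filling gives the equality that lets the other close up too. -/
theorem fill_of_chord (tot : ∀ a b : O, a ≤ b ∨ b ≤ a) {b : B} {h : O} {R : List (B × O)}
    {U : Set B} {n : ℕ}
    (ih : ∀ (L : List (B × O)) (U : Set B) (x₀ : B) (t₀ : O), M.Region (L.map Prod.fst) U →
      {x | x ∈ L.map Prod.fst ∨ x ∈ U}.ncard < n → M.Chain x₀ t₀ L x₀ t₀ →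
      (∀ x ∈ U, ∀ h, M.Up x h → h ≤ M.fullTurn x h) →
      ∃ s : B → O, (∀ x, s (M.ν (M.α x)) = s x) ∧ OrdEquiv (s x₀) t₀ ∧ M.Matches s L ∧
        ∀ x ∈ U, OrdEquiv (s x) (M.X x (s (M.ν x))))
    (hR : M.Region (((b, h) :: R).map Prod.fst) U)
    (hn : {x | x ∈ ((b, h) :: R).map Prod.fst ∨ x ∈ U}.ncard = n)
    (hc : M.Chain b (M.X b h) R (M.α b) h)
    (hI : ∀ x ∈ U, ∀ h, M.Up x h → h ≤ M.fullTurn x h)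
    (hαR : M.α b ∈ R.map Prod.fst) :
    ∃ s : B → O, (∀ x, s (M.ν (M.α x)) = s x) ∧ M.Matches s ((b, h) :: R) ∧
        ∀ x ∈ U, OrdEquiv (s x) (M.X x (s (M.ν x))) := by
  obtain ⟨⟨c, k⟩, hk, hcb⟩ := List.mem_map.1 hαR
  obtain ⟨m₁, m₂, rfl⟩ := List.append_of_mem hk
  obtain ⟨y, u, h1, h2⟩ := hc.split
  change c = M.α b at hcb
  have hαc : M.α c = b := by rw [hcb, M.α_α]
  rw [← hcb] at hc h2 hαR
  obtain ⟨hyc, hku, -, hc₂⟩ := h2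
  change M.Chain c (M.X c k) m₂ c h at hc₂
  have hνc : M.SameFace (M.ν c) b := by
    have := M.sameFace_α c
    rw [hαc] at this
    exact this.symm
  have hc₁ : M.Chain b (M.X b h) m₁ b k := h1.weaken (hyc.trans hνc) hku
  have hXX : ∀ t, M.X c (M.X b t) = t := fun t => by rw [hcb, M.X_α]; simp
  set L := ((b, h) :: (m₁ ++ (c, k) :: m₂)).map Prod.fst with hLdef
  have hL : ∀ x, x ∈ L ↔ x = b ∨ x = c ∨ x ∈ m₁.map Prod.fst ∨ x ∈ m₂.map Prod.fst := by
    intro x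
    simp only [hLdef, List.map_cons, List.map_append, List.mem_cons, List.mem_append]
    tauto
  have hnd := hR.nodup
  simp only [hLdef, List.map_cons, List.map_append, List.nodup_cons, List.mem_append,
    List.mem_cons, List.nodup_append, not_or] at hnd
  obtain ⟨⟨hb1, hbc, hb2⟩, hnd1, ⟨hcm2, hnd2⟩, hdisj⟩ := hnd
  have hcm1 : c ∉ m₁.map Prod.fst := fun h => hdisj c h c (Or.inl rfl) rfl
  have hbL : b ∈ L := (hL b).2 (Or.inl rfl)
  have hcL : c ∈ L := (hL c).2 (Or.inr (Or.inl rfl))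
  set S : Set B := {z | z ∉ L ∧ z ∉ U} with hS
  -- `Q` marks the side of the corner `b`: what can be reached from it without crossing the edge of
  -- `b` or a dart outside the region.
  set Q : B → Prop := CornerLinked M.ν M.α S b b with hQ
  have hQb : Q b := Relation.EqvGen.refl _
  have hQf : ∀ x, Q (M.ν (M.α x)) = Q x := fun x => propext
    ⟨fun hx => hx.trans _ _ _ (Relation.EqvGen.symm _ _ (Relation.EqvGen.rel _ _ (Or.inl rfl))),
      fun hx => hx.trans _ _ _ (Relation.EqvGen.rel _ _ (Or.inl rfl))⟩
  have hQν : ∀ x, (x ∈ L ∨ x ∈ U) → x ≠ b → x ≠ c → (Q (M.ν x) ↔ Q x) := by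
    intro x hx hxb hxc
    have h3 : x = b ∨ x = c ∨ CornerLinked M.ν M.α S b x (M.ν x) := by
      right; right
      refine Relation.EqvGen.rel _ _ (Or.inr ⟨rfl, fun hxS => ?_, hxb, hcb ▸ hxc⟩)
      exact hx.elim hxS.1 hxS.2
    have h4 := (h3.resolve_left hxb).resolve_left hxc
    exact ⟨fun h5 => h5.trans _ _ _ (Relation.EqvGen.symm _ _ h4), fun h5 => h5.trans _ _ _ h4⟩
  have hQα : ∀ x, (x ∈ L ∨ x ∈ U) → x ≠ b → x ≠ c → (Q (M.α x) ↔ Q x) := by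
    intro x hx hxb hxc
    rw [← hQf (M.α x), M.α_α]
    exact hQν x hx hxb hxc
  -- Together with the link of its ends through outside darts, the edge of `b` closes a cycle, so
  -- the corner across `b` is on the other side.
  have hnQ : ¬ Q (M.ν b) := by
    refine M.planar S b (fun x hx => ?_) (fun hbS => hbS.1 hbL) ?_
    · have h3 := hR.mem_α (M.α x)
      rw [M.α_α] at h3
      exact ⟨fun h4 => (h3 (Or.inl h4)).elim hx.1 hx.2, fun h4 => (h3 (Or.inr h4)).elim hx.1 hx.2⟩
    · rw [← hcb]
      exact hR.linked b hbL c hcL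
  have hnQc : ¬ Q c := by
    rw [← hQf c, hαc]; exact hnQ
  have hQνc : Q (M.ν c) := by
    rw [hcb, hQf]; exact hQb
  have hm₁ : ∀ p ∈ m₁, p.1 ∈ L ∧ p.1 ≠ b ∧ p.1 ≠ c := fun p hp => by
    have hp' := List.mem_map_of_mem (f := Prod.fst) hp
    exact ⟨(hL _).2 (Or.inr (Or.inr (Or.inl hp'))), fun e => hb1 (e ▸ hp'),
      fun e => hcm1 (e ▸ hp')⟩
  have hm₂ : ∀ p ∈ m₂, p.1 ∈ L ∧ p.1 ≠ b ∧ p.1 ≠ c := fun p hp => by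
    have hp' := List.mem_map_of_mem (f := Prod.fst) hp
    exact ⟨(hL _).2 (Or.inr (Or.inr (Or.inr hp'))), fun e => hb2 (e ▸ hp'),
      fun e => hcm2 (e ▸ hp')⟩
  have hν₁ : ∀ p ∈ m₁, Q (M.ν p.1) = Q p.1 := fun p hp =>
    propext (hQν _ (Or.inl (hm₁ p hp).1) (hm₁ p hp).2.1 (hm₁ p hp).2.2)
  have hν₂ : ∀ p ∈ m₂, Q (M.ν p.1) = Q p.1 := fun p hp =>
    propext (hQν _ (Or.inl (hm₂ p hp).1) (hm₂ p hp).2.1 (hm₂ p hp).2.2)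
  have hQ₁ : ∀ p ∈ m₁, Q p.1 := fun p hp => by
    rw [(hc₁.forall_iff hQf hν₁).1 p hp]; exact hQb
  have hQ₂ : ∀ p ∈ m₂, ¬ Q p.1 := fun p hp => by
    rw [(hc₂.forall_iff hQf hν₂).1 p hp]; exact hnQc
  have hreg₁ : M.Region (m₁.map Prod.fst) {x | x ∈ U ∧ Q x} := by
    refine hR.restrict hbL (hcb ▸ hcL) (hcb ▸ hQν) (hcb ▸ hQα) (fun x => ?_) hnd1
    rw [← hcb, hL]
    constructor
    · intro hx
      obtain ⟨p, hp, rfl⟩ := List.mem_map.1 hx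
      exact ⟨Or.inr (Or.inr (Or.inl hx)), hQ₁ p hp, (hm₁ p hp).2⟩
    · rintro ⟨hx | hx | hx | hx, hxQ, hxb, hxc⟩
      · exact (hxb hx).elim
      · exact (hxc hx).elim
      · exact hx
      · obtain ⟨p, hp, rfl⟩ := List.mem_map.1 hx
        exact (hQ₂ p hp hxQ).elim
  have hreg₂ : M.Region (m₂.map Prod.fst) {x | x ∈ U ∧ ¬ Q x} := by
    refine hR.restrict (Q := fun x => ¬ Q x) hbL (hcb ▸ hcL)
      (fun x hx hxb hxc => not_congr (hQν x hx hxb (hcb ▸ hxc)))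
      (fun x hx hxb hxc => not_congr (hQα x hx hxb (hcb ▸ hxc))) (fun x => ?_) hnd2
    rw [← hcb, hL]
    constructor
    · intro hx
      obtain ⟨p, hp, rfl⟩ := List.mem_map.1 hx
      exact ⟨Or.inr (Or.inr (Or.inr hx)), hQ₂ p hp, (hm₂ p hp).2⟩
    · rintro ⟨hx | hx | hx | hx, hxQ, hxb, hxc⟩
      · exact (hxb hx).elim
      · exact (hxc hx).elim
      · obtain ⟨p, hp, rfl⟩ := List.mem_map.1 hx
        exact (hxQ (hQ₁ p hp)).elim
      · exact hx
  have hcard₁ : {x | x ∈ m₁.map Prod.fst ∨ x ∈ {x | x ∈ U ∧ Q x}}.ncard < n := by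
    rw [← hn]
    refine Set.ncard_lt_ncard ⟨fun x hx => ?_, fun hsub => ?_⟩ (Set.toFinite _)
    · exact hx.imp (fun h => (hL x).2 (by tauto)) fun h => h.1
    · rcases hsub (Or.inl hbL) with h3 | h3
      · exact hb1 h3
      · exact hR.notMem b hbL h3.1
  have hcard₂ : {x | x ∈ m₂.map Prod.fst ∨ x ∈ {x | x ∈ U ∧ ¬ Q x}}.ncard < n := by
    rw [← hn]
    refine Set.ncard_lt_ncard ⟨fun x hx => ?_, fun hsub => ?_⟩ (Set.toFinite _)
    · exact hx.imp (fun h => (hL x).2 (by tauto)) fun h => h.1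
    · rcases hsub (Or.inl hbL) with h3 | h3
      · exact hb2 h3
      · exact hR.notMem b hbL h3.1
  -- The half `m₁` runs from the state `M.X b h` to `k`, and `m₂` from `M.X c k` to `h`. A half is a
  -- closed contour if its final state can be lowered to its initial one, which is one of the two
  -- possible comparisons of `M.X b h` and `k`.
  have run₁ : M.X b h ≤ k → _ := fun hle =>
    ih m₁ _ b (M.X b h) hreg₁ hcard₁ (hc₁.weaken (M.sameFace_refl b) hle) fun x hx => hI x hx.1
  have run₂ : k ≤ M.X b h → _ := fun hle =>
    ih m₂ _ c (M.X c k) hreg₂ hcard₂ (hc₂.weaken (M.sameFace_refl c) (by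
      have := (M.X c).monotone hle
      rwa [hXX] at this)) fun x hx => hI x hx.1
  have heq : OrdEquiv (M.X b h) k := by
    rcases tot (M.X b h) k with hle | hle
    · obtain ⟨s, hs, hs0, hsm, -⟩ := run₁ hle
      exact ⟨hle, (hc₁.le_last hs hsm hs0.2).trans hs0.1⟩
    · obtain ⟨s, hs, hs0, hsm, -⟩ := run₂ hle
      have h3 := (hc₂.le_last hs hsm hs0.2).trans hs0.1
      refine ⟨?_, hle⟩
      rw [← (M.X c).le_iff_le, hXX]
      exact h3
  obtain ⟨s₁, hs₁, hs01, hsm1, hsI1⟩ := run₁ heq.1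
  obtain ⟨s₂, hs₂, hs02, hsm2, hsI2⟩ := run₂ heq.2
  have hXck : OrdEquiv (M.X c k) h := by
    have := heq.symm.map (M.X c).monotone
    rwa [hXX] at this
  classical
  have hs1 : ∀ x, Q x → (if Q x then s₁ x else s₂ x) = s₁ x := fun x hx => if_pos hx
  have hs2 : ∀ x, ¬ Q x → (if Q x then s₁ x else s₂ x) = s₂ x := fun x hx => if_neg hx
  -- Only the darts `b` and `c` join the two sides, and there the fillings fit together by `heq`.
  refine ⟨fun x => if Q x then s₁ x else s₂ x, fun x => ?_, fun p hp => ?_, fun x hx => ?_⟩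
  · simp only [hQf, hs₁, hs₂]
  · simp only
    rcases List.mem_cons.1 hp with rfl | hp
    · rw [hs2 _ hnQ, hs1 _ hQb]
      refine ⟨?_, hs01⟩
      have h3 := hs₂ c
      rw [hαc] at h3
      rw [h3]
      exact hs02.trans hXck
    · rcases List.mem_append.1 hp with hp | hp
      · rw [hs1 _ (hQ₁ p hp), hs1 _ ((hν₁ p hp).symm ▸ hQ₁ p hp)]
        exact hsm1 p hp
      · rcases List.mem_cons.1 hp with rfl | hp
        · rw [hs1 _ hQνc, hs2 _ hnQc]
          refine ⟨?_, hs02⟩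
          have h3 := hs₁ b
          rw [← hcb] at h3
          rw [h3]
          exact hs01.trans heq
        · rw [hs2 _ (hQ₂ p hp), hs2 _ ((hν₂ p hp).symm ▸ hQ₂ p hp)]
          exact hsm2 p hp
  · simp only
    have h3 : Q (M.ν x) ↔ Q x := hQν x (Or.inr hx) (fun e => hR.notMem b hbL (e ▸ hx))
      (fun e => hR.notMem c hcL (e ▸ hx))
    by_cases hxQ : Q x
    · rw [hs1 _ hxQ, hs1 _ (h3.2 hxQ)]
      exact hsI1 x ⟨hx, hxQ⟩
    · rw [hs2 _ hxQ, hs2 _ (fun h4 => hxQ (h3.1 h4))]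
      exact hsI2 x ⟨hx, hxQ⟩

/-- A closed contour whose states only go down bounds a region on which all states are
determined. -/
theorem fill (tot : ∀ a b : O, a ≤ b ∨ b ≤ a) (n : ℕ) : ∀ (L : List (B × O)) (U : Set B) (x₀ : B)
    (t₀ : O), M.Region (L.map Prod.fst) U → {x | x ∈ L.map Prod.fst ∨ x ∈ U}.ncard = n →
    M.Chain x₀ t₀ L x₀ t₀ → (∀ x ∈ U, ∀ h, M.Up x h → h ≤ M.fullTurn x h) →
    ∃ s : B → O, (∀ x, s (M.ν (M.α x)) = s x) ∧ OrdEquiv (s x₀) t₀ ∧ M.Matches s L ∧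
      ∀ x ∈ U, OrdEquiv (s x) (M.X x (s (M.ν x))) := by
  induction n using Nat.strong_induction_on with
  | _ n ih =>
  intro L U x₀ t₀ hR hn hc hI
  have ih' := fun (L : List (B × O)) (U : Set B) (x₀ : B) (t₀ : O) h1 h2 =>
    ih ({x | x ∈ L.map Prod.fst ∨ x ∈ U}.ncard) h2 L U x₀ t₀ h1 rfl
  -- The induction needs a crossing that does not lower the state; without one, the contour is
  -- empty.
  by_cases hex : ∃ p ∈ L, ¬ M.X p.1 p.2 < p.2
  · obtain ⟨⟨b, h⟩, hp, hbh⟩ := hex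
    replace hbh : h ≤ M.X b h := by
      by_contra hle
      exact hbh (lt_of_le_not_ge ((tot _ _).resolve_right hle) hle)
    obtain ⟨l₁, l₂, rfl⟩ := List.append_of_mem hp
    obtain ⟨y, u, h1, h2⟩ := hc.split
    obtain ⟨hy, hhu, hup, hc₂⟩ := h2
    change M.Chain b (M.X b h) l₂ x₀ t₀ at hc₂
    have hmem : ∀ p, p ∈ (b, h) :: (l₂ ++ l₁) ↔ p ∈ l₁ ++ (b, h) :: l₂ := fun p => by
      simp only [List.mem_cons, List.mem_append]; tauto
    have hperm : ((b, h) :: (l₂ ++ l₁)).Perm (l₁ ++ (b, h) :: l₂) :=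
      (List.perm_append_comm (l₁ := (b, h) :: l₂) (l₂ := l₁))
    have hmem' : ∀ x, x ∈ ((b, h) :: (l₂ ++ l₁)).map Prod.fst ↔
        x ∈ (l₁ ++ (b, h) :: l₂).map Prod.fst := fun x => (hperm.map _).mem_iff
    have hR' : M.Region (((b, h) :: (l₂ ++ l₁)).map Prod.fst) U :=
      hR.of_perm (hperm.map _).symm
    have hn' : {x | x ∈ ((b, h) :: (l₂ ++ l₁)).map Prod.fst ∨ x ∈ U}.ncard = n := by
      simpa only [hmem'] using hn
    -- The contour is rotated to start right after the crossing of `b` and to end right before it,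
    -- in the face shared by the corners `M.ν b` and `M.α b`.
    have hcR : M.Chain b (M.X b h) (l₂ ++ l₁) (M.α b) h :=
      (hc₂.append h1).weaken (hy.trans (M.sameFace_α b).symm) hhu
    obtain ⟨s, hs, hsm, hsI⟩ : ∃ s : B → O, (∀ x, s (M.ν (M.α x)) = s x) ∧
        M.Matches s ((b, h) :: (l₂ ++ l₁)) ∧
        ∀ x ∈ U, OrdEquiv (s x) (M.X x (s (M.ν x))) := by
      rcases hR'.mem_α b (Or.inl (by simp)) with hα | hα
      · refine fill_of_chord tot ih' hR' hn' hcR hI ?_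
        simp only [List.map_cons, List.mem_cons] at hα
        exact hα.resolve_left (M.α_ne b)
      · exact fill_of_mem ih' hR' hn' hup hcR hbh hI hα
    refine ⟨s, hs, ?_, fun p hp => hsm p ((hmem p).2 hp), hsI⟩
    have hsb := hsm (b, h) (by simp)
    have hm₁ : M.Matches s l₁ := fun p hp => hsm p (by simp [hp])
    have hm₂ : M.Matches s l₂ := fun p hp => hsm p (by simp [hp])
    exact ⟨h1.first_le hs hm₁ ((hy.eq hs).trans_le (hsb.1.1.trans hhu)),
      hc₂.le_last hs hm₂ hsb.2.2⟩
  · push Not at hex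
    have h0 := hc.lt_of_forall hex
    have hL : L = [] := by
      by_contra hne
      exact lt_irrefl _ (h0.2 hne)
    subst hL
    refine ⟨fun _ => t₀, fun _ => rfl, OrdEquiv.refl _, fun p hp => by simp at hp, fun x hx => ?_⟩
    -- Every inner dart reaches the contour, so an empty contour has nothing inside.
    obtain ⟨y, hy, -⟩ := hR.reach x hx
    simp at hy

/-! ### Rigidity -/

/-- A quantity that never rises along a finite cycle must return to its value, so no step can lower
it strictly. -/
theorem iterate_le_of_step {P : Type*} [Preorder P] (φ : Equiv.Perm B) (f : B → P) {A : Set B}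
    (hA : ∀ x ∈ A, φ x ∈ A) (hf : ∀ x ∈ A, f (φ x) ≤ f x) {x : B} (hx : x ∈ A) :
    f x ≤ f (φ x) := by
  have h1 : ∀ n, φ^[n] x ∈ A ∧ (1 ≤ n → f (φ^[n] x) ≤ f (φ x)) := by
    intro n
    induction n with
    | zero => exact ⟨hx, fun h => absurd h (by norm_num)⟩
    | succ n ih =>
      rw [Function.iterate_succ_apply']
      refine ⟨hA _ ih.1, fun _ => ?_⟩
      rcases Nat.eq_zero_or_pos n with rfl | hn
      · exact le_rfl
      · exact (hf _ ih.1).trans (ih.2 hn)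
  have h2 : 0 < Function.minimalPeriod φ x :=
    Function.minimalPeriod_pos_of_mem_periodicPts
      (Function.Injective.mem_periodicPts φ.injective x)
  have h3 := (h1 (Function.minimalPeriod φ x)).2 h2
  rwa [Function.iterate_minimalPeriod] at h3

/-- Rigidity: if all full turns around the vertices other than the root are nondecreasing on up
states, and the full turn at the root is nondecreasing at the up state `h₀`, then `h₀` is fixed by
all crossings. -/
theorem rigid (tot : ∀ a b : O, a ≤ b ∨ b ≤ a) {b₀ : B} {h₀ : O} (hup : M.Up b₀ h₀)
    (h₀le : h₀ ≤ M.fullTurn b₀ h₀)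
    (hI : ∀ x ∈ M.component b₀, M.vtx x ≠ M.vtx b₀ → ∀ h, M.Up x h → h ≤ M.fullTurn x h) :
    ∀ x ∈ M.component b₀, OrdEquiv (M.X x h₀) h₀ := by
  set L := M.turns (M.deg b₀) b₀ h₀ with hLdef
  have hL : ∀ x, x ∈ L.map Prod.fst ↔ M.vtx x = M.vtx b₀ := fun x => M.mem_turns_deg h₀
  set J : Set B := {x | x ∈ M.component b₀ ∧ M.vtx x ≠ M.vtx b₀} with hJ
  have hLJ : ∀ x, (x ∈ L.map Prod.fst ∨ x ∈ J) ↔ x ∈ M.component b₀ := by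
    intro x
    have h1 : M.vtx x = M.vtx b₀ → x ∈ M.component b₀ := fun h =>
      mem_component_of_vtx_eq (mem_component_self b₀) h.symm
    simp only [hL, hJ, Set.mem_ofPred_eq]
    tauto
  have hν : ∀ x, M.ν x ∈ M.component b₀ ↔ x ∈ M.component b₀ := fun x =>
    ⟨fun h => mem_component_of_step h (Or.inr (Or.inl rfl)),
      fun h => mem_component_of_step h (Or.inl rfl)⟩
  have hreg : M.Region (L.map Prod.fst) J := by
    refine ⟨fun x => ?_, fun x hx => ?_, M.nodup_turns le_rfl h₀, fun x hx hxJ => ?_,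
      fun x hx y hy => ?_, fun x hx => ?_⟩
    · simp only [hJ, Set.mem_ofPred_eq, M.vtx_ν, hν]
    · rw [hLJ] at hx ⊢
      exact mem_component_of_step hx (Or.inr (Or.inr rfl))
    · exact hxJ.2 ((hL x).1 hx)
    · rw [(hL x).1 hx, (hL y).1 hy]
      exact Relation.EqvGen.refl _
    · have h1 : Relation.ReflTransGen M.Step x b₀ :=
        mem_component_symm hx.1
      induction h1 using Relation.ReflTransGen.head_induction_on with
      | refl => exact (hx.2 rfl).elim
      | @head x z hxz hzy ih =>
        by_cases hz : M.vtx z = M.vtx b₀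
        · exact ⟨z, (hL z).2 hz, .single ⟨hx, hxz⟩⟩
        · obtain ⟨w, hw, hzw⟩ := ih ⟨mem_component_of_step hx.1 hxz, hz⟩
          exact ⟨w, hw, hzw.head ⟨hx, hxz⟩⟩
  -- The circle around the root is the initial contour, with all other vertices of the component
  -- inside; `h₀le` allows the state to go back down to `h₀`.
  have hchain : M.Chain b₀ h₀ L b₀ h₀ := by
    have h1 := hup.chain_turns (M.deg b₀)
    rw [iterate_deg] at h1
    exact h1.weaken (M.sameFace_refl b₀) h₀le
  obtain ⟨s, hs, hs0, hsL, hsI⟩ := fill tot _ L J b₀ h₀ hreg rfl hchain fun x hx =>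
    hI x hx.1 hx.2
  have hsx : ∀ x ∈ M.component b₀, OrdEquiv (s x) (M.X x (s (M.ν x))) := by
    intro x hx
    rcases (hLJ x).2 hx with h1 | h1
    · obtain ⟨p, hp, rfl⟩ := List.mem_map.1 h1
      exact (hsL p hp).2.trans ((hsL p hp).1.symm.map (M.X p.1).monotone)
    · exact hsI x h1
  -- A maximum principle: the faces of maximal state form a set `A` that turns out to be closed
  -- under all moves.
  obtain ⟨m, hm, hmax⟩ := (Set.toFinite (M.component b₀)).exists_maximalFor s _
    ⟨b₀, mem_component_self b₀⟩
  have hmax' : ∀ y ∈ M.component b₀, s y ≤ s m := fun y hy =>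
    (tot _ _).elim id fun h => hmax hy h
  set A : Set B := {y | y ∈ M.component b₀ ∧ s m ≤ s y} with hA
  let φ : Equiv.Perm B := (Equiv.mk M.α M.α M.α_α M.α_α : Equiv.Perm B).trans M.ν
  have hφ : ∀ x, φ x = M.ν (M.α x) := fun x => rfl
  have hAφ : ∀ x ∈ A, φ x ∈ A := fun x hx =>
    ⟨(hν _).2 (mem_component_of_step hx.1 (Or.inr (Or.inr rfl))), by
      rw [hφ, hs]; exact hx.2⟩
  have hAX : ∀ x ∈ A, s m ≤ M.X x (s m) := fun x hx =>
    hx.2.trans ((hsx x hx.1).1.trans ((M.X x).monotone (hmax' _ ((hν x).2 hx.1))))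
  -- No crossing out of a maximal face lowers `s m`, so by `edge` potentials do not rise along its
  -- darts; going once around the face makes them equivalent.
  have hpot : ∀ x ∈ A, M.pot (M.vtx x) (s m) ≤ M.pot (M.vtx (M.α x)) (s m) := by
    intro x hx
    have h1 := iterate_le_of_step φ (fun x => M.pot (M.vtx x) (s m)) hAφ (fun y hy => by
      change M.pot (M.vtx (M.ν (M.α y))) _ ≤ _
      rw [M.vtx_ν]
      exact (M.edge y _).1 (hAX y hy)) hx
    change _ ≤ M.pot (M.vtx (M.ν (M.α x))) _ at h1
    rwa [M.vtx_ν] at h1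
  have hAX' : ∀ x ∈ A, OrdEquiv (M.X x (s m)) (s m) := by
    intro x hx
    refine ⟨?_, hAX x hx⟩
    have h1 := (M.edge (M.α x) (s m)).2 (by rw [M.α_α]; exact hpot x hx)
    have h2 := (M.X x).monotone h1
    rwa [M.X_α, OrderIso.apply_symm_apply] at h2
  -- Crossing `x` takes the state of the neighbouring face to that of `x`, and it fixes `s m`; hence
  -- the neighbour is maximal as well.
  have hAν : ∀ x ∈ A, M.ν x ∈ A := by
    intro x hx
    refine ⟨(hν x).2 hx.1, ?_⟩
    rw [← (M.X x).le_iff_le]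
    exact (hAX' x hx).1.trans (hx.2.trans (hsx x hx.1).1)
  have hAν' : ∀ x, M.ν x ∈ A → x ∈ A := by
    intro x hx
    obtain ⟨k, hk⟩ := M.exists_iterate (M.ν x) x (M.vtx_ν x)
    rw [← hk]
    clear hk
    induction k with
    | zero => exact hx
    | succ k ih => rw [Function.iterate_succ_apply']; exact hAν _ ih
  have hAstep : ∀ x ∈ A, ∀ y, M.Step x y → y ∈ A := by
    rintro x hx y (h | h | h)
    · rw [h]; exact hAν x hx
    · rw [h] at hx; exact hAν' y hx
    · rw [h]; exact hAν' _ (hAφ x hx)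
  have hall : ∀ x ∈ M.component b₀, x ∈ A := by
    intro x hx
    have h1 : Relation.ReflTransGen M.Step m x :=
      (mem_component_symm hm).trans hx
    induction h1 with
    | refl => exact ⟨hm, le_rfl⟩
    | @tail y z h1 h2 ih =>
      exact hAstep y (ih (mem_component_of_step hx h2.symm)) z h2
  have hmh : OrdEquiv (s m) h₀ :=
    OrdEquiv.trans ⟨(hall _ (mem_component_self b₀)).2, hmax' _ (mem_component_self b₀)⟩ hs0
  intro x hx
  exact (hmh.symm.map (M.X x).monotone).trans ((hAX' x (hall x hx)).trans hmh)

/-! ### Duality and balanced vertices -/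

variable (M) in
/-- The same map, acting on the opposite orders. -/
def dual : ActingMap V B Oᵒᵈ O'ᵒᵈ where
  ν := M.ν
  α := M.α
  vtx := M.vtx
  X b := (M.X b).dual
  pot v h := OrderDual.toDual (M.pot v (OrderDual.ofDual h))
  lev v h := OrderDual.toDual (M.lev v (OrderDual.ofDual h))
  α_α := M.α_α
  α_ne := M.α_ne
  vtx_ν := M.vtx_ν
  exists_iterate := M.exists_iterate
  X_α b := by ext h; simp [M.X_α]
  lev_face b := by rw [M.lev_face]
  pot_mono v _ _ h := M.pot_mono v h
  lev_mono v _ _ h := M.lev_mono v h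
  transport b h := M.transport_ge b h
  transport_ge b h := M.transport b h
  -- The reversed statement for `b` is the original one for `M.α b`, as its crossing is the inverse.
  edge b h := by
    have h1 := M.edge (M.α b) (M.X b (OrderDual.ofDual h))
    have h2 := M.edge (M.α b) (OrderDual.ofDual h)
    rw [M.α_α, M.X_α] at h2
    rw [OrderIso.le_symm_apply] at h2
    exact h2
  planar := M.planar

omit [Finite B] in
theorem dual_turnState (n : ℕ) (b : B) (h : O) :
    M.dual.turnState n b (OrderDual.toDual h) = OrderDual.toDual (M.turnState n b h) := by
  induction n generalizing b h with
  | zero => rfl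
  | succ n ih => exact ih _ _

/-- A turn by one step more than the degree can be split off at its first or at its last crossing,
and both cross the same dart. -/
theorem fullTurn_symm (b : B) (h : O) :
    M.fullTurn (M.ν.symm b) (M.X (M.ν.symm b) h) = M.X (M.ν.symm b) (M.fullTurn b h) := by
  have h1 : M.deg (M.ν.symm b) = M.deg b :=
    Function.minimalPeriod_apply (Function.Injective.mem_periodicPts M.ν.symm.injective b)
  have h2 := M.turnState_succ (M.deg b) b h
  rw [Function.iterate_succ_apply', M.iterate_deg] at h2
  rw [fullTurn, h1]
  exact h2

omit [Finite B] in
theorem up_symm_iff (b : B) (h : O) :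
    M.Up (M.ν.symm b) (M.X (M.ν.symm b) h) ↔ M.Up b h := by
  have := M.transport (M.ν.symm b) h
  rw [Equiv.apply_symm_apply, ← M.vtx_ν, Equiv.apply_symm_apply] at this
  rw [Up, Up, this, ← M.vtx_ν, Equiv.apply_symm_apply]

/-- A crossing conjugates the full turns at neighbouring corners and preserves up states, so the
condition depends on the vertex only and may be checked at a convenient corner. -/
theorem up_le_fullTurn_of_vtx_eq {x y : B} (hxy : M.vtx x = M.vtx y)
    (hx : ∀ h, M.Up x h → h ≤ M.fullTurn x h) : ∀ h, M.Up y h → h ≤ M.fullTurn y h := by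
  obtain ⟨k, -, rfl⟩ := M.exists_iterate_lt hxy
  generalize k + 1 = n
  clear hxy
  induction n with
  | zero => exact hx
  | succ n ih =>
    rw [Function.iterate_succ_apply']
    intro h hu
    obtain ⟨k, rfl⟩ := (M.X (M.ν.symm (M.ν.symm^[n] x))).surjective h
    rw [up_symm_iff] at hu
    rw [fullTurn_symm, (M.X _).le_iff_le]
    exact ih k hu

variable (M) in
/-- The full turns around the vertex of `b` compare with the identity as the level of the corner
with the potential. -/
def Balanced (b : B) (h : O) : Prop :=
  (M.Up b h ↔ h ≤ M.fullTurn b h) ∧ (M.lev b h ≤ M.pot (M.vtx b) h ↔ M.fullTurn b h ≤ h)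

/-- If the root is balanced at `h₀` and each other vertex has balanced or trivial full turns, then
`h₀` is fixed by all crossings of the component, and all potentials and levels agree at `h₀`. -/
theorem rigid_of_balanced (tot : ∀ a b : O, a ≤ b ∨ b ≤ a) (tot' : ∀ a b : O', a ≤ b ∨ b ≤ a)
    {b₀ : B} {h₀ : O} (hroot : M.Balanced b₀ h₀)
    (hI : ∀ x ∈ M.component b₀, M.vtx x ≠ M.vtx b₀ → ∃ y, M.vtx y = M.vtx x ∧
      ((∀ h, M.Balanced y h) ∨ ∀ h, OrdEquiv (M.fullTurn y h) h)) :
    ∀ x ∈ M.component b₀, OrdEquiv (M.X x h₀) h₀ ∧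
      OrdEquiv (M.pot (M.vtx x) h₀) (M.pot (M.vtx b₀) h₀) ∧
      OrdEquiv (M.pot (M.vtx x) h₀) (M.lev x h₀) := by
  have hX : ∀ x ∈ M.component b₀, OrdEquiv (M.X x h₀) h₀ := by
    rcases tot' (M.pot (M.vtx b₀) h₀) (M.lev b₀ h₀) with hle | hle
    · refine rigid tot hle (hroot.1.1 hle) fun x hx hxb => ?_
      obtain ⟨y, hy, h1 | h1⟩ := hI x hx hxb
      · exact up_le_fullTurn_of_vtx_eq hy fun h => (h1 h).1.1
      · exact up_le_fullTurn_of_vtx_eq hy fun h _ => (h1 h).2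
    -- If the level is below the potential, the state is up for the opposite order, and balanced and
    -- trivial turns are self-dual conditions.
    · have hd : ∀ x ∈ M.component b₀, OrdEquiv (M.dual.X x (OrderDual.toDual h₀))
          (OrderDual.toDual h₀) := by
        refine rigid (M := M.dual) (fun a b => (tot a b).symm) hle ?_ fun x hx hxb => ?_
        · rw [fullTurn, dual_turnState]
          exact hroot.2.1 hle
        · have h2 : ∀ y h, M.dual.fullTurn y h =
              OrderDual.toDual (M.fullTurn y (OrderDual.ofDual h)) := fun y h =>
            dual_turnState _ y _
          obtain ⟨y, hy, h1 | h1⟩ := hI x hx hxb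
          · refine up_le_fullTurn_of_vtx_eq (M := M.dual) hy fun h hu => ?_
            rw [h2]
            exact (h1 _).2.1 hu
          · refine up_le_fullTurn_of_vtx_eq (M := M.dual) hy fun h _ => ?_
            rw [h2]
            exact (h1 _).1
      exact fun x hx => (hd x hx).symm
  have hpot : ∀ x ∈ M.component b₀,
      OrdEquiv (M.pot (M.vtx (M.α x)) h₀) (M.pot (M.vtx x) h₀) := by
    intro x hx
    have h1 := (M.edge (M.α x) h₀).1
      (hX _ (mem_component_of_step hx (Or.inr (Or.inr rfl)))).2
    rw [M.α_α] at h1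
    exact ⟨(M.edge x h₀).1 (hX x hx).2, h1⟩
  have hft : OrdEquiv (M.fullTurn b₀ h₀) h₀ := by
    have h1 : ∀ n, OrdEquiv (M.turnState n b₀ h₀) h₀ := by
      intro n
      induction n with
      | zero => exact OrdEquiv.refl _
      | succ n ih =>
        rw [turnState_succ]
        refine (ih.map (M.X _).monotone).trans (hX _ ?_)
        exact mem_component_of_vtx_eq (mem_component_self b₀) (M.vtx_iterate _ _).symm
    exact h1 _
  -- As crossing `x` fixes `h₀` up to equivalence, `transport` relates the two corners beside `x` at
  -- the same state.
  have hν : ∀ x ∈ M.component b₀, OrdEquiv (M.pot (M.vtx x) h₀) (M.lev (M.ν x) h₀) ↔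
      OrdEquiv (M.pot (M.vtx x) h₀) (M.lev x h₀) := by
    intro x hx
    have h1 := M.transport x h₀
    have h2 := M.transport_ge x h₀
    have h3 := (hX x hx).map (M.lev_mono x)
    have h4 := (hX x hx).map (M.pot_mono (M.vtx x))
    refine ⟨fun h => ⟨?_, ?_⟩, fun h => ⟨h1.2 ?_, h2.2 ?_⟩⟩
    · exact h4.2.trans ((h1.1 h.1).trans h3.1)
    · exact h3.2.trans ((h2.1 h.2).trans h4.1)
    · exact h4.1.trans (h.1.trans h3.2)
    · exact h3.1.trans (h.2.trans h4.2)
  intro x hx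
  refine ⟨hX x hx, ?_⟩
  have h1 : Relation.ReflTransGen M.Step b₀ x := hx
  induction h1 with
  -- A full turn at the root acts trivially on `h₀`; balance then makes potential and level
  -- equivalent there, which starts the propagation.
  | refl => exact ⟨OrdEquiv.refl _, hroot.1.2 hft.2, hroot.2.2 hft.1⟩
  | @tail y z h1 h2 ih =>
    obtain ⟨h3, h4⟩ := ih h1
    rcases h2 with h2 | h2 | h2
    · subst h2
      rw [M.vtx_ν]
      exact ⟨h3, (hν y h1).2 h4⟩
    · subst h2
      rw [M.vtx_ν] at h3 h4
      exact ⟨h3, (hν z hx).1 h4⟩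
    · subst h2
      refine ⟨(hpot y h1).trans h3, (hν _ hx).1 ?_⟩
      rw [M.lev_face]
      exact (hpot y h1).trans h4

end ActingMap

open scoped ComplexConjugate
open Filter Topology CategoryTheory

noncomputable section

/-! ### Arrows of the fundamental groupoid -/

/-- The homotopy class of a path, as an arrow of the fundamental groupoid. -/
def cls {X : Type*} [TopologicalSpace X] {x y : X} (p : Path x y) :
    FundamentalGroupoid.mk x ⟶ FundamentalGroupoid.mk y :=
  Path.Homotopic.Quotient.mk p

section cls

instance contractibleSpace_unitInterval : ContractibleSpace I :=
  (convex_Icc (0 : ℝ) 1).contractibleSpace ⟨0, by simp⟩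

instance contractibleSpace_prod {X Y : Type*} [TopologicalSpace X] [TopologicalSpace Y]
    [ContractibleSpace X] [ContractibleSpace Y] : ContractibleSpace (X × Y) := by
  obtain ⟨x, ⟨f⟩⟩ := id_nullhomotopic X
  obtain ⟨y, ⟨g⟩⟩ := id_nullhomotopic Y
  rw [contractible_iff_id_nullhomotopic]
  exact ⟨(x, y), ⟨f.prodMap g⟩⟩

variable {X : Type*} [TopologicalSpace X] {x y z : X}

theorem cls_trans (p : Path x y) (q : Path y z) : cls (p.trans q) = cls p ≫ cls q := rfl

theorem cls_refl (x : X) : cls (Path.refl x) = 𝟙 _ := rfl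

theorem cls_symm (p : Path x y) : cls p.symm = Groupoid.inv (cls p) := rfl

theorem exists_cls (a : FundamentalGroupoid.mk x ⟶ FundamentalGroupoid.mk y) :
    ∃ p : Path x y, cls p = a := Path.Homotopic.Quotient.mk_surjective a

theorem cls_eq_of_simplyConnected {S : Type*} [TopologicalSpace S] [SimplyConnectedSpace S]
    {K : S → X} (hK : Continuous K) {a b : S} (p q : Path a b) :
    cls (p.map hK) = cls (q.map hK) :=
  Path.Homotopic.Quotient.eq.2
    ((SimplyConnectedSpace.paths_homotopic p q).map ⟨K, hK⟩)

/-- The two ways around the boundary of a square are homotopic in the square, which is simply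
connected. Most of the later identities between loops are read off from such a square. -/
theorem cls_square {x' y' : X} {K : I × I → X} (hK : Continuous K) {p : Path x y}
    {q : Path x' y'} {u : Path x x'} {v : Path y y'} (hp : ∀ t, p t = K (t, 0))
    (hq : ∀ t, q t = K (t, 1)) (hu : ∀ t, u t = K (0, t)) (hv : ∀ t, v t = K (1, t)) :
    cls p ≫ cls v = cls u ≫ cls q := by
  have h00 : x = K (0, 0) := by rw [← hp 0, p.source]
  have h10 : y = K (1, 0) := by rw [← hp 1, p.target]
  have h01 : x' = K (0, 1) := by rw [← hq 0, q.source]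
  have h11 : y' = K (1, 1) := by rw [← hq 1, q.target]
  subst h00 h10 h01 h11
  let ι : Path (0 : I) 1 := ⟨ContinuousMap.id I, rfl, rfl⟩
  have e1 : p.trans v = ((ι.prod (Path.refl 0)).trans ((Path.refl 1).prod ι)).map hK := by
    rw [Path.map_trans]
    congr 1 <;> ext t
    · exact hp t
    · exact hv t
  have e2 : u.trans q = (((Path.refl 0).prod ι).trans (ι.prod (Path.refl 1))).map hK := by
    rw [Path.map_trans]
    congr 1 <;> ext t
    · exact hu t
    · exact hq t
  rw [← cls_trans, ← cls_trans, e1, e2]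
  exact cls_eq_of_simplyConnected hK _ _

end cls

/-! ### Vertical rays -/

/-- The sign of a direction: `true` is upwards. -/
def sgn (i : Bool) : ℝ := if i then 1 else -1

theorem sgn_mul_self (i : Bool) : sgn i * sgn i = 1 := by cases i <;> simp [sgn]

theorem abs_sgn (i : Bool) : |sgn i| = 1 := by cases i <;> simp [sgn]

/-- Compact subsets of a finite-dimensional space are those contained in balls and closed, so
neighbourhoods of infinity are measured by the norm. -/
theorem tendsto_infty_iff {Y : Type*} {l : Filter Y} {f : Y → ThreeSphere} :
    Tendsto f l (𝓝 OnePoint.infty) ↔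
      ∀ M : ℝ, ∀ᶠ y in l, ∀ p : ℂ × ℝ, f y = p → M < ‖p‖ := by
  rw [OnePoint.hasBasis_nhds_infty.tendsto_right_iff]
  constructor
  · intro h M
    filter_upwards [h (Metric.closedBall 0 M) ⟨Metric.isClosed_closedBall,
      isCompact_closedBall _ _⟩] with y hy p hp
    rw [hp] at hy
    rcases hy with ⟨q, hq, hqp⟩ | hy
    · rw [OnePoint.coe_injective hqp] at hq
      simpa using hq
    · exact (OnePoint.coe_ne_infty _ hy).elim
  · rintro h s ⟨-, hs⟩
    obtain ⟨M, hM⟩ := hs.isBounded.subset_closedBall 0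
    filter_upwards [h M] with y hy
    induction hfy : f y using OnePoint.rec with
    | infty => exact Or.inr rfl
    | coe p =>
      refine Or.inl ⟨p, fun hp => ?_, rfl⟩
      have h1 := hM hp
      have h2 := hy p hfy
      simp only [Metric.mem_closedBall, dist_zero_right] at h1
      linarith

/-- The vertical ray from infinity (`r = 0`) to the point `p` (`r = 1`), in the direction `i`. -/
def ray (i : Bool) (p : ℂ × ℝ) (r : ℝ) : ThreeSphere :=
  if r ≤ 0 then OnePoint.infty else ((p.1, p.2 + sgn i * max (1 / r - 1) 0) : ℂ × ℝ)

theorem ray_one (i : Bool) (p : ℂ × ℝ) : ray i p 1 = p := by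
  simp [ray]

theorem ray_zero (i : Bool) (p : ℂ × ℝ) : ray i p 0 = OnePoint.infty := by
  simp [ray]

theorem continuous_ray (i : Bool) : Continuous fun z : (ℂ × ℝ) × ℝ => ray i z.1 z.2 := by
  rw [continuous_iff_continuousAt]
  rintro ⟨p, r⟩
  rcases lt_trichotomy r 0 with hr | rfl | hr
  · have h1 : (fun z : (ℂ × ℝ) × ℝ => ray i z.1 z.2) =ᶠ[𝓝 (p, r)]
        fun _ => OnePoint.infty := by
      filter_upwards [continuous_snd.continuousAt.eventually (gt_mem_nhds hr)] with z hz
      exact if_pos hz.le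
    exact continuousAt_const.congr h1.symm
  · rw [ContinuousAt, ray_zero, tendsto_infty_iff]
    intro M
    have h1 : ∀ᶠ z : (ℂ × ℝ) × ℝ in 𝓝 (p, 0), |z.1.2| < |p.2| + 1 :=
      ((continuous_snd.comp continuous_fst).abs).continuousAt.eventually
        (gt_mem_nhds (lt_add_one _))
    -- With this bound the ray has climbed more than `|M| + |p.2| + 1`, enough to beat both `M` and
    -- the initial height of a nearby point.
    have h2 : ∀ᶠ z : (ℂ × ℝ) × ℝ in 𝓝 (p, 0), z.2 < 1 / (|M| + |p.2| + 2) :=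
      continuous_snd.continuousAt.eventually (gt_mem_nhds (by positivity))
    filter_upwards [h1, h2] with z hz1 hz2 q hq
    by_cases hz : z.2 ≤ 0
    · simp only [ray, if_pos hz] at hq
      exact (OnePoint.infty_ne_coe _ hq).elim
    · simp only [ray, if_neg hz] at hq
      rw [← OnePoint.coe_injective hq]
      push Not at hz
      have h3 : |M| + |p.2| + 2 < 1 / z.2 := by
        rw [lt_div_iff₀ (by positivity)] at hz2
        rw [lt_div_iff₀ hz]
        linarith
      refine lt_of_lt_of_le ?_ (norm_snd_le _)
      rw [Real.norm_eq_abs]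
      have h4 : |sgn i * max (1 / z.2 - 1) 0| = max (1 / z.2 - 1) 0 := by
        rw [abs_mul, abs_sgn, one_mul, abs_of_nonneg (le_max_right _ _)]
      have h5 := abs_add_le (z.1.2 + sgn i * max (1 / z.2 - 1) 0) (-z.1.2)
      rw [show z.1.2 + sgn i * max (1 / z.2 - 1) 0 + -z.1.2 = sgn i * max (1 / z.2 - 1) 0 by ring,
        h4, abs_neg] at h5
      have h6 := le_max_left (1 / z.2 - 1) 0
      have h7 := le_abs_self M
      linarith
  · have h1 : (fun z : (ℂ × ℝ) × ℝ => ray i z.1 z.2) =ᶠ[𝓝 (p, r)]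
        fun z => ((z.1.1, z.1.2 + sgn i * max (1 / z.2 - 1) 0) : ℂ × ℝ) := by
      filter_upwards [continuous_snd.continuousAt.eventually (lt_mem_nhds hr)] with z hz
      exact if_neg (not_le.2 hz)
    refine ContinuousAt.congr ?_ h1.symm
    refine OnePoint.continuous_coe.continuousAt.comp ?_
    have h2 : ContinuousAt (fun z : (ℂ × ℝ) × ℝ => 1 / z.2) (p, r) :=
      continuousAt_const.div continuous_snd.continuousAt hr.ne'
    have h3 : ContinuousAt (fun z : (ℂ × ℝ) × ℝ => max (1 / z.2 - 1) 0) (p, r) :=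
      (h2.sub continuousAt_const).max continuousAt_const
    exact (by fun_prop : ContinuousAt (fun z : (ℂ × ℝ) × ℝ => z.1.1) (p, r)).prodMk
      ((by fun_prop : ContinuousAt (fun z : (ℂ × ℝ) × ℝ => z.1.2) (p, r)).add
        (continuousAt_const.mul h3))

/-! ### Loops at infinity -/

namespace PlaneDrawing

variable {V E : Type*} (D : PlaneDrawing V E)

/-- A point of space outside the link, as a point of the link exterior. -/
def pt (p : ℂ × ℝ) (h : p ∉ D.link) : D.exterior :=
  ⟨(p : ThreeSphere), by
    rintro ⟨q, hq, hqp⟩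
    exact h (OnePoint.coe_injective hqp ▸ hq)⟩

/-- The point at infinity. -/
def top : D.exterior :=
  ⟨OnePoint.infty, by rintro ⟨q, -, hqp⟩; exact OnePoint.coe_ne_infty _ hqp⟩

/-- The fundamental groupoid's object at infinity. -/
abbrev base : FundamentalGroupoid D.exterior := FundamentalGroupoid.mk D.top

/-- The vertical ray from `p` in the direction `i` misses the link. -/
def Free (i : Bool) (p : ℂ × ℝ) : Prop := ∀ r : ℝ, 0 ≤ r → (p.1, p.2 + sgn i * r) ∉ D.link

variable {D}

theorem Free.notMem {i : Bool} {p : ℂ × ℝ} (h : D.Free i p) : p ∉ D.link := by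
  have := h 0 le_rfl
  simpa using this

theorem Free.ray_mem {i : Bool} {p : ℂ × ℝ} (h : D.Free i p) (r : ℝ) :
    ray i p r ∈ D.exterior := by
  rw [ray]
  split_ifs with hr
  · exact D.top.2
  · exact (D.pt _ (h _ (le_max_right _ _))).2

/-- The vertical path from infinity to `p`. -/
def Free.path {i : Bool} {p : ℂ × ℝ} (h : D.Free i p) : Path D.top (D.pt p h.notMem) where
  toFun r := ⟨ray i p r, h.ray_mem r⟩
  continuous_toFun := Continuous.subtype_mk
    ((continuous_ray i).comp (by fun_prop : Continuous fun r : I => (p, (r : ℝ)))) _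
  source' := Subtype.ext (by simp [ray_zero, top])
  target' := Subtype.ext (by simp [ray_one, pt])

theorem continuous_pt {Y : Type*} [TopologicalSpace Y] {f : Y → ℂ × ℝ} (hf : Continuous f)
    (h : ∀ y, f y ∉ D.link) : Continuous fun y => D.pt (f y) (h y) :=
  (OnePoint.continuous_coe.comp hf).subtype_mk _

/-- A path of points outside the link. -/
def seg {g : I → ℂ × ℝ} (hg : Continuous g) (h : ∀ u, g u ∉ D.link) :
    Path (D.pt (g 0) (h 0)) (D.pt (g 1) (h 1)) where
  toFun u := D.pt (g u) (h u)
  continuous_toFun := continuous_pt hg h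
  source' := rfl
  target' := rfl

/-- The rays to the points of `g` sweep out a square one of whose sides is collapsed to infinity. -/
theorem Free.cls_path_seg {i : Bool} {g : I → ℂ × ℝ} (hg : Continuous g)
    (h : ∀ u, D.Free i (g u)) :
    cls (h 0).path ≫ cls (seg hg fun u => (h u).notMem) = cls (h 1).path := by
  have h1 := cls_square (K := fun z : I × I => (⟨ray i (g z.2) z.1, (h z.2).ray_mem z.1⟩ :
    D.exterior)) (Continuous.subtype_mk ((continuous_ray i).comp
      (by fun_prop : Continuous fun z : I × I => (g z.2, (z.1 : ℝ)))) _)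
    (p := (h 0).path) (q := (h 1).path) (u := Path.refl D.top)
    (v := seg hg fun u => (h u).notMem) (fun _ => rfl) (fun _ => rfl)
    (fun t => Subtype.ext (ray_zero i (g t)).symm)
    (fun t => Subtype.ext (ray_one i (g t)).symm)
  rw [h1, cls_refl, Category.id_comp]

variable (D) in
/-- The validity conditions for the loop `gen`. -/
structure Ok (g : I → ℂ × ℝ) (i j : Bool) : Prop where
  cont : Continuous g
  notMem : ∀ u, g u ∉ D.link
  left : D.Free i (g 0)
  right : D.Free j (g 1)

open Classical in
variable (D) in
/-- The class of the loop at infinity which comes down (or up) vertically to the beginning of `g`,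
follows `g`, and returns vertically to infinity. -/
def gen (g : I → ℂ × ℝ) (i j : Bool) : D.base ⟶ D.base :=
  if h : D.Ok g i j then
    cls h.left.path ≫ cls (seg h.cont h.notMem) ≫ Groupoid.inv (cls h.right.path) else 𝟙 _

theorem gen_of_ok {g : I → ℂ × ℝ} {i j : Bool} (h : D.Ok g i j) : D.gen g i j =
    cls h.left.path ≫ cls (seg h.cont h.notMem) ≫ Groupoid.inv (cls h.right.path) := dif_pos h

/-- The loop `gen` does not change under homotopies during which its ends remain free. -/
theorem gen_homotopy {F : I → I → ℂ × ℝ} (hF : Continuous fun z : I × I => F z.1 z.2)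
    {i j : Bool} (h : ∀ u s, F u s ∉ D.link) (hl : ∀ s, D.Free i (F 0 s))
    (hr : ∀ s, D.Free j (F 1 s)) : D.gen (fun u => F u 0) i j = D.gen (fun u => F u 1) i j := by
  have c0 : ∀ s, Continuous fun u => F u s := fun s =>
    hF.comp (by fun_prop : Continuous fun u : I => (u, s))
  have c1 : ∀ u, Continuous fun s => F u s := fun u =>
    hF.comp (by fun_prop : Continuous fun s : I => (u, s))
  have e0 : D.Ok (fun u => F u 0) i j := ⟨c0 0, fun u => h u 0, hl 0, hr 0⟩
  have e1 : D.Ok (fun u => F u 1) i j := ⟨c0 1, fun u => h u 1, hl 1, hr 1⟩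
  rw [gen_of_ok e0, gen_of_ok e1]
  have s1 := Free.cls_path_seg (c1 0) hl
  have s2 := Free.cls_path_seg (c1 1) hr
  have s3 := cls_square (K := fun z : I × I => D.pt (F z.1 z.2) (h z.1 z.2))
    (continuous_pt hF _) (p := seg (c0 0) fun u => h u 0) (q := seg (c0 1) fun u => h u 1)
    (u := seg (c1 0) fun s => h 0 s) (v := seg (c1 1) fun s => h 1 s)
    (fun _ => rfl) (fun _ => rfl) (fun _ => rfl) (fun _ => rfl)
  rw [← s1, ← s2]
  simp only [Groupoid.inv_eq_inv, IsIso.inv_comp, Category.assoc]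
  rw [← reassoc_of% s3]
  simp

theorem gen_free {g : I → ℂ × ℝ} (hg : Continuous g) {i : Bool} (h : ∀ u, D.Free i (g u)) :
    D.gen g i i = 𝟙 _ := by
  rw [gen_of_ok ⟨hg, fun u => (h u).notMem, h 0, h 1⟩, ← Category.assoc,
    Free.cls_path_seg hg h, Groupoid.comp_inv]

/-- Composition of two sides of a rectangle, along the other two. -/
theorem gen_comp_gen {F : I → I → ℂ × ℝ} (hF : Continuous fun z : I × I => F z.1 z.2)
    {i j k : Bool} (h : ∀ u s, F u s ∉ D.link) (hl : ∀ s, D.Free i (F 0 s))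
    (hj : D.Free j (F 1 0)) (hk : D.Free k (F 1 1)) :
    D.gen (fun u => F u 0) i j ≫ D.gen (fun s => F 1 s) j k = D.gen (fun u => F u 1) i k := by
  have c0 : ∀ s, Continuous fun u => F u s := fun s =>
    hF.comp (by fun_prop : Continuous fun u : I => (u, s))
  have c1 : ∀ u, Continuous fun s => F u s := fun u =>
    hF.comp (by fun_prop : Continuous fun s : I => (u, s))
  have e0 : D.Ok (fun u => F u 0) i j := ⟨c0 0, fun u => h u 0, hl 0, hj⟩
  have e1 : D.Ok (fun u => F u 1) i k := ⟨c0 1, fun u => h u 1, hl 1, hk⟩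
  have e2 : D.Ok (fun s => F 1 s) j k := ⟨c1 1, fun s => h 1 s, hj, hk⟩
  rw [gen_of_ok e0, gen_of_ok e1, gen_of_ok e2]
  have s1 := Free.cls_path_seg (c1 0) hl
  have s3 := cls_square (K := fun z : I × I => D.pt (F z.1 z.2) (h z.1 z.2))
    (continuous_pt hF _) (p := seg (c0 0) fun u => h u 0) (q := seg (c0 1) fun u => h u 1)
    (u := seg (c1 0) fun s => h 0 s) (v := seg (c1 1) fun s => h 1 s)
    (fun _ => rfl) (fun _ => rfl) (fun _ => rfl) (fun _ => rfl)
  rw [← s1]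
  simp only [Groupoid.inv_eq_inv, Category.assoc]
  rw [← reassoc_of% s3]
  simp

theorem gen_const {p : ℂ × ℝ} {i : Bool} (h : D.Free i p) : D.gen (fun _ => p) i i = 𝟙 _ :=
  gen_free continuous_const fun _ => h

/-- The difference between the two vertical ways from infinity to `p`. -/
def vert (D : PlaneDrawing V E) (p : ℂ × ℝ) (i j : Bool) : D.base ⟶ D.base :=
  D.gen (fun _ => p) i j

theorem gen_comp_symm {g : I → ℂ × ℝ} {i j : Bool} (h : D.Ok g i j) :
    D.gen g i j ≫ D.gen (fun u => g (σ u)) j i = 𝟙 _ := by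
  have hc := h.cont
  -- The rectangle has `g` at the bottom, the reversed `g` on the right, and a constant path on the
  -- other two sides.
  have h1 := gen_comp_gen (D := D) (F := fun u s => g (min u (σ s))) (i := i) (j := j) (k := i)
    (hc.comp (by fun_prop)) (fun _ _ => h.notMem _) (fun s => by simpa using h.left)
    (by simpa using h.right) (by simpa using h.left)
  simp only [unitInterval.symm_zero, unitInterval.symm_one] at h1
  have e1 : ∀ u : I, min u 1 = u := fun u => min_eq_left unitInterval.le_one'
  have e2 : ∀ u : I, min 1 (σ u) = σ u := fun u => min_eq_right unitInterval.le_one'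
  have e3 : ∀ u : I, min u 0 = 0 := fun u => min_eq_right unitInterval.nonneg'
  simp only [e1, e2, e3] at h1
  rw [h1, gen_const h.left]

theorem gen_symm {g : I → ℂ × ℝ} {i j : Bool} (h : D.Ok g i j) :
    D.gen (fun u => g (σ u)) j i = Groupoid.inv (D.gen g i j) := by
  have := gen_comp_symm h
  rw [Groupoid.inv_eq_inv]
  exact (IsIso.inv_eq_of_hom_inv_id this).symm

theorem gen_comp_vert {g : I → ℂ × ℝ} {i j k : Bool} (h : D.Ok g i j) (hk : D.Free k (g 1)) :
    D.gen g i j ≫ D.vert (g 1) j k = D.gen g i k :=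
  gen_comp_gen (F := fun u _ => g u) (h.cont.comp continuous_fst) (fun _ _ => h.notMem _)
    (fun _ => h.left) h.right hk

theorem vert_comp_gen {g : I → ℂ × ℝ} {i j k : Bool} (h : D.Ok g i j) (hk : D.Free k (g 0)) :
    D.vert (g 0) k i ≫ D.gen g i j = D.gen g k j := by
  have hc := h.cont
  have h1 := gen_comp_gen (D := D) (F := fun u s => g (u * s)) (i := k) (j := i) (k := j)
    (hc.comp (by fun_prop)) (fun _ _ => h.notMem _) (fun s => by simpa using hk)
    (by simpa using h.left) (by simpa using h.right)
  simpa [vert] using h1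

theorem vert_inv {p : ℂ × ℝ} {i j : Bool} (hi : D.Free i p) (hj : D.Free j p) :
    Groupoid.inv (D.vert p i j) = D.vert p j i :=
  (gen_symm ⟨continuous_const, fun _ => hi.notMem, hi, hj⟩).symm

/-- The loop `gen` for the restriction of `f` to the interval from `a` to `b`. -/
def genOn (D : PlaneDrawing V E) (f : ℝ → ℂ × ℝ) (a b : ℝ) (i j : Bool) : D.base ⟶ D.base :=
  D.gen (fun u : I => f (a + u * (b - a))) i j

theorem add_mul_sub_mem {a b : ℝ} (h : a ≤ b) (u : I) : a + u * (b - a) ∈ Set.Icc a b := by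
  obtain ⟨u, h0, h1⟩ := u
  exact ⟨by nlinarith, by nlinarith⟩

theorem genOn_trans {f : ℝ → ℂ × ℝ} (hf : Continuous f) {a b c : ℝ} (hab : a ≤ b) (hbc : b ≤ c)
    (h : ∀ t ∈ Set.Icc a c, f t ∉ D.link) {i j k : Bool} (hi : D.Free i (f a))
    (hj : D.Free j (f b)) (hk : D.Free k (f c)) :
    D.genOn f a b i j ≫ D.genOn f b c j k = D.genOn f a c i k := by
  have h1 := gen_comp_gen (D := D)
    (F := fun u s : I => f (a + u * (b + s * (c - b) - a))) (i := i) (j := j) (k := k)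
    (hf.comp (by fun_prop)) (fun u s => h _ ?_) (fun s => by simpa using hi)
    (by simpa using hj) (by simpa using hk)
  · simpa [genOn] using h1
  · have h2 := add_mul_sub_mem hbc s
    have h3 := add_mul_sub_mem (hab.trans h2.1) u
    exact ⟨h3.1, h3.2.trans h2.2⟩

theorem genOn_free {f : ℝ → ℂ × ℝ} (hf : Continuous f) {a b : ℝ} (hab : a ≤ b) {i : Bool}
    (h : ∀ t ∈ Set.Icc a b, D.Free i (f t)) : D.genOn f a b i i = 𝟙 _ :=
  gen_free (hf.comp (by fun_prop)) fun u => h _ (add_mul_sub_mem hab u)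

/-- A homotopy between the restrictions of two functions to intervals. -/
theorem genOn_homotopy {F : ℝ → ℝ → ℂ × ℝ} (hF : Continuous fun z : ℝ × ℝ => F z.1 z.2)
    {a b : ℝ} (hab : a ≤ b) {i j : Bool}
    (h : ∀ t ∈ Set.Icc a b, ∀ s ∈ I, F t s ∉ D.link) (hl : ∀ s ∈ I, D.Free i (F a s))
    (hr : ∀ s ∈ I, D.Free j (F b s)) :
    D.genOn (fun t => F t 0) a b i j = D.genOn (fun t => F t 1) a b i j := by
  have h1 := gen_homotopy (D := D) (F := fun u s : I => F (a + u * (b - a)) s) (i := i) (j := j)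
    (hF.comp (by fun_prop : Continuous fun z : I × I => (a + (z.1 : ℝ) * (b - a), (z.2 : ℝ))))
    (fun u s => h _ (add_mul_sub_mem hab u) _ s.2) (fun s => by simpa using hl _ s.2)
    (fun s => by simpa using hr _ s.2)
  simpa [genOn] using h1

end PlaneDrawing

namespace PlaneDrawing

variable {V E : Type*} (D : PlaneDrawing V E)

/-! ### Darts -/

/-- The reversal of a dart (an oriented edge). -/
def flip (b : E × Bool) : E × Bool := (b.1, !b.2)

theorem flip_flip (b : E × Bool) : flip (flip b) = b := by simp [flip]

theorem flip_ne (b : E × Bool) : flip b ≠ b := by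
  rcases b with ⟨e, i⟩
  cases i <;> simp [flip]

/-- The arc of a dart, in the direction of the dart. -/
def crv (b : E × Bool) (t : ℝ) : ℂ := if b.2 then D.curve b.1 t else D.curve b.1 (1 - t)

/-- The initial vertex of a dart. -/
def tail (b : E × Bool) : V := if b.2 then D.source b.1 else D.target b.1

/-- The time at which a dart leaves the disk of its initial vertex. -/
def exT (b : E × Bool) : ℝ := if b.2 then D.exitTime b.1 else 1 - D.enterTime b.1

theorem crv_flip (b : E × Bool) (t : ℝ) : D.crv (flip b) t = D.crv b (1 - t) := by
  rcases b with ⟨e, i⟩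
  cases i <;> simp [crv, flip]

theorem contDiff_crv (b : E × Bool) : ContDiff ℝ ∞ (D.crv b) := by
  rcases b with ⟨e, i⟩
  cases i
  · exact (D.curve_smooth e).comp (contDiff_const.sub contDiff_id)
  · exact D.curve_smooth e

theorem continuous_crv (b : E × Bool) : Continuous (D.crv b) := (D.contDiff_crv b).continuous

theorem continuous_deriv_crv (b : E × Bool) : Continuous (deriv (D.crv b)) :=
  (D.contDiff_crv b).continuous_deriv (by simp)

theorem differentiable_crv (b : E × Bool) : Differentiable ℝ (D.crv b) :=
  (D.contDiff_crv b).differentiable (by simp)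

theorem deriv_crv_flip (b : E × Bool) (t : ℝ) :
    deriv (D.crv (flip b)) t = -deriv (D.crv b) (1 - t) := by
  have h : D.crv (flip b) = fun t => D.crv b (1 - t) := funext (D.crv_flip b)
  rw [h]
  exact deriv_comp_const_sub (f := D.crv b) 1 t

theorem one_sub_mem {t : ℝ} (ht : t ∈ I) : 1 - t ∈ I := ⟨by linarith [ht.2], by linarith [ht.1]⟩

theorem deriv_crv_ne_zero (b : E × Bool) {t : ℝ} (ht : t ∈ I) : deriv (D.crv b) t ≠ 0 := by
  have key : ∀ e, deriv (D.crv (e, true)) = deriv (D.curve e) := fun e => rfl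
  rcases b with ⟨e, i⟩
  cases i
  · change deriv (D.crv (flip (e, true))) t ≠ 0
    rw [deriv_crv_flip, neg_ne_zero]
    exact D.curve_deriv_ne_zero e _ (one_sub_mem ht)
  · exact D.curve_deriv_ne_zero e t ht

theorem crv_injOn (b : E × Bool) : Set.InjOn (D.crv b) I := by
  rcases b with ⟨e, i⟩
  cases i
  · intro s hs t ht h
    have := D.curve_injOn e (one_sub_mem hs) (one_sub_mem ht) h
    linarith
  · exact D.curve_injOn e

theorem fst_eq_of_crv_eq {b b' : E × Bool} {s t : ℝ} (hs : s ∈ I) (ht : t ∈ I)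
    (h : D.crv b s = D.crv b' t) : b.1 = b'.1 := by
  have key : ∀ (b : E × Bool), ∀ t ∈ I, D.crv b t ∈ D.curve b.1 '' I := by
    rintro ⟨e, i⟩ t ht
    cases i
    · exact ⟨1 - t, one_sub_mem ht, rfl⟩
    · exact ⟨t, ht, rfl⟩
  by_contra hne
  exact Set.disjoint_left.1 (D.curve_disjoint _ _ hne) (key b s hs) (h ▸ key b' t ht)

theorem eq_or_eq_flip {b b' : E × Bool} (h : b.1 = b'.1) : b' = b ∨ b' = flip b := by
  rcases b with ⟨e, i⟩
  rcases b' with ⟨e', j⟩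
  obtain rfl : e = e' := h
  cases i <;> cases j <;> simp [flip]

theorem crv_eq_crv {b b' : E × Bool} {s t : ℝ} (hs : s ∈ I) (ht : t ∈ I)
    (h : D.crv b s = D.crv b' t) : (b' = b ∧ t = s) ∨ (b' = flip b ∧ t = 1 - s) := by
  rcases eq_or_eq_flip (D.fst_eq_of_crv_eq hs ht h) with rfl | rfl
  · exact Or.inl ⟨rfl, (D.crv_injOn _ hs ht h).symm⟩
  · rw [crv_flip] at h
    have := D.crv_injOn _ hs (one_sub_mem ht) h
    exact Or.inr ⟨rfl, by linarith⟩

theorem exT_pos (b : E × Bool) : 0 < D.exT b := by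
  rcases b with ⟨e, i⟩
  cases i
  · have := D.enterTime_lt_one e
    simp only [exT]; simp; exact this
  · exact D.exitTime_pos e

theorem exT_add_lt (b : E × Bool) : D.exT b + D.exT (flip b) < 1 := by
  rcases b with ⟨e, i⟩
  have := D.exitTime_lt_enterTime e
  cases i <;> simp [exT, flip] <;> linarith

theorem crv_mem_closedBall (b : E × Bool) (v : V) {t : ℝ} (ht : t ∈ I) :
    D.crv b t ∈ Metric.closedBall (D.center v) (D.radius v) ↔
      (v = D.tail b ∧ t ≤ D.exT b) ∨ (v = D.tail (flip b) ∧ 1 - D.exT (flip b) ≤ t) := by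
  rcases b with ⟨e, i⟩
  cases i
  · have := D.mem_closedBall_iff e v (1 - t) (one_sub_mem ht)
    simp only [crv, tail, exT, flip] at this ⊢
    simp only [Bool.false_eq_true, if_false, Bool.not_false, if_true]
    rw [this, or_comm, le_sub_comm (a := t), sub_le_comm (a := (1 : ℝ)) (b := D.exitTime e)]
  · have := D.mem_closedBall_iff e v t ht
    simp only [crv, tail, exT, flip] at this ⊢
    simpa using this

theorem crv_mem_ball (b : E × Bool) (v : V) {t : ℝ} (ht : t ∈ I) :
    D.crv b t ∈ Metric.ball (D.center v) (D.radius v) ↔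
      (v = D.tail b ∧ t < D.exT b) ∨ (v = D.tail (flip b) ∧ 1 - D.exT (flip b) < t) := by
  rcases b with ⟨e, i⟩
  cases i
  · have := D.mem_ball_iff e v (1 - t) (one_sub_mem ht)
    simp only [crv, tail, exT, flip] at this ⊢
    simp only [Bool.false_eq_true, if_false, Bool.not_false, if_true]
    rw [this, or_comm, lt_sub_comm (a := t), sub_lt_comm (a := (1 : ℝ)) (b := D.exitTime e)]
  · have := D.mem_ball_iff e v t ht
    simp only [crv, tail, exT, flip] at this ⊢
    simpa using this

theorem exT_lt_one (b : E × Bool) : D.exT b < 1 := by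
  have h1 := D.exT_add_lt b
  have h2 := D.exT_pos (flip b)
  linarith

theorem exT_mem (b : E × Bool) : D.exT b ∈ I := ⟨(D.exT_pos b).le, (D.exT_lt_one b).le⟩

theorem transverse (b : E × Bool) :
    0 < inner ℝ (D.crv b (D.exT b) - D.center (D.tail b)) (deriv (D.crv b) (D.exT b)) := by
  rcases b with ⟨e, i⟩
  cases i
  · have h := D.transverse_enter e
    change 0 < inner ℝ (D.crv (flip (e, true)) _ - _) (deriv (D.crv (flip (e, true))) _)
    rw [deriv_crv_flip, crv_flip, inner_neg_right]
    simp only [exT, tail]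
    simp only [Bool.false_eq_true, if_false, sub_sub_cancel]
    change 0 < -inner ℝ (D.curve e (D.enterTime e) - D.center (D.target e))
      (deriv (D.curve e) (D.enterTime e))
    linarith
  · exact D.transverse_exit e

/-! ### The planar sets -/

/-- The union of the arcs. -/
def arcs : Set ℂ := ⋃ b, D.crv b '' I

/-- The union of the boundary circles of the disks. -/
def circles : Set ℂ := ⋃ v, Metric.sphere (D.center v) (D.radius v)

/-- The union of the disks. -/
def disks : Set ℂ := ⋃ v, Metric.closedBall (D.center v) (D.radius v)

/-- The projection of the link to the plane. -/
def proj : Set ℂ := D.arcs ∪ D.circles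

variable {D}

theorem mem_arcs {z : ℂ} : z ∈ D.arcs ↔ ∃ b, ∃ t ∈ I, D.crv b t = z := by
  simp [arcs]

theorem crv_mem_arcs (b : E × Bool) {t : ℝ} (ht : t ∈ I) : D.crv b t ∈ D.arcs :=
  mem_arcs.2 ⟨b, t, ht, rfl⟩

theorem mem_circles {z : ℂ} : z ∈ D.circles ↔ ∃ v, ‖z - D.center v‖ = D.radius v := by
  simp [circles]

theorem crv_mem_circles (b : E × Bool) {t : ℝ} (ht : t ∈ I) :
    D.crv b t ∈ D.circles ↔ t = D.exT b ∨ t = 1 - D.exT (flip b) := by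
  have h1 := D.exT_add_lt b
  rw [circles, Set.mem_iUnion]
  constructor
  · rintro ⟨v, hv⟩
    have h2 := (D.crv_mem_closedBall b v ht).1 (Metric.sphere_subset_closedBall hv)
    have h3 := (D.crv_mem_ball b v ht).not.1 fun h => (Metric.mem_ball.1 h).ne hv
    push Not at h3
    rcases h2 with ⟨h2, h4⟩ | ⟨h2, h4⟩
    · exact Or.inl (le_antisymm h4 (h3.1 h2))
    · exact Or.inr (le_antisymm (h3.2 h2) h4)
  · have key : ∀ v, D.crv b t ∈ Metric.closedBall (D.center v) (D.radius v) →
        D.crv b t ∉ Metric.ball (D.center v) (D.radius v) →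
        ∃ v, D.crv b t ∈ Metric.sphere (D.center v) (D.radius v) := fun v h4 h5 =>
      ⟨v, le_antisymm h4 (not_lt.1 h5)⟩
    rintro (rfl | rfl)
    · refine key (D.tail b) ((D.crv_mem_closedBall b _ ht).2 (Or.inl ⟨rfl, le_rfl⟩)) ?_
      rw [D.crv_mem_ball b _ ht]
      rintro (⟨-, h⟩ | ⟨-, h⟩) <;> linarith
    · refine key (D.tail (flip b)) ((D.crv_mem_closedBall b _ ht).2 (Or.inr ⟨rfl, le_rfl⟩)) ?_
      rw [D.crv_mem_ball b _ ht]
      rintro (⟨-, h⟩ | ⟨-, h⟩) <;> linarith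

/-- Both arcs of an edge loop have squared height `t * (1 - t)`, an expression unchanged by
reversing the edge; so darts may replace oriented edges. -/
theorem mem_link {z : ℂ} {s : ℝ} : (z, s) ∈ D.link ↔
    (z ∈ D.circles ∧ s = 0) ∨ ∃ b, ∃ t ∈ I, D.crv b t = z ∧ s ^ 2 = t * (1 - t) := by
  have hI : ∀ t ∈ I, 0 ≤ t * (1 - t) := fun t ht => mul_nonneg ht.1 (by linarith [ht.2])
  rw [link, Set.mem_union]
  refine or_congr ?_ ?_
  · simp [vertexLoop, circles]
  · rw [Set.mem_iUnion]
    constructor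
    · rintro ⟨e, ⟨t, ht, h⟩ | ⟨t, ht, h⟩⟩
      · rw [Prod.mk.injEq] at h
        exact ⟨(e, true), t, ht, h.1, by rw [← h.2, Real.sq_sqrt (hI t ht)]⟩
      · rw [Prod.mk.injEq] at h
        exact ⟨(e, true), t, ht, h.1, by rw [← h.2, neg_sq, Real.sq_sqrt (hI t ht)]⟩
    · rintro ⟨⟨e, i⟩, t, ht, h1, h2⟩
      obtain ⟨t', ht', h1', h2'⟩ : ∃ t ∈ I, D.curve e t = z ∧ s ^ 2 = t * (1 - t) := by
        cases i
        · exact ⟨1 - t, one_sub_mem ht, h1, by rw [h2]; ring⟩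
        · exact ⟨t, ht, h1, h2⟩
      refine ⟨e, ?_⟩
      have h3 : √(t' * (1 - t')) = |s| := by rw [← h2', Real.sqrt_sq_eq_abs]
      rcases le_total 0 s with hs | hs
      · exact Or.inl ⟨t', ht', by simp only [h3, abs_of_nonneg hs, h1']⟩
      · exact Or.inr ⟨t', ht', by simp only [h3, abs_of_nonpos hs, h1', neg_neg]⟩

/-- Off the arcs the vertical line can meet the link only at height zero on a circle, and a ray that
starts on its own side of the plane moves away from it. -/
theorem free_of_notMem_arcs {z : ℂ} {s : ℝ} {i : Bool} (h : z ∉ D.arcs)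
    (h' : 0 < sgn i * s ∨ z ∉ D.circles) : D.Free i (z, s) := by
  intro r hr hmem
  rcases mem_link.1 hmem with ⟨h1, h2⟩ | ⟨b, t, ht, h1, -⟩
  · rcases h' with h' | h'
    · have h3 : sgn i * (s + sgn i * r) = 0 := by rw [h2, mul_zero]
      rw [mul_add, ← mul_assoc, sgn_mul_self, one_mul] at h3
      linarith
    · exact h' h1
  · exact h (mem_arcs.2 ⟨b, t, ht, h1⟩)

theorem free_of_notMem_proj {z : ℂ} (s : ℝ) (i : Bool) (h : z ∉ D.proj) : D.Free i (z, s) :=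
  free_of_notMem_arcs (fun h' => h (Or.inl h')) (Or.inr fun h' => h (Or.inr h'))

theorem crv_notMem_link (b : E × Bool) {t s : ℝ} (ht : t ∈ I) (hs : s ^ 2 < t * (1 - t))
    (h : s ≠ 0 ∨ D.crv b t ∉ D.circles) : (D.crv b t, s) ∉ D.link := by
  intro hmem
  rcases mem_link.1 hmem with ⟨h1, h2⟩ | ⟨b', t', ht', h1, h2⟩
  · exact h.elim (fun h => h h2) fun h => h h1
  · rcases D.crv_eq_crv ht' ht h1 with ⟨-, rfl⟩ | ⟨-, rfl⟩ <;> nlinarith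

theorem notMem_link_of_notMem_proj {z : ℂ} (s : ℝ) (h : z ∉ D.proj) : (z, s) ∉ D.link :=
  (free_of_notMem_proj s true h).notMem

theorem isCompact_arc (b : E × Bool) : IsCompact (D.crv b '' I) :=
  isCompact_Icc.image (D.continuous_crv b)

theorem isCompact_arcs [Finite E] : IsCompact D.arcs := isCompact_iUnion fun b => isCompact_arc b

theorem isCompact_circles [Finite V] : IsCompact D.circles :=
  isCompact_iUnion fun _ => isCompact_sphere _ _

theorem isCompact_disks [Finite V] : IsCompact D.disks :=
  isCompact_iUnion fun _ => isCompact_closedBall _ _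

theorem isCompact_proj [Finite V] [Finite E] : IsCompact D.proj :=
  isCompact_arcs.union isCompact_circles

/-! ### The arcs near one of their points -/

/-- Near a point of an arc, the union of the arcs stays close to the tangent line. -/
theorem eventually_mem_arcs [Finite E] (b : E × Bool) {t₀ : ℝ} (ht₀ : t₀ ∈ I) {m : ℝ}
    (hm : 0 < m) : ∀ᶠ p : ℝ × ℂ in 𝓝 (t₀, D.crv b t₀), p.2 ∈ D.arcs →
      ∃ s ∈ I, D.crv b s = p.2 ∧
        ‖p.2 - D.crv b p.1 - (s - p.1) • deriv (D.crv b) p.1‖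
          ≤ m * |s - p.1| * ‖deriv (D.crv b) p.1‖ := by
  set c := ‖deriv (D.crv b) t₀‖ with hc
  have hc0 : 0 < c := norm_pos_iff.2 (D.deriv_crv_ne_zero b ht₀)
  have hstrict : HasStrictDerivAt (D.crv b) (deriv (D.crv b) t₀) t₀ :=
    (D.contDiff_crv b).contDiffAt.hasStrictDerivAt (by simp)
  -- Strict differentiability lets both parameters vary. The two errors with factor `m * c / 4`, one
  -- here and one from moving the tangent, add up to at most `m` times the nearby speed, which is at
  -- least `c / 2`.
  have h1 : ∀ᶠ q : ℝ × ℝ in 𝓝 (t₀, t₀), ‖D.crv b q.1 - D.crv b q.2 -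
      (q.1 - q.2) • deriv (D.crv b) t₀‖ ≤ m * c / 4 * ‖q.1 - q.2‖ :=
    hstrict.isLittleO.def (by positivity)
  have h2 : ∀ᶠ t in 𝓝 t₀, ‖deriv (D.crv b) t - deriv (D.crv b) t₀‖ < min (m * c / 4) (c / 2) := by
    have := (D.continuous_deriv_crv b).continuousAt (x := t₀)
    exact (this.sub continuousAt_const).norm.eventually (gt_mem_nhds (by simpa using ⟨by positivity, by positivity⟩))
  rw [nhds_prod_eq] at h1
  obtain ⟨P, hP, Q, hQ, hPQ⟩ := Filter.eventually_prod_iff.1 h1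
  -- The other arcs and the rest of this arc are compact and miss `D.crv b t₀`, so nearby arc points
  -- have nearby parameters.
  have h3 : ∀ᶠ z in 𝓝 (D.crv b t₀), z ∈ D.arcs → ∃ s ∈ I, D.crv b s = z ∧ P s := by
    obtain ⟨U, hUP, hU, htU⟩ := eventually_nhds_iff.1 hP
    have k1 : IsCompact (D.crv b '' (I \ U)) :=
      (isCompact_Icc.diff hU).image (D.continuous_crv b)
    have k2 : IsCompact (⋃ b' : {b' : E × Bool // b'.1 ≠ b.1}, D.crv b' '' I) :=
      isCompact_iUnion fun b' => isCompact_arc b'.1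
    have n1 : D.crv b t₀ ∉ D.crv b '' (I \ U) := by
      rintro ⟨s, hs, hst⟩
      rw [D.crv_injOn b hs.1 ht₀ hst] at hs
      exact hs.2 htU
    have n2 : D.crv b t₀ ∉ ⋃ b' : {b' : E × Bool // b'.1 ≠ b.1}, D.crv b' '' I := by
      rw [Set.mem_iUnion]
      rintro ⟨b', s, hs, hst⟩
      exact b'.2 (D.fst_eq_of_crv_eq hs ht₀ hst)
    filter_upwards [k1.isClosed.isOpen_compl.mem_nhds n1, k2.isClosed.isOpen_compl.mem_nhds n2]
      with z hz1 hz2 hz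
    obtain ⟨b', s, hs, rfl⟩ := mem_arcs.1 hz
    by_cases hb : b'.1 = b.1
    · obtain ⟨s', hs', hss⟩ : ∃ s' ∈ I, D.crv b s' = D.crv b' s := by
        rcases eq_or_eq_flip hb.symm with rfl | rfl
        · exact ⟨s, hs, rfl⟩
        · exact ⟨1 - s, one_sub_mem hs, by rw [crv_flip]⟩
      refine ⟨s', hs', hss, hUP s' ?_⟩
      by_contra hsU
      exact hz1 ⟨s', ⟨hs', hsU⟩, hss⟩
    · exact (hz2 (Set.mem_iUnion.2 ⟨⟨b', hb⟩, s, hs, rfl⟩)).elim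
  rw [nhds_prod_eq]
  filter_upwards [(hQ.and h2).prod_mk h3] with ⟨t, z⟩ ⟨⟨ht, ht2⟩, hz⟩ hza
  obtain ⟨s, hs, rfl, hPs⟩ := hz hza
  refine ⟨s, hs, rfl, ?_⟩
  have h4 := hPQ hPs ht
  simp only at h4 ht2 ⊢
  have h5 : c / 2 ≤ ‖deriv (D.crv b) t‖ := by
    have := norm_sub_norm_le (deriv (D.crv b) t₀) (deriv (D.crv b) t)
    rw [norm_sub_rev] at this
    have := ht2.trans_le (min_le_right _ _)
    linarith
  have h6 : D.crv b s - D.crv b t - (s - t) • deriv (D.crv b) t =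
      (D.crv b s - D.crv b t - (s - t) • deriv (D.crv b) t₀) -
        (s - t) • (deriv (D.crv b) t - deriv (D.crv b) t₀) := by
    rw [smul_sub]; abel
  rw [h6]
  refine (norm_sub_le _ _).trans ?_
  rw [norm_smul, Real.norm_eq_abs]
  rw [Real.norm_eq_abs] at h4
  have h7 := (ht2.trans_le (min_le_left _ _)).le
  have h8 := abs_nonneg (s - t)
  nlinarith [mul_le_mul_of_nonneg_left h7 h8, mul_le_mul_of_nonneg_left h5 (mul_nonneg hm.le h8)]

/-- The point at signed distance proportional to `η` from `crv b t`, on the left for `η > 0`. -/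
def nrm (b : E × Bool) (t η : ℝ) : ℂ := D.crv b t + η * (Complex.I * deriv (D.crv b) t)

end PlaneDrawing

namespace PlaneDrawing

variable {V E : Type*} {D : PlaneDrawing V E}

theorem nrm_zero (b : E × Bool) (t : ℝ) : D.nrm b t 0 = D.crv b t := by simp [nrm]

theorem nrm_flip (b : E × Bool) (t η : ℝ) : D.nrm (flip b) t η = D.nrm b (1 - t) (-η) := by
  simp only [nrm, crv_flip, deriv_crv_flip]
  push_cast
  ring

variable (D) in
theorem continuous_nrm (b : E × Bool) : Continuous fun p : ℝ × ℝ => D.nrm b p.1 p.2 := by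
  have h1 := D.continuous_crv b
  have h2 := D.continuous_deriv_crv b
  unfold nrm
  fun_prop

/-- A normal displacement is orthogonal to the tangent, so if it ended on an arc at parameter `s`,
the tangent estimate with factor 1/2 would bound both `|s - t|` and `|η|` by `|s - t| / 2`. -/
theorem eventually_nrm_notMem_arcs [Finite E] (b : E × Bool) {t₀ : ℝ} (ht₀ : t₀ ∈ I) :
    ∀ᶠ p : ℝ × ℝ in 𝓝 (t₀, 0), (p.2 ≠ 0 ∨ p.1 ∉ I) → D.nrm b p.1 p.2 ∉ D.arcs := by
  have h1 := eventually_mem_arcs (D := D) b ht₀ (m := 1 / 2) (by norm_num)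
  have h2 : Tendsto (fun p : ℝ × ℝ => (p.1, D.nrm b p.1 p.2)) (𝓝 (t₀, 0))
      (𝓝 (t₀, D.crv b t₀)) := by
    have : Continuous fun p : ℝ × ℝ => (p.1, D.nrm b p.1 p.2) :=
      continuous_fst.prodMk (D.continuous_nrm b)
    have h := this.tendsto (t₀, 0)
    rwa [nrm_zero] at h
  have h3 : ∀ᶠ p : ℝ × ℝ in 𝓝 (t₀, 0), deriv (D.crv b) p.1 ≠ 0 :=
    (((D.continuous_deriv_crv b).comp continuous_fst).continuousAt (x := (t₀, 0))).eventually_ne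
      (D.deriv_crv_ne_zero b ht₀)
  filter_upwards [h2.eventually h1, h3] with ⟨t, η⟩ hp hd hor hmem
  obtain ⟨s, hs, hst, hle⟩ := hp hmem
  simp only at hle hd hor
  have h4 : D.nrm b t η - D.crv b t - (s - t) • deriv (D.crv b) t =
      (η * Complex.I - (s - t : ℝ)) * deriv (D.crv b) t := by
    simp only [nrm, Complex.real_smul]; ring
  rw [h4, norm_mul] at hle
  have h5 := le_of_mul_le_mul_right hle (norm_pos_iff.2 hd)
  have h6 : |s - t| ≤ ‖(η * Complex.I - (s - t : ℝ) : ℂ)‖ := by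
    have := Complex.abs_re_le_norm (η * Complex.I - (s - t : ℝ) : ℂ)
    simpa [abs_sub_comm] using this
  have h7 : |η| ≤ ‖(η * Complex.I - (s - t : ℝ) : ℂ)‖ := by
    have := Complex.abs_im_le_norm (η * Complex.I - (s - t : ℝ) : ℂ)
    simpa using this
  have h8 : |s - t| = 0 := by
    have := abs_nonneg (s - t); linarith
  have h9 : |η| = 0 := by
    have := abs_nonneg η; linarith
  have h10 : s = t := by rw [abs_eq_zero] at h8; linarith
  rcases hor with h | h
  · exact h (abs_eq_zero.1 h9)
  · exact h (h10 ▸ hs)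

variable (D) in
/-- A time at which a dart is outside of all disks. -/
def mid (b : E × Bool) : ℝ := (D.exT b + (1 - D.exT (flip b))) / 2

theorem mid_flip (b : E × Bool) : D.mid (flip b) = 1 - D.mid b := by
  simp only [mid, flip_flip]; ring

theorem exT_lt_mid (b : E × Bool) : D.exT b < D.mid b := by
  have := D.exT_add_lt b
  unfold mid; linarith

theorem mid_lt (b : E × Bool) : D.mid b < 1 - D.exT (flip b) := by
  have := D.exT_add_lt b
  unfold mid; linarith

theorem mid_mem (b : E × Bool) : D.mid b ∈ I :=
  ⟨((D.exT_pos b).trans (exT_lt_mid b)).le, by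
    have := D.exT_pos (flip b); have := mid_lt (D := D) b; linarith⟩

-- Compactness of the unit interval makes the local statement uniform. Parameters slightly beyond
-- the unit interval are included because loops have to pass around the ends of the arcs. The last
-- clause keeps two reference normal segments of each dart, outside and inside the disk, off the
-- circles.
variable (D) in
theorem exists_eps [Finite V] [Finite E] : ∃ ε > 0, (∀ b : E × Bool, ∀ t ∈ Set.Icc (-ε) (1 + ε),
    ∀ η, |η| ≤ ε → (η ≠ 0 ∨ t ∉ I) → D.nrm b t η ∉ D.arcs) ∧ ∀ b : E × Bool, ∀ η, |η| ≤ ε →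
    D.nrm b (D.mid b) η ∉ D.circles ∧ D.nrm b (D.exT b / 2) η ∉ D.circles := by
  have h1 : ∀ b : E × Bool, ∀ᶠ p : ℝ × ℝ in 𝓝 (0, 0), ∀ t₀ ∈ I,
      (p.2 ≠ 0 ∨ t₀ + p.1 ∉ I) → D.nrm b (t₀ + p.1) p.2 ∉ D.arcs := by
    intro b
    refine isCompact_Icc.eventually_forall_of_forall_eventually fun t₀ ht₀ => ?_
    have h2 := eventually_nrm_notMem_arcs (D := D) b ht₀
    have h3 : Tendsto (fun z : (ℝ × ℝ) × ℝ => (z.2 + z.1.1, z.1.2)) (𝓝 ((0, 0), t₀))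
        (𝓝 (t₀, 0)) := by
      have : Continuous fun z : (ℝ × ℝ) × ℝ => (z.2 + z.1.1, z.1.2) := by fun_prop
      simpa using this.tendsto ((0, 0), t₀)
    exact h3.eventually h2
  have h4 : ∀ b : E × Bool, ∀ t ∈ I, D.crv b t ∉ D.circles →
      ∀ᶠ η in 𝓝 (0 : ℝ), D.nrm b t η ∉ D.circles := by
    intro b t ht hc
    have : Continuous fun η => D.nrm b t η :=
      (D.continuous_nrm b).comp (by fun_prop : Continuous fun η : ℝ => (t, η))
    have h5 := this.tendsto 0
    rw [nrm_zero] at h5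
    exact h5.eventually (isCompact_circles.isClosed.isOpen_compl.mem_nhds hc)
  have h6 : ∀ b : E × Bool, ∀ᶠ η in 𝓝 (0 : ℝ), D.nrm b (D.mid b) η ∉ D.circles ∧
      D.nrm b (D.exT b / 2) η ∉ D.circles := by
    intro b
    have e0 := D.exT_pos b
    have e1 := D.exT_lt_one b
    have e2 := D.exT_add_lt b
    have e3 := exT_lt_mid (D := D) b
    have e4 := mid_lt (D := D) b
    have hmem : D.exT b / 2 ∈ I := ⟨by linarith, by linarith⟩
    refine (h4 b _ (mid_mem b) ?_).and (h4 b _ hmem ?_)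
    · rw [crv_mem_circles b (mid_mem b)]
      rintro (h | h) <;> linarith
    · rw [crv_mem_circles b hmem]
      rintro (h | h) <;> linarith
  have h1' := eventually_all.2 h1
  have h6' := eventually_all.2 h6
  obtain ⟨ε₁, hε₁, h1''⟩ := Metric.eventually_nhds_iff.1 h1'
  obtain ⟨ε₂, hε₂, h6''⟩ := Metric.eventually_nhds_iff.1 h6'
  refine ⟨min (ε₁ / 2) (ε₂ / 2), by positivity, fun b t ht η hη hor => ?_, fun b η hη => ?_⟩
  · have hm1 : min (ε₁ / 2) (ε₂ / 2) ≤ ε₁ / 2 := min_le_left _ _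
    set t₀ := max 0 (min t 1) with ht₀
    have ht₀I : t₀ ∈ I := ⟨le_max_left _ _, max_le zero_le_one (min_le_right _ _)⟩
    have ht1 : |t - t₀| ≤ ε₁ / 2 := by
      rw [ht₀, abs_le]
      rcases max_cases 0 (min t 1) with h | h <;> rcases min_cases t 1 with h' | h' <;>
        constructor <;> linarith [ht.1, ht.2]
    have h7 := h1'' (y := (t - t₀, η)) (by
      rw [Prod.dist_eq, Real.dist_eq, Real.dist_eq, sub_zero, sub_zero]
      refine max_lt ?_ ?_ <;> linarith) b t₀ ht₀I
    simp only [add_sub_cancel] at h7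
    exact h7 hor
  · refine h6'' ?_ b
    rw [Real.dist_eq, sub_zero]
    have : min (ε₁ / 2) (ε₂ / 2) ≤ ε₂ / 2 := min_le_right _ _
    linarith

variable (D) in
/-- A distance at which the parallels of the arcs are disjoint from the arcs. -/
def eps [Finite V] [Finite E] : ℝ := D.exists_eps.choose

theorem eps_pos [Finite V] [Finite E] : 0 < D.eps := D.exists_eps.choose_spec.1

theorem nrm_notMem_arcs [Finite V] [Finite E] (b : E × Bool) {t η : ℝ}
    (ht : t ∈ Set.Icc (-D.eps) (1 + D.eps)) (hη : |η| ≤ D.eps) (h : η ≠ 0 ∨ t ∉ I) :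
    D.nrm b t η ∉ D.arcs := D.exists_eps.choose_spec.2.1 b t ht η hη h

theorem nrm_notMem_arcs' [Finite V] [Finite E] (b : E × Bool) {t η : ℝ}
    (ht : t ∈ I) (hη : |η| ≤ D.eps) (h : η ≠ 0) : D.nrm b t η ∉ D.arcs := by
  have := eps_pos (D := D)
  exact nrm_notMem_arcs b ⟨by linarith [ht.1], by linarith [ht.2]⟩ hη (Or.inl h)

theorem nrm_mid_notMem_circles [Finite V] [Finite E] (b : E × Bool) {η : ℝ} (hη : |η| ≤ D.eps) :
    D.nrm b (D.mid b) η ∉ D.circles := (D.exists_eps.choose_spec.2.2 b η hη).1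

theorem nrm_half_notMem_circles [Finite V] [Finite E] (b : E × Bool) {η : ℝ} (hη : |η| ≤ D.eps) :
    D.nrm b (D.exT b / 2) η ∉ D.circles := (D.exists_eps.choose_spec.2.2 b η hη).2

/-! ### Crossing an arc -/

variable (D) in
/-- The signed distance from `z` to the tangent line of the arc, up to a positive factor. -/
def side (b : E × Bool) (t : ℝ) (z : ℂ) : ℝ := ((z - D.crv b t) * conj (deriv (D.crv b) t)).im

variable (D) in
/-- The points in the ball of radius `R` around `crv b t` that are seen from there under an angle
of sine at least `m` to the tangent line are not on the arcs. -/
def ConeFree (b : E × Bool) (t m R : ℝ) : Prop := ∀ z, ‖z - D.crv b t‖ < R → z ≠ D.crv b t →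
  m * (‖z - D.crv b t‖ * ‖deriv (D.crv b) t‖) ≤ |D.side b t z| → z ∉ D.arcs

/-- By the tangent estimate with factor `m / 3`, arc points are seen under a smaller angle to the
tangent than the cone allows. -/
theorem exists_coneFree [Finite E] (b : E × Bool) {t₀ : ℝ} (ht₀ : t₀ ∈ I) {m : ℝ} (hm : 0 < m)
    (hm1 : m ≤ 1) : ∃ R > 0, ∀ᶠ t in 𝓝 t₀, D.ConeFree b t m R := by
  have h1 := eventually_mem_arcs (D := D) b ht₀ (m := m / 3) (by positivity)
  rw [nhds_prod_eq] at h1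
  obtain ⟨P, hP, Q, hQ, hPQ⟩ := Filter.eventually_prod_iff.1 h1
  obtain ⟨R, hR, hRQ⟩ := Metric.eventually_nhds_iff.1 hQ
  have h3 : ∀ᶠ t in 𝓝 t₀, deriv (D.crv b) t ≠ 0 :=
    (D.continuous_deriv_crv b).continuousAt.eventually_ne (D.deriv_crv_ne_zero b ht₀)
  have h4 : ∀ᶠ t in 𝓝 t₀, dist (D.crv b t) (D.crv b t₀) < R / 2 :=
    (D.continuous_crv b).continuousAt.eventually (Metric.ball_mem_nhds _ (by positivity))
  refine ⟨R / 2, by positivity, ?_⟩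
  filter_upwards [hP, h3, h4] with t ht hd htR z hz hne hle hmem
  have hzQ : Q z := hRQ (by
    have := dist_triangle z (D.crv b t) (D.crv b t₀)
    rw [dist_eq_norm z (D.crv b t)] at this
    linarith)
  obtain ⟨s, hs, hsz, hle2⟩ := hPQ ht hzQ hmem
  simp only at hsz hle2
  set d := deriv (D.crv b) t with hddef
  set w := z - D.crv b t with hw
  have hd0 : 0 < ‖d‖ := norm_pos_iff.2 hd
  have hw0 : 0 < ‖w‖ := norm_pos_iff.2 (sub_ne_zero.2 hne)
  have h5 : D.side b t z = ((w - (s - t) • d) * conj d).im := by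
    have : (w - (s - t) • d) * conj d =
        w * conj d - (((s - t) * Complex.normSq d : ℝ) : ℂ) := by
      rw [Complex.real_smul, sub_mul, mul_assoc, Complex.mul_conj, Complex.ofReal_mul]
    rw [this, Complex.sub_im, Complex.ofReal_im, sub_zero]
    rfl
  have h6 : |D.side b t z| ≤ ‖w - (s - t) • d‖ * ‖d‖ := by
    rw [h5]
    refine (Complex.abs_im_le_norm _).trans ?_
    rw [norm_mul, Complex.norm_conj]
  have h7 : |s - t| * ‖d‖ ≤ ‖w - (s - t) • d‖ + ‖w‖ := by
    have := norm_sub_le w (w - (s - t) • d)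
    rw [sub_sub_cancel, norm_smul, Real.norm_eq_abs] at this
    linarith
  have h8 : m * ‖w‖ ≤ ‖w - (s - t) • d‖ := by
    refine le_of_mul_le_mul_right (le_trans ?_ (hle.trans h6)) hd0
    rw [mul_assoc]
  have h9 : ‖w - (s - t) • d‖ ≤ m / 3 * (‖w - (s - t) • d‖ + ‖w‖) := by
    refine hle2.trans ?_
    rw [mul_assoc]
    exact mul_le_mul_of_nonneg_left h7 (by positivity)
  -- The deviation `x` from the tangent satisfies `m * ‖w‖ ≤ x ≤ m / 3 * (x + ‖w‖)`, impossible for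
  -- `w ≠ 0` and `m ≤ 1`.
  nlinarith [norm_nonneg (w - (s - t) • d)]

variable (D) in
/-- The curve `f` crosses the arc of `b` from the right to the left at time `t`, transversally in a
weak sense. -/
structure IsCross (b : E × Bool) (t : ℝ) (f : ℝ → ℂ) : Prop where
  cont : Continuous f
  map_zero : f 0 = D.crv b t
  exists_cone : ∃ m R, 0 < m ∧ m ≤ 1 ∧ 0 < R ∧ D.ConeFree b t m R ∧ ∀ u ∈ Set.Icc (-1 : ℝ) 1,
    ‖f u - D.crv b t‖ < R ∧
    (0 < u → f u ≠ D.crv b t ∧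
      m * (‖f u - D.crv b t‖ * ‖deriv (D.crv b) t‖) ≤ D.side b t (f u)) ∧
    (u < 0 → f u ≠ D.crv b t ∧
      m * (‖f u - D.crv b t‖ * ‖deriv (D.crv b) t‖) ≤ -D.side b t (f u))

theorem side_nrm (b : E × Bool) (t η : ℝ) :
    D.side b t (D.nrm b t η) = η * ‖deriv (D.crv b) t‖ ^ 2 := by
  have : (D.nrm b t η - D.crv b t) * conj (deriv (D.crv b) t) =
      ((η * ‖deriv (D.crv b) t‖ ^ 2 : ℝ) : ℂ) * Complex.I := by
    simp only [nrm, add_sub_cancel_left]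
    rw [mul_assoc, mul_assoc, Complex.mul_conj, Complex.normSq_eq_norm_sq]
    push_cast; ring
  rw [side, this, Complex.im_ofReal_mul, Complex.I_im, mul_one]

theorem norm_nrm_sub (b : E × Bool) (t η : ℝ) :
    ‖D.nrm b t η - D.crv b t‖ = |η| * ‖deriv (D.crv b) t‖ := by
  simp [nrm]

/-- The side is affine and the distance is convex, so each half of the double cone is stable under
convex combinations; this permits linear homotopies between crossings. -/
theorem side_comb (b : E × Bool) (t s : ℝ) (z w : ℂ) :
    D.side b t ((1 - s : ℝ) * z + s * w) = (1 - s) * D.side b t z + s * D.side b t w := by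
  have : ((1 - s : ℝ) * z + s * w - D.crv b t) * conj (deriv (D.crv b) t) =
      (1 - s : ℝ) * ((z - D.crv b t) * conj (deriv (D.crv b) t)) +
        s * ((w - D.crv b t) * conj (deriv (D.crv b) t)) := by
    push_cast; ring
  rw [side, this, Complex.add_im, Complex.im_ofReal_mul, Complex.im_ofReal_mul, side, side]

theorem norm_comb_sub_le {s : ℝ} (hs : s ∈ I) (z w c : ℂ) :
    ‖(1 - s : ℝ) * z + s * w - c‖ ≤ (1 - s) * ‖z - c‖ + s * ‖w - c‖ := by
  have : (1 - s : ℝ) * z + s * w - c = (1 - s : ℝ) * (z - c) + s * (w - c) := by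
    push_cast; ring
  rw [this]
  refine (norm_add_le _ _).trans ?_
  rw [norm_mul, norm_mul, Complex.norm_real, Complex.norm_real, Real.norm_eq_abs,
    Real.norm_eq_abs, abs_of_nonneg (by linarith [hs.2]), abs_of_nonneg hs.1]

theorem IsCross.notMem_arcs {b : E × Bool} {t : ℝ} {f : ℝ → ℂ} (hf : D.IsCross b t f) {u : ℝ}
    (hu : u ∈ Set.Icc (-1 : ℝ) 1) (h0 : u ≠ 0) : f u ∉ D.arcs := by
  obtain ⟨m, R, -, -, -, hc, h⟩ := hf.exists_cone
  obtain ⟨h1, h2, h3⟩ := h u hu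
  rcases lt_or_gt_of_ne h0 with h0 | h0
  · exact hc _ h1 (h3 h0).1 ((h3 h0).2.trans (neg_le_abs _))
  · exact hc _ h1 (h2 h0).1 ((h2 h0).2.trans (le_abs_self _))

/-- A crossing can be deformed linearly to a short straight one. -/
theorem IsCross.exists_homotopy {b : E × Bool} {t : ℝ} (ht : t ∈ I) {f : ℝ → ℂ}
    (hf : D.IsCross b t f) : ∃ η₁ > 0, ∀ η, 0 < η → η ≤ η₁ → ∀ u ∈ Set.Icc (-1 : ℝ) 1, u ≠ 0 →
      ∀ s ∈ I, (1 - s : ℝ) * f u + s * D.nrm b t (u * η) ∉ D.arcs := by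
  obtain ⟨m, R, hm, hm1, hR, hc, h⟩ := hf.exists_cone
  set d := ‖deriv (D.crv b) t‖ with hd
  have hd0 : 0 < d := norm_pos_iff.2 (D.deriv_crv_ne_zero b ht)
  -- This bound keeps the straight crossing within `R / 2` of the arc point.
  refine ⟨R / (2 * d), by positivity, fun η hη hηle u hu hu0 s hs => ?_⟩
  obtain ⟨h1, h2, h3⟩ := h u hu
  have hn := norm_nrm_sub (D := D) b t (u * η)
  have hsn := side_nrm (D := D) b t (u * η)
  rw [← hd] at hn hsn
  have hnR : ‖D.nrm b t (u * η) - D.crv b t‖ < R := by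
    rw [hn, abs_mul, abs_of_pos hη]
    have : |u| ≤ 1 := abs_le.2 hu
    have h4 : η * d ≤ R / 2 := by
      rw [le_div_iff₀ (by positivity)] at hηle
      linarith
    nlinarith [abs_nonneg u, mul_pos hη hd0]
  have hle := norm_comb_sub_le hs (f u) (D.nrm b t (u * η)) (D.crv b t)
  have hs0 := hs.1
  have hs1 := hs.2
  have hlt : ‖(1 - s : ℝ) * f u + s * D.nrm b t (u * η) - D.crv b t‖ < R := by
    rcases hs0.eq_or_lt with h | h
    · subst h; simpa using h1
    · have : s * ‖D.nrm b t (u * η) - D.crv b t‖ < s * R := mul_lt_mul_of_pos_left hnR h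
      have : (1 - s) * ‖f u - D.crv b t‖ ≤ (1 - s) * R :=
        mul_le_mul_of_nonneg_left h1.le (by linarith)
      linarith
  have hcomb := side_comb (D := D) b t s (f u) (D.nrm b t (u * η))
  rw [hsn] at hcomb
  -- The sign `ς` treats the left and the right half of the crossing at once.
  have key : ∀ ς : ℝ, (ς = 1 ∨ ς = -1) → 0 < ς * u →
      (f u ≠ D.crv b t ∧ m * (‖f u - D.crv b t‖ * d) ≤ ς * D.side b t (f u)) →
      (1 - s : ℝ) * f u + s * D.nrm b t (u * η) ∉ D.arcs := by
    rintro ς hς hςu ⟨h4, h5⟩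
    have hςη : |u * η| = ς * u * η := by
      rw [abs_mul, abs_of_pos hη]
      congr 1
      rcases hς with rfl | rfl
      · rw [one_mul] at hςu ⊢; exact abs_of_pos hςu
      · rw [neg_one_mul] at hςu ⊢; exact abs_of_neg (by linarith)
    rw [hςη] at hn
    have h6 : 0 < ‖f u - D.crv b t‖ := norm_pos_iff.2 (sub_ne_zero.2 h4)
    have h7 : 0 < ς * u * η := mul_pos hςu hη
    have hpos : 0 < ς * ((1 - s) * D.side b t (f u) + s * (u * η * d ^ 2)) := by
      have e1 : 0 < ς * D.side b t (f u) := lt_of_lt_of_le (by positivity) h5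
      have e2 : 0 < ς * (u * η * d ^ 2) := by
        have : 0 < ς * u * η * d ^ 2 := by positivity
        nlinarith
      rcases hs0.eq_or_lt with h | h
      · subst h; linarith
      · nlinarith [mul_nonneg (sub_nonneg.2 hs1) e1.le, mul_pos h e2]
    refine hc _ hlt ?_ ?_
    · intro he
      rw [he] at hcomb
      rw [← hcomb] at hpos
      simp [side] at hpos
    · rw [hcomb]
      refine le_trans (b := ς * ((1 - s) * D.side b t (f u) + s * (u * η * d ^ 2))) ?_ ?_
      · have e3 := mul_le_mul_of_nonneg_left (mul_le_mul_of_nonneg_right hle hd0.le) hm.le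
        refine e3.trans ?_
        rw [hn]
        have e4 := mul_le_mul_of_nonneg_left h5 (sub_nonneg.2 hs1)
        have e5 : m * (s * (ς * u * η * d) * d) ≤ s * (ς * u * η * d) * d :=
          mul_le_of_le_one_left (by positivity) hm1
        nlinarith
      · refine (le_abs_self _).trans ?_
        rw [abs_mul]
        have : |ς| = 1 := by rcases hς with rfl | rfl <;> simp
        rw [this, one_mul]
  rcases lt_or_gt_of_ne hu0 with h0 | h0
  · exact key (-1) (Or.inr rfl) (by linarith) ⟨(h3 h0).1, by simpa using (h3 h0).2⟩
  · exact key 1 (Or.inl rfl) (by linarith) ⟨(h2 h0).1, by simpa using (h2 h0).2⟩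

end PlaneDrawing

namespace PlaneDrawing

variable {V E : Type*} {D : PlaneDrawing V E} [Finite V] [Finite E]

/-! ### Crossing loops -/

variable (D) in
/-- The loop that passes below the upper arc (for `i = true`) or above the lower arc (for
`i = false`) of the edge of `b`, from the right to the left. -/
def cross (b : E × Bool) (i : Bool) : D.base ⟶ D.base :=
  D.genOn (fun u => (D.nrm b (1 / 2) (u * D.eps), sgn i / 4)) (-1) 1 i i

omit [Finite V] [Finite E] in
theorem continuous_nrm_mul (b : E × Bool) (t η : ℝ) : Continuous fun u : ℝ => D.nrm b t (u * η) :=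
  (D.continuous_nrm b).comp (by fun_prop : Continuous fun u : ℝ => (t, u * η))

/-- The admissible pairs of parameter and height form an open disk, and its half on the side `i` is
convex; so everything moves linearly to the parameters in the definition of `cross`. -/
theorem genOn_nrm {b : E × Bool} {t s η : ℝ} {i : Bool} (hη : 0 < η) (hηε : η ≤ D.eps)
    (hs : s ^ 2 < t * (1 - t)) (hs0 : 0 < sgn i * s) :
    D.genOn (fun u => (D.nrm b t (u * η), s)) (-1) 1 i i = D.cross b i := by
  have hε := eps_pos (D := D)
  have hI : ∀ s t : ℝ, s ^ 2 < t * (1 - t) → t ∈ I := fun s t h =>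
    ⟨by nlinarith [sq_nonneg s], by nlinarith [sq_nonneg s]⟩
  have hcont : Continuous fun z : ℝ × ℝ => ((D.nrm b ((1 - z.2) * t + z.2 * (1 / 2))
      (z.1 * ((1 - z.2) * η + z.2 * D.eps)), (1 - z.2) * s + z.2 * (sgn i / 4)) : ℂ × ℝ) :=
    ((D.continuous_nrm b).comp (by fun_prop : Continuous fun z : ℝ × ℝ =>
      ((1 - z.2) * t + z.2 * (1 / 2), z.1 * ((1 - z.2) * η + z.2 * D.eps)))).prodMk (by fun_prop)
  have hsgn := sgn_mul_self i
  have key : ∀ r ∈ I, ((1 - r) * s + r * (sgn i / 4)) ^ 2 <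
      ((1 - r) * t + r * (1 / 2)) * (1 - ((1 - r) * t + r * (1 / 2))) ∧
      0 < sgn i * ((1 - r) * s + r * (sgn i / 4)) ∧
      0 < (1 - r) * η + r * D.eps ∧ (1 - r) * η + r * D.eps ≤ D.eps := by
    intro r hr
    have h0 := hr.1
    have h1 : 0 ≤ 1 - r := by linarith [hr.2]
    refine ⟨?_, ?_, ?_, ?_⟩
    · have e1 : (sgn i / 4) ^ 2 = 1 / 16 := by rw [div_pow, sq, hsgn]; norm_num
      -- Convexity of the squared distance to the centre `(1/2, 0)` of that disk; the target lies at
      -- squared distance `1/16`, inside the radius `1/2`.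
      have e2 : ((1 - r) * s + r * (sgn i / 4)) ^ 2 + ((1 - r) * t + r * (1 / 2) - 1 / 2) ^ 2 ≤
          (1 - r) * (s ^ 2 + (t - 1 / 2) ^ 2) + r * (1 / 16) := by
        have e3 : 0 ≤ (1 - r) * r * ((s - sgn i / 4) ^ 2 + (t - 1 / 2) ^ 2) := by positivity
        nlinarith
      have e4 : (1 - r) * (s ^ 2 + (t - 1 / 2) ^ 2) + r * (1 / 16) < 1 / 4 := by
        have e5 : s ^ 2 + (t - 1 / 2) ^ 2 < 1 / 4 := by nlinarith
        rcases h1.eq_or_lt with h | h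
        · have : r = 1 := by linarith
          subst this; norm_num
        · nlinarith
      nlinarith
    · have : sgn i * ((1 - r) * s + r * (sgn i / 4)) = (1 - r) * (sgn i * s) + r / 4 := by
        linear_combination (r / 4) * hsgn
      rw [this]
      rcases h0.eq_or_lt with h | h
      · subst h; simpa using hs0
      · nlinarith [mul_nonneg h1 hs0.le]
    · rcases h0.eq_or_lt with h | h
      · subst h; simpa using hη
      · nlinarith [mul_nonneg h1 hη.le, mul_pos h hε]
    · nlinarith
  have hfree : ∀ r ∈ I, ∀ u : ℝ, u ≠ 0 → |u| ≤ 1 → D.Free i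
      (D.nrm b ((1 - r) * t + r * (1 / 2)) (u * ((1 - r) * η + r * D.eps)),
        (1 - r) * s + r * (sgn i / 4)) := by
    intro r hr u hu0 hu
    obtain ⟨k1, k2, k3, k4⟩ := key r hr
    refine free_of_notMem_arcs (nrm_notMem_arcs' b (hI _ _ k1) ?_ (mul_ne_zero hu0 k3.ne'))
      (Or.inl k2)
    rw [abs_mul, abs_of_pos k3]
    nlinarith [abs_nonneg u]
  have h := genOn_homotopy (D := D) (F := fun u r => (D.nrm b ((1 - r) * t + r * (1 / 2))
      (u * ((1 - r) * η + r * D.eps)), (1 - r) * s + r * (sgn i / 4)))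
    hcont (a := -1) (b := 1) (by norm_num) (i := i) (j := i)
    (fun u hu r hr => ?_) (fun r hr => hfree r hr (-1) (by norm_num) (by norm_num))
    (fun r hr => hfree r hr 1 (by norm_num) (by norm_num))
  · simpa [cross] using h
  · by_cases hu0 : u = 0
    · subst hu0
      obtain ⟨k1, k2, k3, k4⟩ := key r hr
      simp only [zero_mul, nrm_zero]
      refine crv_notMem_link b (hI _ _ k1) k1 (Or.inl fun h => ?_)
      rw [h, mul_zero] at k2
      exact lt_irrefl _ k2
    · exact (hfree r hr u hu0 (abs_le.2 hu)).notMem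

theorem genOn_cross_of_pos {b : E × Bool} {t s : ℝ} {i : Bool} {f : ℝ → ℂ}
    (hs : s ^ 2 < t * (1 - t)) (hf : D.IsCross b t f) (h0 : 0 < sgn i * s) :
    D.genOn (fun u => (f u, s)) (-1) 1 i i = D.cross b i := by
  have hε := eps_pos (D := D)
  have ht : t ∈ I := ⟨by nlinarith [sq_nonneg s], by nlinarith [sq_nonneg s]⟩
  obtain ⟨η₁, hη₁, hη⟩ := hf.exists_homotopy ht
  set η := min η₁ D.eps with hηdef
  have hηpos : 0 < η := lt_min hη₁ hε
  have hη' := hη η hηpos (min_le_left _ _)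
  rw [← genOn_nrm (b := b) hηpos (min_le_right _ _) hs h0]
  have hcont : Continuous fun z : ℝ × ℝ =>
      (((1 - z.2 : ℝ) * f z.1 + z.2 * D.nrm b t (z.1 * η), s) : ℂ × ℝ) := by
    have h1 := hf.cont
    have h2 := continuous_nrm_mul (D := D) b t η
    have h3 := h1.comp (continuous_fst (X := ℝ) (Y := ℝ))
    have h4 := h2.comp (continuous_fst (X := ℝ) (Y := ℝ))
    exact (((Complex.continuous_ofReal.comp (by fun_prop)).mul h3).add
      ((Complex.continuous_ofReal.comp continuous_snd).mul h4)).prodMk continuous_const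
  have hfree : ∀ u ∈ Set.Icc (-1 : ℝ) 1, u ≠ 0 → ∀ r ∈ I, D.Free i
      ((1 - r : ℝ) * f u + r * D.nrm b t (u * η), s) := fun u hu hu0 r hr =>
    free_of_notMem_arcs (hη' u hu hu0 r hr) (Or.inl h0)
  have h := genOn_homotopy (D := D)
    (F := fun u r => ((1 - r : ℝ) * f u + r * D.nrm b t (u * η), s)) hcont
    (a := -1) (b := 1) (by norm_num) (i := i) (j := i)
    (fun u hu r hr => ?_) (fun r hr => hfree (-1) (by norm_num) (by norm_num) r hr)
    (fun r hr => hfree 1 (by norm_num) (by norm_num) r hr)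
  · simpa using h
  · by_cases hu0 : u = 0
    · subst hu0
      have : ((1 - r : ℝ) : ℂ) * f 0 + r * D.nrm b t (0 * η) = D.crv b t := by
        rw [hf.map_zero, zero_mul, nrm_zero]; push_cast; ring
      simp only [this]
      refine crv_notMem_link b ht hs (Or.inl fun h => ?_)
      rw [h, mul_zero] at h0
      exact lt_irrefl _ h0
    · exact (hfree u hu hu0 r hr).notMem

/-- The loop that crosses an arc between the upper and the lower arc of the link depends only on the
edge and the side of infinity from which one comes. -/
theorem genOn_cross {b : E × Bool} {t s : ℝ} {i : Bool} {f : ℝ → ℂ}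
    (hs : s ^ 2 < t * (1 - t)) (hf : D.IsCross b t f)
    (h : 0 < sgn i * s ∨ s = 0 ∧ ∀ u ∈ Set.Icc (-1 : ℝ) 1, f u ∉ D.circles) :
    D.genOn (fun u => (f u, s)) (-1) 1 i i = D.cross b i := by
  have ht : t ∈ I := ⟨by nlinarith [sq_nonneg s], by nlinarith [sq_nonneg s]⟩
  rcases h with h0 | ⟨rfl, h0⟩
  · exact genOn_cross_of_pos hs hf h0
  -- At height zero and away from the circles, the whole crossing is lifted to half the height of
  -- the arc above or below it.
  · set s₁ : ℝ := sgn i * (√(t * (1 - t)) / 2) with hs₁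
    have hpos : 0 < t * (1 - t) := by simpa using hs
    have hsqrt : 0 < √(t * (1 - t)) := Real.sqrt_pos.2 hpos
    have hsq : s₁ ^ 2 = t * (1 - t) / 4 := by
      rw [hs₁, mul_pow, sq, sgn_mul_self, div_pow, Real.sq_sqrt hpos.le]; ring
    have hs₁pos : 0 < sgn i * s₁ := by
      rw [hs₁, ← mul_assoc, sgn_mul_self]; positivity
    have ih := genOn_cross_of_pos (i := i) (s := s₁) (by rw [hsq]; linarith) hf hs₁pos
    rw [← ih]
    have hcont : Continuous fun z : ℝ × ℝ => ((f z.1, z.2 * s₁) : ℂ × ℝ) := by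
      have h1 := hf.cont
      fun_prop
    have hfree : ∀ u ∈ Set.Icc (-1 : ℝ) 1, u ≠ 0 → ∀ r : ℝ, D.Free i (f u, r * s₁) :=
      fun u hu hu0 r => free_of_notMem_arcs (hf.notMem_arcs hu hu0) (Or.inr (h0 u hu))
    have h := genOn_homotopy (D := D) (F := fun u r => (f u, r * s₁)) hcont
      (a := -1) (b := 1) (by norm_num) (i := i) (j := i)
      (fun u hu r hr => ?_) (fun r hr => hfree (-1) (by norm_num) (by norm_num) r)
      (fun r hr => hfree 1 (by norm_num) (by norm_num) r)
    · simpa using h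
    · by_cases hu0 : u = 0
      · subst hu0
        have h1 := h0 0 (by norm_num)
        simp only [hf.map_zero] at h1 ⊢
        refine crv_notMem_link b ht ?_ (Or.inr h1)
        rw [mul_pow, hsq]
        have : r ^ 2 ≤ 1 := by nlinarith [hr.1, hr.2]
        nlinarith
      · exact (hfree u hu hu0 r).notMem

theorem cross_flip (b : E × Bool) (i : Bool) :
    D.cross (flip b) i = Groupoid.inv (D.cross b i) := by
  have hε := eps_pos (D := D)
  have hsgn := sgn_mul_self i
  have hs : (sgn i / 4) ^ 2 < (1 / 2 : ℝ) * (1 - 1 / 2) := by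
    rw [div_pow, sq, hsgn]; norm_num
  have hs0 : 0 < sgn i * (sgn i / 4) := by rw [← mul_div_assoc, hsgn]; norm_num
  have hf : ∀ u : ℝ, u ≠ 0 → |u| ≤ 1 → D.Free i (D.nrm b (1 / 2) (u * D.eps), sgn i / 4) :=
    fun u hu0 hu => free_of_notMem_arcs (nrm_notMem_arcs' b ⟨by norm_num, by norm_num⟩ (by
      rw [abs_mul, abs_of_pos hε]; nlinarith) (mul_ne_zero hu0 hε.ne')) (Or.inl hs0)
  have hok : D.Ok (fun u : I => (D.nrm b (1 / 2) ((-1 + u * (1 - -1)) * D.eps), sgn i / 4)) i i := by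
    refine ⟨((continuous_nrm_mul b (1 / 2) D.eps).comp (by fun_prop)).prodMk continuous_const,
      fun u => ?_, ?_, ?_⟩
    · by_cases hu : (-1 + (u : ℝ) * (1 - -1)) = 0
      · rw [hu, zero_mul, nrm_zero]
        refine crv_notMem_link b ⟨by norm_num, by norm_num⟩ hs (Or.inl fun h => ?_)
        rw [h, mul_zero] at hs0
        exact lt_irrefl _ hs0
      · refine (hf _ hu ?_).notMem
        rw [abs_le]
        have := u.2.1; have := u.2.2
        constructor <;> linarith
    · exact hf _ (by simp) (by simp)
    · exact hf _ (by norm_num) (by norm_num)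
  have h := gen_symm hok
  rw [cross, cross, genOn, genOn, ← h]
  congr 1
  ext1 u
  rw [nrm_flip, unitInterval.coe_symm_eq]
  congr 2
  · norm_num
  · ring

/-! ### Paths in the complement of the projection -/

variable (D) in
/-- The points `z` and `w` are joined by a path outside the projection of the link. -/
def Conn (z w : ℂ) : Prop := JoinedIn D.projᶜ z w

omit [Finite V] [Finite E] in
theorem Conn.symm {z w : ℂ} (h : D.Conn z w) : D.Conn w z := JoinedIn.symm h

omit [Finite V] [Finite E] in
theorem Conn.trans {x z w : ℂ} (h : D.Conn x z) (h' : D.Conn z w) : D.Conn x w :=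
  JoinedIn.trans h h'

omit [Finite V] [Finite E] in
theorem Conn.of_line {f : ℝ → ℂ} (hf : Continuous f) {a b : ℝ}
    (h : ∀ t ∈ Set.uIcc a b, f t ∉ D.proj) : D.Conn (f a) (f b) := by
  refine JoinedIn.ofLine (f := fun u => f (a + u * (b - a))) (by fun_prop) (by simp) (by simp) ?_
  rintro _ ⟨u, hu, rfl⟩
  refine h _ ?_
  rcases le_total a b with hab | hab
  · rw [Set.uIcc_of_le hab]
    exact add_mul_sub_mem hab ⟨u, hu⟩
  · rw [Set.uIcc_of_ge hab]
    have := add_mul_sub_mem hab ⟨1 - u, one_sub_mem hu⟩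
    convert this using 1
    simp only; ring

variable (D) in
/-- The loop that comes down from infinity through the point `z` of the plane. -/
def drop (z : ℂ) : D.base ⟶ D.base := D.vert (z, 0) true false

omit [Finite V] [Finite E] in
theorem Conn.drop_eq {z w : ℂ} (h : D.Conn z w) : D.drop z = D.drop w := by
  obtain ⟨γ, hγ⟩ := h
  have h1 := gen_homotopy (D := D) (F := fun _ s : I => (γ s, (0 : ℝ))) (i := true) (j := false)
    (by have := γ.continuous; fun_prop)
    (fun u s => notMem_link_of_notMem_proj 0 (hγ s)) (fun s => free_of_notMem_proj 0 _ (hγ s))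
    (fun s => free_of_notMem_proj 0 _ (hγ s))
  simpa [drop, vert] using h1

omit [Finite V] [Finite E] in
theorem IsCross.notMem_proj {b : E × Bool} {t : ℝ} {f : ℝ → ℂ} (hf : D.IsCross b t f)
    (h : ∀ u ∈ Set.Icc (-1 : ℝ) 1, f u ∉ D.circles) {u : ℝ}
    (hu : u ∈ Set.Icc (-1 : ℝ) 1) (h0 : u ≠ 0) : f u ∉ D.proj := fun hp =>
  hp.elim (hf.notMem_arcs hu h0) (h u hu)

/-- Both products are the loop that comes down from above on the right, crosses the arc at height
zero and leaves downwards on the left. -/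
theorem cross_comp_drop {b : E × Bool} {t : ℝ} {f : ℝ → ℂ} (ht : 0 < t) (ht1 : t < 1)
    (hf : D.IsCross b t f) (h : ∀ u ∈ Set.Icc (-1 : ℝ) 1, f u ∉ D.circles) :
    D.cross b true ≫ D.drop (f 1) = D.drop (f (-1)) ≫ D.cross b false := by
  have h0 : (0 : ℝ) ^ 2 < t * (1 - t) := by nlinarith
  have hI : t ∈ I := ⟨ht.le, ht1.le⟩
  rw [← genOn_cross (i := true) h0 hf (Or.inr ⟨rfl, h⟩),
    ← genOn_cross (i := false) h0 hf (Or.inr ⟨rfl, h⟩)]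
  have n1 : f 1 ∉ D.proj := hf.notMem_proj h (by norm_num) (by norm_num)
  have n2 : f (-1) ∉ D.proj := hf.notMem_proj h (by norm_num) (by norm_num)
  have hok : ∀ i j, D.Ok (fun u : I => ((f (-1 + u * (1 - -1)), (0 : ℝ)) : ℂ × ℝ)) i j := by
    intro i j
    refine ⟨by have := hf.cont; fun_prop, fun u => ?_, ?_, ?_⟩
    · have hu := add_mul_sub_mem (show (-1 : ℝ) ≤ 1 by norm_num) u
      by_cases hu0 : (-1 + (u : ℝ) * (1 - -1)) = 0
      · have h1 := h 0 (by norm_num)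
        rw [hu0]
        rw [hf.map_zero] at h1 ⊢
        exact crv_notMem_link b hI h0 (Or.inr h1)
      · exact notMem_link_of_notMem_proj _ (hf.notMem_proj h hu hu0)
    · simpa using free_of_notMem_proj 0 i n2
    · have : (-1 + (1 : ℝ) * (1 - -1)) = 1 := by norm_num
      simpa [this] using free_of_notMem_proj 0 j n1
  have e1 := gen_comp_vert (k := false) (hok true true) (hok true false).right
  have e2 := vert_comp_gen (k := true) (hok false false) (hok true false).left
  have a1 : (-1 + ((1 : I) : ℝ) * (1 - -1)) = 1 := by norm_num
  have a2 : (-1 + ((0 : I) : ℝ) * (1 - -1)) = -1 := by norm_num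
  simp only [a1] at e1
  simp only [a2] at e2
  exact e1.trans e2.symm

-- The crossing is followed back to a small parameter `±u₀`, and then a segment leads to the normal
-- of the arc: the homotopy keeps it off the arcs, and smallness keeps it in a ball without circles.
omit [Finite E] in
theorem IsCross.exists_conn {b : E × Bool} {t : ℝ} (ht : t ∈ I) {f : ℝ → ℂ}
    (hf : D.IsCross b t f) (h : ∀ u ∈ Set.Icc (-1 : ℝ) 1, f u ∉ D.circles) :
    ∃ η₁ > 0, ∀ η, 0 < η → η ≤ η₁ → D.Conn (f 1) (D.nrm b t η) ∧
      D.Conn (f (-1)) (D.nrm b t (-η)) := by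
  obtain ⟨η₁, hη₁, hη⟩ := hf.exists_homotopy ht
  have hc : D.crv b t ∉ D.circles := hf.map_zero ▸ h 0 (by norm_num)
  obtain ⟨R, hR, hRc⟩ := Metric.mem_nhds_iff.1 (isCompact_circles.isClosed.isOpen_compl.mem_nhds hc)
  have hfR : ∀ᶠ u in 𝓝 (0 : ℝ), f u ∈ Metric.ball (D.crv b t) R := by
    have := hf.cont.continuousAt (x := 0)
    rw [ContinuousAt, hf.map_zero] at this
    exact this.eventually (Metric.ball_mem_nhds _ hR)
  obtain ⟨r, hr, hru⟩ := Metric.eventually_nhds_iff.1 hfR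
  have hnR : ∀ᶠ u in 𝓝 (0 : ℝ), D.nrm b t u ∈ Metric.ball (D.crv b t) R := by
    have : Continuous fun u => D.nrm b t u :=
      (D.continuous_nrm b).comp (by fun_prop : Continuous fun u : ℝ => (t, u))
    have h2 := this.tendsto 0
    rw [nrm_zero] at h2
    exact h2.eventually (Metric.ball_mem_nhds _ hR)
  obtain ⟨r', hr', hru'⟩ := Metric.eventually_nhds_iff.1 hnR
  set u₀ := min (r / 2) 1 with hu₀
  have hu₀pos : 0 < u₀ := lt_min (by positivity) one_pos
  have hu₀1 : u₀ ≤ 1 := min_le_right _ _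
  have hu₀r : u₀ ≤ r / 2 := min_le_left _ _
  have key : ∀ ς : ℝ, (ς = 1 ∨ ς = -1) → ∀ η, 0 < η → η ≤ u₀ * min η₁ (r' / 2) →
      D.Conn (f ς) (D.nrm b t (ς * η)) := by
    intro ς hς η hη0 hηle
    have habs : |ς| = 1 := by rcases hς with rfl | rfl <;> simp
    have hςI : ς * u₀ ∈ Set.Icc (-1 : ℝ) 1 := by
      refine abs_le.1 ?_
      rw [abs_mul, habs, abs_of_pos hu₀pos, one_mul]; exact hu₀1
    have hς0 : ς ≠ 0 := by rcases hς with rfl | rfl <;> norm_num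
    have h1 : D.Conn (f ς) (f (ς * u₀)) := by
      refine Conn.of_line hf.cont fun u hu => hf.notMem_proj h ?_ ?_
      · rcases hς with rfl | rfl
        · rw [one_mul, Set.uIcc_of_ge hu₀1] at hu
          exact ⟨by linarith [hu.1], hu.2⟩
        · rw [Set.uIcc_of_le (by linarith)] at hu
          exact ⟨hu.1, by linarith [hu.2]⟩
      · rcases hς with rfl | rfl
        · rw [one_mul, Set.uIcc_of_ge hu₀1] at hu
          exact (hu₀pos.trans_le hu.1).ne'
        · rw [Set.uIcc_of_le (by linarith)] at hu
          exact (lt_of_le_of_lt hu.2 (by linarith)).ne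
    set η' := η / u₀ with hη'
    have hη'pos : 0 < η' := by positivity
    have hη'1 : η' ≤ min η₁ (r' / 2) := by rw [hη', div_le_iff₀ hu₀pos, mul_comm]; exact hηle
    have hη'2 : u₀ * η' = η := by rw [hη']; field_simp
    have h2 : D.Conn (f (ς * u₀)) (D.nrm b t (ς * u₀ * η')) := by
      have h3 := Conn.of_line (D := D) (a := 0) (b := 1)
        (f := fun s : ℝ => (1 - s : ℝ) * f (ς * u₀) + s * D.nrm b t (ς * u₀ * η'))
        (by fun_prop) fun s hs => ?_
      · simpa using h3
      · rw [Set.uIcc_of_le zero_le_one] at hs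
        rintro (h4 | h4)
        · exact hη η' hη'pos (hη'1.trans (min_le_left _ _)) _ hςI
            (mul_ne_zero hς0 hu₀pos.ne') s hs h4
        · refine hRc ?_ h4
          rw [Metric.mem_ball, dist_eq_norm]
          have b1 := hru (y := ς * u₀) (by
            rw [Real.dist_eq, sub_zero, abs_mul, habs, abs_of_pos hu₀pos]; linarith)
          have b2 := hru' (y := ς * u₀ * η') (by
            rw [Real.dist_eq, sub_zero, mul_assoc, abs_mul, habs, hη'2, abs_of_pos hη0]
            have : u₀ * min η₁ (r' / 2) ≤ 1 * (r' / 2) :=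
              mul_le_mul hu₀1 (min_le_right _ _) (le_min hη₁.le (by positivity)) zero_le_one
            linarith)
          rw [Metric.mem_ball, dist_eq_norm] at b1 b2
          refine (norm_comb_sub_le hs _ _ _).trans_lt ?_
          rcases hs.1.eq_or_lt with h | h
          · subst h; simpa using b1
          · nlinarith [mul_le_mul_of_nonneg_left b1.le (sub_nonneg.2 hs.2),
              mul_lt_mul_of_pos_left b2 h]
    rw [mul_assoc, hη'2] at h2
    exact h1.trans h2
  refine ⟨u₀ * min η₁ (r' / 2), by positivity, fun η h1 h2 => ⟨?_, ?_⟩⟩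
  · simpa using key 1 (Or.inl rfl) η h1 h2
  · simpa using key (-1) (Or.inr rfl) η h1 h2

theorem exists_nrm_notMem_proj (b : E × Bool) {t₁ t₂ : ℝ} (h : Set.uIcc t₁ t₂ ⊆ I)
    (h1 : D.exT b ∉ Set.uIcc t₁ t₂) (h2 : 1 - D.exT (flip b) ∉ Set.uIcc t₁ t₂) :
    ∃ η₁ > 0, ∀ η, η ≠ 0 → |η| ≤ η₁ → ∀ t ∈ Set.uIcc t₁ t₂, D.nrm b t η ∉ D.proj := by
  have h3 : ∀ᶠ η in 𝓝 (0 : ℝ), ∀ t ∈ Set.uIcc t₁ t₂, D.nrm b t η ∉ D.circles := by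
    refine isCompact_uIcc.eventually_forall_of_forall_eventually fun t ht => ?_
    have hc : D.crv b t ∉ D.circles := by
      rw [crv_mem_circles b (h ht)]
      rintro (rfl | rfl)
      · exact h1 ht
      · exact h2 ht
    have h4 : Tendsto (fun z : ℝ × ℝ => D.nrm b z.2 z.1) (𝓝 (0, t)) (𝓝 (D.crv b t)) := by
      have : Continuous fun z : ℝ × ℝ => D.nrm b z.2 z.1 :=
        (D.continuous_nrm b).comp (by fun_prop : Continuous fun z : ℝ × ℝ => (z.2, z.1))
      have h5 := this.tendsto (0, t)
      rwa [nrm_zero] at h5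
    exact h4.eventually (isCompact_circles.isClosed.isOpen_compl.mem_nhds hc)
  obtain ⟨r, hr, hrη⟩ := Metric.eventually_nhds_iff.1 h3
  have hε := eps_pos (D := D)
  refine ⟨min (r / 2) D.eps, by positivity, fun η hη0 hη t ht => ?_⟩
  rintro (h4 | h4)
  · exact nrm_notMem_arcs' b (h ht) (hη.trans (min_le_right _ _)) hη0 h4
  · refine hrη (y := η) ?_ t ht h4
    rw [Real.dist_eq, sub_zero]
    have := hη.trans (min_le_left _ _)
    linarith

theorem exists_conn_nrm (b : E × Bool) {t₁ t₂ : ℝ} (h : Set.uIcc t₁ t₂ ⊆ I)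
    (h1 : D.exT b ∉ Set.uIcc t₁ t₂) (h2 : 1 - D.exT (flip b) ∉ Set.uIcc t₁ t₂) :
    ∃ η₁ > 0, ∀ η, η ≠ 0 → |η| ≤ η₁ → ∀ t ∈ Set.uIcc t₁ t₂,
      D.Conn (D.nrm b t η) (D.nrm b t₂ η) := by
  obtain ⟨η₁, hη₁, hη⟩ := exists_nrm_notMem_proj b h h1 h2
  exact ⟨η₁, hη₁, fun η h0 h1 t ht => Conn.of_line (f := fun t => D.nrm b t η)
    ((D.continuous_nrm b).comp (by fun_prop : Continuous fun t : ℝ => (t, η)))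
    fun s hs => hη η h0 h1 s (Set.uIcc_subset_uIcc ht Set.right_mem_uIcc hs)⟩

end PlaneDrawing

namespace PlaneDrawing

variable {V E : Type*} (D : PlaneDrawing V E)

/-! ### Polar coordinates around a vertex -/

/-- The point with polar coordinates `ρ` and `θ` around the center of the disk of `v`. -/
def circ (v : V) (ρ θ : ℝ) : ℂ := D.center v + ρ * Complex.exp (θ * Complex.I)

variable {D}

theorem continuous_circ (v : V) : Continuous fun p : ℝ × ℝ => D.circ v p.1 p.2 := by
  unfold circ; fun_prop

theorem continuous_circ' (v : V) (ρ : ℝ) : Continuous (D.circ v ρ) :=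
  (continuous_circ v).comp (by fun_prop : Continuous fun θ : ℝ => (ρ, θ))

theorem norm_circ_sub (v : V) {ρ : ℝ} (hρ : 0 ≤ ρ) (θ : ℝ) :
    ‖D.circ v ρ θ - D.center v‖ = ρ := by
  rw [circ, add_sub_cancel_left, norm_mul, Complex.norm_exp_ofReal_mul_I, mul_one,
    Complex.norm_real, Real.norm_eq_abs, abs_of_nonneg hρ]

theorem circ_add_two_pi (v : V) (ρ θ : ℝ) : D.circ v ρ (θ + 2 * Real.pi) = D.circ v ρ θ := by
  have : ((θ + 2 * Real.pi : ℝ) : ℂ) * Complex.I = θ * Complex.I + 2 * Real.pi * Complex.I := by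
    push_cast; ring
  rw [circ, circ, this, Complex.exp_periodic]

theorem circ_add (v : V) (ρ θ ξ : ℝ) : D.circ v ρ (θ + ξ) - D.circ v ρ θ =
    (D.circ v ρ θ - D.center v) * (Complex.exp (Complex.I * ξ) - 1) := by
  have : ((θ + ξ : ℝ) : ℂ) * Complex.I = θ * Complex.I + Complex.I * ξ := by
    push_cast; ring
  rw [circ, circ, this, Complex.exp_add]
  ring

theorem circ_injective {v : V} {ρ θ θ' : ℝ} (hρ : ρ ≠ 0) (h : D.circ v ρ θ = D.circ v ρ θ') :
    ∃ n : ℤ, θ = θ' + n * (2 * Real.pi) := by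
  have h1 := mul_left_cancel₀ (Complex.ofReal_ne_zero.2 hρ) (add_left_cancel h)
  obtain ⟨n, hn⟩ := Complex.exp_eq_exp_iff_exists_int.1 h1
  refine ⟨n, ?_⟩
  have h2 := congrArg Complex.im hn
  simpa using h2

theorem circ_injOn {v : V} {ρ θ θ' a : ℝ} (hρ : ρ ≠ 0) (h : D.circ v ρ θ = D.circ v ρ θ')
    (hθ : θ ∈ Set.Icc a (a + 2 * Real.pi)) (hθ' : θ' ∈ Set.Ioo a (a + 2 * Real.pi)) :
    θ = θ' := by
  obtain ⟨n, hn⟩ := circ_injective hρ h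
  have hpi := Real.pi_pos
  have h1 : (n : ℝ) < 1 := by
    by_contra hc
    push Not at hc
    nlinarith [hθ.2, hθ'.1]
  have h2 : (-1 : ℝ) < n := by
    by_contra hc
    push Not at hc
    nlinarith [hθ.1, hθ'.2]
  have h3 : n < 1 := by exact_mod_cast h1
  have h4 : -1 < n := by exact_mod_cast h2
  have h5 : n = 0 := by omega
  subst h5
  simpa using hn

theorem exists_circ_eq (v : V) (z : ℂ) (a : ℝ) :
    ∃ θ ∈ Set.Ioc a (a + 2 * Real.pi), z = D.circ v ‖z - D.center v‖ θ := by
  obtain ⟨m, hm, -⟩ := existsUnique_add_zsmul_mem_Ioc Real.two_pi_pos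
    (Complex.arg (z - D.center v)) a
  refine ⟨_, hm, ?_⟩
  have h1 := Complex.norm_mul_exp_arg_mul_I (z - D.center v)
  have h2 : Complex.exp (((Complex.arg (z - D.center v) + m • (2 * Real.pi) : ℝ) : ℂ) * Complex.I)
      = Complex.exp ((Complex.arg (z - D.center v) : ℂ) * Complex.I) := by
    rw [Complex.exp_eq_exp_iff_exists_int]
    exact ⟨m, by simp; ring⟩
  rw [circ, h2, h1]
  ring

/-! ### Exit angles -/

/-- An arc meets the circles only where it leaves the disk of its tail or enters the disk of its
head, and the second point is the exit point of the reversed dart. -/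
theorem tail_eq_of_crv_mem_sphere {b : E × Bool} {t : ℝ} (ht : t ∈ I) {v : V}
    (h : ‖D.crv b t - D.center v‖ = D.radius v) :
    ∃ b', D.tail b' = v ∧ D.crv b' (D.exT b') = D.crv b t := by
  have h0 : D.crv b t ∈ D.circles := mem_circles.2 ⟨v, h⟩
  have h1 : D.crv b t ∈ Metric.closedBall (D.center v) (D.radius v) := by
    rw [Metric.mem_closedBall, dist_eq_norm, h]
  have hlt := D.exT_add_lt b
  rw [D.crv_mem_closedBall b v ht] at h1
  rcases (crv_mem_circles b ht).1 h0 with rfl | rfl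
  · rcases h1 with ⟨h1, -⟩ | ⟨-, h1⟩
    · exact ⟨b, h1.symm, rfl⟩
    · linarith
  · rcases h1 with ⟨-, h1⟩ | ⟨h1, -⟩
    · linarith
    · exact ⟨flip b, h1.symm, by rw [crv_flip]⟩

theorem norm_crv_exT (b : E × Bool) :
    ‖D.crv b (D.exT b) - D.center (D.tail b)‖ = D.radius (D.tail b) := by
  have h1 := (D.crv_mem_closedBall b (D.tail b) (D.exT_mem b)).2 (Or.inl ⟨rfl, le_rfl⟩)
  have h2 : D.crv b (D.exT b) ∉ Metric.ball (D.center (D.tail b)) (D.radius (D.tail b)) := by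
    rw [D.crv_mem_ball b _ (D.exT_mem b)]
    have := D.exT_add_lt b
    rintro (⟨-, h⟩ | ⟨-, h⟩) <;> linarith
  rw [Metric.mem_closedBall, dist_eq_norm] at h1
  rw [Metric.mem_ball, dist_eq_norm, not_lt] at h2
  exact le_antisymm h1 h2

-- A circle is infinite, but the arcs meet it only in the finitely many exit points.
variable (D) in
theorem exists_baseAngle [Finite E] (v : V) : ∃ θ : ℝ, D.circ v (D.radius v) θ ∉ D.arcs := by
  by_contra! h
  have hr := (D.radius_pos v).ne'
  have h1 : Set.InjOn (D.circ v (D.radius v)) (Set.Ioo 0 (0 + 2 * Real.pi)) :=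
    fun a ha b hb hab => circ_injOn hr hab (Set.Ioo_subset_Icc_self ha) hb
  have h2 : (Set.Ioo (0 : ℝ) (0 + 2 * Real.pi)).Infinite :=
    Set.Ioo_infinite (by linarith [Real.pi_pos])
  refine (h2.image h1) ((Set.finite_range fun b => D.crv b (D.exT b)).subset ?_)
  rintro _ ⟨θ, -, rfl⟩
  obtain ⟨b, t, ht, hbt⟩ := mem_arcs.1 (h θ)
  obtain ⟨b', -, hb'⟩ := tail_eq_of_crv_mem_sphere (v := v) ht (by
    rw [hbt, norm_circ_sub v (D.radius_pos v).le])
  exact ⟨b', hb'.trans hbt⟩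

variable (D) in
/-- A direction in which the circle of `v` meets no arc. -/
def baseAngle [Finite E] (v : V) : ℝ := (D.exists_baseAngle v).choose

theorem circ_baseAngle [Finite E] (v : V) : D.circ v (D.radius v) (D.baseAngle v) ∉ D.arcs :=
  (D.exists_baseAngle v).choose_spec

-- Angles are measured from the base direction, which no arc uses; they are thus interior to one
-- period, and sorting them gives the cyclic order of the darts.
variable (D) in
theorem exists_ang [Finite E] (b : E × Bool) : ∃ θ : ℝ,
    θ ∈ Set.Ioo (D.baseAngle (D.tail b)) (D.baseAngle (D.tail b) + 2 * Real.pi) ∧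
    D.crv b (D.exT b) = D.circ (D.tail b) (D.radius (D.tail b)) θ := by
  obtain ⟨θ, hθ, h⟩ := exists_circ_eq (D := D) (D.tail b) (D.crv b (D.exT b))
    (D.baseAngle (D.tail b))
  rw [norm_crv_exT] at h
  refine ⟨θ, ⟨hθ.1, lt_of_le_of_ne hθ.2 ?_⟩, h⟩
  rintro rfl
  rw [circ_add_two_pi] at h
  exact circ_baseAngle (D := D) (D.tail b) (h ▸ crv_mem_arcs b (D.exT_mem b))

variable (D) in
/-- The direction in which a dart leaves the disk of its initial vertex. -/
def ang [Finite E] (b : E × Bool) : ℝ := (D.exists_ang b).choose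

theorem ang_mem [Finite E] (b : E × Bool) :
    D.ang b ∈ Set.Ioo (D.baseAngle (D.tail b)) (D.baseAngle (D.tail b) + 2 * Real.pi) :=
  (D.exists_ang b).choose_spec.1

theorem crv_exT [Finite E] (b : E × Bool) :
    D.crv b (D.exT b) = D.circ (D.tail b) (D.radius (D.tail b)) (D.ang b) :=
  (D.exists_ang b).choose_spec.2

theorem ang_injective [Finite E] {b b' : E × Bool} (ht : D.tail b = D.tail b')
    (h : D.ang b = D.ang b') : b = b' := by
  have h1 : D.crv b (D.exT b) = D.crv b' (D.exT b') := by rw [crv_exT, crv_exT, ht, h]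
  rcases D.crv_eq_crv (D.exT_mem b) (D.exT_mem b') h1 with ⟨h2, -⟩ | ⟨h2, h3⟩
  · exact h2.symm
  · have := D.exT_add_lt b
    rw [← h2] at this
    linarith

open Classical in
variable (D) in
/-- The darts at the vertex `v`, in counterclockwise order. -/
def darts [Finite E] (v : V) : List (E × Bool) :=
  ((Set.toFinite {b | D.tail b = v}).toFinset.toList).insertionSort fun a b => D.ang a ≤ D.ang b

theorem mem_darts [Finite E] {v : V} {b : E × Bool} : b ∈ D.darts v ↔ D.tail b = v := by
  simp [darts]

theorem nodup_darts [Finite E] (v : V) : (D.darts v).Nodup :=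
  (List.perm_insertionSort _ _).nodup_iff.2 (Finset.nodup_toList _)

theorem pairwise_darts [Finite E] (v : V) :
    (D.darts v).Pairwise fun a b => D.ang a < D.ang b := by
  have h1 : (D.darts v).Pairwise fun a b => D.ang a ≤ D.ang b := by
    have : Std.Total fun a b : E × Bool => D.ang a ≤ D.ang b := ⟨fun a b => le_total _ _⟩
    have : IsTrans (E × Bool) fun a b => D.ang a ≤ D.ang b := ⟨fun _ _ _ => le_trans⟩
    exact List.pairwise_insertionSort _ _
  have h2 : (D.darts v).Pairwise fun a b => a ≠ b := nodup_darts v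
  refine (h1.and h2).imp_of_mem fun {a b} ha hb hab => lt_of_le_of_ne hab.1 fun h => hab.2 ?_
  exact ang_injective ((mem_darts.1 ha).trans (mem_darts.1 hb).symm) h

open Classical in
variable (D) in
/-- The cyclic permutation of the darts at a vertex, counterclockwise. -/
def rotAt [Finite E] (v : V) : Equiv.Perm (E × Bool) := (D.darts v).formPerm

theorem tail_rotAt [Finite E] {v : V} {b : E × Bool} (h : D.tail b = v) :
    D.tail (D.rotAt v b) = v := by
  classical
  exact mem_darts.1 (List.formPerm_mem_iff_mem.2 (mem_darts.2 h))

theorem tail_rotAt_symm [Finite E] {v : V} {b : E × Bool} (h : D.tail b = v) :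
    D.tail ((D.rotAt v).symm b) = v := by
  classical
  refine mem_darts.1 (List.formPerm_mem_iff_mem.1 (?_ : D.rotAt v ((D.rotAt v).symm b) ∈ _))
  rw [Equiv.apply_symm_apply]
  exact mem_darts.2 h

theorem rotAt_getElem [Finite E] {v : V} {i : ℕ} (h : i < (D.darts v).length) :
    D.rotAt v (D.darts v)[i] = (D.darts v)[(i + 1) % (D.darts v).length]'
      (Nat.mod_lt _ (Nat.zero_lt_of_lt h)) := by
  classical
  exact List.formPerm_apply_getElem _ (nodup_darts v) i h

variable (D) in
/-- The rotation of the darts, counterclockwise around their initial vertices. -/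
def rot [Finite E] : Equiv.Perm (E × Bool) where
  toFun b := D.rotAt (D.tail b) b
  invFun b := (D.rotAt (D.tail b)).symm b
  left_inv b := by
    simp only [tail_rotAt rfl, Equiv.symm_apply_apply]
  right_inv b := by
    simp only [tail_rotAt_symm rfl, Equiv.apply_symm_apply]

theorem rot_apply [Finite E] {v : V} {b : E × Bool} (h : D.tail b = v) :
    D.rot b = D.rotAt v b := by
  subst h; rfl

theorem tail_rot [Finite E] (b : E × Bool) : D.tail (D.rot b) = D.tail b := by
  rw [rot_apply rfl]; exact tail_rotAt rfl

theorem rot_getElem [Finite E] {v : V} {i : ℕ} (h : i < (D.darts v).length) :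
    D.rot (D.darts v)[i] = (D.darts v)[(i + 1) % (D.darts v).length]'
      (Nat.mod_lt _ (Nat.zero_lt_of_lt h)) := by
  rw [rot_apply (mem_darts.1 (List.getElem_mem h)), rotAt_getElem]

theorem iterate_rot_getElem [Finite E] {v : V} {i : ℕ} (h : i < (D.darts v).length) (k : ℕ) :
    D.rot^[k] (D.darts v)[i] = (D.darts v)[(i + k) % (D.darts v).length]'
      (Nat.mod_lt _ (Nat.zero_lt_of_lt h)) := by
  induction k with
  | zero => simp [Nat.mod_eq_of_lt h]
  | succ k ih =>
    rw [Function.iterate_succ_apply', ih, rot_getElem]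
    congr 1
    rw [Nat.mod_add_mod, add_assoc]

theorem exists_iterate_rot [Finite E] {x y : E × Bool} (h : D.tail x = D.tail y) :
    ∃ k : ℕ, D.rot^[k] x = y := by
  obtain ⟨i, hi, hx⟩ := List.getElem_of_mem (mem_darts.2 h)
  obtain ⟨j, hj, hy⟩ := List.getElem_of_mem (mem_darts.2 (rfl : D.tail y = D.tail y))
  refine ⟨j + ((D.darts (D.tail y)).length - i), ?_⟩
  rw [← hx, iterate_rot_getElem hi]
  refine Eq.trans ?_ hy
  congr 1
  rw [show i + (j + ((D.darts (D.tail y)).length - i)) = j + (D.darts (D.tail y)).length by omega,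
    Nat.add_mod_right, Nat.mod_eq_of_lt hj]

/-! ### The arcs in polar coordinates near their exit points -/

/-- The piecewise linear function with values `-φ`, `χ`, `φ` at `-1`, `0`, `1`. -/
def window (χ φ u : ℝ) : ℝ := χ + max u 0 * (φ - χ) + min u 0 * (φ + χ)

theorem continuous_window (χ φ : ℝ) : Continuous (window χ φ) := by
  unfold window; fun_prop

theorem window_one (χ φ : ℝ) : window χ φ 1 = φ := by simp [window]

theorem window_neg_one (χ φ : ℝ) : window χ φ (-1) = -φ := by simp [window]

theorem window_zero (χ φ : ℝ) : window χ φ 0 = χ := by simp [window]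

theorem window_of_nonneg (χ φ : ℝ) {u : ℝ} (hu : 0 ≤ u) : window χ φ u = χ + u * (φ - χ) := by
  simp [window, hu]

theorem window_of_nonpos (χ φ : ℝ) {u : ℝ} (hu : u ≤ 0) : window χ φ u = χ + u * (φ + χ) := by
  simp [window, hu]

/-- The inequality that places the points rotated by the angle `ξ` in a cone. -/
theorem cone_estimate {A : ℂ} {a K m ξ : ℝ} (ha : a ≤ A.re) (hA : ‖A‖ ≤ K) (ha0 : 0 < a)
    (hK : 0 < K) (hξ0 : 0 < ξ) (hξ1 : ξ ≤ 1) (hξ : ξ * (4 * K) ≤ a) (hm0 : 0 < m)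
    (hm : m * (8 * K) ≤ a) :
    m * (‖A‖ * ξ) < (A * (Complex.exp (Complex.I * ξ) - 1)).im ∧
    m * (‖A‖ * ξ) < -(A * (Complex.exp (Complex.I * (-ξ : ℝ)) - 1)).im := by
  have e : ∀ x : ℝ, (A * (Complex.exp (Complex.I * x) - 1)).im =
      A.re * Real.sin x + A.im * (Real.cos x - 1) := by
    intro x
    rw [mul_comm Complex.I, Complex.mul_im, Complex.sub_re, Complex.sub_im,
      Complex.exp_ofReal_mul_I_re, Complex.exp_ofReal_mul_I_im]
    simp
  rw [e, e, Real.sin_neg, Real.cos_neg]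
  have h1 : ξ / 2 ≤ Real.sin ξ := by
    have h2 := Real.mul_le_sin hξ0.le (by linarith [Real.pi_gt_three])
    have h3 : 1 / 2 ≤ 2 / Real.pi := by
      rw [div_le_div_iff₀ (by norm_num) Real.pi_pos]; linarith [Real.pi_le_four]
    nlinarith
  have h2 := Real.one_sub_sq_div_two_le_cos (x := ξ)
  have h3 := Real.cos_le_one ξ
  have h4 : |A.im| ≤ K := (Complex.abs_im_le_norm A).trans hA
  have h5 : |A.im * (Real.cos ξ - 1)| ≤ K * (ξ ^ 2 / 2) := by
    rw [abs_mul]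
    refine mul_le_mul h4 ?_ (abs_nonneg _) hK.le
    rw [abs_le]; constructor <;> nlinarith
  have h6 : a * (ξ / 2) ≤ A.re * Real.sin ξ :=
    mul_le_mul ha h1 (by positivity) (ha0.le.trans ha)
  have h7 : m * (‖A‖ * ξ) ≤ a * ξ / 8 := by
    have : m * (‖A‖ * ξ) ≤ m * (K * ξ) := by gcongr
    nlinarith
  have h8 : K * (ξ ^ 2 / 2) ≤ a * ξ / 8 := by nlinarith
  have h9 := abs_le.1 h5
  have h10 : 0 < a * ξ := by positivity
  constructor <;> linarith [h9.1, h9.2]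

set_option maxHeartbeats 1000000 in
/-- In polar coordinates around its initial vertex, a dart crosses the circles near the boundary of
the disk. -/
theorem exists_polar [Finite E] (b : E × Bool) : ∃ φ₀ > 0, ∀ φ, 0 < φ → φ ≤ φ₀ → ∃ δ > 0, ∀ ρ,
    |ρ - D.radius (D.tail b)| < δ → ∃ t χ, 0 < t ∧ t < 1 - D.exT (flip b) ∧ |χ| < φ ∧
    D.crv b t = D.circ (D.tail b) ρ (D.ang b + χ) ∧
    (D.radius (D.tail b) < ρ → D.exT b < t) ∧ (ρ < D.radius (D.tail b) → t < D.exT b) ∧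
    D.IsCross b t (fun u => D.circ (D.tail b) ρ (D.ang b + window χ φ u)) := by
  set v := D.tail b with hv
  set c := D.center v with hc
  set r := D.radius v with hr
  set T := D.exT b with hT
  have hr0 : 0 < r := D.radius_pos v
  -- Rotating a point of the arc around `c` by `ξ` displaces it by the factor `exp (I * ξ) - 1`, so
  -- its side is the imaginary part of `A t` times this factor. Transversality at the exit says that
  -- `A T` has positive real part.
  set A : ℝ → ℂ := fun t => (D.crv b t - c) * conj (deriv (D.crv b) t) with hA
  have hAc : Continuous A := by
    have h1 := D.continuous_crv b
    have h2 := D.continuous_deriv_crv b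
    fun_prop
  have hq : 0 < (A T).re := by
    have := D.transverse b
    rw [real_inner_comm, Complex.inner] at this
    exact this
  set q := (A T).re with hqdef
  set K := ‖A T‖ + 1 with hK
  have hK0 : 0 < K := by positivity
  have hq2 : q ≤ K := (Complex.re_le_norm _).trans (by rw [hK]; linarith)
  set m := q / 2 / (8 * K) with hm
  have hm0 : 0 < m := by positivity
  have hm1 : m ≤ 1 := by
    rw [hm, div_le_one (by positivity)]; linarith
  obtain ⟨R, hR, hcone⟩ := exists_coneFree (D := D) b (D.exT_mem b) hm0 hm1
  have hnorm : ‖D.crv b T - c‖ = r := norm_crv_exT b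
  have hne : D.crv b T - c ≠ 0 := by rw [← norm_pos_iff, hnorm]; exact hr0
  have ev1 : ∀ᶠ t in 𝓝 T, q / 2 < (A t).re :=
    ((Complex.continuous_re.comp hAc).continuousAt).eventually (lt_mem_nhds (half_lt_self hq))
  have ev2 : ∀ᶠ t in 𝓝 T, ‖A t‖ < K :=
    hAc.norm.continuousAt.eventually (gt_mem_nhds (lt_add_one _))
  have hcc : Continuous fun t => D.crv b t - c := (D.continuous_crv b).sub continuous_const
  have ev3 : ∀ᶠ t in 𝓝 T, ‖D.crv b t - c‖ < 2 * r :=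
    hcc.norm.continuousAt.eventually (gt_mem_nhds (by simp only [hnorm]; linarith))
  have ev4 : ∀ᶠ t in 𝓝 T, 0 < t := lt_mem_nhds (D.exT_pos b)
  have ev5 : ∀ᶠ t in 𝓝 T, t < 1 - D.exT (flip b) :=
    gt_mem_nhds (by linarith [D.exT_add_lt b])
  have ev6 : ∀ᶠ t in 𝓝 T, D.crv b t - c ≠ 0 := hcc.continuousAt.eventually_ne hne
  -- Rotation angles inside a window are at most `2 * φ`. The three bounds make them at most 1,
  -- small enough for `cone_estimate`, and small enough to stay within `R`.
  set φ₀ := min (1 / 2) (min (q / 2 / (8 * K)) (R / (8 * r))) with hφ₀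
  refine ⟨φ₀, by positivity, fun φ hφ hφle => ?_⟩
  have hφ1 : 2 * φ ≤ 1 := by
    have := hφle.trans (min_le_left _ _); linarith
  have hφ2 : 2 * φ * (4 * K) ≤ q / 2 := by
    have := hφle.trans ((min_le_right _ _).trans (min_le_left _ _))
    rw [le_div_iff₀ (by positivity)] at this
    linarith
  have hφ3 : 2 * φ * (2 * r) < R := by
    have := hφle.trans ((min_le_right _ _).trans (min_le_right _ _))
    rw [le_div_iff₀ (by positivity)] at this
    linarith
  have ev7 : ∀ᶠ t in 𝓝 T, |Complex.arg ((D.crv b t - c) / (D.crv b T - c))| < φ := by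
    have h1 : ContinuousAt (fun t => |Complex.arg ((D.crv b t - c) / (D.crv b T - c))|) T := by
      refine ContinuousAt.abs (ContinuousAt.comp (g := Complex.arg)
        (f := fun t => (D.crv b t - c) / (D.crv b T - c)) ?_ ?_)
      · rw [div_self hne]
        exact Complex.continuousAt_arg Complex.one_mem_slitPlane
      · exact (hcc.div_const _).continuousAt
    refine h1.eventually (gt_mem_nhds ?_)
    simpa [div_self hne] using hφ
  obtain ⟨κ, hκ, hall⟩ := Metric.eventually_nhds_iff.1
    (ev1.and (ev2.and (ev3.and (ev4.and (ev5.and (ev6.and (ev7.and hcone)))))))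
  have hIn : ∀ t, dist t T < κ → t ∈ I := fun t ht =>
    ⟨(hall ht).2.2.2.1.le, by
      have := (hall ht).2.2.2.2.1; have := D.exT_pos (flip b); linarith⟩
  have hlt : ∀ t, dist t T < κ → t < T → ‖D.crv b t - c‖ < r := by
    intro t ht htT
    have := (D.crv_mem_ball b v (hIn t ht)).2 (Or.inl ⟨rfl, htT⟩)
    rwa [Metric.mem_ball, dist_eq_norm] at this
  have hgt : ∀ t, dist t T < κ → T < t → r < ‖D.crv b t - c‖ := by
    intro t ht htT
    have := (D.crv_mem_closedBall b v (hIn t ht)).not.2 (by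
      rintro (⟨-, h⟩ | ⟨-, h⟩)
      · linarith
      · linarith [(hall ht).2.2.2.2.1])
    rwa [Metric.mem_closedBall, dist_eq_norm, not_le] at this
  have hd1 : dist (T - κ / 2) T < κ := by
    rw [Real.dist_eq, sub_sub_cancel_left, abs_neg, abs_of_pos (by positivity)]; linarith
  have hd2 : dist (T + κ / 2) T < κ := by
    rw [Real.dist_eq, add_sub_cancel_left, abs_of_pos (by positivity)]; linarith
  have hl := hlt _ hd1 (by linarith)
  have hg := hgt _ hd2 (by linarith)
  -- The arc passes from inside to outside between the times `T - κ / 2` and `T + κ / 2`, so it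
  -- meets every circle whose radius lies between its two distances.
  refine ⟨min (r - ‖D.crv b (T - κ / 2) - c‖) (‖D.crv b (T + κ / 2) - c‖ - r),
    lt_min (by linarith) (by linarith), fun ρ hρ => ?_⟩
  have hρ1 := abs_lt.1 (hρ.trans_le (min_le_left _ _))
  have hρ2 := abs_lt.1 (hρ.trans_le (min_le_right _ _))
  obtain ⟨t, htm, htρ⟩ := intermediate_value_Icc (show T - κ / 2 ≤ T + κ / 2 by linarith)
    hcc.norm.continuousOn (show ρ ∈ Set.Icc _ _ from ⟨by linarith, by linarith⟩)
  simp only at htρ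
  have htd : dist t T < κ := by
    rw [Real.dist_eq, abs_lt]; constructor <;> linarith [htm.1, htm.2]
  obtain ⟨k1, k2, k3, k4, k5, k6, k7, k8⟩ := hall htd
  set χ := Complex.arg ((D.crv b t - c) / (D.crv b T - c)) with hχ
  have hpt : D.crv b t = D.circ v ρ (D.ang b + χ) := by
    have h1 := Complex.norm_mul_exp_arg_mul_I ((D.crv b t - c) / (D.crv b T - c))
    rw [norm_div, hnorm, htρ, ← hχ] at h1
    have h2 : D.crv b T - c = r * Complex.exp (D.ang b * Complex.I) := by
      rw [hT, crv_exT, circ, add_sub_cancel_left]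
    have h3 : D.crv b t - c = ρ * Complex.exp ((D.ang b + χ : ℝ) * Complex.I) := by
      rw [eq_div_iff hne, h2] at h1
      rw [← h1]
      push_cast
      rw [add_mul, Complex.exp_add]
      have : (r : ℂ) ≠ 0 := Complex.ofReal_ne_zero.2 hr0.ne'
      field_simp
    rw [circ, ← h3]; ring
  have hρ0 : 0 < ρ := by rw [← htρ]; exact norm_pos_iff.2 k6
  refine ⟨t, χ, k4, k5, k7, hpt, fun h => ?_, fun h => ?_, ?_⟩
  · by_contra hcon
    push Not at hcon
    rcases hcon.lt_or_eq with h' | h'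
    · have := hlt t htd h'; linarith
    · rw [h', hnorm] at htρ; linarith
  · by_contra hcon
    push Not at hcon
    rcases hcon.lt_or_eq with h' | h'
    · have := hgt t htd h'; linarith
    · rw [← h', hnorm] at htρ; linarith
  · refine ⟨(continuous_circ' v ρ).comp (continuous_const.add (continuous_window χ φ)), ?_,
      m, R, hm0, hm1, hR, k8, fun u hu => ?_⟩
    · simp only [window_zero]; exact hpt.symm
    · obtain ⟨ξ, hξ⟩ : ∃ ξ, window χ φ u = χ + ξ := ⟨window χ φ u - χ, by ring⟩
      have hχ' := abs_lt.1 k7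
      have hdiff : D.circ v ρ (D.ang b + window χ φ u) - D.crv b t =
          (D.crv b t - c) * (Complex.exp (Complex.I * ξ) - 1) := by
        rw [hξ, ← add_assoc, hpt, circ_add]
      have hside : D.side b t (D.circ v ρ (D.ang b + window χ φ u)) =
          (A t * (Complex.exp (Complex.I * ξ) - 1)).im := by
        rw [side, hdiff]
        congr 1
        simp only [hA]; ring
      have hexp : ‖Complex.exp (Complex.I * ξ) - 1‖ ≤ |ξ| := by
        have := Real.norm_exp_I_mul_ofReal_sub_one_le (x := ξ)
        rwa [Real.norm_eq_abs] at this
      have hξle : |ξ| ≤ 2 * φ := by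
        rcases le_total 0 u with h | h
        · rw [window_of_nonneg _ _ h] at hξ
          have : ξ = u * (φ - χ) := by linarith
          rw [this, abs_of_nonneg (mul_nonneg h (by linarith))]
          nlinarith [hu.2]
        · rw [window_of_nonpos _ _ h] at hξ
          have : ξ = u * (φ + χ) := by linarith
          rw [this, abs_of_nonpos (mul_nonpos_of_nonpos_of_nonneg h (by linarith))]
          nlinarith [hu.1]
      have hdn : ‖D.circ v ρ (D.ang b + window χ φ u) - D.crv b t‖ ≤
          ‖D.crv b t - c‖ * |ξ| := by
        rw [hdiff, norm_mul]
        exact mul_le_mul_of_nonneg_left hexp (norm_nonneg _)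
      have hmn : m * (‖D.circ v ρ (D.ang b + window χ φ u) - D.crv b t‖ *
          ‖deriv (D.crv b) t‖) ≤ m * (‖A t‖ * |ξ|) := by
        refine mul_le_mul_of_nonneg_left ?_ hm0.le
        have hAn : ‖A t‖ = ‖D.crv b t - c‖ * ‖deriv (D.crv b) t‖ := by
          simp only [hA, norm_mul, Complex.norm_conj]
        rw [hAn, mul_right_comm]
        exact mul_le_mul_of_nonneg_right hdn (norm_nonneg _)
      have hne' : ∀ x : ℝ, 0 < x * D.side b t (D.circ v ρ (D.ang b + window χ φ u)) →
          D.circ v ρ (D.ang b + window χ φ u) ≠ D.crv b t := by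
        intro x hx h
        rw [h] at hx
        simp [side] at hx
      have hmA : ∀ x, 0 ≤ x → 0 ≤ m * (‖A t‖ * x) := fun x hx => by positivity
      refine ⟨?_, fun h => ?_, fun h => ?_⟩
      · refine hdn.trans_lt ?_
        have : ‖D.crv b t - c‖ * |ξ| ≤ 2 * r * (2 * φ) :=
          mul_le_mul k3.le hξle (abs_nonneg _) (by positivity)
        linarith
      · have hξ0 : 0 < ξ := by
          rw [window_of_nonneg _ _ h.le] at hξ
          have : ξ = u * (φ - χ) := by linarith
          rw [this]; exact mul_pos h (by linarith)
        rw [abs_of_pos hξ0] at hξle hmn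
        have h1 := (cone_estimate k1.le k2.le (by positivity) hK0 hξ0 (by linarith)
          (by nlinarith) hm0 (by rw [hm]; field_simp; exact le_rfl)).1
        rw [← hside] at h1
        exact ⟨hne' 1 (by linarith [hmA ξ hξ0.le]), hmn.trans h1.le⟩
      · have hξ0 : 0 < -ξ := by
          rw [window_of_nonpos _ _ h.le] at hξ
          have : ξ = u * (φ + χ) := by linarith
          rw [this]; nlinarith
        rw [abs_of_neg (by linarith)] at hξle hmn
        have h1 := (cone_estimate k1.le k2.le (by positivity) hK0 hξ0 (by linarith)
          (by nlinarith) hm0 (by rw [hm]; field_simp; exact le_rfl)).2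
        rw [neg_neg, ← hside] at h1
        exact ⟨hne' (-1) (by linarith [hmA (-ξ) hξ0.le]), hmn.trans h1.le⟩

end PlaneDrawing

namespace PlaneDrawing

variable {V E : Type*} {D : PlaneDrawing V E}

theorem circ_sub_circ (v : V) (ρ ρ' θ : ℝ) : ‖D.circ v ρ θ - D.circ v ρ' θ‖ = |ρ - ρ'| := by
  have : D.circ v ρ θ - D.circ v ρ' θ = ((ρ - ρ' : ℝ) : ℂ) * Complex.exp (θ * Complex.I) := by
    simp only [circ]; push_cast; ring
  rw [this, norm_mul, Complex.norm_exp_ofReal_mul_I, mul_one, Complex.norm_real, Real.norm_eq_abs]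

/-- A set of directions whose points on the circle of `v` are outside of a closed set can be moved
to concentric circles. -/
theorem exists_circ_notMem (v : V) (ρ : ℝ) {A : Set ℂ} (hA : IsClosed A) {S : Set ℝ}
    (hS : IsCompact S) (h : ∀ θ ∈ S, D.circ v ρ θ ∉ A) :
    ∃ δ > 0, ∀ ρ', |ρ' - ρ| < δ → ∀ θ ∈ S, D.circ v ρ' θ ∉ A := by
  obtain ⟨δ, hδ, hsub⟩ := (hS.image (continuous_circ' v ρ)).exists_thickening_subset_open
    hA.isOpen_compl (by rintro _ ⟨θ, hθ, rfl⟩; exact h θ hθ)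
  refine ⟨δ, hδ, fun ρ' hρ' θ hθ => hsub (Metric.mem_thickening_iff.2 ⟨_, ⟨θ, hθ, rfl⟩, ?_⟩)⟩
  rw [dist_eq_norm, circ_sub_circ]; exact hρ'

/-- The circle of radius `ρ` around `v` crosses the arcs like the circle of `v` does, in windows of
half-width `φ` around the exit angles. -/
structure IsGood [Finite E] (D : PlaneDrawing V E) (v : V) (φ ρ : ℝ) : Prop where
  pos : 0 < ρ
  ne : ρ ≠ D.radius v
  window_pos : 0 < φ
  circles : ∀ θ, D.circ v ρ θ ∉ D.circles
  lo : ∀ b, D.tail b = v → D.baseAngle v ≤ D.ang b - φ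
  hi : ∀ b, D.tail b = v → D.ang b + φ ≤ D.baseAngle v + 2 * Real.pi
  sep : ∀ b, D.tail b = v → ∀ b', D.tail b' = v → D.ang b < D.ang b' →
    D.ang b + φ ≤ D.ang b' - φ
  arcs : ∀ θ ∈ Set.Icc (D.baseAngle v) (D.baseAngle v + 2 * Real.pi),
    (∀ b, D.tail b = v → φ ≤ |θ - D.ang b|) → D.circ v ρ θ ∉ D.arcs
  cross : ∀ b, D.tail b = v → ∃ t χ, 0 < t ∧ t < 1 - D.exT (flip b) ∧ |χ| < φ ∧
    (D.radius v < ρ → D.exT b < t) ∧ (ρ < D.radius v → t < D.exT b) ∧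
    D.IsCross b t (fun u => D.circ v ρ (D.ang b + window χ φ u))

-- The window width is chosen first, from the finitely many exit angles. Outside the windows the
-- circle is at positive distance from the arcs, which persists for nearby radii; inside them
-- `exists_polar` describes the crossing.
variable (D) in
theorem exists_isGood [Finite V] [Finite E] (v : V) : ∃ φ > 0, ∃ δ > 0, δ < D.radius v ∧
    (∀ ρ, |ρ - D.radius v| < δ → D.circ v ρ (D.baseAngle v) ∉ D.arcs) ∧
    (∀ ρ, |ρ - D.radius v| < δ → ρ ≠ D.radius v → ∀ θ, D.circ v ρ θ ∉ D.circles) ∧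
    ∀ ρ, |ρ - D.radius v| < δ → ρ ≠ D.radius v → D.IsGood v φ ρ := by
  have hr := D.radius_pos v
  have hsmall : ∀ᶠ φ in 𝓝[>] (0 : ℝ), ∀ b, D.tail b = v →
      D.baseAngle v ≤ D.ang b - φ ∧ D.ang b + φ ≤ D.baseAngle v + 2 * Real.pi ∧
      (∀ b', D.tail b' = v → D.ang b < D.ang b' → D.ang b + φ ≤ D.ang b' - φ) ∧
      ∃ δ > 0, ∀ ρ, |ρ - D.radius v| < δ → ∃ t χ, 0 < t ∧ t < 1 - D.exT (flip b) ∧ |χ| < φ ∧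
      (D.radius v < ρ → D.exT b < t) ∧ (ρ < D.radius v → t < D.exT b) ∧
      D.IsCross b t (fun u => D.circ v ρ (D.ang b + window χ φ u)) := by
    have key : ∀ x : ℝ, 0 < x → ∀ᶠ φ in 𝓝[>] (0 : ℝ), φ ≤ x := fun x hx =>
      (eventually_le_nhds hx).filter_mono nhdsWithin_le_nhds
    refine eventually_all.2 fun b => ?_
    by_cases hb : D.tail b = v
    swap
    · exact Eventually.of_forall fun φ h => absurd h hb
    have hm := ang_mem (D := D) b
    rw [hb] at hm
    obtain ⟨φ₀, hφ₀, hpol⟩ := exists_polar (D := D) b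
    have h3 : ∀ᶠ φ in 𝓝[>] (0 : ℝ), ∀ b', D.tail b' = v → D.ang b < D.ang b' →
        D.ang b + φ ≤ D.ang b' - φ := by
      refine eventually_all.2 fun b' => ?_
      by_cases hlt : D.ang b < D.ang b'
      · filter_upwards [key ((D.ang b' - D.ang b) / 2) (by linarith)] with φ hφ _ _
        linarith
      · exact Eventually.of_forall fun φ _ h => absurd h hlt
    filter_upwards [key _ (sub_pos.2 hm.1), key _ (sub_pos.2 hm.2), h3, key _ hφ₀,
      self_mem_nhdsWithin] with φ k1 k2 k3 k4 k5 _
    refine ⟨by linarith, by linarith, k3, ?_⟩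
    obtain ⟨δ, hδ, hδ'⟩ := hpol φ k5 k4
    rw [hb] at hδ'
    refine ⟨δ, hδ, fun ρ hρ => ?_⟩
    obtain ⟨t, χ, a1, a2, a3, -, a5, a6, a7⟩ := hδ' ρ hρ
    exact ⟨t, χ, a1, a2, a3, a5, a6, a7⟩
  obtain ⟨φ, hφ, hφ0 : 0 < φ⟩ := (hsmall.and self_mem_nhdsWithin).exists
  choose! hlo hhi hsep dl hdl hcr using hφ
  -- circles
  have hcirc : ∃ δ > 0, ∀ ρ, |ρ - D.radius v| < δ → ∀ θ ∈ Set.Icc 0 (0 + 2 * Real.pi),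
      D.circ v ρ θ ∉ ⋃ w : {w // w ≠ v}, Metric.sphere (D.center w) (D.radius w) := by
    refine exists_circ_notMem v _ (isClosed_iUnion_of_finite fun w => Metric.isClosed_sphere)
      isCompact_Icc fun θ _ hθ => ?_
    obtain ⟨⟨w, hw⟩, hθ⟩ := Set.mem_iUnion.1 hθ
    refine Set.disjoint_left.1 (D.disk_disjoint w v hw) (Metric.sphere_subset_closedBall hθ) ?_
    rw [Metric.mem_closedBall, dist_eq_norm, norm_circ_sub v hr.le]
  obtain ⟨δ₁, hδ₁, hc⟩ := hcirc
  have harcs : ∃ δ > 0, ∀ ρ, |ρ - D.radius v| < δ →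
      ∀ θ ∈ (Set.Icc (D.baseAngle v) (D.baseAngle v + 2 * Real.pi) ∩
        ⋂ b : {b // D.tail b = v}, {θ | φ ≤ |θ - D.ang b|}), D.circ v ρ θ ∉ D.arcs := by
    refine exists_circ_notMem v _ isCompact_arcs.isClosed
      (isCompact_Icc.inter_right (isClosed_iInter fun b => isClosed_le (by fun_prop)
        (by fun_prop))) fun θ hθ hmem => ?_
    obtain ⟨b, t, ht, hbt⟩ := mem_arcs.1 hmem
    obtain ⟨b', hb', hb''⟩ := tail_eq_of_crv_mem_sphere (v := v) ht (by
      rw [hbt, norm_circ_sub v hr.le])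
    rw [hbt, crv_exT, hb'] at hb''
    have hm := ang_mem (D := D) b'
    rw [hb'] at hm
    have h1 := circ_injOn hr.ne' hb''.symm hθ.1 hm
    have h2 := Set.mem_iInter.1 hθ.2 ⟨b', hb'⟩
    rw [Set.mem_ofPred_eq, h1, sub_self, abs_zero] at h2
    linarith
  obtain ⟨δ₂, hδ₂, ha⟩ := harcs
  obtain ⟨δ₃, hδ₃, hpol⟩ : ∃ δ > 0, ∀ b, D.tail b = v → δ ≤ dl b := by
    have : ∀ᶠ δ in 𝓝[>] (0 : ℝ), ∀ b, D.tail b = v → δ ≤ dl b := by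
      refine eventually_all.2 fun b => ?_
      by_cases hb : D.tail b = v
      · exact ((eventually_le_nhds (hdl b hb)).filter_mono nhdsWithin_le_nhds).mono fun _ h _ => h
      · exact Eventually.of_forall fun φ h => absurd h hb
    obtain ⟨δ, h1, h2⟩ := (this.and self_mem_nhdsWithin).exists
    exact ⟨δ, h2, h1⟩
  have hcc : ∀ ρ, |ρ - D.radius v| < δ₁ → 0 < ρ → ρ ≠ D.radius v →
      ∀ θ, D.circ v ρ θ ∉ D.circles := by
    intro ρ hρ hρ0 hne θ hmem
    obtain ⟨w, hw⟩ := mem_circles.1 hmem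
    by_cases hwv : w = v
    · subst hwv
      rw [norm_circ_sub w hρ0.le] at hw
      exact hne hw
    · obtain ⟨θ', hθ', hz⟩ := exists_circ_eq (D := D) v (D.circ v ρ θ) 0
      rw [norm_circ_sub v hρ0.le] at hz
      refine hc ρ hρ θ' (Set.Ioc_subset_Icc_self hθ') (Set.mem_iUnion.2 ⟨⟨w, hwv⟩, ?_⟩)
      rw [← hz, mem_sphere_iff_norm]; exact hw
  refine ⟨φ, hφ0, min (D.radius v / 2) (min δ₁ (min δ₂ δ₃)), by positivity,
    (min_le_left _ _).trans_lt (half_lt_self hr), fun ρ hρ => ?_, fun ρ hρ hne => ?_,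
    fun ρ hρ hne => ?_⟩
  all_goals
    have e0 : 0 < ρ := by
      have := (abs_lt.1 (hρ.trans_le (min_le_left _ _))).1; linarith
    have e1 := hρ.trans_le ((min_le_right _ _).trans (min_le_left _ _))
    have e2 := hρ.trans_le ((min_le_right _ _).trans ((min_le_right _ _).trans (min_le_left _ _)))
    have e3 := hρ.trans_le ((min_le_right _ _).trans ((min_le_right _ _).trans (min_le_right _ _)))
  · refine ha ρ e2 _ ⟨⟨le_rfl, by linarith [Real.pi_pos]⟩, Set.mem_iInter.2 fun b => ?_⟩
    have := hlo b b.2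
    rw [Set.mem_ofPred_eq, abs_sub_comm]
    exact le_trans (by linarith) (le_abs_self _)
  · exact hcc ρ e1 e0 hne
  · exact ⟨e0, hne, hφ0, hcc ρ e1 e0 hne, hlo, hhi, hsep,
      fun θ hθ hb => ha ρ e2 θ ⟨hθ, Set.mem_iInter.2 fun b => hb b b.2⟩,
      fun b hb => hcr b hb ρ (e3.trans_le (hpol b hb))⟩

/-! ### Going around a vertex -/

variable (D) in
/-- A time at which the dart is outside (for `o = true`) or inside (for `o = false`) of the disk of
its initial vertex. -/
def tm (o : Bool) (b : E × Bool) : ℝ := if o then D.mid b else D.exT b / 2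

theorem tm_mem (o : Bool) (b : E × Bool) : D.tm o b ∈ I := by
  cases o
  · have := D.exT_pos b; have := D.exT_lt_one b
    exact ⟨by simp [tm]; linarith, by simp [tm]; linarith⟩
  · exact mid_mem b

variable (D) in
/-- A point on the left (for `0 < x`) or on the right of a dart. -/
def sidePt [Finite V] [Finite E] (o : Bool) (x : ℝ) (b : E × Bool) : ℂ :=
  D.nrm b (D.tm o b) (x * D.eps)

theorem nrm_tm_notMem_proj [Finite V] [Finite E] (o : Bool) (b : E × Bool) {η : ℝ}
    (h0 : η ≠ 0) (h : |η| ≤ D.eps) : D.nrm b (D.tm o b) η ∉ D.proj := by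
  rintro (hm | hm)
  · exact nrm_notMem_arcs' b (tm_mem o b) h h0 hm
  · cases o
    · exact nrm_half_notMem_circles b h hm
    · exact nrm_mid_notMem_circles b h hm

theorem conn_sidePt [Finite V] [Finite E] (o : Bool) (b : E × Bool) {η x : ℝ}
    (hx : |x| = 1) (h0 : 0 < η) (h : η ≤ D.eps) :
    D.Conn (D.nrm b (D.tm o b) (x * η)) (D.sidePt o x b) := by
  have hc : Continuous fun y : ℝ => D.nrm b (D.tm o b) (x * y) :=
    (D.continuous_nrm b).comp (by fun_prop : Continuous fun y : ℝ => (D.tm o b, x * y))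
  refine Conn.of_line hc (a := η) (b := D.eps) fun y hy => ?_
  rw [Set.uIcc_of_le h] at hy
  refine nrm_tm_notMem_proj o b (mul_ne_zero ?_ (by linarith [hy.1])) ?_
  · rintro rfl; simp at hx
  · rw [abs_mul, hx, one_mul, abs_of_pos (by linarith [hy.1])]; exact hy.2

namespace IsGood

variable [Finite V] [Finite E] {v : V} {φ ρ : ℝ}

/-- From the end of the window one approaches the arc and then follows it on one side to its
reference time. Both times are on the same side of the exit time, so no circle is met. -/
theorem conn_side (h : D.IsGood v φ ρ) {b : E × Bool} (hb : D.tail b = v) {o : Bool}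
    (ho : o = true ↔ D.radius v < ρ) :
    D.Conn (D.circ v ρ (D.ang b + φ)) (D.sidePt o 1 b) ∧
    D.Conn (D.circ v ρ (D.ang b - φ)) (D.sidePt o (-1) b) := by
  obtain ⟨t, χ, ht, ht1, -, hout, hin, hcr⟩ := h.cross b hb
  have hI : t ∈ I := ⟨ht.le, by linarith [D.exT_pos (flip b)]⟩
  obtain ⟨η₁, hη₁, h1⟩ := hcr.exists_conn hI fun u _ => h.circles _
  have htm : (D.exT b < t ∧ D.tm o b = D.mid b) ∨ (t < D.exT b ∧ D.tm o b = D.exT b / 2) := by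
    cases o
    · refine Or.inr ⟨hin (lt_of_le_of_ne ?_ h.ne), rfl⟩
      by_contra hc
      exact absurd (ho.2 (not_le.1 hc)) (by simp)
    · exact Or.inl ⟨hout (ho.1 rfl), rfl⟩
  have hsub : Set.uIcc t (D.tm o b) ⊆ I := Set.uIcc_subset_Icc hI (tm_mem o b)
  have k1 := exT_lt_mid (D := D) b
  have k2 := mid_lt (D := D) b
  have k3 := D.exT_pos b
  have k4 := D.exT_add_lt b
  obtain ⟨η₂, hη₂, h2⟩ := exists_conn_nrm (D := D) b hsub
    (by
      rw [Set.mem_uIcc]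
      rcases htm with ⟨a1, a2⟩ | ⟨a1, a2⟩ <;> rw [a2] <;> rintro (⟨c1, c2⟩ | ⟨c1, c2⟩) <;> linarith)
    (by
      rw [Set.mem_uIcc]
      rcases htm with ⟨a1, a2⟩ | ⟨a1, a2⟩ <;> rw [a2] <;> rintro (⟨c1, c2⟩ | ⟨c1, c2⟩) <;> linarith)
  set η := min η₁ (min η₂ D.eps)
  have hη : 0 < η := lt_min hη₁ (lt_min hη₂ eps_pos)
  obtain ⟨a1, a2⟩ := h1 η hη (min_le_left _ _)
  have hη2 : η ≤ η₂ := (min_le_right _ _).trans (min_le_left _ _)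
  have hη3 : η ≤ D.eps := (min_le_right _ _).trans (min_le_right _ _)
  simp only [window_one, window_neg_one] at a1 a2
  refine ⟨(a1.trans (h2 η hη.ne' (by rwa [abs_of_pos hη]) t Set.left_mem_uIcc)).trans ?_, ?_⟩
  · simpa using conn_sidePt o b (x := 1) (by simp) hη hη3
  · rw [sub_eq_add_neg]
    refine (a2.trans (h2 (-η) (by linarith [hη]) (by rwa [abs_neg, abs_of_pos hη]) t
      Set.left_mem_uIcc)).trans ?_
    simpa using conn_sidePt o b (x := -1) (by simp) hη hη3

omit [Finite V] in
theorem notMem_proj (h : D.IsGood v φ ρ) {θ : ℝ}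
    (hθ : θ ∈ Set.Icc (D.baseAngle v) (D.baseAngle v + 2 * Real.pi))
    (hb : ∀ b, D.tail b = v → φ ≤ |θ - D.ang b|) : D.circ v ρ θ ∉ D.proj := fun hm =>
  hm.elim (h.arcs θ hθ hb) (h.circles θ)

omit [Finite V] in
theorem conn_of_free (h : D.IsGood v φ ρ) {x y : ℝ} (hxy : x ≤ y) (hx : D.baseAngle v ≤ x)
    (hy : y ≤ D.baseAngle v + 2 * Real.pi)
    (hb : ∀ b, D.tail b = v → D.ang b + φ ≤ x ∨ y ≤ D.ang b - φ) :
    ∀ θ ∈ Set.Icc x y, D.circ v ρ θ ∉ D.proj := by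
  intro θ hθ
  refine h.notMem_proj ⟨hx.trans hθ.1, hθ.2.trans hy⟩ fun b hbv => ?_
  rcases hb b hbv with h1 | h1
  · exact le_trans (by linarith [hθ.1]) (le_abs_self _)
  · exact le_trans (by linarith [hθ.2]) (neg_le_abs _)

theorem conn_circ (h : D.IsGood v φ ρ) {x y : ℝ} (hxy : x ≤ y) (hx : D.baseAngle v ≤ x)
    (hy : y ≤ D.baseAngle v + 2 * Real.pi)
    (hb : ∀ b, D.tail b = v → D.ang b + φ ≤ x ∨ y ≤ D.ang b - φ) :
    D.Conn (D.circ v ρ x) (D.circ v ρ y) := by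
  refine Conn.of_line (continuous_circ' v ρ) fun θ hθ => ?_
  rw [Set.uIcc_of_le hxy] at hθ
  exact h.conn_of_free hxy hx hy hb θ hθ

theorem conn_base (h : D.IsGood v φ ρ) {b : E × Bool} {L : List (E × Bool)}
    (hL : D.darts v = b :: L) {o : Bool} (ho : o = true ↔ D.radius v < ρ) :
    D.Conn (D.circ v ρ (D.baseAngle v)) (D.sidePt o (-1) b) := by
  have hb : D.tail b = v := mem_darts.1 (by rw [hL]; simp)
  refine Conn.trans ?_ (h.conn_side hb ho).2
  refine h.conn_circ (h.lo b hb) le_rfl (by linarith [h.hi b hb, h.window_pos]) fun b' hb' => ?_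
  have h1 := mem_darts.2 hb'
  have h2 := pairwise_darts (D := D) v
  rw [hL] at h1 h2
  rcases List.mem_cons.1 h1 with rfl | h1
  · exact Or.inr le_rfl
  · have := (List.pairwise_cons.1 h2).1 _ h1
    exact Or.inr (by linarith)

/-- Between the windows of consecutive darts the circle is free of arcs. -/
theorem conn_rot (h : D.IsGood v φ ρ) {b : E × Bool} (hb : D.tail b = v) {o : Bool}
    (ho : o = true ↔ D.radius v < ρ) :
    D.Conn (D.sidePt o 1 b) (D.sidePt o (-1) (D.rot b)) := by
  obtain ⟨i, hi, rfl⟩ := List.getElem_of_mem (mem_darts.2 hb)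
  have hsort : ∀ j k (hj : j < (D.darts v).length) (hk : k < (D.darts v).length), j < k →
      D.ang (D.darts v)[j] < D.ang (D.darts v)[k] := fun j k hj hk hjk =>
    List.pairwise_iff_getElem.1 (pairwise_darts v) j k hj hk hjk
  have hw := h.window_pos
  rw [rot_getElem hi]
  have hside := (h.conn_side hb ho).1.symm
  by_cases hlast : i + 1 < (D.darts v).length
  · have hmod : (i + 1) % (D.darts v).length = i + 1 := Nat.mod_eq_of_lt hlast
    simp only [hmod]
    have hb' : D.tail (D.darts v)[i + 1] = v := mem_darts.1 (List.getElem_mem _)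
    refine (hside.trans ?_).trans (h.conn_side hb' ho).2
    have hlo := h.lo _ hb
    have hhi := h.hi _ hb'
    refine h.conn_circ (h.sep _ hb _ hb' (hsort _ _ _ _ (Nat.lt_succ_self i))) (by linarith)
      (by linarith) fun b'' hb'' => ?_
    obtain ⟨j, hj, rfl⟩ := List.getElem_of_mem (mem_darts.2 hb'')
    rcases Nat.lt_or_ge i j with hij | hij
    · refine Or.inr ?_
      rcases Nat.lt_or_ge (i + 1) j with hij' | hij'
      · linarith [hsort _ _ hlast hj hij']
      · have : j = i + 1 := by omega
        subst this; exact le_rfl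
    · refine Or.inl ?_
      rcases hij.lt_or_eq with hij' | rfl
      · linarith [hsort _ _ hj hi hij']
      · exact le_rfl
  -- After the last dart one continues through the base direction to the first, a full period
  -- further.
  · have hlen : i + 1 = (D.darts v).length := by omega
    have hmod : (i + 1) % (D.darts v).length = 0 := by rw [hlen, Nat.mod_self]
    simp only [hmod]
    have hpos : 0 < (D.darts v).length := by omega
    have hcons : D.darts v = (D.darts v)[0] :: (D.darts v).tail := by
      conv_lhs => rw [← List.cons_head_tail (List.length_pos_iff.1 hpos)]
      rw [List.head_eq_getElem]
    refine (hside.trans ?_).trans (h.conn_base hcons ho)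
    rw [← circ_add_two_pi v ρ (D.baseAngle v)]
    refine h.conn_circ (h.hi _ hb) (by linarith [h.lo _ hb]) le_rfl fun b'' hb'' => Or.inl ?_
    obtain ⟨j, hj, rfl⟩ := List.getElem_of_mem (mem_darts.2 hb'')
    have hij : j ≤ i := by omega
    rcases hij.lt_or_eq with hij' | rfl
    · linarith [hsort _ _ hj hi hij']
    · exact le_rfl

variable (D) in
/-- The product of the loops that cross the darts in a list. -/
def crossProd (L : List (E × Bool)) : D.base ⟶ D.base :=
  L.foldr (fun b a => D.cross b true ≫ a) (𝟙 _)

omit [Finite V] in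
theorem notMem_link (h : D.IsGood v φ ρ) {θ : ℝ}
    (hθ : θ ∈ Set.Icc (D.baseAngle v) (D.baseAngle v + 2 * Real.pi)) :
    (D.circ v ρ θ, (0 : ℝ)) ∉ D.link := by
  by_cases hb : ∀ b, D.tail b = v → φ ≤ |θ - D.ang b|
  · exact notMem_link_of_notMem_proj _ (h.notMem_proj hθ hb)
  · push Not at hb
    obtain ⟨b, hb, hlt⟩ := hb
    obtain ⟨t, χ, ht, ht1, -, -, -, hcr⟩ := h.cross b hb
    have hI : t ∈ I := ⟨ht.le, by linarith [D.exT_pos (flip b)]⟩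
    obtain ⟨u, hu, hu'⟩ := intermediate_value_Icc (show (-1 : ℝ) ≤ 1 by norm_num)
      (continuous_window χ φ).continuousOn
      (show θ - D.ang b ∈ Set.Icc _ _ by
        rw [window_one, window_neg_one]
        exact ⟨(abs_lt.1 hlt).1.le, (abs_lt.1 hlt).2.le⟩)
    have hθ' : θ = D.ang b + window χ φ u := by rw [hu']; ring
    by_cases hu0 : u = 0
    · subst hu0
      have h0 := hcr.map_zero
      have h1 := h.circles θ
      rw [hθ', h0] at h1 ⊢
      refine crv_notMem_link b hI ?_ (Or.inr h1)
      have := D.exT_pos (flip b)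
      nlinarith
    · have h1 := hcr.notMem_arcs hu hu0
      have h2 := h.circles θ
      rw [hθ'] at h2 ⊢
      exact notMem_link_of_notMem_proj _ fun hm => hm.elim h1 h2

/-- The window with its corner at the crossing is reparametrized linearly; the homotopy stays on the
circle, which at height zero misses the link, and it fixes the ends. -/
theorem genOn_window (h : D.IsGood v φ ρ) {b : E × Bool} (hb : D.tail b = v) :
    D.genOn (fun θ => (D.circ v ρ θ, (0 : ℝ))) (D.ang b - φ) (D.ang b + φ) true true =
      D.cross b true := by
  obtain ⟨t, χ, ht, ht1, hχ, -, -, hcr⟩ := h.cross b hb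
  have hχ' := abs_lt.1 hχ
  have hlo := h.lo b hb
  have hhi := h.hi b hb
  have hφ := h.window_pos
  have hs : (0 : ℝ) ^ 2 < t * (1 - t) := by have := D.exT_pos (flip b); nlinarith
  rw [← genOn_cross (i := true) hs hcr (Or.inr ⟨rfl, fun u _ => h.circles _⟩)]
  have hbd : ∀ u ∈ Set.Icc (-1 : ℝ) 1, window χ φ u ∈ Set.Icc (-φ) φ := by
    intro u hu
    rcases le_total 0 u with h0 | h0
    · rw [window_of_nonneg _ _ h0]; constructor <;> nlinarith [hu.2]
    · rw [window_of_nonpos _ _ h0]; constructor <;> nlinarith [hu.1]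
  have hside : ∀ x, x = 1 ∨ x = -1 → D.circ v ρ (D.ang b + x * φ) ∉ D.proj := by
    intro x hx
    refine h.notMem_proj ?_ fun b' hb' => ?_
    · rcases hx with rfl | rfl <;> constructor <;> linarith
    · have habs : |x * φ| = φ := by
        rcases hx with rfl | rfl <;> simp [abs_of_pos hφ]
      by_cases hbb : b' = b
      · subst hbb; rw [add_sub_cancel_left, habs]
      · have hne : D.ang b' ≠ D.ang b := fun he => hbb (ang_injective (hb'.trans hb.symm) he)
        have h1 := neg_abs_le (x * φ)
        have h2 := le_abs_self (x * φ)
        rw [habs] at h1 h2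
        rcases hne.lt_or_gt with hlt | hlt
        · have := h.sep _ hb' _ hb hlt
          exact le_trans (by linarith) (le_abs_self _)
        · have := h.sep _ hb _ hb' hlt
          exact le_trans (by linarith) (neg_le_abs _)
  have hcont : Continuous fun z : ℝ × ℝ => (D.circ v ρ
      (D.ang b + ((1 - z.2) * window χ φ z.1 + z.2 * (z.1 * φ))), (0 : ℝ)) := by
    have h1 := continuous_circ' (D := D) v ρ
    have h2 := continuous_window χ φ
    exact (h1.comp (by fun_prop)).prodMk continuous_const
  have hhom := genOn_homotopy (D := D) (F := fun u s => (D.circ v ρ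
    (D.ang b + ((1 - s) * window χ φ u + s * (u * φ))), (0 : ℝ))) hcont (a := -1) (b := 1)
    (by norm_num) (i := true) (j := true) ?_ ?_ ?_
  · simp only [sub_zero, one_mul, zero_mul, add_zero, sub_self, zero_add] at hhom
    rw [hhom]
    unfold genOn
    congr 1
    funext u
    refine congrArg (fun x => (D.circ v ρ x, (0 : ℝ))) ?_
    ring
  · intro u hu s hs'
    refine h.notMem_link ?_
    have h1 := hbd u hu
    have h2 : u * φ ∈ Set.Icc (-φ) φ := ⟨by nlinarith [hu.1], by nlinarith [hu.2]⟩
    have h3 := (convex_Icc (-φ) φ) h1 h2 (by linarith [hs'.2] : 0 ≤ 1 - s) hs'.1 (by ring)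
    simp only [smul_eq_mul] at h3
    exact ⟨by linarith [h3.1], by linarith [h3.2]⟩
  · intro s _
    refine free_of_notMem_proj _ _ ?_
    rw [window_neg_one, show (1 - s) * -φ + s * (-1 * φ) = -1 * φ by ring]
    exact hside (-1) (Or.inr rfl)
  · intro s _
    refine free_of_notMem_proj _ _ ?_
    rw [window_one, show (1 - s) * φ + s * (1 * φ) = 1 * φ by ring]
    exact hside 1 (Or.inl rfl)

/-- The arc of the circle up to the next window is free, the window contributes one crossing, and
the rest is the same situation with a shorter list. -/
theorem genOn_suffix (h : D.IsGood v φ ρ) (L : List (E × Bool)) {a : ℝ}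
    (hL : ∀ b ∈ L, D.tail b = v) (hsort : L.Pairwise fun a b => D.ang a < D.ang b)
    (ha : D.baseAngle v ≤ a) (ha' : a ≤ D.baseAngle v + 2 * Real.pi)
    (hin : ∀ b ∈ L, a ≤ D.ang b - φ) (hout : ∀ b, D.tail b = v → b ∉ L → D.ang b + φ ≤ a) :
    D.genOn (fun θ => (D.circ v ρ θ, (0 : ℝ))) a (D.baseAngle v + 2 * Real.pi) true true =
      crossProd D L := by
  have hc : Continuous fun θ => (D.circ v ρ θ, (0 : ℝ)) :=
    (continuous_circ' v ρ).prodMk continuous_const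
  have hφ := h.window_pos
  induction L generalizing a with
  | nil =>
    refine genOn_free hc ha' fun θ hθ => free_of_notMem_proj _ _ ?_
    exact h.conn_of_free ha' ha le_rfl (fun b hb => Or.inl (hout b hb (by simp))) θ hθ
  | cons b L ih =>
    have hb := hL b (by simp)
    have hs := List.pairwise_cons.1 hsort
    have hhi := h.hi b hb
    have hlo := h.lo b hb
    have h1 : a ≤ D.ang b - φ := hin b (by simp)
    have hout' : ∀ b', D.tail b' = v → b' ∉ L → D.ang b' + φ ≤ D.ang b + φ := by
      intro b' hb' hn
      by_cases hbb : b' = b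
      · rw [hbb]
      · have := hout b' hb' (by simp [hbb, hn])
        linarith
    have hin' : ∀ b' ∈ L, D.ang b + φ ≤ D.ang b' - φ := fun b' hb' =>
      h.sep _ hb _ (hL b' (by simp [hb'])) (hs.1 b' hb')
    have ih' := ih (a := D.ang b + φ) (fun b' hb' => hL b' (by simp [hb'])) hs.2 (by linarith) hhi
      hin' hout'
    have hdich : ∀ b', D.tail b' = v → D.ang b' + φ ≤ a ∨ D.ang b - φ ≤ D.ang b' - φ := by
      intro b' hb'
      by_cases hbb : b' ∈ b :: L
      · rcases List.mem_cons.1 hbb with rfl | hbb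
        · exact Or.inr le_rfl
        · have := hs.1 b' hbb
          exact Or.inr (by linarith)
      · exact Or.inl (hout b' hb' hbb)
    have hfree := h.conn_of_free h1 ha (by linarith) hdich
    have hend : D.circ v ρ (D.ang b + φ) ∉ D.proj := by
      refine h.notMem_proj ⟨by linarith, hhi⟩ fun b' hb' => ?_
      by_cases hbb : b' ∈ L
      · have := hin' b' hbb
        exact le_trans (by linarith) (neg_le_abs _)
      · have := hout' b' hb' hbb
        exact le_trans (by linarith) (le_abs_self _)
    have hlast : D.circ v ρ (D.baseAngle v + 2 * Real.pi) ∉ D.proj :=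
      h.notMem_proj ⟨by linarith, le_rfl⟩ fun b' hb' => by
        have := h.hi b' hb'
        exact le_trans (by linarith) (le_abs_self _)
    have hlink : ∀ θ ∈ Set.Icc a (D.baseAngle v + 2 * Real.pi),
        (D.circ v ρ θ, (0 : ℝ)) ∉ D.link := fun θ hθ => h.notMem_link ⟨ha.trans hθ.1, hθ.2⟩
    rw [← genOn_trans hc h1 (by linarith) hlink (free_of_notMem_proj _ true (hfree a ⟨le_rfl, h1⟩))
      (free_of_notMem_proj _ true (hfree _ ⟨h1, le_rfl⟩)) (free_of_notMem_proj _ true hlast),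
      ← genOn_trans hc (show D.ang b - φ ≤ D.ang b + φ by linarith) hhi
      (fun θ hθ => hlink θ ⟨h1.trans hθ.1, hθ.2⟩)
      (free_of_notMem_proj _ true (hfree _ ⟨h1, le_rfl⟩)) (free_of_notMem_proj _ true hend)
      (free_of_notMem_proj _ true hlast), h.genOn_window hb, ih',
      genOn_free hc h1 fun θ hθ => free_of_notMem_proj _ _ (hfree θ hθ), Category.id_comp]
    rfl

/-- The loop around a vertex crosses all of its darts in their order. -/
theorem genOn_circ (h : D.IsGood v φ ρ) :
    D.genOn (fun θ => (D.circ v ρ θ, (0 : ℝ))) (D.baseAngle v) (D.baseAngle v + 2 * Real.pi)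
      true true = crossProd D (D.darts v) :=
  h.genOn_suffix _ (fun b hb => mem_darts.1 hb) (pairwise_darts v) le_rfl
    (by linarith [Real.pi_pos]) (fun b hb => h.lo b (mem_darts.1 hb))
    fun b hb hn => absurd (mem_darts.2 hb) hn

end IsGood

/-! ### Inside of a disk -/

/-- Two points of an open disk outside of the arcs, on the two sides of a dart. -/
theorem conn_inner [Finite V] [Finite E] (b : E × Bool) :
    D.Conn (D.sidePt false 1 b) (D.sidePt false (-1) b) := by
  set v := D.tail b
  set T := D.exT b
  have hT : 0 < T := D.exT_pos b
  have hT1 : T < 1 := D.exT_lt_one b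
  -- a neighbourhood of the part of the arc inside of the disk
  have hK : IsCompact (Set.Icc (0 : ℝ) (T / 2)) := isCompact_Icc
  have hc := D.continuous_nrm b
  have hopen : IsOpen {p : ℝ × ℝ | D.nrm b p.1 p.2 ∈ Metric.ball (D.center v) (D.radius v)} :=
    Metric.isOpen_ball.preimage hc
  obtain ⟨δ, hδ, hsub⟩ := (hK.prod (isCompact_singleton (x := (0 : ℝ)))).exists_thickening_subset_open
    hopen (by
      rintro ⟨t, η⟩ ⟨ht, rfl : η = 0⟩
      rw [Set.mem_ofPred_eq, nrm_zero, D.crv_mem_ball b v ⟨ht.1, by linarith [ht.2]⟩]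
      exact Or.inl ⟨rfl, by linarith [ht.2]⟩)
  set κ := min D.eps (δ / 2)
  have hκ : 0 < κ := lt_min eps_pos (by positivity)
  have hκε : κ ≤ D.eps := min_le_left _ _
  have hκδ : κ < δ := (min_le_right _ _).trans_lt (by linarith)
  have hfree : ∀ t ∈ Set.Icc (-κ) (T / 2), ∀ η, |η| ≤ κ → (η ≠ 0 ∨ t < 0) →
      D.nrm b t η ∉ D.proj := by
    intro t ht η hη h0
    rintro (hm | hm)
    · refine nrm_notMem_arcs b ⟨by linarith [ht.1], by linarith [ht.2, eps_pos (D := D)]⟩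
        (hη.trans hκε) ?_ hm
      exact h0.imp_right fun h hI => absurd hI.1 (not_le.2 h)
    · have hball : D.nrm b t η ∈ Metric.ball (D.center v) (D.radius v) := by
        refine @hsub (t, η) (Metric.mem_thickening_iff.2
          ⟨(max t 0, 0), ⟨⟨le_max_right _ _, ?_⟩, rfl⟩, ?_⟩)
        · exact max_le ht.2 (by linarith)
        · rw [Prod.dist_eq, max_lt_iff, Real.dist_eq, Real.dist_eq, sub_zero]
          refine ⟨?_, hη.trans_lt hκδ⟩
          rcases le_total 0 t with h | h
          · rw [max_eq_left h]; simpa using hδ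
          · rw [max_eq_right h, sub_zero, abs_of_nonpos h]; linarith [ht.1]
      obtain ⟨w, hw⟩ := mem_circles.1 hm
      by_cases hwv : w = v
      · subst hwv
        rw [Metric.mem_ball, dist_eq_norm, hw] at hball
        exact lt_irrefl _ hball
      · refine Set.disjoint_left.1 (D.disk_disjoint w v hwv) ?_ (Metric.ball_subset_closedBall hball)
        rw [Metric.mem_closedBall, dist_eq_norm, hw]
  have hlineT : ∀ η, η ≠ 0 → |η| ≤ κ → D.Conn (D.nrm b (T / 2) η) (D.nrm b (-κ) η) := by
    intro η h0 hη
    refine Conn.of_line (f := fun t => D.nrm b t η) (hc.comp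
      (by fun_prop : Continuous fun t : ℝ => (t, η))) fun t ht => ?_
    rw [Set.uIcc_of_ge (by linarith)] at ht
    exact hfree t ht η hη (Or.inl h0)
  -- The arc ends inside the disk, so one changes sides by passing around its end, at the parameter
  -- `-κ`.
  have hlineE : D.Conn (D.nrm b (-κ) κ) (D.nrm b (-κ) (-κ)) := by
    refine Conn.of_line (f := fun η => D.nrm b (-κ) η) (hc.comp
      (by fun_prop : Continuous fun η : ℝ => (-κ, η))) fun η hη => ?_
    rw [Set.uIcc_of_ge (by linarith)] at hη
    exact hfree _ ⟨le_rfl, by linarith⟩ η (abs_le.2 hη) (Or.inr (by linarith))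
  have e1 := conn_sidePt (D := D) false b (x := 1) (by simp) hκ hκε
  have e2 := conn_sidePt (D := D) false b (x := -1) (by simp) hκ hκε
  simp only [one_mul, neg_mul] at e1 e2
  have htm : D.tm false b = T / 2 := rfl
  rw [htm] at e1 e2
  exact (e1.symm.trans ((hlineT κ hκ.ne' (abs_of_pos hκ).le).trans (hlineE.trans
    (hlineT (-κ) (by linarith) (by rw [abs_neg, abs_of_pos hκ])).symm))).trans e2

end PlaneDrawing

/-! ### A crossing argument in the plane -/

/-- A continuous logarithm of the ratio of the differences to the two endpoints of a path, on the
complement of the path. -/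
theorem exists_log_ratio {z₀ z₁ : ℂ} (γ : Path z₀ z₁) :
    ∃ L : {w : ℂ // w ∉ Set.range γ} → ℂ, Continuous L ∧
      ∀ w, Complex.exp (L w) = (z₁ - w) / (z₀ - w) := by
  have hne : ∀ (t : I) (w : {w : ℂ // w ∉ Set.range γ}), γ t - w ≠ 0 := fun t w h =>
    w.2 ⟨t, sub_eq_zero.1 h⟩
  -- Letting the endpoint move along `γ` connects the constant 1 with the ratio in question; this
  -- homotopy lifts through the exponential, starting from 0.
  let H : C(I × {w : ℂ // w ∉ Set.range γ}, {z : ℂ // z ≠ 0}) :=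
    ⟨fun p => ⟨(γ p.1 - p.2) / (γ 0 - p.2), div_ne_zero (hne _ _) (hne _ _)⟩, by
      refine Continuous.subtype_mk (Continuous.div ?_ ?_ fun p => hne _ _) _
      · exact (γ.continuous.comp continuous_fst).sub (continuous_subtype_val.comp continuous_snd)
      · exact continuous_const.sub (continuous_subtype_val.comp continuous_snd)⟩
  have H0 : ∀ a, H (0, a) = ⟨Complex.exp ((0 : C({w : ℂ // w ∉ Set.range γ}, ℂ)) a),
      Complex.exp_ne_zero _⟩ := fun a => Subtype.ext (by
    simpa [H] using div_self (hne 0 a))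
  obtain ⟨L, hL⟩ : ∃ L, L = Complex.isCoveringMap_exp.liftHomotopy H 0 H0 := ⟨_, rfl⟩
  refine ⟨fun w => L (1, w), L.continuous.comp (by fun_prop), fun w => ?_⟩
  have h1 := congrFun (Complex.isCoveringMap_exp.liftHomotopy_lifts H 0 H0) (1, w)
  rw [← hL] at h1
  have h2 := congrArg Subtype.val h1
  simpa [H] using h2

/-- Two continuous logarithms on a preconnected set differ by a constant. -/
theorem sub_eq_sub_of_exp_eq {X : Type*} [TopologicalSpace X] {S : Set X} (hS : IsPreconnected S)
    {f g : X → ℂ} (hf : ContinuousOn f S) (hg : ContinuousOn g S)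
    (h : ∀ x ∈ S, Complex.exp (f x) = Complex.exp (g x)) {x y : X} (hx : x ∈ S) (hy : y ∈ S) :
    (f x - g x).im = (f y - g y).im := by
  have hT : _root_.IsDiscrete ((AddSubgroup.zmultiples (2 * Real.pi) : AddSubgroup ℝ) : Set ℝ) :=
    ⟨inferInstanceAs (DiscreteTopology (AddSubgroup.zmultiples (2 * Real.pi)))⟩
  refine hS.constant_of_mapsTo (f := fun x => (f x - g x).im) hT
    (Complex.continuous_im.comp_continuousOn (hf.sub hg)) (fun z hz => ?_) hx hy
  obtain ⟨n, hn⟩ := Complex.exp_eq_exp_iff_exists_int.1 (h z hz)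
  refine ⟨n, ?_⟩
  simp [hn]

/-- The crossing argument: a path between the two sides of a short arc meets the arc or any connected
set that contains the endpoints of the arc but stays away from its middle. Coordinates are chosen
such that the middle of the arc is `0` and its tangent there is real. -/
theorem not_joinedIn_of_isPreconnected {K P : Set ℂ} (hK : IsPreconnected K)
    (hP : IsPreconnected P) {p q : ℂ} (hpK : p ∈ K) (hqK : q ∈ K) (hpP : p ∈ P) (hqP : q ∈ P)
    (hp : 0 < p.re) (hq : q.re < 0) (hP0 : ∀ z ∈ P, z.re = 0 → z = 0) {η : ℝ} (hη : 0 < η)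
    (hKη : ∀ z ∈ K, 3 * η < ‖z‖) :
    ¬ JoinedIn (K ∪ P)ᶜ (-(η * Complex.I)) (η * Complex.I) := by
  rintro ⟨γ, hγ⟩
  obtain ⟨L, hL, hexp⟩ := exists_log_ratio γ
  have hout : ∀ z ∈ K ∪ P, z ∉ Set.range γ := by
    rintro z hz ⟨t, rfl⟩; exact hγ t hz
  set r : ℂ → ℂ := fun z => (η * Complex.I - z) / (-(η * Complex.I) - z) with hr
  have hd : ∀ z ∈ K ∪ P, -(η * Complex.I) - z ≠ 0 := fun z hz h =>
    hout z hz ⟨0, by rw [γ.source]; exact sub_eq_zero.1 h⟩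
  set N : ℂ → ℝ := fun z => Complex.normSq (-(η * Complex.I) - z) with hN
  have hNpos : ∀ z ∈ K ∪ P, 0 < N z := fun z hz => Complex.normSq_pos.2 (hd z hz)
  have hre : ∀ z ∈ K ∪ P, (-r z).re = (η ^ 2 - z.re ^ 2 - z.im ^ 2) / N z := by
    intro z hz
    rw [Complex.neg_re, Complex.div_re]
    simp only [Complex.sub_re, Complex.sub_im, Complex.neg_re, Complex.neg_im,
      Complex.mul_re, Complex.mul_im, Complex.ofReal_re, Complex.ofReal_im, Complex.I_re,
      Complex.I_im]
    have := (hNpos z hz).ne'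
    simp only [hN] at this ⊢
    field_simp
    ring
  have him : ∀ z ∈ K ∪ P, (-r z).im = 2 * η * z.re / N z := by
    intro z hz
    rw [Complex.neg_im, Complex.div_im]
    simp only [Complex.sub_re, Complex.sub_im, Complex.neg_re, Complex.neg_im,
      Complex.mul_re, Complex.mul_im, Complex.ofReal_re, Complex.ofReal_im, Complex.I_re,
      Complex.I_im]
    have := (hNpos z hz).ne'
    simp only [hN] at this ⊢
    field_simp
    ring
  -- `-r` is real only over points with real part 0; on `P` that is the origin, where `-r = 1`.
  have hslitP : ∀ z ∈ P, -r z ∈ Complex.slitPlane := by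
    intro z hz
    rw [Complex.mem_slitPlane_iff, hre z (Or.inr hz), him z (Or.inr hz)]
    by_cases h0 : z.re = 0
    · left
      rw [hP0 z hz h0]
      have h1 := hNpos z (Or.inr hz)
      rw [hP0 z hz h0] at h1
      simp only [Complex.zero_re, Complex.zero_im]
      have : 0 < η ^ 2 := by positivity
      exact div_pos (by linarith) h1
    · right
      exact div_ne_zero (mul_ne_zero (by positivity) h0) (hNpos z (Or.inr hz)).ne'
  -- On `K`, far from both `±η * I`, the ratio is at distance less than 1 from 1.
  have hslitK : ∀ z ∈ K, r z ∈ Complex.slitPlane := by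
    intro z hz
    have h1 := hd z (Or.inl hz)
    have h2 : r z = 1 + 2 * η * Complex.I / (-(η * Complex.I) - z) := by
      simp only [hr]; field_simp; ring
    rw [h2]
    refine Complex.mem_slitPlane_of_norm_lt_one ?_
    rw [norm_div, div_lt_one (norm_pos_iff.2 h1)]
    have h3 : ‖(2 * η * Complex.I : ℂ)‖ = 2 * η := by
      simp [abs_of_pos hη]
    have h4 : ‖z‖ - η ≤ ‖-(η * Complex.I) - z‖ := by
      have := norm_sub_norm_le z (-(η * Complex.I))
      have h5 : ‖-((η : ℂ) * Complex.I)‖ = η := by simp [abs_of_pos hη]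
      rw [h5] at this
      rwa [norm_sub_rev] at this
    rw [h3]
    linarith [hKη z hz]
  have hrc : ContinuousOn r (K ∪ P) :=
    ContinuousOn.div (by fun_prop) (by fun_prop) hd
  classical
  set M : ℂ → ℂ := fun z => if h : z ∉ Set.range γ then L ⟨z, h⟩ else 0 with hM
  have hMc : ContinuousOn M (K ∪ P) := by
    rw [continuousOn_iff_continuous_domRestrict]
    have : (K ∪ P).domRestrict M = fun z : ↥(K ∪ P) => L ⟨z, hout z z.2⟩ := by
      funext z
      simp only [Set.domRestrict_apply, hM]
      rw [dif_pos (hout z z.2)]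
    rw [this]
    exact hL.comp (by fun_prop)
  have hMe : ∀ z ∈ K ∪ P, Complex.exp (M z) = r z := by
    intro z hz
    simp only [hM]
    rw [dif_pos (hout z hz), hexp]
  have hr0 : ∀ z ∈ K ∪ P, r z ≠ 0 := fun z hz => by rw [← hMe z hz]; exact Complex.exp_ne_zero _
  -- On `K` the continuous logarithm differs by a constant from `log r`, and on `P` from `log (-r) +
  -- π * I`. But the arguments of `r` and `-r` differ by `π` with opposite signs at `p` and `q`.
  have e1 := sub_eq_sub_of_exp_eq hK (hMc.mono Set.subset_union_left)
    (ContinuousOn.clog (hrc.mono Set.subset_union_left) hslitK)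
    (fun z hz => by rw [hMe z (Or.inl hz), Complex.exp_log (hr0 z (Or.inl hz))]) hpK hqK
  have e2 := sub_eq_sub_of_exp_eq hP (hMc.mono Set.subset_union_right)
    (g := fun z => Complex.log (-r z) + Real.pi * Complex.I)
    ((ContinuousOn.clog (hrc.mono Set.subset_union_right).neg hslitP).add continuousOn_const)
    (fun z hz => by
      rw [hMe z (Or.inr hz), Complex.exp_add, Complex.exp_log (neg_ne_zero.2 (hr0 z (Or.inr hz))),
        Complex.exp_pi_mul_I]; ring) hpP hqP
  simp only [Complex.sub_im, Complex.add_im, Complex.log_im] at e1 e2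
  have i1 : 0 < (-r p).im := by
    rw [him p (Or.inl hpK)]; exact div_pos (by positivity) (hNpos p (Or.inl hpK))
  have i2 : (-r q).im < 0 := by
    rw [him q (Or.inl hqK)]
    exact div_neg_of_neg_of_pos (by nlinarith) (hNpos q (Or.inl hqK))
  have a1 := Complex.arg_neg_eq_arg_sub_pi_of_im_pos i1
  have a2 := Complex.arg_neg_eq_arg_add_pi_of_im_neg i2
  rw [neg_neg] at a1 a2
  have := Real.pi_pos
  linarith

/-! ### Planarity of the rotation system -/

namespace PlaneDrawing

variable {V E : Type*} {D : PlaneDrawing V E}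

theorem conn_rot [Finite V] [Finite E] (o : Bool) (b : E × Bool) :
    D.Conn (D.sidePt o 1 b) (D.sidePt o (-1) (D.rot b)) := by
  obtain ⟨φ, hφ, δ, hδ, hδr, -, -, hgood⟩ := D.exists_isGood (D.tail b)
  have hr := D.radius_pos (D.tail b)
  cases o
  · have e : |D.radius (D.tail b) - δ / 2 - D.radius (D.tail b)| < δ := by
      rw [sub_sub_cancel_left, abs_neg, abs_of_pos (by positivity)]; linarith
    exact (hgood _ e (by linarith)).conn_rot rfl (by simp; linarith)
  · have e : |D.radius (D.tail b) + δ / 2 - D.radius (D.tail b)| < δ := by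
      rw [add_sub_cancel_left, abs_of_pos (by positivity)]; linarith
    exact (hgood _ e (by linarith)).conn_rot rfl (by simp; linarith)

theorem sidePt_flip [Finite V] [Finite E] (b : E × Bool) (x : ℝ) :
    D.sidePt true x (flip b) = D.sidePt true (-x) b := by
  simp only [sidePt, tm, nrm_flip, mid_flip, if_true]
  congr 1 <;> ring

/-- The reference normal segment is connected and meets no circle, and its midpoint on the arc is
outside all disks. -/
theorem sidePt_notMem_disks [Finite V] [Finite E] (b : E × Bool) {x : ℝ} (hx : |x| ≤ 1) :
    D.sidePt true x b ∉ D.disks := by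
  have hpre : IsPreconnected ((fun η => D.nrm b (D.mid b) η) '' Set.Icc (-D.eps) D.eps) :=
    isPreconnected_Icc.image _ ((D.continuous_nrm b).comp
      (by fun_prop : Continuous fun η : ℝ => (D.mid b, η))).continuousOn
  intro hmem
  obtain ⟨v, hv⟩ := Set.mem_iUnion.1 hmem
  have hxe : x * D.eps ∈ Set.Icc (-D.eps) D.eps := by
    have := abs_le.1 hx
    have := eps_pos (D := D)
    constructor <;> nlinarith
  have hcov : ((fun η => D.nrm b (D.mid b) η) '' Set.Icc (-D.eps) D.eps) ⊆
      Metric.ball (D.center v) (D.radius v) ∪ (Metric.closedBall (D.center v) (D.radius v))ᶜ := by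
    rintro _ ⟨η, hη, rfl⟩
    have h1 := nrm_mid_notMem_circles (D := D) b (abs_le.2 hη)
    rcases lt_trichotomy ‖D.nrm b (D.mid b) η - D.center v‖ (D.radius v) with h | h | h
    · left; rwa [Metric.mem_ball, dist_eq_norm]
    · exact absurd (mem_circles.2 ⟨v, h⟩) h1
    · right; rwa [Set.mem_compl_iff, Metric.mem_closedBall, dist_eq_norm, not_le]
  have hdisj : Disjoint (Metric.ball (D.center v) (D.radius v))
      (Metric.closedBall (D.center v) (D.radius v))ᶜ :=
    Set.disjoint_compl_right_iff_subset.2 Metric.ball_subset_closedBall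
  have hsub := hpre.subset_left_of_subset_union Metric.isOpen_ball
    Metric.isClosed_closedBall.isOpen_compl hdisj hcov ⟨_, ⟨x * D.eps, hxe, rfl⟩, by
      rcases hcov ⟨x * D.eps, hxe, rfl⟩ with h | h
      · exact h
      · exact absurd (show D.nrm b (D.mid b) (x * D.eps) ∈ _ from hv) h⟩
  have h0 : D.crv b (D.mid b) ∈ Metric.ball (D.center v) (D.radius v) :=
    hsub ⟨0, ⟨by linarith [eps_pos (D := D)], eps_pos.le⟩, nrm_zero b _⟩
  rcases (D.crv_mem_ball b v (mid_mem b)).1 h0 with ⟨-, h⟩ | ⟨-, h⟩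
  · linarith [exT_lt_mid (D := D) b]
  · linarith [mid_lt (D := D) b]

/-- A path outside of the circles that starts outside of the disks stays outside of the disks. -/
theorem joinedIn_disks [Finite V] {A : Set ℂ} {z w : ℂ} (h : JoinedIn (D.circles ∪ A)ᶜ z w)
    (hz : z ∉ D.disks) : JoinedIn (D.disks ∪ A)ᶜ z w := by
  obtain ⟨γ, hγ⟩ := h
  refine ⟨γ, fun t => ?_⟩
  -- Off the circles, closed and open disks have the same preimage.
  have hcl : IsClopen {t | γ t ∈ D.disks} := by
    refine ⟨isCompact_disks.isClosed.preimage γ.continuous, ?_⟩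
    have : {t | γ t ∈ D.disks} = γ ⁻¹' ⋃ v, Metric.ball (D.center v) (D.radius v) := by
      ext t
      simp only [disks, Set.mem_ofPred_eq, Set.mem_iUnion, Set.mem_preimage, Metric.mem_closedBall,
        Metric.mem_ball, dist_eq_norm]
      refine exists_congr fun v => ⟨fun h => lt_of_le_of_ne h fun he => ?_, le_of_lt⟩
      exact hγ t (Or.inl (mem_circles.2 ⟨v, he⟩))
    rw [this]
    exact (isOpen_iUnion fun v => Metric.isOpen_ball).preimage γ.continuous
  rcases isClopen_iff.1 hcl with he | he
  · rintro (h | h)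
    · exact Set.eq_empty_iff_forall_notMem.1 he t h
    · exact hγ t (Or.inr h)
  · refine absurd ?_ hz
    have : (0 : I) ∈ {t | γ t ∈ D.disks} := by rw [he]; trivial
    simpa using this

/-- Linked vertices lie in a connected union of disks and arcs. -/
theorem exists_isPreconnected {S : Set (E × Bool)} {u v : V}
    (h : DartLinked flip D.tail S u v) : ∃ K : Set ℂ, IsCompact K ∧ IsPreconnected K ∧
      K ⊆ D.disks ∪ ⋃ x ∈ S, D.crv x '' I ∧ Metric.closedBall (D.center u) (D.radius u) ⊆ K ∧
      Metric.closedBall (D.center v) (D.radius v) ⊆ K := by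
  have hball : ∀ u, IsPreconnected (Metric.closedBall (D.center u) (D.radius u)) := fun u =>
    (convex_closedBall _ _).isPreconnected
  have hdisk : ∀ u, Metric.closedBall (D.center u) (D.radius u) ⊆
      D.disks ∪ ⋃ x ∈ S, D.crv x '' I := fun u =>
    (Set.subset_iUnion (fun v => Metric.closedBall (D.center v) (D.radius v)) u).trans
      Set.subset_union_left
  have hcen : ∀ u, D.center u ∈ Metric.closedBall (D.center u) (D.radius u) := fun u =>
    Metric.mem_closedBall_self (D.radius_pos u).le
  induction h with
  | rel u v h =>
    obtain ⟨x, hx, rfl, rfl⟩ := h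
    have h0 : D.crv x 0 ∈ Metric.closedBall (D.center (D.tail x)) (D.radius (D.tail x)) :=
      (D.crv_mem_closedBall x _ ⟨le_rfl, zero_le_one⟩).2 (Or.inl ⟨rfl, (D.exT_pos x).le⟩)
    have h1 : D.crv x 1 ∈
        Metric.closedBall (D.center (D.tail (flip x))) (D.radius (D.tail (flip x))) :=
      (D.crv_mem_closedBall x _ ⟨zero_le_one, le_rfl⟩).2
        (Or.inr ⟨rfl, by linarith [D.exT_pos (flip x)]⟩)
    refine ⟨Metric.closedBall (D.center (D.tail x)) (D.radius (D.tail x)) ∪ D.crv x '' I ∪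
      Metric.closedBall (D.center (D.tail (flip x))) (D.radius (D.tail (flip x))), ((isCompact_closedBall _ _).union (isCompact_arc x)).union
      (isCompact_closedBall _ _), ?_, ?_, ?_, Set.subset_union_right⟩
    · refine IsPreconnected.union (D.crv x 1) (Or.inr ⟨1, ⟨zero_le_one, le_rfl⟩, rfl⟩) h1
        (IsPreconnected.union (D.crv x 0) h0 ⟨0, ⟨le_rfl, zero_le_one⟩, rfl⟩ (hball _)
          (isPreconnected_Icc.image _ (D.continuous_crv x).continuousOn)) (hball _)
    · refine Set.union_subset (Set.union_subset (hdisk _) ?_) (hdisk _)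
      exact (Set.subset_biUnion_of_mem (u := fun x => D.crv x '' I) hx).trans Set.subset_union_right
    · exact Set.subset_union_left.trans Set.subset_union_left
  | refl u =>
    exact ⟨_, isCompact_closedBall _ _, hball u, hdisk u, le_rfl, le_rfl⟩
  | symm u v _ ih =>
    obtain ⟨K, h1, h2, h3, h4, h5⟩ := ih
    exact ⟨K, h1, h2, h3, h5, h4⟩
  | trans u v w _ _ ih ih' =>
    obtain ⟨K, h1, h2, h3, h4, h5⟩ := ih
    obtain ⟨K', h1', h2', h3', h4', h5'⟩ := ih'
    exact ⟨K ∪ K', h1.union h1', h2.union (D.center v) (h5 (hcen v)) (h4' (hcen v)) h2',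
      Set.union_subset h3 h3', h4.trans Set.subset_union_left, h5'.trans Set.subset_union_right⟩

/-- Linked corners are joined outside of the disks and the arcs that must not be crossed. -/
theorem joinedIn_of_cornerLinked [Finite V] [Finite E] {S : Set (E × Bool)}
    (hS : ∀ x, x ∈ S → flip x ∈ S) {b x y : E × Bool}
    (h : CornerLinked D.rot flip S b x y) :
    JoinedIn (D.circles ∪ ((⋃ x ∈ S, D.crv x '' I) ∪ D.crv b '' I))ᶜ
      (D.sidePt true (-1) x) (D.sidePt true (-1) y) := by
  have hsub : D.projᶜ ⊆ (D.circles ∪ ((⋃ x ∈ S, D.crv x '' I) ∪ D.crv b '' I))ᶜ := by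
    refine Set.compl_subset_compl.2 (Set.union_subset Set.subset_union_right ?_)
    refine (Set.union_subset (Set.iUnion₂_subset fun x _ => ?_) ?_).trans Set.subset_union_left
    · exact Set.subset_iUnion (fun x => D.crv x '' I) x
    · exact Set.subset_iUnion (fun x => D.crv x '' I) b
  have hpt : ∀ x, D.sidePt true (-1) x ∈ D.projᶜ := fun x =>
    nrm_tm_notMem_proj true x (by have := eps_pos (D := D); linarith)
      (by rw [neg_one_mul, abs_neg, abs_of_pos eps_pos])
  induction h with
  | rel x y h =>
    rcases h with rfl | ⟨rfl, hxS, hxb, hxb'⟩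
    · have := conn_rot (D := D) true (flip x)
      rw [sidePt_flip] at this
      exact JoinedIn.mono this hsub
    -- The dart `x` may be crossed: its reference normal segment meets no arc but its own.
    · refine JoinedIn.trans ?_ (JoinedIn.mono (conn_rot (D := D) true x) hsub)
      refine ⟨⟨⟨fun u => D.nrm x (D.mid x) ((2 * u - 1) * D.eps), ?_⟩, ?_, ?_⟩, fun u => ?_⟩
      · exact (D.continuous_nrm x).comp
          (by fun_prop : Continuous fun u : I => (D.mid x, (2 * (u : ℝ) - 1) * D.eps))
      · simp [sidePt, tm]
      · simp [sidePt, tm]; norm_num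
      · have hu : |(2 * (u : ℝ) - 1) * D.eps| ≤ D.eps := by
          rw [abs_mul, abs_of_pos (eps_pos (D := D))]
          have : |2 * (u : ℝ) - 1| ≤ 1 := abs_le.2 ⟨by linarith [u.2.1], by linarith [u.2.2]⟩
          nlinarith [eps_pos (D := D)]
        show D.nrm x (D.mid x) ((2 * u - 1) * D.eps) ∈ _
        by_cases h0 : (2 * (u : ℝ) - 1) * D.eps = 0
        · rw [h0, nrm_zero]
          have hne : ∀ x', x' ≠ x → x' ≠ flip x → D.crv x (D.mid x) ∉ D.crv x' '' I := by
            rintro x' h1 h2 ⟨t, ht, he⟩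
            rcases D.crv_eq_crv (mid_mem x) ht he.symm with ⟨h, -⟩ | ⟨h, -⟩
            · exact h1 h
            · exact h2 h
          rintro (h | h | h)
          · have := nrm_mid_notMem_circles (D := D) x (η := 0) (by simpa using eps_pos.le)
            rw [nrm_zero] at this
            exact this h
          · obtain ⟨x', hx', hmem⟩ := Set.mem_iUnion₂.1 h
            refine hne x' (fun he => hxS (he ▸ hx')) (fun he => hxS ?_) hmem
            have := hS _ hx'
            rwa [he, flip_flip] at this
          · exact hne b (fun he => hxb he.symm) (fun he => hxb' (by rw [he, flip_flip])) h
        · exact hsub (nrm_tm_notMem_proj true x h0 hu)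
  | refl x => exact JoinedIn.refl (hsub (hpt x))
  | symm x y _ ih => exact ih.symm
  | trans x y z _ _ ih ih' => exact ih.trans ih'

/-- After division by the tangent vector, the real part has derivative 1 at `t₀`. -/
theorem exists_re_sign (b : E × Bool) {t₀ : ℝ} (ht₀ : t₀ ∈ I) : ∀ᶠ t in 𝓝 t₀,
    (t₀ < t → 0 < ((D.crv b t - D.crv b t₀) / deriv (D.crv b) t₀).re) ∧
    (t < t₀ → ((D.crv b t - D.crv b t₀) / deriv (D.crv b) t₀).re < 0) := by
  have h1 : HasDerivAt (fun t => (D.crv b t - D.crv b t₀) / deriv (D.crv b) t₀)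
      (deriv (D.crv b) t₀ / deriv (D.crv b) t₀) t₀ :=
    (((D.differentiable_crv b) t₀).hasDerivAt.sub_const _).div_const _
  rw [div_self (D.deriv_crv_ne_zero b ht₀)] at h1
  have h2 : HasDerivAt (fun t => ((D.crv b t - D.crv b t₀) / deriv (D.crv b) t₀).re) 1 t₀ := by
    exact (Complex.reCLM.hasFDerivAt.comp_hasDerivAt t₀ h1).congr_deriv (by simp)
  have h3 := (hasDerivAt_iff_tendsto_slope.1 h2).eventually (lt_mem_nhds one_pos)
  rw [eventually_nhdsWithin_iff] at h3
  filter_upwards [h3] with t ht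
  constructor
  · intro hlt
    have := ht hlt.ne'
    rw [slope_def_field, sub_self, zero_div, Complex.zero_re, sub_zero] at this
    exact (div_pos_iff_of_pos_right (by linarith)).1 this
  · intro hlt
    have := ht hlt.ne
    rw [slope_def_field, sub_self, zero_div, Complex.zero_re, sub_zero] at this
    by_contra hc
    exact absurd this (not_lt.2 (div_nonpos_of_nonneg_of_nonpos (not_lt.1 hc) (by linarith)))

/-- Planarity of the rotation system: an edge that closes a cycle separates its sides. -/
theorem not_cornerLinked [Finite V] [Finite E] {S : Set (E × Bool)}
    (hS : ∀ x, x ∈ S → flip x ∈ S) {b : E × Bool} (hb : b ∉ S)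
    (hlink : DartLinked flip D.tail S (D.tail b) (D.tail (flip b))) :
    ¬ CornerLinked D.rot flip S b b (D.rot b) := by
  intro hcor
  obtain ⟨K₀, hK1, hK2, hK3, hK4, hK5⟩ := exists_isPreconnected hlink
  set t₀ := D.mid b with ht₀
  set c := D.crv b t₀ with hc
  set c' := deriv (D.crv b) t₀ with hc'
  have hc0 : c' ≠ 0 := D.deriv_crv_ne_zero b (mid_mem b)
  have hlo := exT_lt_mid (D := D) b
  have hhi := mid_lt (D := D) b
  have hT := D.exT_pos b
  have hT' := D.exT_pos (flip b)
  obtain ⟨κ, hκ, hsign⟩ := Metric.eventually_nhds_iff.1 (exists_re_sign (D := D) b (mid_mem b))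
  obtain ⟨τ, hτ, hτκ, hτ1, hτ2⟩ : ∃ τ > 0, τ < κ ∧ 0 < t₀ - τ ∧ t₀ + τ < 1 := by
    refine ⟨min (κ / 2) (min (t₀ / 2) ((1 - t₀) / 2)), by
      refine lt_min (by positivity) (lt_min ?_ ?_) <;> linarith, ?_, ?_, ?_⟩
    · exact (min_le_left _ _).trans_lt (by linarith)
    · have := (min_le_right (κ / 2) _).trans (min_le_left (t₀ / 2) ((1 - t₀) / 2)); linarith
    · have := (min_le_right (κ / 2) _).trans (min_le_right (t₀ / 2) ((1 - t₀) / 2)); linarith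
  have hcont := (D.continuous_crv b).continuousOn (s := Set.Icc (0 : ℝ) (t₀ - τ))
  have hcont' := (D.continuous_crv b).continuousOn (s := Set.Icc (t₀ + τ) 1)
  -- The cycle consists of the connection `K₀` of the two ends, the two outer pieces of the arc, and
  -- the middle piece `P`. Only `P` comes near the midpoint.
  set K := K₀ ∪ D.crv b '' Set.Icc 0 (t₀ - τ) ∪ D.crv b '' Set.Icc (t₀ + τ) 1 with hK
  have hKc : IsCompact K := (hK1.union (isCompact_Icc.image_of_continuousOn hcont)).union
    (isCompact_Icc.image_of_continuousOn hcont')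
  have h0 : D.crv b 0 ∈ K₀ := hK4 ((D.crv_mem_closedBall b _ ⟨le_rfl, zero_le_one⟩).2
    (Or.inl ⟨rfl, (D.exT_pos b).le⟩))
  have h1 : D.crv b 1 ∈ K₀ := hK5 ((D.crv_mem_closedBall b _ ⟨zero_le_one, le_rfl⟩).2
    (Or.inr ⟨rfl, by linarith [D.exT_pos (flip b)]⟩))
  have hKp : IsPreconnected K := by
    refine IsPreconnected.union (D.crv b 1) (Or.inl h1) ⟨1, ⟨hτ2.le, le_rfl⟩, rfl⟩
      (IsPreconnected.union (D.crv b 0) h0 ⟨0, ⟨le_rfl, hτ1.le⟩, rfl⟩ hK2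
        (isPreconnected_Icc.image _ hcont)) (isPreconnected_Icc.image _ hcont')
  have hcK : c ∉ K := by
    rintro ((h | ⟨t, ht, he⟩) | ⟨t, ht, he⟩)
    · rcases hK3 h with h | h
      · obtain ⟨v, hv⟩ := Set.mem_iUnion.1 h
        rcases (D.crv_mem_closedBall b v (mid_mem b)).1 hv with ⟨-, h⟩ | ⟨-, h⟩ <;> linarith
      · obtain ⟨x, hx, t, ht, he⟩ := Set.mem_iUnion₂.1 h
        rcases D.crv_eq_crv (mid_mem b) ht he.symm with ⟨h, -⟩ | ⟨h, -⟩
        · exact hb (h ▸ hx)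
        · have := hS _ hx
          rw [h, flip_flip] at this
          exact hb this
    · have := D.crv_injOn b ⟨ht.1, by linarith [ht.2]⟩ (mid_mem b) he
      linarith [ht.2]
    · have := D.crv_injOn b ⟨by linarith [ht.1], ht.2⟩ (mid_mem b) he
      linarith [ht.1]
  obtain ⟨ρ, hρ, hball⟩ := Metric.isOpen_iff.1 hKc.isClosed.isOpen_compl c hcK
  -- In tangent coordinates `K` then keeps the distance `4 * η`, more than the `3 * η` required.
  set η := min D.eps (ρ / (4 * ‖c'‖)) with hη
  have hn : 0 < ‖c'‖ := norm_pos_iff.2 hc0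
  have hη0 : 0 < η := lt_min eps_pos (by positivity)
  have hηe : η ≤ D.eps := min_le_left _ _
  have hηρ : η * (4 * ‖c'‖) ≤ ρ := (le_div_iff₀ (by positivity)).1 (min_le_right _ _)
  set P := D.crv b '' Set.Icc (t₀ - τ) (t₀ + τ) with hP
  -- the path
  have hKP : K ∪ P ⊆ D.disks ∪ ((⋃ x ∈ S, D.crv x '' I) ∪ D.crv b '' I) := by
    have hi : ∀ {x y : ℝ}, 0 ≤ x → y ≤ 1 → D.crv b '' Set.Icc x y ⊆
        D.disks ∪ ((⋃ x ∈ S, D.crv x '' I) ∪ D.crv b '' I) := fun hx hy =>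
      (Set.image_mono (Set.Icc_subset_Icc hx hy)).trans
        (Set.subset_union_right.trans Set.subset_union_right)
    refine Set.union_subset (Set.union_subset (Set.union_subset ?_ (hi le_rfl (by linarith)))
      (hi (by linarith) le_rfl)) (hi hτ1.le hτ2.le)
    rw [← Set.union_assoc]
    exact hK3.trans Set.subset_union_left
  have hsub : D.projᶜ ⊆ (D.circles ∪ ((⋃ x ∈ S, D.crv x '' I) ∪ D.crv b '' I))ᶜ := by
    refine Set.compl_subset_compl.2 (Set.union_subset Set.subset_union_right ?_)
    refine (Set.union_subset (Set.iUnion₂_subset fun x _ => ?_) ?_).trans Set.subset_union_left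
    · exact Set.subset_iUnion (fun x => D.crv x '' I) x
    · exact Set.subset_iUnion (fun x => D.crv x '' I) b
  -- A link of the two corners beside `b` yields a path from its right to its left side that avoids
  -- the cycle.
  have j1 : JoinedIn (D.circles ∪ ((⋃ x ∈ S, D.crv x '' I) ∪ D.crv b '' I))ᶜ
      (D.sidePt true (-1) b) (D.sidePt true 1 b) :=
    (joinedIn_of_cornerLinked hS hcor).trans (JoinedIn.mono (conn_rot true b) hsub).symm
  have j2 := conn_sidePt (D := D) true b (x := -1) (by simp) hη0 hηe
  have j3 := conn_sidePt (D := D) true b (x := 1) (by simp) hη0 hηe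
  have j4 := JoinedIn.mono (joinedIn_disks ((JoinedIn.mono j2 hsub).trans
    (j1.trans (JoinedIn.mono j3 hsub).symm)) (fun hmem => by
      have hx : |(-η / D.eps)| ≤ 1 := by
        rw [abs_div, abs_neg, abs_of_pos hη0, abs_of_pos eps_pos]
        exact (div_le_one eps_pos).2 hηe
      refine sidePt_notMem_disks (D := D) b hx ?_
      rwa [sidePt, div_mul_cancel₀ _ eps_pos.ne', ← neg_one_mul])) (Set.compl_subset_compl.2 hKP)
  -- change of coordinates
  set A : ℂ → ℂ := fun z => (z - c) / c' with hA
  have hAc : Continuous A := by fun_prop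
  have hAinj : Function.Injective A := fun z w h => by
    have := (div_left_inj' hc0).1 h
    exact sub_left_injective this
  have hAn : ∀ η : ℝ, A (D.nrm b t₀ η) = η * Complex.I := by
    intro η
    simp only [hA, nrm, ← hc, ← hc']
    field_simp
    ring
  refine not_joinedIn_of_isPreconnected (K := A '' K) (P := A '' P) (p := A (D.crv b (t₀ + τ)))
    (q := A (D.crv b (t₀ - τ))) (hKp.image _ hAc.continuousOn)
    ((isPreconnected_Icc.image _ (D.continuous_crv b).continuousOn).image _ hAc.continuousOn)
    ⟨_, Or.inr ⟨_, ⟨le_rfl, hτ2.le⟩, rfl⟩, rfl⟩ ⟨_, Or.inl (Or.inr ⟨_, ⟨hτ1.le, le_rfl⟩, rfl⟩), rfl⟩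
    ⟨_, ⟨_, ⟨by linarith, le_rfl⟩, rfl⟩, rfl⟩ ⟨_, ⟨_, ⟨le_rfl, by linarith⟩, rfl⟩, rfl⟩
    ((hsign (by rw [Real.dist_eq, add_sub_cancel_left, abs_of_pos hτ]; exact hτκ)).1 (by linarith))
    ((hsign (by rw [Real.dist_eq, sub_sub_cancel_left, abs_neg, abs_of_pos hτ]; exact hτκ)).2
      (by linarith)) ?_ hη0 ?_ ?_
  · rintro _ ⟨_, ⟨t, ht, rfl⟩, rfl⟩ hre
    have hd : dist t t₀ < κ := by
      rw [Real.dist_eq, abs_lt]; constructor <;> linarith [ht.1, ht.2]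
    have : t = t₀ := by
      rcases lt_trichotomy t t₀ with h | h | h
      · exact absurd hre ((hsign hd).2 h).ne
      · exact h
      · exact absurd hre ((hsign hd).1 h).ne'
    simp [hA, this, hc]
  · rintro _ ⟨z, hz, rfl⟩
    have hd : ρ ≤ ‖z - c‖ := by
      by_contra hcon
      exact hball (mem_ball_iff_norm.2 (not_le.1 hcon)) hz
    simp only [hA, norm_div]
    rw [lt_div_iff₀ hn]
    nlinarith
  · obtain ⟨γ, hγ⟩ := j4
    have e1 : A (D.nrm b (D.tm true b) (-1 * η)) = -(η * Complex.I) := by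
      rw [show D.tm true b = t₀ from rfl, hAn]; push_cast; ring
    have e2 : A (D.nrm b (D.tm true b) (1 * η)) = η * Complex.I := by
      rw [show D.tm true b = t₀ from rfl, hAn]; push_cast; ring
    rw [← e1, ← e2]
    refine ⟨γ.map hAc, fun t => ?_⟩
    rw [← Set.image_union]
    rintro ⟨z, hz, he⟩
    exact hγ t (hAinj he ▸ hz)

end PlaneDrawing

section

open scoped Pointwise

/-! ### The neighbourhood of infinity -/

/-- Division of the points of the three-sphere by a number, with infinity as the quotient by zero. -/
def scaleInv (x : ThreeSphere) (r : ℝ) : ThreeSphere :=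
  if r = 0 then OnePoint.infty else OnePoint.map (fun p : ℂ × ℝ => r⁻¹ • p) x

theorem scaleInv_one (x : ThreeSphere) : scaleInv x 1 = x := by
  induction x using OnePoint.rec <;> simp [scaleInv]

theorem scaleInv_zero (x : ThreeSphere) : scaleInv x 0 = OnePoint.infty := by simp [scaleInv]

theorem scaleInv_infty (r : ℝ) : scaleInv OnePoint.infty r = OnePoint.infty := by simp [scaleInv]

theorem scaleInv_coe (p : ℂ × ℝ) {r : ℝ} (hr : r ≠ 0) :
    scaleInv p r = ((r⁻¹ • p : ℂ × ℝ) : ThreeSphere) := by simp [scaleInv, hr]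

theorem scaleInv_eq_coe {x : ThreeSphere} {r : ℝ} {q : ℂ × ℝ} (h : scaleInv x r = q) :
    r ≠ 0 ∧ x = ((r • q : ℂ × ℝ) : ThreeSphere) := by
  by_cases hr : r = 0
  · rw [hr, scaleInv_zero] at h
    exact absurd h.symm (OnePoint.coe_ne_infty _)
  · refine ⟨hr, ?_⟩
    induction x using OnePoint.rec with
    | infty => rw [scaleInv_infty] at h; exact absurd h.symm (OnePoint.coe_ne_infty _)
    | coe p =>
      rw [scaleInv_coe p hr] at h
      rw [← OnePoint.coe_injective h, smul_inv_smul₀ hr]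

/-- The points of norm greater than `R`, with infinity. -/
def nearInfty (R : ℝ) : Set ThreeSphere := {x | ∀ p : ℂ × ℝ, x = p → R < ‖p‖}

theorem coe_mem_nearInfty {R : ℝ} {p : ℂ × ℝ} : (p : ThreeSphere) ∈ nearInfty R ↔ R < ‖p‖ :=
  ⟨fun h => h p rfl, fun h q hq => by rwa [← OnePoint.coe_injective hq]⟩

theorem infty_mem_nearInfty (R : ℝ) : OnePoint.infty ∈ nearInfty R := fun p hp =>
  absurd hp.symm (OnePoint.coe_ne_infty p)

theorem isOpen_nearInfty (R : ℝ) : IsOpen (nearInfty R) := by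
  have : nearInfty R = ((fun p : ℂ × ℝ => (p : ThreeSphere)) '' Metric.closedBall 0 R)ᶜ := by
    ext x
    constructor
    · rintro h ⟨p, hp, rfl⟩
      have := coe_mem_nearInfty.1 h
      rw [mem_closedBall_zero_iff] at hp
      linarith
    · rintro h p rfl
      by_contra hc
      exact h ⟨p, mem_closedBall_zero_iff.2 (not_lt.1 hc), rfl⟩
  rw [this]
  exact OnePoint.isOpen_compl_image_coe.2 ⟨Metric.isClosed_closedBall, isCompact_closedBall _ _⟩

theorem scaleInv_mem_nearInfty {R : ℝ} (hR : 0 < R) {x : ThreeSphere} (hx : x ∈ nearInfty R)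
    {r : ℝ} (hr : r ∈ I) : scaleInv x r ∈ nearInfty R := by
  intro q hq
  obtain ⟨h0, rfl⟩ := scaleInv_eq_coe hq
  have h1 := coe_mem_nearInfty.1 hx
  rw [norm_smul, Real.norm_eq_abs, abs_of_nonneg hr.1] at h1
  nlinarith [hr.2, norm_nonneg q]

/-- As `r` tends to 0, the norm of the quotient exceeds `R / r`; near infinity, division by `r ≤ 1`
does not decrease norms; elsewhere this is continuity of scalar multiplication. -/
theorem continuous_scaleInv {R : ℝ} (hR : 0 < R) {Y : Type*} [TopologicalSpace Y]
    {f : Y → ThreeSphere} (hf : Continuous f) (hfR : ∀ y, f y ∈ nearInfty R) {g : Y → ℝ}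
    (hg : Continuous g) (hgI : ∀ y, g y ∈ I) : Continuous fun y => scaleInv (f y) (g y) := by
  rw [continuous_iff_continuousAt]
  intro y
  have hbig : ∀ M : ℝ, ∀ z, M * g z < R → ∀ q : ℂ × ℝ, scaleInv (f z) (g z) = q → M < ‖q‖ := by
    intro M z hz q hq
    obtain ⟨h0, h1⟩ := scaleInv_eq_coe hq
    have h2 := hfR z _ h1
    rw [norm_smul, Real.norm_eq_abs, abs_of_nonneg (hgI z).1] at h2
    have h3 : 0 < g z := lt_of_le_of_ne (hgI z).1 (Ne.symm h0)
    nlinarith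
  by_cases hr : g y = 0
  · unfold ContinuousAt
    simp only [hr, scaleInv_zero]
    rw [tendsto_infty_iff]
    intro M
    have : ∀ᶠ z in 𝓝 y, M * g z < R := by
      refine (hg.const_mul M).continuousAt.eventually (gt_mem_nhds ?_)
      simpa [hr] using hR
    filter_upwards [this] with z hz q hq using hbig M z hz q hq
  · induction hx : f y using OnePoint.rec with
    | infty =>
      unfold ContinuousAt
      simp only [hx, scaleInv_infty]
      rw [tendsto_infty_iff]
      intro M
      have h1 : Tendsto f (𝓝 y) (𝓝 OnePoint.infty) := by
        have := hf.continuousAt (x := y); unfold ContinuousAt at this; rwa [hx] at this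
      filter_upwards [tendsto_infty_iff.1 h1 M] with z hz q hq
      obtain ⟨h2, h3⟩ := scaleInv_eq_coe hq
      have h4 := hz _ h3
      rw [norm_smul, Real.norm_eq_abs, abs_of_nonneg (hgI z).1] at h4
      nlinarith [(hgI z).2, norm_nonneg q]
    | coe p =>
      have h1 : ContinuousAt (fun w : ThreeSphere × ℝ => scaleInv w.1 w.2)
          (Prod.map (fun p : ℂ × ℝ => (p : ThreeSphere)) id (p, g y)) := by
        rw [← (OnePoint.isOpenEmbedding_coe.prodMap (.id)).continuousAt_iff]
        have h2 : ∀ᶠ w : (ℂ × ℝ) × ℝ in 𝓝 (p, g y), w.2 ≠ 0 :=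
          continuous_snd.continuousAt.eventually_ne hr
        have h3 : ContinuousAt (fun w : (ℂ × ℝ) × ℝ => ((w.2⁻¹ • w.1 : ℂ × ℝ) : ThreeSphere))
            (p, g y) := by
          refine OnePoint.continuous_coe.continuousAt.comp ?_
          exact (continuousAt_snd.inv₀ hr).smul continuousAt_fst
        refine h3.congr ?_
        filter_upwards [h2] with w hw
        exact (scaleInv_coe w.1 hw).symm
      have h4 : (Prod.map (fun p : ℂ × ℝ => (p : ThreeSphere)) id (p, g y)) = (f y, g y) := by
        simp [hx]
      rw [h4] at h1
      exact ContinuousAt.comp (f := fun y => (f y, g y)) h1 (hf.prodMk hg).continuousAt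

namespace PlaneDrawing

variable {V E : Type*} {D : PlaneDrawing V E}

theorem isCompact_link [Finite V] [Finite E] : IsCompact D.link := by
  refine (isCompact_iUnion fun v => ?_).union (isCompact_iUnion fun e => ?_)
  · exact (isCompact_sphere _ _).prod isCompact_singleton
  · have hc : Continuous (D.curve e) := (D.curve_smooth e).continuous
    exact (isCompact_Icc.image (by fun_prop)).union (isCompact_Icc.image (by fun_prop))

variable (D) in
theorem exists_bound [Finite V] [Finite E] :
    ∃ R : ℝ, 0 < R ∧ (∀ p ∈ D.link, ‖p‖ ≤ R) ∧ ∀ z ∈ D.proj, ‖z‖ ≤ R := by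
  obtain ⟨R₁, h1⟩ := (isCompact_link (D := D)).isBounded.subset_closedBall 0
  obtain ⟨R₂, h2⟩ := (isCompact_proj (D := D)).isBounded.subset_closedBall 0
  refine ⟨max 1 (max R₁ R₂), by positivity, fun p hp => ?_, fun z hz => ?_⟩
  · exact (mem_closedBall_zero_iff.1 (h1 hp)).trans
      ((le_max_left _ _).trans (le_max_right _ _))
  · exact (mem_closedBall_zero_iff.1 (h2 hz)).trans
      ((le_max_right _ _).trans (le_max_right _ _))

variable (D) in
/-- The radius of a ball that contains the link. -/
def bound [Finite V] [Finite E] : ℝ := D.exists_bound.choose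

theorem bound_pos [Finite V] [Finite E] : 0 < D.bound := D.exists_bound.choose_spec.1

theorem norm_le_bound [Finite V] [Finite E] {p : ℂ × ℝ} (h : p ∈ D.link) : ‖p‖ ≤ D.bound :=
  D.exists_bound.choose_spec.2.1 p h

theorem norm_le_bound_of_mem_proj [Finite V] [Finite E] {z : ℂ} (h : z ∈ D.proj) :
    ‖z‖ ≤ D.bound := D.exists_bound.choose_spec.2.2 z h

theorem mem_exterior_of_nearInfty [Finite V] [Finite E] {x : ThreeSphere}
    (hx : x ∈ nearInfty D.bound) : x ∈ D.exterior := by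
  rintro ⟨p, hp, rfl⟩
  exact absurd (coe_mem_nearInfty.1 hx) (not_lt.2 (norm_le_bound hp))

/-- The radial path to infinity. -/
def radial [Finite V] [Finite E] (x : D.exterior) (hx : x.1 ∈ nearInfty D.bound) :
    Path x D.top where
  toFun r := ⟨scaleInv x.1 (1 - r), mem_exterior_of_nearInfty
    (scaleInv_mem_nearInfty bound_pos hx ⟨by linarith [r.2.2], by linarith [r.2.1]⟩)⟩
  continuous_toFun := (continuous_scaleInv bound_pos continuous_const (fun _ => hx)
    (by fun_prop) fun r => ⟨by linarith [r.2.2], by linarith [r.2.1]⟩).subtype_mk _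
  source' := Subtype.ext (by simp [scaleInv_one])
  target' := Subtype.ext (by simp [scaleInv_zero, top])

theorem cls_radial [Finite V] [Finite E] {x y : D.exterior} (c : Path x y)
    (h : ∀ t, (c t).1 ∈ nearInfty D.bound) (hx : x.1 ∈ nearInfty D.bound)
    (hy : y.1 ∈ nearInfty D.bound) : cls c ≫ cls (radial y hy) = cls (radial x hx) := by
  have hI : ∀ r : I, 1 - (r : ℝ) ∈ I := fun r => ⟨by linarith [r.2.2], by linarith [r.2.1]⟩
  have h1 := cls_square (K := fun z : I × I => (⟨scaleInv (c z.1).1 (1 - z.2),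
      mem_exterior_of_nearInfty (scaleInv_mem_nearInfty bound_pos (h _) (hI _))⟩ : D.exterior))
    (Continuous.subtype_mk (continuous_scaleInv bound_pos
      (by fun_prop : Continuous fun z : I × I => (c z.1).1) (fun z => h z.1)
      (by fun_prop : Continuous fun z : I × I => 1 - (z.2 : ℝ)) fun z => hI z.2) _)
    (p := c) (q := Path.refl D.top) (u := radial x hx) (v := radial y hy)
    (fun t => Subtype.ext (by simp [scaleInv_one]))
    (fun t => Subtype.ext (by
      simp only [Path.refl_apply, Set.Icc.coe_one, sub_self, scaleInv_zero]
      rfl))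
    (fun t => Subtype.ext (by simp [radial])) (fun t => Subtype.ext (by simp [radial]))
  rw [h1, cls_refl, Category.comp_id]

theorem cls_radial_top [Finite V] [Finite E] (h : D.top.1 ∈ nearInfty D.bound) :
    cls (radial D.top h) = 𝟙 _ := by
  have : radial D.top h = Path.refl D.top := by
    ext t
    exact scaleInv_infty _
  rw [this, cls_refl]

/-- A vertical path close to infinity. -/
theorem Free.cls_path_radial [Finite V] [Finite E] {i : Bool} {p : ℂ × ℝ} (h : D.Free i p)
    (hn : ∀ r : ℝ, 0 ≤ r → D.bound < ‖((p.1, p.2 + sgn i * r) : ℂ × ℝ)‖)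
    (hp : (D.pt p h.notMem).1 ∈ nearInfty D.bound) :
    cls h.path ≫ cls (radial _ hp) = 𝟙 _ := by
  have ht : D.top.1 ∈ nearInfty D.bound := infty_mem_nearInfty _
  rw [cls_radial h.path (fun r => ?_) ht hp, cls_radial_top]
  change ray i p r ∈ _
  rw [ray]
  split_ifs
  · exact infty_mem_nearInfty _
  · exact coe_mem_nearInfty.2 (hn _ (le_max_right _ _))

theorem free_of_norm_lt [Finite V] [Finite E] {z : ℂ} (h : D.bound < ‖z‖) (s : ℝ) (i : Bool) :
    D.Free i (z, s) :=
  free_of_notMem_proj s i fun hz => absurd (norm_le_bound_of_mem_proj hz) (not_le.2 h)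

/-- Over a distant point both vertical rays stay outside the ball that contains the link, and each
is undone by the same radial path. -/
theorem drop_eq_one [Finite V] [Finite E] {z : ℂ} (h : D.bound < ‖z‖) : D.drop z = 𝟙 _ := by
  have hf : ∀ i, D.Free i (z, 0) := free_of_norm_lt h 0
  have hn : ∀ i, ∀ r : ℝ, 0 ≤ r → D.bound < ‖(((z, (0 : ℝ)).1, (z, (0 : ℝ)).2 + sgn i * r) : ℂ × ℝ)‖ :=
    fun i r _ => h.trans_le (le_max_left _ _)
  have hp : (D.pt (z, 0) (hf true).notMem).1 ∈ nearInfty D.bound :=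
    coe_mem_nearInfty.2 (h.trans_le (le_max_left _ _))
  have e1 := (hf true).cls_path_radial (hn true) hp
  have e2 := (hf false).cls_path_radial (hn false) hp
  have e3 : cls (hf true).path = cls (hf false).path := by
    rw [← cancel_mono (cls (radial _ hp)), e1, e2]
  unfold drop vert
  have hok : D.Ok (fun _ => (z, (0 : ℝ))) true false :=
    ⟨continuous_const, fun _ => (hf true).notMem, hf true, hf false⟩
  have hok' : D.Ok (fun _ => (z, (0 : ℝ))) true true :=
    ⟨continuous_const, fun _ => (hf true).notMem, hf true, hf true⟩
  rw [gen_of_ok hok]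
  have e4 := gen_of_ok hok'
  rw [gen_const (hf true)] at e4
  rw [e4]
  congr 3
  exact e3.symm

/-- Freeness is an open condition. -/
theorem Free.eventually [Finite V] [Finite E] {i : Bool} {p : ℂ × ℝ} (h : D.Free i p) :
    ∀ᶠ q in 𝓝 p, D.Free i q := by
  have hcl : IsClosed ((fun r : ℝ => ((0 : ℂ), -(sgn i * r))) '' Set.Ici 0) := by
    have : ((fun r : ℝ => ((0 : ℂ), -(sgn i * r))) '' Set.Ici 0) =
        {q : ℂ × ℝ | q.1 = 0 ∧ 0 ≤ -(sgn i * q.2)} := by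
      ext ⟨z, s⟩
      constructor
      · rintro ⟨r, hr, he⟩
        obtain ⟨rfl, rfl⟩ := Prod.ext_iff.1 he
        refine ⟨rfl, ?_⟩
        show 0 ≤ -(sgn i * -(sgn i * r))
        rw [mul_neg, neg_neg, ← mul_assoc, sgn_mul_self, one_mul]; exact hr
      · rintro ⟨h0 : z = 0, h1⟩
        refine ⟨_, h1, Prod.ext h0.symm ?_⟩
        show -(sgn i * -(sgn i * s)) = s
        rw [mul_neg, neg_neg, ← mul_assoc, sgn_mul_self, one_mul]
    rw [this]
    exact (isClosed_eq continuous_fst continuous_const).inter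
      (isClosed_le continuous_const (continuous_const.mul continuous_snd).neg)
  -- The points that are not free form the sum of the compact link and a closed ray.
  have hcl2 := hcl.add_left_of_isCompact (isCompact_link (D := D))
  have key : ∀ q : ℂ × ℝ, q ∈ D.link + ((fun r : ℝ => ((0 : ℂ), -(sgn i * r))) '' Set.Ici 0) ↔
      ¬ D.Free i q := by
    intro q
    simp only [Free, not_forall, not_not]
    constructor
    · rintro ⟨l, hl, _, ⟨r, hr, rfl⟩, rfl⟩
      refine ⟨r, hr, ?_⟩
      convert hl using 1
      ext <;> simp
    · rintro ⟨r, hr, hl⟩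
      exact ⟨_, hl, _, ⟨r, hr, rfl⟩, by ext <;> simp⟩
  filter_upwards [hcl2.isOpen_compl.mem_nhds (fun hm => (key p).1 hm h)] with q hq
  by_contra hc
  exact hq ((key q).2 hc)

end PlaneDrawing

end

namespace PlaneDrawing

variable {V E : Type*} {D : PlaneDrawing V E}

/-! ### Coordinates near an arc -/

/-- Points near an inner point of an arc lie on a normal segment of the arc. -/
theorem eventually_eq_nrm [Finite E] (b : E × Bool) {t₀ : ℝ} (h0 : 0 < t₀) (h1 : t₀ < 1) {ε : ℝ}
    (hε : 0 < ε) : ∀ᶠ z in 𝓝 (D.crv b t₀), ∃ t η, |t - t₀| < ε ∧ |η| < ε ∧ z = D.nrm b t η := by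
  have hI : t₀ ∈ I := ⟨h0.le, h1.le⟩
  have hc0 : 0 < ‖deriv (D.crv b) t₀‖ := norm_pos_iff.2 (D.deriv_crv_ne_zero b hI)
  set c' := ‖deriv (D.crv b) t₀‖ with hc'
  -- nearby points of the arc have nearby parameters
  have hnear : ∀ᶠ w in 𝓝 (D.crv b t₀), w ∈ D.arcs → ∃ s ∈ I, D.crv b s = w ∧
      |s - t₀| * c' ≤ 2 * ‖w - D.crv b t₀‖ := by
    have hev := eventually_mem_arcs (D := D) b hI (m := 1 / 2) (by norm_num)
    have hcont : ContinuousAt (fun w : ℂ => (t₀, w)) (D.crv b t₀) := by fun_prop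
    filter_upwards [hcont.eventually hev] with w hw hwa
    obtain ⟨s, hs, hsw, hle⟩ := hw hwa
    refine ⟨s, hs, hsw, ?_⟩
    have h2 : ‖(s - t₀) • deriv (D.crv b) t₀‖ = |s - t₀| * c' := by
      rw [norm_smul, Real.norm_eq_abs]
    have h3 := norm_sub_norm_le ((s - t₀) • deriv (D.crv b) t₀) (w - D.crv b t₀)
    rw [h2, norm_sub_rev ((s - t₀) • deriv (D.crv b) t₀)] at h3
    rw [← hc'] at hle
    linarith
  have hder : ∀ᶠ t in 𝓝 t₀, c' / 2 < ‖deriv (D.crv b) t‖ :=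
    (D.continuous_deriv_crv b).norm.continuousAt.eventually (lt_mem_nhds (half_lt_self hc0))
  obtain ⟨κ, hκ, hκ'⟩ := Metric.eventually_nhds_iff.1
    (hder.and ((lt_mem_nhds h0).and (gt_mem_nhds h1)))
  obtain ⟨δ, hδ, hδ'⟩ := Metric.eventually_nhds_iff.1 hnear
  rw [Metric.eventually_nhds_iff]
  refine ⟨min (δ / 2) (min (ε * c' / 4) (κ * c' / 4)), by positivity, fun z hz => ?_⟩
  have z1 := hz.trans_le (min_le_left _ _)
  have z2 := hz.trans_le ((min_le_right _ _).trans (min_le_left _ _))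
  have z3 := hz.trans_le ((min_le_right _ _).trans (min_le_right _ _))
  rw [dist_eq_norm] at z1 z2 z3
  -- The nearest point of the arc serves: its parameter is interior by `hnear`, so the derivative of
  -- the squared distance vanishes and the difference to `z` is normal.
  obtain ⟨t, ht, hmin⟩ := isCompact_Icc.exists_isMinOn (s := Set.Icc (0 : ℝ) 1)
    ⟨0, le_rfl, zero_le_one⟩ (f := fun t => ‖D.crv b t - z‖ ^ 2)
    (((D.continuous_crv b).sub continuous_const).norm.pow 2).continuousOn
  have hle : ‖D.crv b t - z‖ ≤ ‖z - D.crv b t₀‖ := by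
    have h2 : ‖D.crv b t - z‖ ^ 2 ≤ ‖D.crv b t₀ - z‖ ^ 2 := hmin hI
    rw [norm_sub_rev z]
    exact le_of_sq_le_sq h2 (norm_nonneg _)
  have hw : ‖D.crv b t - D.crv b t₀‖ ≤ 2 * ‖z - D.crv b t₀‖ := by
    have := norm_sub_le_norm_sub_add_norm_sub (D.crv b t) z (D.crv b t₀)
    linarith
  obtain ⟨s, hs, hst, hsle⟩ := hδ' (y := D.crv b t) (by rw [dist_eq_norm]; linarith)
    (crv_mem_arcs b ht)
  obtain rfl : s = t := D.crv_injOn b hs ht hst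
  have hsε : |s - t₀| < ε := by
    have : |s - t₀| * c' < ε * c' := by linarith
    exact lt_of_mul_lt_mul_right this hc0.le
  have hsκ : |s - t₀| < κ := by
    have : |s - t₀| * c' < κ * c' := by linarith
    exact lt_of_mul_lt_mul_right this hc0.le
  obtain ⟨hd, hs0, hs1⟩ := hκ' (y := s) hsκ
  have hd0 : deriv (D.crv b) s ≠ 0 := norm_pos_iff.1 (by linarith)
  have hcrit := ((D.differentiable_crv b s).hasDerivAt.sub_const z).norm_sq
  have hloc : IsLocalMin (fun t => ‖D.crv b t - z‖ ^ 2) s := by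
    filter_upwards [Icc_mem_nhds hs0 hs1] with x hx using hmin hx
  have hzero := hloc.hasDerivAt_eq_zero hcrit
  rw [Complex.inner] at hzero
  set q := (z - D.crv b s) / deriv (D.crv b) s with hq
  have hqre : q.re = 0 := by
    have h2 : q = -(conj (conj (D.crv b s - z) * deriv (D.crv b) s)) /
        (Complex.normSq (deriv (D.crv b) s) : ℂ) := by
      rw [hq, map_mul, Complex.conj_conj, Complex.normSq_eq_conj_mul_self]
      have : conj (deriv (D.crv b) s) ≠ 0 := (map_ne_zero _).2 hd0
      field_simp
      ring
    rw [h2, Complex.div_ofReal_re, Complex.neg_re, Complex.conj_re]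
    have h3 : (conj (D.crv b s - z) * deriv (D.crv b) s).re = 0 := by
      rw [mul_comm]; linarith
    rw [h3]; simp
  have hqi : q = q.im * Complex.I := by
    apply Complex.ext <;> simp [hqre]
  have hqn : |q.im| = ‖z - D.crv b s‖ / ‖deriv (D.crv b) s‖ := by
    rw [← norm_div, ← hq]
    conv_rhs => rw [hqi]
    simp
  refine ⟨s, q.im, hsε, ?_, ?_⟩
  · rw [hqn, div_lt_iff₀ (by linarith), norm_sub_rev]
    nlinarith
  · rw [nrm, ← mul_assoc, ← hqi, hq, div_mul_cancel₀ _ hd0]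
    ring

/-! ### Free points -/

/-- The two rays form the whole vertical line, and over every point of the projection there is a
point of the link. -/
theorem notMem_proj_of_free {p : ℂ × ℝ} (h : D.Free true p) (h' : D.Free false p) :
    p.1 ∉ D.proj := by
  have key : ∀ s, (p.1, s) ∉ D.link := by
    intro s hs
    rcases le_total p.2 s with hle | hle
    · refine h (s - p.2) (by linarith) ?_
      simpa [sgn] using hs
    · refine h' (p.2 - s) (by linarith) ?_
      simpa [sgn] using hs
  rintro (hm | hm)
  · obtain ⟨b, t, ht, hbt⟩ := mem_arcs.1 hm
    refine key (√(t * (1 - t))) (mem_link.2 (Or.inr ⟨b, t, ht, hbt, ?_⟩))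
    exact Real.sq_sqrt (mul_nonneg ht.1 (by linarith [ht.2]))
  · exact key 0 (mem_link.2 (Or.inl ⟨hm, rfl⟩))

theorem vert_eq_drop {p : ℂ × ℝ} (h : D.Free true p) (h' : D.Free false p) :
    D.vert p true false = D.drop p.1 := by
  have hz := notMem_proj_of_free h h'
  have := gen_homotopy (D := D) (F := fun _ s : I => (p.1, (1 - (s : ℝ)) * p.2))
    (by fun_prop) (i := true) (j := false) (fun _ s => notMem_link_of_notMem_proj _ hz)
    (fun s => free_of_notMem_proj _ _ hz) (fun s => free_of_notMem_proj _ _ hz)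
  simp only [Set.Icc.coe_zero, sub_zero, one_mul, Set.Icc.coe_one, sub_self, zero_mul] at this
  exact this

/-- A point over an arc that is beyond the edge loop is visible from its own side; one between the
two arcs is inside the vertical disk. Elsewhere only the circles can obstruct. -/
theorem free_or_mem (p : ℂ × ℝ) (hp : p ∉ D.link) : (∃ i, D.Free i p) ∨
    ∃ b t, p.1 = D.crv b t ∧ p.2 ^ 2 < t * (1 - t) := by
  obtain ⟨z, s⟩ := p
  have hdir : s ≠ 0 → ∃ i, 0 < sgn i * s := fun hs => by
    rcases lt_or_gt_of_ne hs with h | h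
    · exact ⟨false, by simpa [sgn] using h⟩
    · exact ⟨true, by simpa [sgn] using h⟩
  by_cases ha : z ∈ D.arcs
  · obtain ⟨b, t, ht, rfl⟩ := mem_arcs.1 ha
    rcases lt_trichotomy (s ^ 2) (t * (1 - t)) with h | h | h
    · exact Or.inr ⟨b, t, rfl, h⟩
    · exact absurd (mem_link.2 (Or.inr ⟨b, t, ht, rfl, h⟩)) hp
    · have h0 : 0 ≤ t * (1 - t) := mul_nonneg ht.1 (by linarith [ht.2])
      have hs : s ≠ 0 := by rintro rfl; simp at h; linarith
      obtain ⟨i, hi⟩ := hdir hs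
      refine Or.inl ⟨i, fun r hr hm => ?_⟩
      simp only at hm
      have hsq := sgn_mul_self i
      have hbig : s ^ 2 ≤ (s + sgn i * r) ^ 2 := by
        have : (s + sgn i * r) ^ 2 = s ^ 2 + 2 * (sgn i * s) * r + (sgn i * sgn i) * r ^ 2 := by
          ring
        rw [this, hsq]
        have := mul_nonneg hi.le hr
        nlinarith [sq_nonneg r]
      rcases mem_link.1 hm with ⟨-, h2⟩ | ⟨b', t', ht', he, h2⟩
      · rw [h2] at hbig
        have := sq_pos_of_ne_zero hs
        linarith
      · rcases D.crv_eq_crv ht ht' he.symm with ⟨-, rfl⟩ | ⟨-, rfl⟩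
        · linarith
        · have : (1 - t) * (1 - (1 - t)) = t * (1 - t) := by ring
          linarith
  · left
    by_cases hcir : z ∈ D.circles
    · have hs : s ≠ 0 := by
        rintro rfl
        exact hp (mem_link.2 (Or.inl ⟨hcir, rfl⟩))
      obtain ⟨i, hi⟩ := hdir hs
      exact ⟨i, free_of_notMem_arcs ha (Or.inl hi)⟩
    · exact ⟨true, free_of_notMem_arcs ha (Or.inr hcir)⟩

theorem not_free_of_sq_lt {b : E × Bool} {t s : ℝ} (h : s ^ 2 < t * (1 - t)) (i : Bool) :
    ¬ D.Free i (D.crv b t, s) := by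
  intro hf
  have h0 : 0 ≤ t * (1 - t) := (sq_nonneg s).trans h.le
  have ht : t ∈ I := ⟨by nlinarith, by nlinarith⟩
  have hs : sgn i * s ≤ √(t * (1 - t)) := by
    refine Real.le_sqrt_of_sq_le ?_
    have : (sgn i * s) ^ 2 = (sgn i * sgn i) * s ^ 2 := by ring
    rw [this, sgn_mul_self, one_mul]; exact h.le
  refine hf (√(t * (1 - t)) - sgn i * s) (by linarith) (mem_link.2 (Or.inr ⟨b, t, ht, rfl, ?_⟩))
  have : s + sgn i * (√(t * (1 - t)) - sgn i * s) = sgn i * √(t * (1 - t)) := by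
    have := sgn_mul_self i
    linear_combination -s * this
  show (s + sgn i * (√(t * (1 - t)) - sgn i * s)) ^ 2 = t * (1 - t)
  rw [this, mul_pow, sq, sgn_mul_self, one_mul, Real.sq_sqrt h0]

variable [Finite V] [Finite E]

/-! ### Generators of the link group -/

/-- A set of loops at infinity that is closed under the groupoid operations and contains the
loops `cross` and `drop`. -/
structure IsStab (D : PlaneDrawing V E) (H : (D.base ⟶ D.base) → Prop) : Prop where
  one : H (𝟙 _)
  comp : ∀ a b, H a → H b → H (a ≫ b)
  inv : ∀ a, H a → H (Groupoid.inv a)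
  cross : ∀ b, H (D.cross b true)
  drop : ∀ z, z ∉ D.proj → H (D.drop z)

variable {H : (D.base ⟶ D.base) → Prop}

/-- The lower crossing is the upper one multiplied by drops on the two sides, by `cross_comp_drop`.
-/
theorem IsStab.cross' (h : D.IsStab H) (b : E × Bool) (i : Bool) : H (D.cross b i) := by
  cases i
  swap
  · exact h.cross b
  · obtain ⟨φ, hφ, δ, hδ, hδr, -, -, hgood⟩ := D.exists_isGood (D.tail b)
    have e : |D.radius (D.tail b) + δ / 2 - D.radius (D.tail b)| < δ := by
      rw [add_sub_cancel_left, abs_of_pos (by positivity)]; linarith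
    have hg := hgood _ e (by linarith)
    obtain ⟨t, χ, ht, ht1, -, -, -, hcr⟩ := hg.cross b rfl
    have h2 := cross_comp_drop ht (by linarith [D.exT_pos (flip b)]) hcr fun u _ => hg.circles _
    have h3 := hcr.notMem_proj (fun u _ => hg.circles _) (u := 1) (by simp) (by simp)
    have h4 := hcr.notMem_proj (fun u _ => hg.circles _) (u := -1) (by simp) (by simp)
    have h5 : D.cross b false = Groupoid.inv (D.drop (D.circ (D.tail b)
        (D.radius (D.tail b) + δ / 2) (D.ang b + window χ φ (-1)))) ≫ D.cross b true ≫
        D.drop (D.circ (D.tail b) (D.radius (D.tail b) + δ / 2) (D.ang b + window χ φ 1)) := by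
      rw [h2]; simp
    rw [h5]
    exact h.comp _ _ (h.inv _ (h.drop _ h4)) (h.comp _ _ (h.cross b) (h.drop _ h3))

theorem IsStab.vert (h : D.IsStab H) {p : ℂ × ℝ} {i j : Bool} (hi : D.Free i p)
    (hj : D.Free j p) : H (D.vert p i j) := by
  have key : ∀ (h1 : D.Free true p) (h2 : D.Free false p), H (D.vert p true false) :=
    fun h1 h2 => by rw [vert_eq_drop h1 h2]; exact h.drop _ (notMem_proj_of_free h1 h2)
  cases i <;> cases j
  · have := gen_const hi; unfold PlaneDrawing.vert; rw [this]; exact h.one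
  · rw [← vert_inv hj hi]; exact h.inv _ (key hj hi)
  · exact key hi hj
  · have := gen_const hi; unfold PlaneDrawing.vert; rw [this]; exact h.one

/-- The directions of the vertical rays do not matter. -/
theorem IsStab.gen_of_gen (h : D.IsStab H) {g : I → ℂ × ℝ} (hg : Continuous g)
    (hl : ∀ u, g u ∉ D.link) {i j k : Bool} (hi : D.Free i (g 0)) (hj : D.Free j (g 1))
    (hk0 : D.Free k (g 0)) (hk1 : D.Free k (g 1)) (hH : H (D.gen g k k)) : H (D.gen g i j) := by
  rw [← gen_comp_vert (k := j) ⟨hg, hl, hi, hk1⟩ hj, ← vert_comp_gen (k := i) ⟨hg, hl, hk0, hk1⟩ hi]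
  exact h.comp _ _ (h.comp _ _ (h.vert hi hk0) hH) (h.vert hk1 hj)

theorem IsStab.gen_near_free (h : D.IsStab H) {k : Bool} {g : I → ℂ × ℝ} (hg : Continuous g)
    (hl : ∀ u, D.Free k (g u)) {i j : Bool} (hi : D.Free i (g 0)) (hj : D.Free j (g 1)) :
    H (D.gen g i j) := by
  refine h.gen_of_gen hg (fun u => (hl u).notMem) hi hj (hl 0) (hl 1) ?_
  rw [gen_free hg hl]; exact h.one

/-- Off the plane the direction is that of `s₀`, and `s₁ = s₀`. In the plane the point is off the
circles, so any direction is free next to the arc, and `s₁` is a small positive height that makes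
`genOn_nrm` applicable. -/
theorem exists_box (b : E × Bool) {t₀ s₀ : ℝ} (h : s₀ ^ 2 < t₀ * (1 - t₀))
    (hp : (D.crv b t₀, s₀) ∉ D.link) : ∃ i s₁ ρ, 0 < ρ ∧ |s₁ - s₀| < ρ ∧ 0 < sgn i * s₁ ∧
      s₁ ^ 2 < t₀ * (1 - t₀) ∧ ∀ z s, ‖z - D.crv b t₀‖ < ρ → |s - s₀| < ρ →
        (z, s) ∉ D.link ∧ (z ∉ D.arcs → D.Free i (z, s)) := by
  have h0 : 0 ≤ t₀ * (1 - t₀) := (sq_nonneg s₀).trans h.le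
  have ht : t₀ ∈ I := ⟨by nlinarith, by nlinarith⟩
  obtain ⟨ρ, hρ, hball⟩ := Metric.isOpen_iff.1 (isCompact_link (D := D)).isClosed.isOpen_compl _ hp
  have hlink : ∀ z s, ‖z - D.crv b t₀‖ < ρ → |s - s₀| < ρ → (z, s) ∉ D.link := fun z s hz hs =>
    hball (by
      rw [Metric.mem_ball, Prod.dist_eq, max_lt_iff, dist_eq_norm, Real.dist_eq]; exact ⟨hz, hs⟩)
  by_cases hs : s₀ = 0
  · subst hs
    have hcir : D.crv b t₀ ∉ D.circles := fun hc => hp (mem_link.2 (Or.inl ⟨hc, rfl⟩))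
    obtain ⟨ρ', hρ', hball'⟩ := Metric.isOpen_iff.1
      (isCompact_circles (D := D)).isClosed.isOpen_compl _ hcir
    have hpos : 0 < t₀ * (1 - t₀) := by simpa using h
    refine ⟨true, min (min ρ ρ' / 2) (t₀ * (1 - t₀) / 2), min ρ ρ', lt_min hρ hρ', ?_, ?_, ?_, ?_⟩
    · rw [sub_zero, abs_of_pos (by positivity)]
      exact (min_le_left _ _).trans_lt (half_lt_self (lt_min hρ hρ'))
    · rw [sgn, if_pos rfl, one_mul]; positivity
    · have h1 : min (min ρ ρ' / 2) (t₀ * (1 - t₀) / 2) ≤ t₀ * (1 - t₀) / 2 := min_le_right _ _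
      have h2 : 0 < min (min ρ ρ' / 2) (t₀ * (1 - t₀) / 2) := by positivity
      have h3 : t₀ * (1 - t₀) ≤ 1 := by nlinarith [ht.1, ht.2]
      nlinarith
    · intro z s hz hs
      refine ⟨hlink z s (hz.trans_le (min_le_left _ _)) (hs.trans_le (min_le_left _ _)),
        fun ha => free_of_notMem_arcs ha (Or.inr fun hc => hball' ?_ hc)⟩
      rw [Metric.mem_ball, dist_eq_norm]; exact hz.trans_le (min_le_right _ _)
  · obtain ⟨i, hi⟩ : ∃ i, 0 < sgn i * s₀ := by
      rcases lt_or_gt_of_ne hs with h | h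
      · exact ⟨false, by simpa [sgn] using h⟩
      · exact ⟨true, by simpa [sgn] using h⟩
    have habs : |s₀| = sgn i * s₀ := by
      rw [← abs_of_pos hi, abs_mul, abs_sgn, one_mul]
    refine ⟨i, s₀, min ρ |s₀|, lt_min hρ (abs_pos.2 hs), ?_, hi, h, fun z s hz hs' =>
      ⟨hlink z s (hz.trans_le (min_le_left _ _)) (hs'.trans_le (min_le_left _ _)), fun ha =>
        free_of_notMem_arcs ha (Or.inl ?_)⟩⟩
    · rw [sub_self, abs_zero]; exact lt_min hρ (abs_pos.2 hs)
    · have h1 := hs'.trans_le (min_le_right _ _)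
      have h2 : |sgn i * (s - s₀)| < sgn i * s₀ := by
        rw [abs_mul, abs_sgn, one_mul, ← habs]; exact h1
      have := (abs_lt.1 h2).1
      linarith [mul_sub (sgn i) s s₀]

/-- The loops that stay near an inner point of the vertical disk of an edge. -/
theorem IsStab.gen_near_disk (h : D.IsStab H) (b : E × Bool) {t₀ s₀ : ℝ}
    (hs₀ : s₀ ^ 2 < t₀ * (1 - t₀)) (hp : (D.crv b t₀, s₀) ∉ D.link) :
    ∃ U ∈ 𝓝 (D.crv b t₀, s₀), ∀ (g : I → ℂ × ℝ) (i j : Bool), Continuous g → (∀ u, g u ∈ U) →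
      D.Free i (g 0) → D.Free j (g 1) → H (D.gen g i j) := by
  obtain ⟨k, s₁, ρ, hρ, hs₁, hk, hs₁', hbox⟩ := exists_box b hs₀ hp
  have h00 : 0 < t₀ * (1 - t₀) := (sq_nonneg s₀).trans_lt hs₀
  have h0 : 0 < t₀ := by nlinarith
  have h1 : t₀ < 1 := by nlinarith
  -- a box of parameters
  have hc := D.continuous_nrm b
  have ev1 : ∀ᶠ p : ℝ × ℝ in 𝓝 (t₀, 0), ‖D.nrm b p.1 p.2 - D.crv b t₀‖ < ρ := by
    refine (hc.sub continuous_const).norm.continuousAt.eventually (gt_mem_nhds ?_)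
    simpa [nrm_zero] using hρ
  have ev2 : ∀ᶠ p : ℝ × ℝ in 𝓝 (t₀, s₀), p.2 ^ 2 < p.1 * (1 - p.1) := by
    have hcc : Continuous fun p : ℝ × ℝ => p.1 * (1 - p.1) - p.2 ^ 2 := by fun_prop
    have := hcc.continuousAt.eventually (lt_mem_nhds (show (0 : ℝ) <
      (fun p : ℝ × ℝ => p.1 * (1 - p.1) - p.2 ^ 2) (t₀, s₀) from sub_pos.2 hs₀))
    filter_upwards [this] with p hp using sub_pos.1 hp
  obtain ⟨ε₁, hε₁, hb1⟩ := Metric.eventually_nhds_iff.1 ev1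
  obtain ⟨ε₂, hε₂, hb2⟩ := Metric.eventually_nhds_iff.1 ev2
  set ε := min (min ε₁ ε₂) (min D.eps (min t₀ (1 - t₀))) with hε
  have hεpos : 0 < ε := lt_min (lt_min hε₁ hε₂) (lt_min eps_pos (lt_min h0 (by linarith)))
  have e1 : ε ≤ ε₁ := (min_le_left _ _).trans (min_le_left _ _)
  have e2 : ε ≤ ε₂ := (min_le_left _ _).trans (min_le_right _ _)
  have e3 : ε ≤ D.eps := (min_le_right _ _).trans (min_le_left _ _)
  have e4 : ε ≤ t₀ := (min_le_right _ _).trans ((min_le_right _ _).trans (min_le_left _ _))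
  have e5 : ε ≤ 1 - t₀ := (min_le_right _ _).trans ((min_le_right _ _).trans (min_le_right _ _))
  have hin : ∀ t η, |t - t₀| < ε → |η| < ε → ‖D.nrm b t η - D.crv b t₀‖ < ρ := by
    intro t η ht hη
    refine @hb1 (t, η) ?_
    rw [Prod.dist_eq, max_lt_iff, Real.dist_eq, Real.dist_eq, sub_zero]
    exact ⟨ht.trans_le e1, hη.trans_le e1⟩
  have hI : ∀ t, |t - t₀| < ε → t ∈ I := fun t ht => by
    have := abs_lt.1 ht; exact ⟨by linarith, by linarith⟩
  -- the neighbourhood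
  have ev3 : ∀ᶠ p : ℂ × ℝ in 𝓝 (D.crv b t₀, s₀),
      (∃ t η, |t - t₀| < ε ∧ |η| < ε ∧ p.1 = D.nrm b t η) ∧ |p.2 - s₀| < ρ ∧ |p.2 - s₀| < ε₂ := by
    have hsnd : ContinuousAt (fun p : ℂ × ℝ => |p.2 - s₀|) (D.crv b t₀, s₀) := by fun_prop
    exact (continuous_fst.continuousAt.eventually (eventually_eq_nrm b h0 h1 hεpos)).and
      ((hsnd.eventually (gt_mem_nhds (by simpa using hρ))).and
        (hsnd.eventually (gt_mem_nhds (by simpa using hε₂))))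
  refine ⟨_, ev3, fun g i j hg hU hi hj => ?_⟩
  have hgb : ∀ u, ‖(g u).1 - D.crv b t₀‖ < ρ ∧ |(g u).2 - s₀| < ρ := by
    intro u
    obtain ⟨⟨t, η, ht, hη, he⟩, hs, -⟩ := hU u
    rw [he]
    exact ⟨hin t η ht hη, hs⟩
  have hgl : ∀ u, g u ∉ D.link := fun u => (hbox _ _ (hgb u).1 (hgb u).2).1
  have hend : ∀ u i, D.Free i (g u) → ∃ t η, |t - t₀| < ε ∧ |η| < ε ∧ η ≠ 0 ∧
      g u = (D.nrm b t η, (g u).2) := by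
    intro u i hf
    obtain ⟨⟨t, η, ht, hη, he⟩, -, hs⟩ := hU u
    refine ⟨t, η, ht, hη, ?_, Prod.ext he rfl⟩
    rintro rfl
    rw [nrm_zero] at he
    have h2 : (g u).2 ^ 2 < t * (1 - t) := by
      refine @hb2 (t, (g u).2) ?_
      rw [Prod.dist_eq, max_lt_iff, Real.dist_eq, Real.dist_eq]
      exact ⟨ht.trans_le e2, hs⟩
    have h3 := not_free_of_sq_lt (D := D) (b := b) h2 i
    rw [← he] at h3
    exact h3 hf
  have hfree : ∀ t η s, |t - t₀| < ε → |η| < ε → η ≠ 0 → |s - s₀| < ρ →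
      D.Free k (D.nrm b t η, s) := fun t η s ht hη h0 hs =>
    (hbox _ _ (hin t η ht hη) hs).2 (nrm_notMem_arcs' b (hI t ht) (hη.le.trans e3) h0)
  obtain ⟨t, η, ht, hη, hη0, hg0⟩ := hend 0 i hi
  obtain ⟨t', η', ht', hη', hη0', hg1⟩ := hend 1 j hj
  have hk0 : D.Free k (g 0) := by rw [hg0]; exact hfree _ _ _ ht hη hη0 (hgb 0).2
  have hk1 : D.Free k (g 1) := by rw [hg1]; exact hfree _ _ _ ht' hη' hη0' (hgb 1).2
  refine h.gen_of_gen hg hgl hi hj hk0 hk1 ?_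
  -- convexity of the box
  have hconv : ∀ (p q : ℂ × ℝ) (a : ℝ), a ∈ I → ‖p.1 - D.crv b t₀‖ < ρ → |p.2 - s₀| < ρ →
      ‖q.1 - D.crv b t₀‖ < ρ → |q.2 - s₀| < ρ → ((1 - a) • p + a • q) ∉ D.link := by
    intro p q a ha hp1 hp2 hq1 hq2
    have hP : p ∈ Metric.ball (D.crv b t₀, s₀) ρ := by
      rw [Metric.mem_ball, Prod.dist_eq, max_lt_iff, dist_eq_norm, Real.dist_eq]; exact ⟨hp1, hp2⟩
    have hQ : q ∈ Metric.ball (D.crv b t₀, s₀) ρ := by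
      rw [Metric.mem_ball, Prod.dist_eq, max_lt_iff, dist_eq_norm, Real.dist_eq]; exact ⟨hq1, hq2⟩
    have := convex_ball (D.crv b t₀, s₀) ρ hP hQ (by linarith [ha.2] : 0 ≤ 1 - a) ha.1 (by ring)
    rw [Metric.mem_ball, Prod.dist_eq, max_lt_iff, dist_eq_norm, Real.dist_eq] at this
    exact (hbox _ _ this.1 this.2).1
  -- The box is convex and misses the link, so the path may be straightened.
  have hline : D.gen g k k = D.gen (fun u : I => (1 - (u : ℝ)) • g 0 + (u : ℝ) • g 1) k k := by
    have := gen_homotopy (D := D) (F := fun u s : I => (1 - (s : ℝ)) • g u +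
      (s : ℝ) • ((1 - (u : ℝ)) • g 0 + (u : ℝ) • g 1)) (by fun_prop) (i := k) (j := k) ?_ ?_ ?_
    · simpa using this
    · intro u s
      have hb : (1 - (u : ℝ)) • g 0 + (u : ℝ) • g 1 ∈ Metric.ball (D.crv b t₀, s₀) ρ := by
        refine convex_ball _ ρ ?_ ?_ (by linarith [u.2.2]) u.2.1 (by ring)
        · rw [Metric.mem_ball, Prod.dist_eq, max_lt_iff, dist_eq_norm, Real.dist_eq]; exact hgb 0
        · rw [Metric.mem_ball, Prod.dist_eq, max_lt_iff, dist_eq_norm, Real.dist_eq]; exact hgb 1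
      rw [Metric.mem_ball, Prod.dist_eq, max_lt_iff, dist_eq_norm, Real.dist_eq] at hb
      exact hconv _ _ _ s.2 (hgb u).1 (hgb u).2 hb.1 hb.2
    · intro s
      have : (1 - (s : ℝ)) • g 0 + (s : ℝ) • ((1 - ((0 : I) : ℝ)) • g 0 + ((0 : I) : ℝ) • g 1)
          = g 0 := by simp [← add_smul]
      rw [this]; exact hk0
    · intro s
      have : (1 - (s : ℝ)) • g 1 + (s : ℝ) • ((1 - ((1 : I) : ℝ)) • g 0 + ((1 : I) : ℝ) • g 1)
          = g 1 := by simp [← add_smul]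
      rw [this]; exact hk1
  -- moving the ends
  set η₁ := ε / 2 with hη₁
  have hη₁0 : 0 < η₁ := by positivity
  have hη₁ε : η₁ < ε := by rw [hη₁]; linarith
  -- Each end moves through free points, without changing sides of the arc, to one of two standard
  -- points. The loop is then trivial, a crossing, or an inverse crossing.
  have hmove : ∀ (t η s : ℝ), |t - t₀| < ε → |η| < ε → η ≠ 0 → |s - s₀| < ρ → ∃ x : Bool,
      ∃ X : I → ℂ × ℝ, Continuous X ∧ X 0 = (D.nrm b t η, s) ∧
        X 1 = (D.nrm b t₀ (sgn x * η₁), s₁) ∧ ∀ a, D.Free k (X a) ∧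
          ‖(X a).1 - D.crv b t₀‖ < ρ ∧ |(X a).2 - s₀| < ρ := by
    intro t η s ht hη hη0 hs
    obtain ⟨x, hx⟩ : ∃ x, 0 < sgn x * η := by
      rcases lt_or_gt_of_ne hη0 with h | h
      · exact ⟨false, by simpa [sgn] using h⟩
      · exact ⟨true, by simpa [sgn] using h⟩
    have cv : ∀ {c r p q a : ℝ}, a ∈ I → |p - c| < r → |q - c| < r →
        |(1 - a) * p + a * q - c| < r := by
      intro c r p q a ha hp hq
      have h1 := abs_lt.1 hp
      have h2 := abs_lt.1 hq
      have ha0 := ha.1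
      have ha1 : 0 ≤ 1 - a := by linarith [ha.2]
      have := (convex_Ioo (c - r) (c + r)) (x := p) ⟨by linarith [h1.1], by linarith [h1.2]⟩
        (y := q) ⟨by linarith [h2.1], by linarith [h2.2]⟩ ha1 ha0 (by ring)
      simp only [smul_eq_mul] at this
      rw [abs_lt]; constructor <;> linarith [this.1, this.2]
    have hsx : |sgn x * η₁| < ε := by rw [abs_mul, abs_sgn, one_mul, abs_of_pos hη₁0]; exact hη₁ε
    have hb : ∀ a : I, |(1 - (a : ℝ)) * t + a * t₀ - t₀| < ε ∧
        |(1 - (a : ℝ)) * η + a * (sgn x * η₁)| < ε ∧ (1 - (a : ℝ)) * η + a * (sgn x * η₁) ≠ 0 ∧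
        |(1 - (a : ℝ)) * s + a * s₁ - s₀| < ρ := by
      intro a
      refine ⟨cv a.2 ht (by simpa using hεpos), ?_, ?_, cv a.2 hs hs₁⟩
      · have := cv (c := 0) a.2 (p := η) (q := sgn x * η₁) (r := ε) (by simpa using hη)
          (by simpa using hsx)
        simpa using this
      · intro h0
        have h1 : (1 - (a : ℝ)) * (sgn x * η) + a * η₁ = 0 := by
          have h2 := sgn_mul_self x
          linear_combination sgn x * h0 - a * η₁ * h2
        have ha0 := a.2.1
        have ha1 := a.2.2
        rcases ha0.eq_or_lt with h2 | h2
        · rw [← h2] at h1; simp at h1; rcases h1 with h1 | h1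
          · rw [h1] at hx; simp at hx
          · exact hη0 h1
        · have : 0 ≤ (1 - (a : ℝ)) * (sgn x * η) := mul_nonneg (by linarith) hx.le
          have := mul_pos h2 hη₁0
          linarith
    refine ⟨x, fun a => (D.nrm b ((1 - (a : ℝ)) * t + a * t₀)
      ((1 - (a : ℝ)) * η + a * (sgn x * η₁)), (1 - (a : ℝ)) * s + a * s₁), ?_, ?_, ?_, fun a => ?_⟩
    · exact (hc.comp (by fun_prop : Continuous fun a : I => ((1 - (a : ℝ)) * t + a * t₀,
        (1 - (a : ℝ)) * η + a * (sgn x * η₁)))).prodMk (by fun_prop)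
    · simp
    · simp
    · obtain ⟨b1, b2, b3, b4⟩ := hb a
      exact ⟨hfree _ _ _ b1 b2 b3 b4, hin _ _ b1 b2, b4⟩
  obtain ⟨x, X, hX, hX0, hX1, hXf⟩ := hmove t η _ ht hη hη0 (hgb 0).2
  obtain ⟨y, Y, hY, hY0, hY1, hYf⟩ := hmove t' η' _ ht' hη' hη0' (hgb 1).2
  rw [← hg0] at hX0
  rw [← hg1] at hY0
  have hmv := gen_homotopy (D := D) (F := fun u a : I => (1 - (u : ℝ)) • X a + (u : ℝ) • Y a)
    (by fun_prop) (i := k) (j := k)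
    (fun u a => hconv _ _ _ u.2 (hXf a).2.1 (hXf a).2.2 (hYf a).2.1 (hYf a).2.2)
    (fun a => by simpa using (hXf a).1) (fun a => by simpa using (hYf a).1)
  simp only [hX0, hY0, hX1, hY1] at hmv
  rw [hline, hmv]
  have hcross : D.gen (fun u : I => (1 - (u : ℝ)) • (D.nrm b t₀ (-1 * η₁), s₁) +
      (u : ℝ) • (D.nrm b t₀ (1 * η₁), s₁)) k k = D.cross b k := by
    rw [← genOn_nrm hη₁0 (hη₁ε.le.trans e3) hs₁' hk, genOn]
    congr 1
    funext u
    refine Prod.ext ?_ ?_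
    · simp only [nrm, Prod.smul_mk, Prod.mk_add_mk, Complex.real_smul]
      push_cast
      ring
    · simp only [Prod.smul_mk, Prod.mk_add_mk, smul_eq_mul]; ring
  have hPf : ∀ x, D.Free k (D.nrm b t₀ (sgn x * η₁), s₁) := fun x =>
    hfree _ _ _ (by simpa using hεpos) (by
      rw [abs_mul, abs_sgn, one_mul, abs_of_pos hη₁0]; exact hη₁ε)
      (by cases x <;> simp [sgn, hη₁0.ne']) hs₁
  have hconst : ∀ p : ℂ × ℝ, (fun u : I => (1 - (u : ℝ)) • p + (u : ℝ) • p) = fun _ => p :=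
    fun p => by funext u; rw [← add_smul, sub_add_cancel, one_smul]
  cases x <;> cases y
  · rw [hconst, gen_const (hPf _)]; exact h.one
  · simp only [sgn, if_true, Bool.false_eq_true, if_false]
    rw [hcross]; exact h.cross' b k
  · have hok : D.Ok (fun u : I => (1 - (u : ℝ)) • (D.nrm b t₀ (-1 * η₁), s₁) +
        (u : ℝ) • (D.nrm b t₀ (1 * η₁), s₁)) k k := by
      have p1 := hin t₀ (-1 * η₁) (by simpa using hεpos) (by simpa [abs_of_pos hη₁0] using hη₁ε)
      have p2 := hin t₀ (1 * η₁) (by simpa using hεpos) (by simpa [abs_of_pos hη₁0] using hη₁ε)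
      refine ⟨by fun_prop, fun u => hconv _ _ _ u.2 p1 hs₁ p2 hs₁, ?_, ?_⟩
      · simpa [sgn] using hPf false
      · simpa [sgn] using hPf true
    have hs := gen_symm hok
    rw [hcross] at hs
    have he : (fun u : I => (1 - (u : ℝ)) • (D.nrm b t₀ (sgn true * η₁), s₁) +
        (u : ℝ) • (D.nrm b t₀ (sgn false * η₁), s₁)) = fun u : I =>
        (1 - ((unitInterval.symm u : I) : ℝ)) • (D.nrm b t₀ (-1 * η₁), s₁) +
        ((unitInterval.symm u : I) : ℝ) • (D.nrm b t₀ (1 * η₁), s₁) := by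
      funext u
      simp only [sgn, if_true, Bool.false_eq_true, if_false, unitInterval.coe_symm_eq]
      rw [add_comm, sub_sub_cancel]
    rw [he, hs]
    exact h.inv _ (h.cross' b k)
  · rw [hconst, gen_const (hPf _)]; exact h.one

end PlaneDrawing

/-! ### Subdividing loops into small pieces -/

/-- The straight path between two points of the unit interval. -/
def lineI (a b : I) : Path a b where
  toFun u := ⟨(1 - (u : ℝ)) * a + u * b, by
    have h1 : 0 ≤ 1 - (u : ℝ) := by linarith [u.2.2]
    exact convex_Icc (0 : ℝ) 1 a.2 b.2 h1 u.2.1 (by ring)⟩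
  continuous_toFun := by fun_prop
  source' := Subtype.ext (by simp)
  target' := Subtype.ext (by simp)

theorem lineI_mem {a b : I} (h : a ≤ b) (u : I) : lineI a b u ∈ Set.Icc a b := by
  have h' : (a : ℝ) ≤ b := h
  have h0 := u.2.1
  have h1 := u.2.2
  refine ⟨?_, ?_⟩
  · show (a : ℝ) ≤ (1 - (u : ℝ)) * a + u * b
    nlinarith
  · show (1 - (u : ℝ)) * a + u * b ≤ (b : ℝ)
    nlinarith

namespace PlaneDrawing

variable {V E : Type*} {D : PlaneDrawing V E}

variable (D) in
/-- The standard arrows from infinity: the trivial one, and the vertical paths. -/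
inductive Std : (x : D.exterior) → (D.base ⟶ FundamentalGroupoid.mk x) → Prop
  | infty : Std D.top (𝟙 _)
  | ray {i : Bool} {p : ℂ × ℝ} (h : D.Free i p) : Std (D.pt p h.notMem) (cls h.path)

/-- Paths of finite points come from paths in space. -/
theorem exists_lift {x y : D.exterior} (c : Path x y) (h : ∀ t, ∃ p : ℂ × ℝ, (c t).1 = p) :
    ∃ g : I → ℂ × ℝ, Continuous g ∧ ∀ t, (c t).1 = (g t : ThreeSphere) := by
  choose g hg using h
  refine ⟨g, ?_, hg⟩
  rw [OnePoint.isOpenEmbedding_coe.isInducing.continuous_iff]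
  have : (fun p : ℂ × ℝ => (p : ThreeSphere)) ∘ g = fun t => (c t).1 := funext fun t => (hg t).symm
  rw [this]
  fun_prop

theorem exists_pt {x : D.exterior} (hx : x ≠ D.top) : ∃ p, ∃ h : p ∉ D.link, x = D.pt p h := by
  obtain ⟨x, hx'⟩ := x
  induction x using OnePoint.rec with
  | infty => exact absurd rfl hx
  | coe p => exact ⟨p, fun h => hx' ⟨p, h, rfl⟩, rfl⟩

variable [Finite V] [Finite E]

variable {H : (D.base ⟶ D.base) → Prop}

/-- The paths in `U` between endpoints of standard arrows give elements of `H`. -/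
def IsSmall (H : (D.base ⟶ D.base) → Prop) (U : Set D.exterior) : Prop :=
  ∀ (x y : D.exterior) (c : Path x y), (∀ t, c t ∈ U) → ∀ a b, D.Std x a → D.Std y b →
    H (a ≫ cls c ≫ Groupoid.inv b)

omit [Finite V] [Finite E] in
theorem isSmall_of_gen {U : Set (ℂ × ℝ)}
    (h : ∀ (g : I → ℂ × ℝ) (i j : Bool), Continuous g → (∀ u, g u ∈ U) → (∀ u, g u ∉ D.link) →
      D.Free i (g 0) → D.Free j (g 1) → H (D.gen g i j)) :
    IsSmall H {x : D.exterior | ∃ p ∈ U, x.1 = p} := by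
  intro x y c hc a b ha hb
  obtain ⟨g, hg, hcg⟩ := exists_lift c fun t => by
    obtain ⟨p, -, hp⟩ := hc t; exact ⟨p, hp⟩
  have hgU : ∀ t, g t ∈ U := fun t => by
    obtain ⟨p, hp, hp'⟩ := hc t
    rw [hcg] at hp'
    rwa [OnePoint.coe_injective hp']
  have hgl : ∀ t, g t ∉ D.link := fun t hm => (c t).2 ⟨g t, hm, (hcg t).symm⟩
  cases ha with
  | infty =>
    have := hcg 0
    rw [c.source] at this
    exact absurd this.symm (OnePoint.coe_ne_infty _)
  | @ray i p hi =>
    cases hb with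
    | infty =>
      have := hcg 1
      rw [c.target] at this
      exact absurd this.symm (OnePoint.coe_ne_infty _)
    | @ray j q hj =>
      have h0 : g 0 = p := OnePoint.coe_injective ((hcg 0).symm.trans (by rw [c.source]; rfl))
      have h1 : g 1 = q := OnePoint.coe_injective ((hcg 1).symm.trans (by rw [c.target]; rfl))
      subst h0 h1
      have hok : D.Ok g i j := ⟨hg, hgl, hi, hj⟩
      have hcs : c = seg hg hgl := by
        ext t; exact hcg t
      rw [hcs]
      have := h g i j hg hgU hgl hi hj
      rwa [gen_of_ok hok] at this

omit [Finite V] [Finite E] in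
theorem mem_nhds_of_coe {p : ℂ × ℝ} (hp : p ∉ D.link) {U : Set (ℂ × ℝ)} (hU : U ∈ 𝓝 p) :
    {x : D.exterior | ∃ p ∈ U, x.1 = p} ∈ 𝓝 (D.pt p hp) := by
  have h1 : (fun p : ℂ × ℝ => (p : ThreeSphere)) '' U ∈ 𝓝 ((p : ℂ × ℝ) : ThreeSphere) :=
    OnePoint.isOpenEmbedding_coe.image_mem_nhds.2 hU
  have h2 := (continuous_subtype_val (p := fun x => x ∈ D.exterior)).continuousAt
    (x := D.pt p hp) |>.preimage_mem_nhds h1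
  refine mem_of_superset h2 ?_
  rintro x ⟨q, hq, hqx⟩
  exact ⟨q, hq, hqx.symm⟩

/-- A vertical path close to infinity, up to `H`. -/
theorem IsStab.std_radial (h : D.IsStab H) {x : D.exterior} (hx : x.1 ∈ nearInfty D.bound) {a}
    (ha : D.Std x a) : H (a ≫ cls (radial x hx)) := by
  cases ha with
  | infty => rw [cls_radial_top, Category.comp_id]; exact h.one
  | @ray i p hi =>
    -- the vertical ray, or the opposite one, is close to infinity
    have hp : D.bound < ‖p‖ := coe_mem_nearInfty.1 hx
    by_cases hz : D.bound < ‖p.1‖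
    · rw [hi.cls_path_radial (fun r _ => hz.trans_le (le_max_left _ _)) hx]; exact h.one
    · have hs : D.bound < |p.2| := by
        rcases lt_max_iff.1 (show D.bound < max ‖p.1‖ ‖p.2‖ from hp) with h | h
        · exact absurd h hz
        · exact h
      have hbp := bound_pos (D := D)
      -- The ray pointing away from the plane stays near infinity; the given ray differs from it by
      -- a `vert`.
      obtain ⟨k, hk⟩ : ∃ k, sgn k * p.2 = |p.2| := by
        rcases le_total 0 p.2 with h | h
        · exact ⟨true, by rw [abs_of_nonneg h]; simp [sgn]⟩
        · exact ⟨false, by rw [abs_of_nonpos h]; simp [sgn]⟩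
      have hn : ∀ r : ℝ, 0 ≤ r → D.bound < ‖((p.1, p.2 + sgn k * r) : ℂ × ℝ)‖ := by
        intro r hr
        refine lt_of_lt_of_le ?_ (le_max_right _ _)
        show D.bound < |p.2 + sgn k * r|
        have h1 : sgn k * (p.2 + sgn k * r) = |p.2| + r := by
          rw [mul_add, hk, ← mul_assoc, sgn_mul_self, one_mul]
        have h2 : |p.2 + sgn k * r| = |p.2| + r := by
          rw [← abs_of_nonneg (show 0 ≤ |p.2| + r by positivity), ← h1, abs_mul, abs_sgn, one_mul]
        rw [h2]; linarith
      have hkf : D.Free k p := fun r hr hm => absurd (norm_le_bound hm) (not_le.2 (hn r hr))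
      have e := hkf.cls_path_radial hn hx
      have e2 : cls hi.path ≫ cls (radial _ hx) = D.vert p i k := by
        unfold PlaneDrawing.vert
        have hok : D.Ok (fun _ => p) i k := ⟨continuous_const, fun _ => hi.notMem, hi, hkf⟩
        have hok' : D.Ok (fun _ => p) k k := ⟨continuous_const, fun _ => hi.notMem, hkf, hkf⟩
        rw [gen_of_ok hok]
        have e4 := gen_of_ok hok'
        rw [gen_const hkf] at e4
        have e5 : cls (seg hok.cont hok.notMem) ≫ Groupoid.inv (cls hok.right.path) =
            Groupoid.inv (cls hkf.path) := by
          rw [← cancel_epi (cls hkf.path)]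
          simpa using e4.symm
        rw [e5]
        have e6 : cls (radial _ hx) = Groupoid.inv (cls hkf.path) := by
          rw [← cancel_epi (cls hkf.path), e]; simp
        rw [e6]
      rw [e2]
      exact h.vert hi hkf

/-- There are three kinds of points: infinity, where radial paths contract; points with a free ray,
which stays free nearby; and inner points of the vertical disk of an edge. -/
theorem IsStab.exists_small (h : D.IsStab H) (x : D.exterior) : ∃ U ∈ 𝓝 x, IsSmall H U := by
  by_cases hx : x = D.top
  · subst hx
    refine ⟨Subtype.val ⁻¹' nearInfty D.bound, continuous_subtype_val.continuousAt.preimage_mem_nhds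
      ((isOpen_nearInfty _).mem_nhds (infty_mem_nearInfty _)), fun x y c hc a b ha hb => ?_⟩
    have hx : x.1 ∈ nearInfty D.bound := by simpa using hc 0
    have hy : y.1 ∈ nearInfty D.bound := by simpa using hc 1
    have h1 := cls_radial c hc hx hy
    have h2 : a ≫ cls c ≫ Groupoid.inv b =
        (a ≫ cls (radial x hx)) ≫ Groupoid.inv (b ≫ cls (radial y hy)) := by
      rw [← h1]; simp
    rw [h2]
    exact h.comp _ _ (h.std_radial hx ha) (h.inv _ (h.std_radial hy hb))
  · obtain ⟨p, hp, rfl⟩ := exists_pt hx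
    rcases free_or_mem p hp with ⟨k, hk⟩ | ⟨b, t, hz, hs⟩
    · refine ⟨_, mem_nhds_of_coe hp hk.eventually, isSmall_of_gen fun g i j hg hU _ hi hj => ?_⟩
      exact h.gen_near_free hg hU hi hj
    · obtain ⟨z, s⟩ := p
      obtain rfl : z = D.crv b t := hz
      obtain ⟨U, hU, hgen⟩ := h.gen_near_disk b hs hp
      exact ⟨_, mem_nhds_of_coe hp hU, isSmall_of_gen fun g i j hg hgU _ hi hj =>
        hgen g i j hg hgU hi hj⟩

omit [Finite V] in
theorem exists_nrm_free (b : E × Bool) {t s : ℝ} (hs : s ^ 2 < t * (1 - t))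
    (hp : (D.crv b t, s) ∉ D.link) [Finite V] : ∀ᶠ η in 𝓝[>] (0 : ℝ), ∃ i, D.Free i (D.nrm b t η, s) := by
  obtain ⟨k, s₁, ρ, hρ, -, -, -, hbox⟩ := exists_box b hs hp
  have h00 : 0 < t * (1 - t) := (sq_nonneg s).trans_lt hs
  have ht : t ∈ I := ⟨by nlinarith, by nlinarith⟩
  have hc : Continuous fun η => ‖D.nrm b t η - D.crv b t‖ :=
    (((D.continuous_nrm b).comp (by fun_prop : Continuous fun η : ℝ => (t, η))).sub
      continuous_const).norm
  have e1 : ∀ᶠ η in 𝓝 (0 : ℝ), ‖D.nrm b t η - D.crv b t‖ < ρ :=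
    hc.continuousAt.eventually (gt_mem_nhds (by simpa [nrm_zero] using hρ))
  filter_upwards [e1.filter_mono nhdsWithin_le_nhds, self_mem_nhdsWithin,
    (eventually_le_nhds (eps_pos (D := D))).filter_mono nhdsWithin_le_nhds] with η h1 h2 h3
  exact ⟨k, (hbox _ _ h1 (by simpa using hρ)).2 (nrm_notMem_arcs' b ht
    (by rw [abs_of_pos h2]; exact h3) (ne_of_gt h2))⟩

/-- Every point is joined to the end of a standard arrow inside of any neighbourhood. -/
theorem exists_std (x : D.exterior) {U : Set D.exterior} (hU : U ∈ 𝓝 x) :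
    ∃ (y : D.exterior) (d : Path x y) (b : D.base ⟶ FundamentalGroupoid.mk y),
      (∀ t, d t ∈ U) ∧ D.Std y b := by
  by_cases hx : x = D.top
  · subst hx
    exact ⟨_, Path.refl _, _, fun _ => mem_of_mem_nhds hU, Std.infty⟩
  · obtain ⟨p, hp, rfl⟩ := exists_pt hx
    rcases free_or_mem p hp with ⟨k, hk⟩ | ⟨b, t, hz, hs⟩
    · exact ⟨_, Path.refl _, _, fun _ => mem_of_mem_nhds hU, Std.ray hk⟩
    · obtain ⟨z, s⟩ := p
      obtain rfl : z = D.crv b t := hz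
      have hc : Continuous fun η : ℝ => (D.nrm b t η, s) :=
        ((D.continuous_nrm b).comp (by fun_prop : Continuous fun η : ℝ => (t, η))).prodMk
          continuous_const
      have h0 : (D.nrm b t 0, s) = (D.crv b t, s) := by rw [nrm_zero]
      have hl : ∀ᶠ η in 𝓝 (0 : ℝ), (D.nrm b t η, s) ∉ D.link :=
        hc.continuousAt.eventually ((isCompact_link (D := D)).isClosed.isOpen_compl.mem_nhds
          (by simpa [nrm_zero] using hp))
      obtain ⟨U', hU', hsub⟩ : ∃ U' ∈ 𝓝 (D.crv b t, s), ∀ q ∈ U', ∀ hq : q ∉ D.link,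
          D.pt q hq ∈ U := by
        obtain ⟨W, hW, hWU⟩ := mem_nhds_subtype _ _ _ |>.1 hU
        refine ⟨(fun p : ℂ × ℝ => (p : ThreeSphere)) ⁻¹' W,
          OnePoint.continuous_coe.continuousAt.preimage_mem_nhds hW, fun q hq hq' => hWU hq⟩
      have hU2 : ∀ᶠ η in 𝓝 (0 : ℝ), (D.nrm b t η, s) ∈ U' :=
        hc.continuousAt.eventually (by simp only [nrm_zero]; exact hU')
      obtain ⟨δ, hδ, hall⟩ := Metric.eventually_nhds_iff.1 (hl.and hU2)
      obtain ⟨η, ⟨⟨i, hi⟩, hη⟩, hη0⟩ := ((exists_nrm_free b hs hp).and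
        ((gt_mem_nhds hδ).filter_mono nhdsWithin_le_nhds) |>.and self_mem_nhdsWithin).exists
      have hη0' : 0 < η := hη0
      have hd : ∀ u : I, dist ((u : ℝ) * η) 0 < δ := fun u => by
        rw [Real.dist_eq, sub_zero, abs_of_nonneg (mul_nonneg u.2.1 hη0'.le)]
        nlinarith [u.2.2]
      refine ⟨_, ⟨⟨fun u : I => D.pt (D.nrm b t (u * η), s) (hall (hd u)).1,
        continuous_pt (hc.comp (by fun_prop)) _⟩, ?_, ?_⟩, _, fun u => hsub _ (hall (hd u)).2 (hall (hd u)).1,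
        Std.ray hi⟩
      · exact Subtype.ext (by simp [pt, nrm_zero])
      · exact Subtype.ext (by simp [pt])

/-- The loops `cross` and `drop` generate the link group. -/
theorem IsStab.all (h : D.IsStab H) (a : D.base ⟶ D.base) : H a := by
  obtain ⟨γ, rfl⟩ := exists_cls a
  choose U hU hsmall using h.exists_small
  obtain ⟨t, ht0, htm, ⟨n, hn⟩, hcov⟩ := exists_monotone_Icc_subset_open_cover_unitInterval
    (c := fun x : D.exterior => γ ⁻¹' interior (U x))
    (fun x => isOpen_interior.preimage γ.continuous)
    (fun u _ => Set.mem_iUnion.2 ⟨γ u, mem_interior_iff_mem_nhds.2 (hU (γ u))⟩)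
  have hγ : Continuous γ := γ.continuous
  have hmem : ∀ (y : D.exterior), y ∈ U y := fun y => mem_of_mem_nhds (hU y)
  let c : ∀ n, Path D.top (γ (t n)) := fun n => ((lineI 0 (t n)).map hγ).cast γ.source.symm rfl
  have hstep : ∀ n, cls (c (n + 1)) = cls (c n) ≫ cls ((lineI (t n) (t (n + 1))).map hγ) := by
    intro n
    have h1 : cls ((lineI 0 (t (n + 1))).map hγ) =
        cls ((lineI 0 (t n)).map hγ) ≫ cls ((lineI (t n) (t (n + 1))).map hγ) := by
      rw [← cls_trans, ← Path.map_trans]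
      exact cls_eq_of_simplyConnected hγ _ _
    have h2 : ∀ {x x' y z : D.exterior} (hx : x' = x) (p : Path x y) (q : Path y z) (r : Path x z),
        cls r = cls p ≫ cls q → cls (r.cast hx rfl) = cls (p.cast hx rfl) ≫ cls q := by
      rintro x _ y z rfl p q r h
      exact h
    exact h2 _ _ _ _ h1
  -- The detour to a standard arrow can be taken in any prescribed neighbourhood `W`; in the
  -- induction `W` is the small set that covers the next piece.
  have key : ∀ n, ∀ W ∈ 𝓝 (γ (t n)), ∃ (y : D.exterior) (d : Path (γ (t n)) y)
      (b : D.base ⟶ FundamentalGroupoid.mk y), (∀ u, d u ∈ W) ∧ D.Std y b ∧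
      H (cls (c n) ≫ cls d ≫ Groupoid.inv b) := by
    intro n
    induction n with
    | zero =>
      intro W hW
      have h0 : γ (t 0) = D.top := by rw [ht0, γ.source]
      have hUt : U D.top ∈ 𝓝 (γ (t 0)) := by rw [h0]; exact hU _
      obtain ⟨y, d, b, hd, hb⟩ := exists_std (γ (t 0)) (inter_mem hW hUt)
      refine ⟨y, d, b, fun u => (hd u).1, hb, ?_⟩
      have h1 := hsmall D.top D.top y ((c 0).trans d) (fun u => ?_) _ b Std.infty hb
      · rwa [Category.id_comp, cls_trans, Category.assoc] at h1
      · have hr : Set.range ((c 0).trans d) ⊆ U D.top := by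
          rw [Path.trans_range]
          refine Set.union_subset ?_ ?_
          · rintro _ ⟨v, rfl⟩
            have hv : c 0 v = D.top := by
              have : lineI 0 (t 0) v = 0 := Subtype.ext (by rw [ht0]; simp [lineI])
              show γ (lineI 0 (t 0) v) = _
              rw [this, γ.source]
            rw [hv]; exact hmem _
          · rintro _ ⟨v, rfl⟩; exact (hd v).2
        exact hr ⟨u, rfl⟩
    | succ n ih =>
      intro W hW
      obtain ⟨x, hx⟩ := hcov n
      have hle : t n ≤ t (n + 1) := htm (Nat.le_succ n)
      obtain ⟨y, d, b, hd, hb, hH⟩ := ih (U x)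
        (mem_interior_iff_mem_nhds.1 (hx ⟨le_rfl, hle⟩))
      obtain ⟨y', d', b', hd', hb'⟩ := exists_std (γ (t (n + 1)))
        (inter_mem hW (mem_interior_iff_mem_nhds.1 (hx ⟨hle, le_rfl⟩)))
      refine ⟨y', d', b', fun u => (hd' u).1, hb', ?_⟩
      have h1 := hsmall x y y' (d.symm.trans (((lineI (t n) (t (n + 1))).map hγ).trans d'))
        (fun u => ?_) b b' hb hb'
      · have h2 := h.comp _ _ hH h1
        rw [cls_trans, cls_trans, cls_symm] at h2
        rw [hstep]
        simpa using h2
      · have hr : Set.range (d.symm.trans (((lineI (t n) (t (n + 1))).map hγ).trans d')) ⊆ U x := by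
          rw [Path.trans_range, Path.trans_range, Path.symm_range]
          refine Set.union_subset ?_ (Set.union_subset ?_ ?_)
          · rintro _ ⟨v, rfl⟩; exact hd v
          · rintro _ ⟨v, rfl⟩; exact interior_subset (hx (lineI_mem hle v))
          · rintro _ ⟨v, rfl⟩; exact (hd' v).2
        exact hr ⟨u, rfl⟩
  have h1 : γ (t n) = D.top := by rw [hn n le_rfl, γ.target]
  obtain ⟨y, d, b, hd, hb, hH⟩ := key n (U D.top) (by rw [h1]; exact hU _)
  have hfin : ∀ (z : D.exterior) (hz : z = D.top) (e : Path D.top z) (d : Path z y),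
      (∀ u, d u ∈ U D.top) → H (cls e ≫ cls d ≫ Groupoid.inv b) →
      H (cls (e.cast rfl hz.symm)) := by
    rintro _ rfl e d hd hH
    have h2 := h.comp _ _ hH (h.inv _ (hsmall D.top D.top y d hd _ b Std.infty hb))
    simpa using h2
  have hγc : γ = (c n).cast rfl h1.symm := by
    ext1
    funext u
    have : lineI 0 (t n) u = u := Subtype.ext (by rw [hn n le_rfl]; simp [lineI])
    show γ u = γ (lineI 0 (t n) u)
    rw [this]
  rw [hγc]
  exact hfin _ h1 _ d hd hH

end PlaneDrawing

/-! ### Functions that are constant on the complement of the projection -/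

namespace PlaneDrawing

variable {V E : Type*} {D : PlaneDrawing V E}

theorem exists_window_eq {χ φ ψ : ℝ} (h : |ψ| ≤ φ) :
    ∃ u ∈ Set.Icc (-1 : ℝ) 1, window χ φ u = ψ := by
  obtain ⟨u, hu, h⟩ := intermediate_value_Icc (by norm_num : (-1 : ℝ) ≤ 1)
    (continuous_window χ φ).continuousOn
    (show ψ ∈ Set.Icc _ _ by rw [window_one, window_neg_one]; exact abs_le.1 h)
  exact ⟨u, hu, h⟩

namespace IsGood

variable [Finite V] [Finite E] {v : V} {φ ρ : ℝ}

/-- The points of a circle around a disk, outside the arcs, can be moved to the base direction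
or to the side of an arc. -/
theorem conn_or (h : D.IsGood v φ ρ) {o : Bool} (ho : o = true ↔ D.radius v < ρ) {θ : ℝ}
    (hθ : θ ∈ Set.Icc (D.baseAngle v) (D.baseAngle v + 2 * Real.pi))
    (hp : D.circ v ρ θ ∉ D.proj) :
    D.Conn (D.circ v ρ θ) (D.circ v ρ (D.baseAngle v)) ∨
      ∃ b, D.tail b = v ∧ ∃ x, (x = 1 ∨ x = -1) ∧ D.Conn (D.circ v ρ θ) (D.sidePt o x b) := by
  by_cases hb : ∃ b, D.tail b = v ∧ |θ - D.ang b| < φ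
  · obtain ⟨b, hb, hlt⟩ := hb
    obtain ⟨t, χ, ht, ht1, -, -, -, hcr⟩ := h.cross b hb
    obtain ⟨u, hu, hw⟩ := exists_window_eq (χ := χ) hlt.le
    have hθu : θ = D.ang b + window χ φ u := by rw [hw]; ring
    have hc : Continuous fun u => D.circ v ρ (D.ang b + window χ φ u) := hcr.cont
    have h0 : u ≠ 0 := by
      rintro rfl
      refine hp (Or.inl ?_)
      rw [hθu]
      have := hcr.map_zero
      rw [this]
      exact crv_mem_arcs b ⟨ht.le, by linarith [D.exT_pos (flip b)]⟩
    refine Or.inr ⟨b, hb, ?_⟩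
    rw [hθu]
    rcases lt_or_gt_of_ne h0 with h0 | h0
    · refine ⟨-1, Or.inr rfl, Conn.trans (Conn.of_line hc (a := u) (b := -1) fun s hs => ?_) ?_⟩
      · rw [Set.uIcc_of_ge hu.1] at hs
        exact hcr.notMem_proj (fun _ _ => h.circles _) ⟨hs.1, hs.2.trans hu.2⟩
          (hs.2.trans_lt h0).ne
      · simp only [window_neg_one]
        exact (h.conn_side hb ho).2
    · refine ⟨1, Or.inl rfl, Conn.trans (Conn.of_line hc (a := u) (b := 1) fun s hs => ?_) ?_⟩
      · rw [Set.uIcc_of_le hu.2] at hs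
        exact hcr.notMem_proj (fun _ _ => h.circles _) ⟨hu.1.trans hs.1, hs.2⟩
          (h0.trans_le hs.1).ne'
      · simp only [window_one]
        exact (h.conn_side hb ho).1
  · push Not at hb
    have hb' : ∀ b, D.tail b = v → D.ang b + φ ≤ θ ∨ θ ≤ D.ang b - φ := fun b hbv => by
      rcases le_abs'.1 (hb b hbv) with h1 | h1
      · exact Or.inr (by linarith)
      · exact Or.inl (by linarith)
    have hw := h.window_pos
    by_cases hne : ∃ b, D.tail b = v ∧ D.ang b + φ ≤ θ
    -- Going back clockwise, the first window met is that of the last dart before `θ`.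
    · obtain ⟨b, ⟨hbv, hbθ⟩, hmax⟩ := Set.exists_max_image {b | D.tail b = v ∧ D.ang b + φ ≤ θ}
        D.ang (Set.toFinite _) hne
      refine Or.inr ⟨b, hbv, 1, Or.inl rfl, Conn.trans (Conn.symm ?_) (h.conn_side hbv ho).1⟩
      refine h.conn_circ hbθ (by linarith [h.lo b hbv]) hθ.2 fun b' hb'v => ?_
      rcases hb' b' hb'v with h1 | h1
      · exact Or.inl (by linarith [hmax b' ⟨hb'v, h1⟩])
      · exact Or.inr h1
    · push Not at hne
      exact Or.inl (Conn.symm (h.conn_circ hθ.1 le_rfl hθ.2 fun b hbv =>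
        (hb' b hbv).imp (fun h1 => absurd h1 (not_le.2 (hne b hbv))) id))

theorem eq_base {α : Type*} {κ : ℂ → α} (hκ : ∀ z w, D.Conn z w → κ z = κ w) {o : Bool}
    (hside : ∀ b, κ (D.sidePt o 1 b) = κ (D.sidePt o (-1) b)) (h : D.IsGood v φ ρ)
    (ho : o = true ↔ D.radius v < ρ) {b : E × Bool} (hb : D.tail b = v) :
    κ (D.sidePt o (-1) b) = κ (D.circ v ρ (D.baseAngle v)) := by
  rcases hL : D.darts v with _ | ⟨b₀, L⟩
  · have := mem_darts.2 hb
    rw [hL] at this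
    exact absurd this (List.not_mem_nil)
  · have hb₀ : D.tail b₀ = v := mem_darts.1 (by rw [hL]; simp)
    rw [hκ _ _ (h.conn_base hL ho)]
    obtain ⟨k, rfl⟩ := exists_iterate_rot (hb₀.trans hb.symm)
    have key : ∀ k, D.tail (D.rot^[k] b₀) = v ∧
        κ (D.sidePt o (-1) (D.rot^[k] b₀)) = κ (D.sidePt o (-1) b₀) := by
      intro k
      induction k with
      | zero => exact ⟨hb₀, rfl⟩
      | succ k ih =>
        rw [Function.iterate_succ_apply', tail_rot, ← hκ _ _ (PlaneDrawing.conn_rot o _), hside]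
        exact ih
    exact (key k).2

theorem eq_circ {α : Type*} {κ : ℂ → α} (hκ : ∀ z w, D.Conn z w → κ z = κ w) {o : Bool}
    (hside : ∀ b, κ (D.sidePt o 1 b) = κ (D.sidePt o (-1) b)) (h : D.IsGood v φ ρ)
    (ho : o = true ↔ D.radius v < ρ) {z : ℂ} (hz : ‖z - D.center v‖ = ρ) (hp : z ∉ D.proj) :
    κ z = κ (D.circ v ρ (D.baseAngle v)) := by
  obtain ⟨θ, hθ, hzθ⟩ := exists_circ_eq (D := D) v z (D.baseAngle v)
  rw [hz] at hzθ
  rcases h.conn_or ho ⟨hθ.1.le, hθ.2⟩ (hzθ ▸ hp) with h1 | ⟨b, hb, x, hx, h1⟩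
  · rw [hzθ, hκ _ _ h1]
  · rw [hzθ, hκ _ _ h1]
    rcases hx with rfl | rfl
    · rw [hside, eq_base hκ hside h ho hb]
    · exact eq_base hκ hside h ho hb

end IsGood

/-- Normal displacements leave the arcs, and circles have empty interior; both sets are closed, so
the complements are open and dense. -/
theorem dense_proj_compl [Finite V] [Finite E] : Dense D.projᶜ := by
  have h1 : Dense D.arcsᶜ := by
    rw [← interior_eq_empty_iff_dense_compl, Set.eq_empty_iff_forall_notMem]
    intro z hz
    obtain ⟨b, t, ht, rfl⟩ := mem_arcs.1 (interior_subset hz)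
    have hc : Continuous fun η => D.nrm b t η :=
      (D.continuous_nrm b).comp (by fun_prop : Continuous fun η : ℝ => (t, η))
    have h2 : ∀ᶠ η in 𝓝[>] (0 : ℝ), D.nrm b t η ∈ interior D.arcs :=
      (hc.continuousAt.eventually (by
        simp only [nrm_zero]; exact isOpen_interior.mem_nhds hz)).filter_mono nhdsWithin_le_nhds
    obtain ⟨η, ⟨h2, h3⟩, h4⟩ := ((h2.and ((eventually_le_nhds (eps_pos (D := D))).filter_mono
      nhdsWithin_le_nhds)).and self_mem_nhdsWithin).exists
    have h4' : 0 < η := h4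
    exact nrm_notMem_arcs' b ht (by rwa [abs_of_pos h4']) h4'.ne' (interior_subset h2)
  have h2 : Dense D.circlesᶜ := by
    rw [circles, Set.compl_iUnion]
    refine dense_iInter_of_isOpen (fun v => Metric.isClosed_sphere.isOpen_compl) fun v => ?_
    rw [← interior_eq_empty_iff_dense_compl]
    exact interior_sphere _ (D.radius_pos v).ne'
  rw [proj, Set.compl_union]
  exact h1.inter_of_isOpen_left h2 isCompact_arcs.isClosed.isOpen_compl

variable [Finite V] [Finite E]

variable (D) in
/-- The radius of a good neighbourhood of the circle of `v`. -/
def tubeRadius (v : V) : ℝ := (D.exists_isGood v).choose_spec.2.choose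

theorem tubeRadius_pos (v : V) : 0 < D.tubeRadius v :=
  (D.exists_isGood v).choose_spec.2.choose_spec.1

theorem circ_baseAngle_notMem_arcs {v : V} {ρ : ℝ} (h : |ρ - D.radius v| < D.tubeRadius v) :
    D.circ v ρ (D.baseAngle v) ∉ D.arcs :=
  (D.exists_isGood v).choose_spec.2.choose_spec.2.2.1 ρ h

theorem circ_notMem_circles {v : V} {ρ : ℝ} (h : |ρ - D.radius v| < D.tubeRadius v)
    (h' : ρ ≠ D.radius v) (θ : ℝ) : D.circ v ρ θ ∉ D.circles :=
  (D.exists_isGood v).choose_spec.2.choose_spec.2.2.2.1 ρ h h' θ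

theorem isGood_of_lt {v : V} {ρ : ℝ} (h : |ρ - D.radius v| < D.tubeRadius v)
    (h' : ρ ≠ D.radius v) : D.IsGood v (D.exists_isGood v).choose ρ :=
  (D.exists_isGood v).choose_spec.2.choose_spec.2.2.2.2 ρ h h'

variable (D) in
/-- A point next to the circle of `v`, inside of the disk if `o` is false. -/
def basePt (o : Bool) (v : V) : ℂ :=
  D.circ v (D.radius v + sgn o * (D.tubeRadius v / 2)) (D.baseAngle v)

theorem isGood_basePt (o : Bool) (v : V) :
    |D.radius v + sgn o * (D.tubeRadius v / 2) - D.radius v| < D.tubeRadius v ∧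
    (o = true ↔ D.radius v < D.radius v + sgn o * (D.tubeRadius v / 2)) ∧
    D.IsGood v (D.exists_isGood v).choose (D.radius v + sgn o * (D.tubeRadius v / 2)) := by
  have h := tubeRadius_pos (D := D) v
  have h1 : |D.radius v + sgn o * (D.tubeRadius v / 2) - D.radius v| < D.tubeRadius v := by
    rw [add_sub_cancel_left, abs_mul, abs_sgn, one_mul, abs_of_pos] <;> linarith
  refine ⟨h1, ?_, isGood_of_lt h1 ?_⟩ <;> cases o <;> simp [sgn] <;> linarith

theorem conn_basePt {v : V} {ρ : ℝ} (h : |ρ - D.radius v| < D.tubeRadius v) {o : Bool}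
    (h' : 0 < sgn o * (ρ - D.radius v)) :
    D.Conn (D.circ v ρ (D.baseAngle v)) (D.basePt o v) := by
  refine Conn.of_line (f := fun ρ => D.circ v ρ (D.baseAngle v))
    ((continuous_circ v).comp (by fun_prop : Continuous fun ρ : ℝ => (ρ, D.baseAngle v)))
    fun x hx => ?_
  have hδ := tubeRadius_pos (D := D) v
  have a1 := abs_lt.1 h
  have hρδ : |x - D.radius v| < D.tubeRadius v ∧ x ≠ D.radius v := by
    rw [Set.mem_uIcc] at hx
    refine ⟨abs_lt.2 ?_, ?_⟩ <;> cases o <;> simp only [sgn] at hx h' <;> simp at hx h'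
    · constructor <;> rcases hx with hx | hx <;> linarith [hx.1, hx.2]
    · constructor <;> rcases hx with hx | hx <;> linarith [hx.1, hx.2]
    · rintro rfl; rcases hx with hx | hx <;> linarith [hx.1, hx.2]
    · rintro rfl; rcases hx with hx | hx <;> linarith [hx.1, hx.2]
  exact fun h => h.elim (circ_baseAngle_notMem_arcs hρδ.1) (circ_notMem_circles hρδ.1 hρδ.2 _)

/-- Near an inner point of an arc that is not on the circles. -/
theorem eventually_eq_crv {α : Type*} {κ : ℂ → α} (hκ : ∀ z w, D.Conn z w → κ z = κ w)
    (hside : ∀ o b, κ (D.sidePt o 1 b) = κ (D.sidePt o (-1) b)) (b : E × Bool) {t : ℝ}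
    (h0 : 0 < t) (h1 : t < 1 - D.exT (flip b)) (h2 : t ≠ D.exT b) :
    ∃ c, ∀ᶠ z in 𝓝 (D.crv b t), z ∉ D.proj → κ z = c := by
  have k1 := exT_lt_mid (D := D) b
  have k2 := mid_lt (D := D) b
  have k3 := D.exT_pos b
  have k4 := D.exT_pos (flip b)
  -- The interval `[a, c]` contains `t` and the reference time on the same side of the exit time, so
  -- both sides of the arc can be followed to the reference points.
  obtain ⟨o, a, c, ha0, hat, htc, hao, hoc, hx⟩ : ∃ o a c, 0 < a ∧ a < t ∧ t < c ∧
      a ≤ D.tm o b ∧ D.tm o b ≤ c ∧ (c < D.exT b ∨ D.exT b < a ∧ c < 1 - D.exT (flip b)) := by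
    rcases lt_or_gt_of_ne h2 with h3 | h3
    · refine ⟨false, min (t / 2) (D.exT b / 2), max ((t + D.exT b) / 2) (D.exT b / 2),
        by positivity, (min_le_left _ _).trans_lt (by linarith),
        lt_of_lt_of_le (by linarith) (le_max_left _ _), min_le_right _ _, le_max_right _ _,
        Or.inl (max_lt (by linarith) (by linarith))⟩
    · exact ⟨true, min ((t + D.exT b) / 2) (D.mid b), max ((t + (1 - D.exT (flip b))) / 2)
        (D.mid b), lt_min (by linarith) (by linarith), (min_le_left _ _).trans_lt (by linarith),
        lt_of_lt_of_le (by linarith) (le_max_left _ _), min_le_right _ _, le_max_right _ _,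
        Or.inr ⟨lt_min (by linarith) k1, max_lt (by linarith) k2⟩⟩
  have k5 := D.exT_add_lt b
  have hac : a ≤ c := (hat.trans htc).le
  have hc1 : c < 1 - D.exT (flip b) := hx.elim (fun h => by linarith) fun h => h.2
  have hI : Set.uIcc a c ⊆ I := by
    rw [Set.uIcc_of_le hac]
    exact Set.Icc_subset_Icc ha0.le (by linarith)
  obtain ⟨η₁, hη₁, hη⟩ := exists_conn_nrm (D := D) b hI
    (by rw [Set.uIcc_of_le hac]
        exact fun h => hx.elim (fun h' => absurd h.2 (not_le.2 h'))
          fun h' => absurd h.1 (not_le.2 h'.1))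
    (by rw [Set.uIcc_of_le hac]; exact fun h => absurd h.2 (not_le.2 hc1))
  rw [Set.uIcc_of_le hac] at hI hη
  refine ⟨κ (D.sidePt o (-1) b), ?_⟩
  have hε := eps_pos (D := D)
  filter_upwards [eventually_eq_nrm (D := D) b h0 (by linarith : t < 1)
    (lt_min (lt_min (sub_pos.2 hat) (sub_pos.2 htc)) (lt_min hη₁ hε))] with z ⟨t', η, ht', hη', hz⟩ hp
  have e1 := abs_lt.1 (ht'.trans_le ((min_le_left _ _).trans (min_le_left _ _)))
  have e2 := abs_lt.1 (ht'.trans_le ((min_le_left _ _).trans (min_le_right _ _)))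
  have e3 := hη'.le.trans ((min_le_right _ _).trans (min_le_left _ _))
  have e4 := hη'.le.trans ((min_le_right _ _).trans (min_le_right _ _))
  have hm : t' ∈ Set.Icc a c := ⟨by linarith, by linarith⟩
  have hη0 : η ≠ 0 := by
    rintro rfl
    rw [nrm_zero] at hz
    exact hp (Or.inl (hz ▸ crv_mem_arcs b (hI hm)))
  have hconn := (hη η hη0 e3 t' hm).trans (hη η hη0 e3 _ ⟨hao, hoc⟩).symm
  rw [hz, hκ _ _ hconn]
  rcases lt_or_gt_of_ne hη0 with h3 | h3
  · rw [abs_of_neg h3] at e4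
    have := conn_sidePt o b (x := -1) (by simp) (neg_pos.2 h3) e4
    rw [show -1 * -η = η by ring] at this
    exact hκ _ _ this
  · rw [abs_of_pos h3] at e4
    have := conn_sidePt o b (x := 1) (by simp) h3 e4
    rw [one_mul] at this
    rw [hκ _ _ this, hside]

/-- A function on the complement of the projection that is constant along paths and does not
change across the arcs and the circles is constant. -/
theorem eq_of_sides {α : Type*} {κ : ℂ → α} (hκ : ∀ z w, D.Conn z w → κ z = κ w)
    (hside : ∀ b, κ (D.sidePt true 1 b) = κ (D.sidePt true (-1) b))
    (hcirc : ∀ v, κ (D.basePt false v) = κ (D.basePt true v))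
    {z w : ℂ} (hz : z ∉ D.proj) (hw : w ∉ D.proj) : κ z = κ w := by
  have hside' : ∀ o b, κ (D.sidePt o 1 b) = κ (D.sidePt o (-1) b) := fun o b => by
    cases o
    · exact hκ _ _ (conn_inner b)
    · exact hside b
  -- The ends of the arcs need no local analysis: they are finitely many, and removing them leaves
  -- the plane connected.
  set F : Set ℂ := Set.range fun b => D.crv b 0
  have hloc : ∀ p, p ∉ F → ∃ c, ∀ᶠ z in 𝓝 p, z ∉ D.proj → κ z = c := by
    intro p hpF
    by_cases hp : p ∈ D.proj
    swap
    · obtain ⟨r, hr, hsub⟩ := Metric.isOpen_iff.1 isCompact_proj.isClosed.isOpen_compl p hp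
      refine ⟨κ p, ?_⟩
      filter_upwards [Metric.ball_mem_nhds p hr] with z hz _
      exact hκ _ _ ((((convex_ball p r).isPathConnected ⟨p, Metric.mem_ball_self hr⟩).joinedIn
        _ hz _ (Metric.mem_ball_self hr)).mono hsub)
    by_cases hc : p ∈ D.circles
    · obtain ⟨v, hv⟩ := mem_circles.1 hc
      have hnear : ∀ᶠ z in 𝓝 p, |‖z - D.center v‖ - D.radius v| < D.tubeRadius v := by
        have : Continuous fun z : ℂ => |‖z - D.center v‖ - D.radius v| := by fun_prop
        exact this.continuousAt.eventually (gt_mem_nhds (by simpa [hv] using tubeRadius_pos v))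
      refine ⟨κ (D.basePt true v), ?_⟩
      filter_upwards [hnear] with z hz hzp
      have hne : ‖z - D.center v‖ ≠ D.radius v := fun h => hzp (Or.inr (mem_circles.2 ⟨v, h⟩))
      have hg := isGood_of_lt hz hne
      rcases lt_or_gt_of_ne hne with h1 | h1
      · rw [hg.eq_circ hκ (hside' false) (by simpa using h1.le) rfl hzp, ← hcirc]
        exact hκ _ _ (conn_basePt hz (by simp [sgn, h1]))
      · rw [hg.eq_circ hκ (hside' true) (by simpa using h1) rfl hzp]
        exact hκ _ _ (conn_basePt hz (by simp [sgn, h1]))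
    · obtain ⟨b, t, ht, rfl⟩ := mem_arcs.1 (hp.resolve_right hc)
      rw [crv_mem_circles b ht] at hc
      push Not at hc
      have h0 : t ≠ 0 := by rintro rfl; exact hpF ⟨b, rfl⟩
      have h1 : t ≠ 1 := by
        rintro rfl
        exact hpF ⟨flip b, by simp [crv_flip]⟩
      rcases lt_or_gt_of_ne hc.2 with h2 | h2
      · exact eventually_eq_crv hκ hside' b (lt_of_le_of_ne ht.1 h0.symm) h2 hc.1
      · have := eventually_eq_crv hκ hside' (flip b) (t := 1 - t)
          (by have := lt_of_le_of_ne ht.2 h1; linarith)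
          (by rw [flip_flip]; linarith [D.exT_add_lt b]) (by linarith)
        rwa [crv_flip, sub_sub_cancel] at this
  have hF : IsPreconnected Fᶜ :=
    ((Set.finite_range _).countable.isPathConnected_compl_of_one_lt_rank
      (by rw [Complex.rank_real_complex]; norm_num)).isConnected.isPreconnected
  have hopen : ∀ P : ℂ → Prop, IsOpen {p | ∀ᶠ z in 𝓝 p, P z} := fun P =>
    isOpen_iff_mem_nhds.2 fun p hp => eventually_eventually_nhds.2 hp
  have hproj : ∀ p, p ∉ D.proj → p ∉ F := by
    rintro _ hp ⟨b, rfl⟩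
    exact hp (Or.inl (crv_mem_arcs b (by simp)))
  have hmem : ∀ p, p ∉ D.proj → ∀ᶠ z in 𝓝 p, z ∉ D.proj := fun p hp =>
    isCompact_proj.isClosed.isOpen_compl.mem_nhds hp
  by_contra hne
  -- The points near which `κ` takes the value `κ w`, and those near which it does not, are open and
  -- cover a connected set; a common point contradicts density of the complement of the projection.
  obtain ⟨p, -, hp1, hp2⟩ := hF _ _ (hopen fun x => x ∉ D.proj → κ x = κ w)
    (hopen fun x => x ∉ D.proj → κ x ≠ κ w) (fun p hp => by
      obtain ⟨c, hc⟩ := hloc p hp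
      by_cases h : c = κ w
      · exact Or.inl (hc.mono fun x hx hxp => (hx hxp).trans h)
      · exact Or.inr (hc.mono fun x hx hxp => (hx hxp).trans_ne h))
    ⟨w, hproj w hw, by
      obtain ⟨c, hc⟩ := hloc w (hproj w hw)
      rw [← hc.self_of_nhds hw] at hc
      exact hc⟩
    ⟨z, hproj z hz, by
      obtain ⟨c, hc⟩ := hloc z (hproj z hz)
      rw [← hc.self_of_nhds hz] at hc
      exact hc.mono fun x hx hxp => (hx hxp).trans_ne hne⟩
  obtain ⟨x, hx, hxp⟩ := mem_closure_iff_nhds.1 (dense_proj_compl (D := D) p) _ (hp1.and hp2)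
  exact hx.2 hxp (hx.1 hxp)

end PlaneDrawing

/-! ### The preorder on arrows to the base point -/

section HomPreorder

variable {C : Type*} [Groupoid C] {x₀ q q' : C} {le : End x₀ → End x₀ → Prop}

theorem IsLeftTotalPreorder.one_le_inv_iff (hle : IsLeftTotalPreorder le) {g : End x₀} :
    le 1 g⁻¹ ↔ le g 1 := by
  refine ⟨fun h => ?_, fun h => ?_⟩
  · simpa using hle.mul_left g _ _ h
  · simpa using hle.mul_left g⁻¹ _ _ h

/-- A left total preorder on the vertex group at `x₀` induces a preorder on the arrows to `x₀`. -/
@[reducible]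
def homPreorder (hle : IsLeftTotalPreorder le) (q : C) : Preorder (q ⟶ x₀) where
  le h k := le 1 (Groupoid.inv h ≫ k : x₀ ⟶ x₀)
  le_refl h := by
    rw [Groupoid.inv_comp]; exact hle.refl 1
  le_trans h k l hk hl := by
    have h1 := hle.mul_left (Groupoid.inv k ≫ l : x₀ ⟶ x₀) _ _ hk
    rw [mul_one, End.mul_def, Category.assoc, ← Category.assoc k, Groupoid.comp_inv,
      Category.id_comp] at h1
    exact hle.trans _ _ _ hl h1

variable (hle : IsLeftTotalPreorder le)

/-- The arrow `c` cancels in the quotient; left invariance of `le` enters only through transitivity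
and totality. -/
theorem comp_le_comp_iff (c : q ⟶ q') (h k : q' ⟶ x₀) :
    (homPreorder hle q).le (c ≫ h) (c ≫ k) ↔ (homPreorder hle q').le h k := by
  change le 1 _ ↔ le 1 _
  simp

theorem inv_comp_le_iff (c : q' ⟶ q) (h : q' ⟶ x₀) (k : q ⟶ x₀) :
    (homPreorder hle q).le (Groupoid.inv c ≫ h) k ↔ (homPreorder hle q').le h (c ≫ k) := by
  rw [← comp_le_comp_iff hle c]
  simp

theorem le_inv_comp_iff (c : q' ⟶ q) (h : q' ⟶ x₀) (k : q ⟶ x₀) :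
    (homPreorder hle q).le k (Groupoid.inv c ≫ h) ↔ (homPreorder hle q').le (c ≫ k) h := by
  rw [← comp_le_comp_iff hle c]
  simp

theorem one_le_conj_iff (h : q ⟶ x₀) (a : q ⟶ q) :
    le 1 (Groupoid.inv h ≫ a ≫ h : x₀ ⟶ x₀) ↔ (homPreorder hle q).le h (a ≫ h) := Iff.rfl

theorem conj_le_one_iff (h : q ⟶ x₀) (a : q ⟶ q) :
    le (Groupoid.inv h ≫ a ≫ h : x₀ ⟶ x₀) 1 ↔ (homPreorder hle q).le (a ≫ h) h := by
  rw [← hle.one_le_inv_iff]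
  change le 1 (Groupoid.inv (Groupoid.inv h ≫ a ≫ h) : x₀ ⟶ x₀) ↔
    le 1 (Groupoid.inv (a ≫ h) ≫ h : x₀ ⟶ x₀)
  simp

theorem homPreorder_total (h k : q ⟶ x₀) :
    (homPreorder hle q).le h k ∨ (homPreorder hle q).le k h := by
  have h1 := hle.total 1 (Groupoid.inv h ≫ (k ≫ Groupoid.inv h) ≫ h : x₀ ⟶ x₀)
  rw [one_le_conj_iff hle, conj_le_one_iff hle] at h1
  simpa using h1

/-- The exponent vectors `(1, 0)` and `(0, -1)` lie on the same side of a line of positive slope.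
For a negative slope they are `(1, 0)` and `(0, 1)`. Only these signs are used. -/
theorem WeaklyDetectsPositive.iff (hle : IsLeftTotalPreorder le) {m l : End x₀} (hd : WeaklyDetectsPositive le m l) :
    (le 1 m ↔ le l 1) ∧ (le m 1 ↔ le 1 l) := by
  obtain ⟨x, y, hxy, hd⟩ := hd
  rw [← hle.one_le_inv_iff, ← hle.one_le_inv_iff (g := m)]
  refine ⟨⟨fun h => ?_, fun h => ?_⟩, ⟨fun h => ?_, fun h => ?_⟩⟩
  · simpa using hd 1 0 0 (-1) (by simpa using h) (by simpa [mul_comm] using hxy)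
  · simpa using hd 0 (-1) 1 0 (by simpa using h) (by simpa [mul_comm] using hxy)
  · simpa using hd (-1) 0 0 1 (by simpa using h) (by simpa [mul_comm] using hxy)
  · simpa using hd 0 1 (-1) 0 (by simpa using h) (by simpa [mul_comm] using hxy)

theorem WeaklyDetectsNegative.iff (hle : IsLeftTotalPreorder le) {m l : End x₀} (hd : WeaklyDetectsNegative le m l) :
    (le 1 m ↔ le 1 l) ∧ (le m 1 ↔ le l 1) := by
  obtain ⟨x, y, hxy, hd⟩ := hd
  rw [← hle.one_le_inv_iff, ← hle.one_le_inv_iff (g := l)]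
  refine ⟨⟨fun h => ?_, fun h => ?_⟩, ⟨fun h => ?_, fun h => ?_⟩⟩
  · simpa using hd 1 0 0 1 (by simpa using h) (by simpa [mul_comm] using hxy)
  · simpa using hd 0 1 1 0 (by simpa using h) (by simpa [mul_comm] using hxy)
  · simpa using hd (-1) 0 0 (-1) (by simpa using h) (by simpa [mul_comm] using hxy)
  · simpa using hd 0 (-1) (-1) 0 (by simpa using h) (by simpa [mul_comm] using hxy)

/-- Any two arrows differ by a group element, so a condition on all conjugates is a condition on all
states. -/
theorem exists_conj_eq (w h : q ⟶ x₀) : ∃ g : End x₀, ∀ (m : End x₀) (a : q ⟶ q),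
    m = (Groupoid.inv w ≫ a ≫ w : x₀ ⟶ x₀) →
      g * m * g⁻¹ = (Groupoid.inv h ≫ a ≫ h : x₀ ⟶ x₀) := by
  refine ⟨(Groupoid.inv w ≫ h : x₀ ⟶ x₀), ?_⟩
  rintro _ a rfl
  change Groupoid.inv (Groupoid.inv w ≫ h) ≫ (Groupoid.inv w ≫ a ≫ w) ≫ Groupoid.inv w ≫ h = _
  simp

variable {m l : End x₀} {w : q ⟶ x₀} {a b : q ⟶ q}

theorem WeaklyDetectsPositive.comp_iff (hd : WeaklyDetectsPositive le m l)
    (hm : m = (Groupoid.inv w ≫ a ≫ w : x₀ ⟶ x₀)) (hl : l = (Groupoid.inv w ≫ b ≫ w : x₀ ⟶ x₀)) :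
    ((homPreorder hle q).le w (a ≫ w) ↔ (homPreorder hle q).le (b ≫ w) w) ∧
      ((homPreorder hle q).le (a ≫ w) w ↔ (homPreorder hle q).le w (b ≫ w)) := by
  have h1 := hd.iff hle
  rw [hm, hl] at h1
  rwa [one_le_conj_iff hle, one_le_conj_iff hle, conj_le_one_iff hle, conj_le_one_iff hle] at h1

theorem WeaklyDetectsNegative.comp_iff (hd : WeaklyDetectsNegative le m l)
    (hm : m = (Groupoid.inv w ≫ a ≫ w : x₀ ⟶ x₀)) (hl : l = (Groupoid.inv w ≫ b ≫ w : x₀ ⟶ x₀)) :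
    ((homPreorder hle q).le w (a ≫ w) ↔ (homPreorder hle q).le w (b ≫ w)) ∧
      ((homPreorder hle q).le (a ≫ w) w ↔ (homPreorder hle q).le (b ≫ w) w) := by
  have h1 := hd.iff hle
  rw [hm, hl] at h1
  rwa [one_le_conj_iff hle, one_le_conj_iff hle, conj_le_one_iff hle, conj_le_one_iff hle] at h1

theorem StronglyDetects.comp_iff (hd : StronglyDetects le m l 0 1)
    (hl : l = (Groupoid.inv w ≫ b ≫ w : x₀ ⟶ x₀)) (h : q ⟶ x₀) :
    (homPreorder hle q).le (b ≫ h) h ∧ (homPreorder hle q).le h (b ≫ h) := by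
  obtain ⟨g, hg⟩ := exists_conj_eq w h
  have h1 := hd g
  rw [zpow_zero, zpow_one, one_mul, hg l b hl] at h1
  exact ⟨(conj_le_one_iff hle h b).1 h1.2, h1.1⟩

end HomPreorder

/-! ### Meridians and longitudes as loops at infinity -/

namespace PlaneDrawing

variable {V E : Type*} {D : PlaneDrawing V E} {c : V ⊕ E} {δ : ℝ}

theorem tube_add_one_left (c : V ⊕ E) (δ s θ : ℝ) : D.tube c δ (s + 1) θ = D.tube c δ s θ := by
  have e : 2 * Real.pi * (s + 1) = 2 * Real.pi * s + 2 * Real.pi := by ring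
  cases c <;> simp [tube, e]

theorem tube_add_one_right (c : V ⊕ E) (δ s θ : ℝ) : D.tube c δ s (θ + 1) = D.tube c δ s θ := by
  have e : 2 * Real.pi * (θ + 1) = 2 * Real.pi * θ + 2 * Real.pi := by ring
  cases c <;> simp [tube, e]

variable (D) in
theorem continuous_tube_uncurry (c : V ⊕ E) :
    Continuous fun z : ℝ × ℝ × ℝ => D.tube c z.1 z.2.1 z.2.2 := by
  cases c with
  | inl v =>
    simp only [tube]
    fun_prop
  | inr e =>
    have h1 : Continuous (D.curve e) := (D.curve_smooth e).continuous
    have h2 : Continuous (deriv (D.curve e)) :=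
      (D.curve_smooth e).continuous_deriv (by simp)
    simp only [tube]
    fun_prop

theorem gen_eq_path {g : I → ℂ × ℝ} (hg : Continuous g) {p q : ℂ × ℝ} {i j : Bool}
    (hp : D.Free i p) (hq : D.Free j q) (γ : Path (D.pt p hp.notMem) (D.pt q hq.notMem))
    (h : ∀ t, (γ t).1 = (g t : ThreeSphere)) :
    D.gen g i j = cls hp.path ≫ cls γ ≫ Groupoid.inv (cls hq.path) := by
  have h0 := h 0
  have h1 := h 1
  rw [γ.source] at h0
  rw [γ.target] at h1
  obtain rfl : p = g 0 := OnePoint.coe_injective h0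
  obtain rfl : q = g 1 := OnePoint.coe_injective h1
  have hl : ∀ t, g t ∉ D.link := fun t hm => (γ t).2 ⟨_, hm, (h t).symm⟩
  rw [gen_of_ok ⟨hg, hl, hp, hq⟩]
  have : γ = seg hg hl := Path.ext (funext fun t => Subtype.ext (h t))
  rw [this]

namespace IsTubeRadius

/-- Two loops that are the ends of a map of an annulus are conjugate. -/
theorem conj_loop {x y : D.exterior} {K : I × I → D.exterior} (hK : Continuous K)
    {p : Path x x} {q : Path y y} {u : Path x y} (hp : ∀ t, p t = K (t, 0))
    (hq : ∀ t, q t = K (t, 1)) (hu : ∀ t, u t = K (0, t)) (hu' : ∀ t, u t = K (1, t)) :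
    cls p = cls u ≫ cls q ≫ Groupoid.inv (cls u) := by
  rw [← Category.assoc, ← cls_square hK hp hq hu hu']
  simp

/-- Shrinking the tube and moving the starting point along the torus at once gives one path that
conjugates meridian and longitude simultaneously. -/
theorem exists_gen (h : D.IsTubeRadius c δ) {ε : ℝ} (h0 : 0 < ε) (hε : ε ≤ δ) {s₀ θ₀ : ℝ}
    (hf : D.Free true (D.tube c ε s₀ θ₀)) :
    ∃ w : FundamentalGroupoid.mk (h.torus 0 0) ⟶ D.base,
      cls h.meridian = w ≫ D.gen (fun u : I => D.tube c ε (s₀ + u) θ₀) true true ≫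
        Groupoid.inv w ∧
      cls h.longitude = w ≫ D.gen (fun u : I => D.tube c ε s₀ (θ₀ + u)) true true ≫
        Groupoid.inv w := by
  have hr : ∀ t : I, 0 < δ + t * (ε - δ) ∧ δ + t * (ε - δ) ≤ δ := fun t =>
    ⟨by nlinarith [t.2.1, t.2.2], by nlinarith [t.2.1]⟩
  have hl : ∀ (t : I) s θ, D.tube c (δ + t * (ε - δ)) s θ ∉ D.link := fun t s θ =>
    h.2 _ (hr t).1 (hr t).2 s θ
  have hl' : ∀ s θ, D.tube c ε s θ ∉ D.link := fun s θ => h.2 _ h0 hε s θ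
  have hT := D.continuous_tube_uncurry c
  let u : Path (h.torus 0 0) (D.pt _ hf.notMem) :=
    { toFun := fun t => D.pt (D.tube c (δ + t * (ε - δ)) (t * s₀) (t * θ₀)) (hl _ _ _)
      continuous_toFun := continuous_pt (hT.comp (by fun_prop :
        Continuous fun t : I => (δ + (t : ℝ) * (ε - δ), (t : ℝ) * s₀, (t : ℝ) * θ₀))) _
      source' := Subtype.ext (by simp [pt, torus])
      target' := Subtype.ext (by simp [pt]) }
  let m : Path (D.pt _ hf.notMem) (D.pt _ hf.notMem) :=
    { toFun := fun t => D.pt (D.tube c ε (s₀ + t) θ₀) (hl' _ _)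
      continuous_toFun := continuous_pt (hT.comp (by fun_prop :
        Continuous fun t : I => (ε, s₀ + (t : ℝ), θ₀))) _
      source' := Subtype.ext (by simp [pt])
      target' := Subtype.ext (by simp [pt, tube_add_one_left]) }
  let l : Path (D.pt _ hf.notMem) (D.pt _ hf.notMem) :=
    { toFun := fun t => D.pt (D.tube c ε s₀ (θ₀ + t)) (hl' _ _)
      continuous_toFun := continuous_pt (hT.comp (by fun_prop :
        Continuous fun t : I => (ε, s₀, θ₀ + (t : ℝ)))) _
      source' := Subtype.ext (by simp [pt])
      target' := Subtype.ext (by simp [pt, tube_add_one_right]) }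
  have hm := gen_eq_path (g := fun u : I => D.tube c ε (s₀ + u) θ₀)
    (hT.comp (by fun_prop : Continuous fun t : I => (ε, s₀ + (t : ℝ), θ₀))) hf hf m fun _ => rfl
  have hlo := gen_eq_path (g := fun u : I => D.tube c ε s₀ (θ₀ + u))
    (hT.comp (by fun_prop : Continuous fun t : I => (ε, s₀, θ₀ + (t : ℝ)))) hf hf l fun _ => rfl
  have hext : ∀ {p q : ℂ × ℝ} {x y : D.exterior}, p = q → x.1 = (p : ThreeSphere) →
      y.1 = (q : ThreeSphere) → x = y := fun h h1 h2 => Subtype.ext (h1.trans (h ▸ h2.symm))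
  refine ⟨cls u ≫ Groupoid.inv (cls hf.path), ?_, ?_⟩
  · rw [hm, conj_loop (K := fun z => D.pt (D.tube c (δ + z.2 * (ε - δ)) (z.2 * s₀ + z.1)
      (z.2 * θ₀)) (hl _ _ _)) (continuous_pt (hT.comp (by fun_prop :
        Continuous fun z : I × I => (δ + (z.2 : ℝ) * (ε - δ), (z.2 : ℝ) * s₀ + z.1,
          (z.2 : ℝ) * θ₀))) _) (p := h.meridian) (q := m) (u := u)
      (fun t => hext (by simp) rfl rfl)
      (fun t => hext (by simp) rfl rfl) (fun t => hext (by simp) rfl rfl)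
      (fun t => hext (by simp [tube_add_one_left]) rfl rfl)]
    simp
  · rw [hlo, conj_loop (K := fun z => D.pt (D.tube c (δ + z.2 * (ε - δ)) (z.2 * s₀)
      (z.2 * θ₀ + z.1)) (hl _ _ _)) (continuous_pt (hT.comp (by fun_prop :
        Continuous fun z : I × I => (δ + (z.2 : ℝ) * (ε - δ), (z.2 : ℝ) * s₀,
          (z.2 : ℝ) * θ₀ + z.1))) _) (p := h.longitude) (q := l) (u := u)
      (fun t => hext (by simp) rfl rfl)
      (fun t => hext (by simp) rfl rfl) (fun t => hext (by simp) rfl rfl)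
      (fun t => hext (by simp [tube_add_one_right]) rfl rfl)]
    simp

end IsTubeRadius

/-- Meridian-longitude pairs in terms of loops at infinity. -/
theorem IsMeridianLongitudePair.exists_gen {x₀ : D.exterior} {m l : FundamentalGroup D.exterior x₀}
    (h : D.IsMeridianLongitudePair c x₀ m l) : ∃ δ > 0, ∀ ε, 0 < ε → ε ≤ δ →
      (∀ s θ, D.tube c ε s θ ∉ D.link) ∧ ∀ s₀ θ₀, D.Free true (D.tube c ε s₀ θ₀) →
      ∃ w : D.base ⟶ FundamentalGroupoid.mk x₀,
        m = (Groupoid.inv w ≫ D.gen (fun u : I => D.tube c ε (s₀ + u) θ₀) true true ≫ w :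
          FundamentalGroupoid.mk x₀ ⟶ _) ∧
        l = (Groupoid.inv w ≫ D.gen (fun u : I => D.tube c ε s₀ (θ₀ + u)) true true ≫ w :
          FundamentalGroupoid.mk x₀ ⟶ _) := by
  obtain ⟨δ, h, w, rfl, rfl⟩ := h
  refine ⟨δ, h.1, fun ε h0 hε => ⟨h.2 ε h0 hε, fun s₀ θ₀ hf => ?_⟩⟩
  obtain ⟨w', h1, h2⟩ := h.exists_gen h0 hε hf
  refine ⟨Groupoid.inv w' ≫ Groupoid.inv (cls w), ?_, ?_⟩
  · change (cls w ≫ cls h.meridian) ≫ Groupoid.inv (cls w) = _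
    rw [h1]; simp
  · change (cls w ≫ cls h.longitude) ≫ Groupoid.inv (cls w) = _
    rw [h2]; simp

end PlaneDrawing

/-! ### The meridians and longitudes of the vertex loops and edge loops -/

namespace PlaneDrawing

variable {V E : Type*} {D : PlaneDrawing V E}

theorem tube_inl (v : V) (ε s θ : ℝ) : D.tube (Sum.inl v) ε s θ =
    (D.circ v (D.radius v - ε * Real.cos (2 * Real.pi * s)) (2 * Real.pi * θ),
      ε * Real.sin (2 * Real.pi * s)) := by
  simp only [tube, circ, Complex.exp_mul_I, Complex.ofReal_cos, Complex.ofReal_sin]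

theorem tube_inr (e : E) (ε s θ : ℝ) : D.tube (Sum.inr e) ε s θ =
    (D.nrm (e, true) (1 / 2 + (1 / 2 - ε * Real.cos (2 * Real.pi * s)) * Real.cos (2 * Real.pi * θ))
      (ε * Real.sin (2 * Real.pi * s)),
      -((1 / 2 - ε * Real.cos (2 * Real.pi * s)) * Real.sin (2 * Real.pi * θ))) := rfl

/-- A loop at infinity whose middle part can be seen from the other side. -/
theorem genOn_of_free_not {f : ℝ → ℂ × ℝ} (hf : Continuous f) {i : Bool} {a b : ℝ} (hab : a ≤ b)
    (h : ∀ t ∈ Set.Icc a b, D.Free (!i) (f t)) (ha : D.Free i (f a)) (hb : D.Free i (f b)) :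
    D.genOn f a b i i = D.vert (f a) i (!i) ≫ D.vert (f b) (!i) i := by
  have hl : ∀ u : I, f (a + u * (b - a)) ∉ D.link := fun u =>
    (h _ (add_mul_sub_mem hab u)).notMem
  have ha' := h a ⟨le_rfl, hab⟩
  have hb' := h b ⟨hab, le_rfl⟩
  have hok : ∀ j, D.Free j (f b) → D.Ok (fun u : I => f (a + u * (b - a))) (!i) j := fun j hj =>
    ⟨hf.comp (by fun_prop), hl, by simpa using ha', by simpa using hj⟩
  have e1 := vert_comp_gen (hok i hb) (k := i) (by simpa using ha)
  have e2 := gen_comp_vert (hok (!i) hb') (k := i) (by simpa using hb)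
  have e3 := genOn_free hf hab h
  simp only [Set.Icc.coe_zero, zero_mul, add_zero, Set.Icc.coe_one, one_mul,
    add_sub_cancel] at e1 e2
  unfold genOn at e3 ⊢
  rw [← e1, ← e2, e3, Category.id_comp]

variable [Finite V] [Finite E]

variable (D) in
/-- The loop through the disk of `v` (for false), or through the plane next to it. -/
def baseDrop (o : Bool) (v : V) : D.base ⟶ D.base := D.drop (D.basePt o v)

/-- The meridian starts inside the disk. Its upper half is visible from above and contributes
nothing; its lower half is visible from below, which leaves the changes of direction outside and
inside the circle. -/
theorem meridian_vertex {v : V} {ε : ℝ} (h0 : 0 < ε) (hε : ε < D.tubeRadius v) :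
    D.gen (fun u : I => D.tube (Sum.inl v) ε (0 + u) (D.baseAngle v / (2 * Real.pi))) true true =
      D.baseDrop true v ≫ Groupoid.inv (D.baseDrop false v) := by
  have hpi := Real.pi_pos
  have hθ : 2 * Real.pi * (D.baseAngle v / (2 * Real.pi)) = D.baseAngle v := by field_simp
  have hf := (D.continuous_tube_uncurry (Sum.inl v)).comp (by fun_prop :
    Continuous fun s : ℝ => (ε, s, D.baseAngle v / (2 * Real.pi)))
  have hr : ∀ s, |D.radius v - ε * Real.cos (2 * Real.pi * s) - D.radius v| < D.tubeRadius v := by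
    intro s
    have h1 := Real.abs_cos_le_one (2 * Real.pi * s)
    rw [sub_sub_cancel_left, abs_neg, abs_mul, abs_of_pos h0]
    nlinarith
  have hfree : ∀ i s, 0 ≤ sgn i * Real.sin (2 * Real.pi * s) →
      D.Free i (D.tube (Sum.inl v) ε s (D.baseAngle v / (2 * Real.pi))) := by
    intro i s hs
    rw [tube_inl, hθ]
    refine free_of_notMem_arcs (circ_baseAngle_notMem_arcs (hr s)) ?_
    rcases hs.lt_or_eq with hs | hs
    · exact Or.inl (by nlinarith)
    · refine Or.inr (circ_notMem_circles (hr s) (fun h => ?_) _)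
      have h1 : Real.cos (2 * Real.pi * s) = 0 := by
        have : ε * Real.cos (2 * Real.pi * s) = 0 := by linarith
        exact (mul_eq_zero.1 this).resolve_left h0.ne'
      have h2 : Real.sin (2 * Real.pi * s) = 0 :=
        (mul_eq_zero.1 hs.symm).resolve_left (by cases i <;> simp [sgn])
      have := Real.sin_sq_add_cos_sq (2 * Real.pi * s)
      rw [h1, h2] at this
      norm_num at this
  have hup : ∀ t ∈ Set.Icc (0 : ℝ) (1 / 2), D.Free true
      (D.tube (Sum.inl v) ε t (D.baseAngle v / (2 * Real.pi))) := fun t ht => hfree _ _ (by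
    have := Real.sin_nonneg_of_nonneg_of_le_pi (x := 2 * Real.pi * t)
      (by nlinarith [ht.1]) (by nlinarith [ht.2])
    simpa [sgn] using this)
  have hdown : ∀ t ∈ Set.Icc (1 / 2 : ℝ) 1, D.Free false
      (D.tube (Sum.inl v) ε t (D.baseAngle v / (2 * Real.pi))) := fun t ht => hfree _ _ (by
    have := Real.sin_nonneg_of_nonneg_of_le_pi (x := 2 * Real.pi * t - Real.pi)
      (by nlinarith [ht.1]) (by nlinarith [ht.2])
    rw [Real.sin_sub_pi] at this
    simpa [sgn] using this)
  have h1 := genOn_of_free_not (D := D) hf (i := true) (a := 1 / 2) (b := 1) (by norm_num)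
    hdown (hup _ ⟨by norm_num, le_rfl⟩) (hfree _ _ (by simp))
  rw [← Category.id_comp (D.genOn _ _ _ _ _), ← genOn_free hf (by norm_num : (0 : ℝ) ≤ 1 / 2) hup,
    genOn_trans hf (by norm_num) (by norm_num) (fun t ht => (le_total t (1 / 2)).elim
      (fun h => (hup t ⟨ht.1, h⟩).notMem) fun h => (hdown t ⟨h, ht.2⟩).notMem)
      (hup _ ⟨le_rfl, by norm_num⟩) (hup _ ⟨by norm_num, le_rfl⟩) (hfree _ _ (by simp))] at h1
  · have e : D.gen (fun u : I => D.tube (Sum.inl v) ε (0 + u) (D.baseAngle v / (2 * Real.pi)))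
        true true = _ := (congrArg (D.gen · true true) (funext fun u => by simp)).trans h1
    rw [e]
    simp only [Function.comp, tube_inl, hθ]
    rw [show 2 * Real.pi * (1 / 2) = Real.pi by ring, mul_one, Real.cos_pi, Real.sin_pi,
      Real.cos_two_pi, Real.sin_two_pi, mul_zero]
    have c1 := (conn_basePt (D := D) (v := v) (ρ := D.radius v - ε * -1) (o := true)
      (by rw [abs_of_pos] <;> linarith) (by simp [sgn, h0])).drop_eq
    have c2 := (conn_basePt (D := D) (v := v) (ρ := D.radius v - ε * 1) (o := false)
      (by rw [abs_of_neg] <;> linarith) (by simp [sgn, h0])).drop_eq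
    have f1 := hfree true 1 (by simp)
    have f2 := hfree false 1 (by simp)
    rw [tube_inl, hθ, mul_one, Real.cos_two_pi, Real.sin_two_pi, mul_zero] at f1 f2
    unfold baseDrop
    rw [← c1, ← c2, drop, drop, vert_inv f1 f2]
    rfl

theorem longitude_vertex {v : V} {ε : ℝ} (h0 : 0 < ε) (hε : ε < D.tubeRadius v) :
    D.gen (fun u : I => D.tube (Sum.inl v) ε 0 (D.baseAngle v / (2 * Real.pi) + u)) true true =
      IsGood.crossProd D (D.darts v) := by
  have hg := isGood_of_lt (D := D) (v := v) (ρ := D.radius v - ε)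
    (by rw [abs_of_neg] <;> linarith) (by linarith)
  rw [← hg.genOn_circ, genOn]
  congr 1
  funext u
  rw [tube_inl, mul_zero, Real.cos_zero, Real.sin_zero, mul_zero, mul_one]
  congr 2
  field_simp
  ring

theorem drop_sidePt (b : E × Bool) {x : ℝ} (hx : x = 1 ∨ x = -1) :
    D.drop (D.sidePt false x b) = D.baseDrop false (D.tail b) := by
  have h : D.drop (D.sidePt false (-1) b) = D.baseDrop false (D.tail b) :=
    IsGood.eq_base (fun _ _ h => h.drop_eq) (fun b => (conn_inner b).drop_eq)
      (isGood_basePt false (D.tail b)).2.2 (isGood_basePt false (D.tail b)).2.1 rfl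
  rcases hx with rfl | rfl
  · rw [(conn_inner b).drop_eq, h]
  · exact h

theorem exists_drop_nrm (b : E × Bool) : ∃ ε > 0, ∀ η, η ≠ 0 → |η| ≤ ε →
    D.drop (D.nrm b 0 η) = D.baseDrop false (D.tail b) := by
  have h1 := D.exT_pos b
  have h2 := D.exT_add_lt b
  have h3 := D.exT_pos (flip b)
  have hu : Set.uIcc 0 (D.exT b / 2) = Set.Icc 0 (D.exT b / 2) := Set.uIcc_of_le (by linarith)
  obtain ⟨η₁, hη₁, hη⟩ := exists_conn_nrm (D := D) b (t₁ := 0) (t₂ := D.exT b / 2)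
    (by rw [hu]; exact Set.Icc_subset_Icc le_rfl (by linarith))
    (by rw [hu]; exact fun h => by linarith [h.2]) (by rw [hu]; exact fun h => by linarith [h.2])
  refine ⟨min η₁ D.eps, lt_min hη₁ eps_pos, fun η h0 hle => ?_⟩
  have e4 := hle.trans (min_le_right _ _)
  rw [(hη η h0 (hle.trans (min_le_left _ _)) 0 Set.left_mem_uIcc).drop_eq]
  rcases lt_or_gt_of_ne h0 with h | h
  · rw [abs_of_neg h] at e4
    have := conn_sidePt false b (x := -1) (by simp) (neg_pos.2 h) e4
    rw [show -1 * -η = η by ring] at this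
    exact this.drop_eq.trans (drop_sidePt b (Or.inr rfl))
  · rw [abs_of_pos h] at e4
    have := conn_sidePt false b (x := 1) (by simp) h e4
    rw [one_mul] at this
    exact this.drop_eq.trans (drop_sidePt b (Or.inl rfl))

omit [Finite E] in
theorem exists_nrm_notMem_circles (b : E × Bool) : ∃ ε > 0, ∀ t η, |t - 1| ≤ ε → |η| ≤ ε →
    D.nrm b t η ∉ D.circles := by
  have hc : D.crv b 1 ∉ D.circles := by
    rw [crv_mem_circles b (by simp)]
    have h1 := D.exT_lt_one b
    have h2 := D.exT_pos (flip b)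
    rintro (h | h) <;> linarith
  have h := (D.continuous_nrm b).continuousAt (x := ((1 : ℝ), (0 : ℝ)))
  have h2 := h.eventually (isCompact_circles.isClosed.isOpen_compl.mem_nhds
    (by simpa [nrm_zero] using hc))
  obtain ⟨r, hr, hall⟩ := Metric.eventually_nhds_iff.1 h2
  refine ⟨r / 2, by linarith, fun t η ht hη => hall (y := (t, η)) ?_⟩
  rw [Prod.dist_eq, Real.dist_eq, Real.dist_eq, sub_zero]
  exact max_lt (by linarith) (by linarith)

/-- At `θ = 0` the meridian is a small horizontal loop around the end of the arc in the target disk.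
Started on the right, at `s = -1/4`, it first crosses the arc and then returns freely around the
end. -/
theorem meridian_edge (e : E) : ∃ ε₀ > 0, ∀ ε, 0 < ε → ε ≤ ε₀ →
    D.Free true (D.tube (Sum.inr e) ε (-(1 / 4)) 0) ∧
    D.gen (fun u : I => D.tube (Sum.inr e) ε (-(1 / 4) + u) 0) true true =
      D.cross (e, true) true := by
  have hpi := Real.pi_pos
  set b : E × Bool := (e, true)
  obtain ⟨R, hR, hcirc⟩ := exists_nrm_notMem_circles (D := D) b
  refine ⟨min R (min D.eps (1 / 4)), lt_min hR (lt_min eps_pos (by norm_num)), fun ε h0 hε => ?_⟩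
  have hε1 : ε ≤ R := hε.trans (min_le_left _ _)
  have hε2 : ε ≤ D.eps := hε.trans ((min_le_right _ _).trans (min_le_left _ _))
  have hε3 : ε ≤ 1 / 4 := hε.trans ((min_le_right _ _).trans (min_le_right _ _))
  have hp : ∀ t η, |t - 1| ≤ ε → |η| ≤ ε → (η ≠ 0 ∨ t ∉ I) → D.nrm b t η ∉ D.proj := by
    intro t η ht hη h hm
    have a1 := abs_le.1 ht
    exact hm.elim (nrm_notMem_arcs b ⟨by linarith, by linarith⟩ (hη.trans hε2) h)
      (hcirc t η (ht.trans hε1) (hη.trans hε1))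
  set f : ℝ → ℂ × ℝ := fun s =>
    (D.nrm b (1 - ε * Real.cos (2 * Real.pi * s)) (ε * Real.sin (2 * Real.pi * s)), 0) with hf
  have htube : ∀ s, D.tube (Sum.inr e) ε s 0 = f s := fun s => by
    simp only [tube_inr, hf, mul_zero, Real.cos_zero, Real.sin_zero, mul_one, neg_zero]
    congr 2
    ring
  have hfc : Continuous f := Continuous.prodMk ((D.continuous_nrm b).comp (by fun_prop :
    Continuous fun s : ℝ => (1 - ε * Real.cos (2 * Real.pi * s),
      ε * Real.sin (2 * Real.pi * s)))) continuous_const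
  have hcos : ∀ s, |1 - ε * Real.cos (2 * Real.pi * s) - 1| ≤ ε := fun s => by
    have := Real.abs_cos_le_one (2 * Real.pi * s)
    rw [sub_sub_cancel_left, abs_neg, abs_mul, abs_of_pos h0]
    nlinarith
  have hsin : ∀ s, |ε * Real.sin (2 * Real.pi * s)| ≤ ε := fun s => by
    have := Real.abs_sin_le_one (2 * Real.pi * s)
    rw [abs_mul, abs_of_pos h0]
    nlinarith
  have hright : ∀ s ∈ Set.Icc (1 / 4 : ℝ) (3 / 4), D.Free true (f s) := by
    intro s hs
    refine free_of_notMem_proj 0 true (hp _ _ (hcos s) (hsin s) ?_)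
    by_contra hne
    push Not at hne
    have h1 : Real.sin (2 * Real.pi * s) = 0 := (mul_eq_zero.1 hne.1).resolve_left h0.ne'
    have h2 := Real.cos_nonpos_of_pi_div_two_le_of_le (x := 2 * Real.pi * s)
      (by nlinarith [hs.1]) (by nlinarith [hs.2])
    have h3 := Real.sin_sq_add_cos_sq (2 * Real.pi * s)
    rw [h1] at h3
    have h4 := hne.2.2
    nlinarith
  have hq : f (-(1 / 4)) = f (3 / 4) := by
    have := D.tube_add_one_left (Sum.inr e) ε (-(1 / 4)) 0
    rw [htube, htube] at this
    rw [← this]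
    norm_num
  have hstart : D.Free true (f (-(1 / 4))) := hq ▸ hright _ ⟨by norm_num, le_rfl⟩
  refine ⟨(htube _).symm ▸ hstart, ?_⟩
  -- raising the left half of the loop and making it straight
  set F : ℝ → ℝ → ℂ × ℝ := fun s r =>
    (D.nrm b (1 - ε * ((1 - r) * Real.cos (2 * Real.pi * s) + r))
      (ε * ((1 - r) * Real.sin (2 * Real.pi * s) + r * (4 * s))), r * (ε / 2)) with hF
  have hFc : Continuous fun z : ℝ × ℝ => F z.1 z.2 :=
    Continuous.prodMk ((D.continuous_nrm b).comp (by fun_prop :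
      Continuous fun z : ℝ × ℝ => (1 - ε * ((1 - z.2) * Real.cos (2 * Real.pi * z.1) + z.2),
        ε * ((1 - z.2) * Real.sin (2 * Real.pi * z.1) + z.2 * (4 * z.1))))) (by fun_prop)
  have hFproj : ∀ s ∈ Set.Icc (-(1 / 4) : ℝ) (1 / 4), ∀ r ∈ I, s ≠ 0 → (F s r).1 ∉ D.proj := by
    intro s hs r hr hs0
    have k1 := Real.cos_nonneg_of_neg_pi_div_two_le_of_le (x := 2 * Real.pi * s)
      (by nlinarith [hs.1]) (by nlinarith [hs.2])
    have k2 := Real.cos_le_one (2 * Real.pi * s)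
    have k3 := Real.sin_le_one (2 * Real.pi * s)
    have k4 := Real.neg_one_le_sin (2 * Real.pi * s)
    have r0 := hr.1
    have r1 : 0 ≤ 1 - r := by linarith [hr.2]
    refine hp _ _ ?_ ?_ (Or.inl ?_)
    · rw [sub_sub_cancel_left, abs_neg, abs_mul, abs_of_pos h0, abs_of_nonneg (by positivity)]
      exact mul_le_of_le_one_right h0.le (by nlinarith)
    · rw [abs_mul, abs_of_pos h0]
      refine mul_le_of_le_one_right h0.le (abs_le.2 ⟨?_, ?_⟩)
      · nlinarith [hs.1]
      · nlinarith [hs.2]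
    · refine mul_ne_zero h0.ne' ?_
      rcases lt_or_gt_of_ne hs0 with h | h
      · have := Real.sin_neg_of_neg_of_neg_pi_lt (x := 2 * Real.pi * s)
          (by nlinarith) (by nlinarith [hs.1])
        rcases r0.lt_or_eq with r0 | rfl
        · nlinarith
        · linarith
      · have := Real.sin_pos_of_pos_of_lt_pi (x := 2 * Real.pi * s)
          (by nlinarith) (by nlinarith [hs.2])
        rcases r0.lt_or_eq with r0 | rfl
        · nlinarith
        · linarith
  have hI : 1 - ε ∈ I := ⟨by linarith, by linarith⟩
  have hsq : (ε / 2) ^ 2 < (1 - ε) * (1 - (1 - ε)) := by nlinarith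
  have hFlink : ∀ s ∈ Set.Icc (-(1 / 4) : ℝ) (1 / 4), ∀ r ∈ I, F s r ∉ D.link := by
    intro s hs r hr
    rcases eq_or_ne s 0 with rfl | hs0
    · simp only [hF, mul_zero, Real.cos_zero, Real.sin_zero, mul_one, sub_add_cancel, add_zero,
        nrm_zero]
      refine crv_notMem_link b hI ?_ (Or.inr ?_)
      · have : r ^ 2 ≤ 1 := by nlinarith [hr.1, hr.2]
        nlinarith
      · rw [← nrm_zero]
        exact hcirc _ _ (by rw [sub_sub_cancel_left, abs_neg, abs_of_pos h0]; exact hε1)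
          (by simpa using hR.le)
    · exact notMem_link_of_notMem_proj _ (hFproj s hs r hr hs0)
  have hleft := genOn_homotopy (D := D) (F := F) hFc (a := -(1 / 4)) (b := 1 / 4) (i := true)
    (j := true) (by norm_num) hFlink
    (fun r hr => free_of_notMem_proj _ _ (hFproj _ ⟨le_rfl, by norm_num⟩ r hr (by norm_num)))
    (fun r hr => free_of_notMem_proj _ _ (hFproj _ ⟨by norm_num, le_rfl⟩ r hr (by norm_num)))
  have hF0 : (fun s => F s 0) = f := funext fun s => by simp [hF, hf]
  have hF1 : D.genOn (fun s => F s 1) (-(1 / 4)) (1 / 4) true true = D.cross b true := by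
    rw [← genOn_nrm (b := b) h0 hε2 hsq (by simp [sgn]; linarith), genOn, genOn]
    congr 1
    funext u
    exact congrArg₂ Prod.mk (congrArg₂ (D.nrm b) (by ring) (by ring)) (by ring)
  rw [hF0, hF1] at hleft
  have hall := genOn_trans (D := D) hfc (a := -(1 / 4)) (b := 1 / 4) (c := 3 / 4) (by norm_num)
    (by norm_num) (fun s hs => ?_) hstart (hright _ ⟨le_rfl, by norm_num⟩)
    (hright _ ⟨by norm_num, le_rfl⟩)
  · rw [hleft, genOn_free hfc (by norm_num) hright, Category.comp_id] at hall
    rw [hall, genOn]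
    congr 1
    funext u
    rw [htube]
    congr 1
    ring
  · rcases le_total s (1 / 4) with h | h
    · rw [← congrFun hF0 s]
      exact hFlink s ⟨hs.1, h⟩ 0 (by simp)
    · exact (hright s ⟨h, hs.2⟩).notMem

/-- The longitude, moved to the right of the vertical disk, runs below the plane from target to
source and back above it; only the changes of direction at the two ends count, and they are drops
inside the two disks. -/
theorem longitude_edge (e : E) : ∃ ε₀ > 0, ∀ ε, 0 < ε → ε ≤ ε₀ →
    D.gen (fun u : I => D.tube (Sum.inr e) ε (-(1 / 4)) (0 + u)) true true =
      D.baseDrop false (D.target e) ≫ Groupoid.inv (D.baseDrop false (D.source e)) := by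
  have hpi := Real.pi_pos
  set b : E × Bool := (e, true) with hb
  obtain ⟨r₁, hr₁, h1⟩ := exists_drop_nrm (D := D) b
  obtain ⟨r₂, hr₂, h2⟩ := exists_drop_nrm (D := D) (flip b)
  obtain ⟨R₁, hR₁, hc1⟩ := exists_nrm_notMem_circles (D := D) b
  obtain ⟨R₂, hR₂, hc2⟩ := exists_nrm_notMem_circles (D := D) (flip b)
  refine ⟨min (min r₁ r₂) (min (min R₁ R₂) D.eps), lt_min (lt_min hr₁ hr₂) (lt_min
    (lt_min hR₁ hR₂) eps_pos), fun ε h0 hε => ?_⟩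
  have e1 := hε.trans ((min_le_left _ _).trans (min_le_left _ _))
  have e2 := hε.trans ((min_le_left _ _).trans (min_le_right _ _))
  have e3 := hε.trans ((min_le_right _ _).trans ((min_le_left _ _).trans (min_le_left _ _)))
  have e4 := hε.trans ((min_le_right _ _).trans ((min_le_left _ _).trans (min_le_right _ _)))
  have e5 := hε.trans ((min_le_right _ _).trans (min_le_right _ _))
  set f : ℝ → ℂ × ℝ := fun θ =>
    (D.nrm b (1 / 2 + 1 / 2 * Real.cos (2 * Real.pi * θ)) (-ε),
      -(1 / 2 * Real.sin (2 * Real.pi * θ))) with hf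
  have htube : ∀ θ, D.tube (Sum.inr e) ε (-(1 / 4)) θ = f θ := fun θ => by
    rw [tube_inr, show 2 * Real.pi * -(1 / 4) = -(Real.pi / 2) by ring, Real.cos_neg,
      Real.sin_neg, Real.cos_pi_div_two, Real.sin_pi_div_two, mul_zero, sub_zero, mul_neg, mul_one]
  have hfc : Continuous f := Continuous.prodMk ((D.continuous_nrm b).comp (by fun_prop :
    Continuous fun θ : ℝ => (1 / 2 + 1 / 2 * Real.cos (2 * Real.pi * θ), -ε))) (by fun_prop)
  have habs : |-ε| = ε := by rw [abs_neg, abs_of_pos h0]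
  have harcs : ∀ θ, (f θ).1 ∉ D.arcs := fun θ =>
    nrm_notMem_arcs' b ⟨by linarith [Real.neg_one_le_cos (2 * Real.pi * θ)],
      by linarith [Real.cos_le_one (2 * Real.pi * θ)]⟩ (habs.trans_le e5) (by linarith)
  have hone : D.nrm b 1 (-ε) ∉ D.circles := hc1 _ _ (by simpa using hR₁.le) (habs.trans_le e3)
  have hzero : D.nrm b 0 (-ε) ∉ D.circles := by
    have := hc2 1 ε (by simpa using hR₂.le) ((abs_of_pos h0).trans_le e4)
    rwa [nrm_flip, sub_self] at this
  have f0 : f 0 = (D.nrm b 1 (-ε), 0) := by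
    simp only [hf, mul_zero, Real.cos_zero, Real.sin_zero]; norm_num
  have f1 : f 1 = (D.nrm b 1 (-ε), 0) := by
    simp only [hf, mul_one, Real.cos_two_pi, Real.sin_two_pi]; norm_num
  have f2 : f (1 / 2) = (D.nrm b 0 (-ε), 0) := by
    rw [hf]
    simp only
    rw [show 2 * Real.pi * (1 / 2) = Real.pi by ring, Real.cos_pi, Real.sin_pi]; norm_num
  have hfree : ∀ θ i, 0 < sgn i * (f θ).2 ∨ (f θ).1 ∉ D.circles → D.Free i (f θ) := fun θ i h =>
    free_of_notMem_arcs (harcs θ) h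
  have hend : ∀ i, D.Free i (f 0) ∧ D.Free i (f (1 / 2)) ∧ D.Free i (f 1) := fun i =>
    ⟨hfree _ _ (Or.inr (by rw [f0]; exact hone)), hfree _ _ (Or.inr (by rw [f2]; exact hzero)),
      hfree _ _ (Or.inr (by rw [f1]; exact hone))⟩
  have hdown : ∀ θ ∈ Set.Icc (0 : ℝ) (1 / 2), D.Free false (f θ) := fun θ hθ => by
    rcases hθ.1.lt_or_eq with h | rfl
    · rcases hθ.2.lt_or_eq with h' | rfl
      · have := Real.sin_pos_of_pos_of_lt_pi (x := 2 * Real.pi * θ) (by positivity) (by nlinarith)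
        exact hfree _ _ (Or.inl (by simp only [hf, sgn]; simpa using this))
      · exact (hend _).2.1
    · exact (hend _).1
  have hup : ∀ θ ∈ Set.Icc (1 / 2 : ℝ) 1, D.Free true (f θ) := fun θ hθ => by
    rcases hθ.1.lt_or_eq with h | rfl
    · rcases hθ.2.lt_or_eq with h' | rfl
      · have := Real.sin_pos_of_pos_of_lt_pi (x := 2 * Real.pi * θ - Real.pi) (by nlinarith)
          (by nlinarith)
        rw [Real.sin_sub_pi] at this
        exact hfree _ _ (Or.inl (by simp only [hf, sgn, if_true]; linarith))
      · exact (hend _).2.2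
    · exact (hend _).2.1
  have hall := genOn_trans (D := D) hfc (a := 0) (b := 1 / 2) (c := 1) (by norm_num) (by norm_num)
    (fun θ hθ => (le_total θ (1 / 2)).elim (fun h => (hdown θ ⟨hθ.1, h⟩).notMem)
      fun h => (hup θ ⟨h, hθ.2⟩).notMem) (hend true).1 (hend true).2.1 (hend true).2.2
  rw [genOn_free hfc (by norm_num) hup, Category.comp_id, genOn_of_free_not (D := D) hfc
    (by norm_num) hdown (hend true).1 (hend true).2.1] at hall
  have d1 : D.drop (D.nrm b 1 (-ε)) = D.baseDrop false (D.target e) := by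
    rw [← sub_zero 1, ← nrm_flip]
    exact h2 ε h0.ne' ((abs_of_pos h0).trans_le e2)
  have d2 : D.drop (D.nrm b 0 (-ε)) = D.baseDrop false (D.source e) :=
    h1 _ (by linarith) (habs.trans_le e1)
  have hin := vert_inv (D := D) (hend true).2.1 (hend false).2.1
  rw [f0, f2] at hall
  rw [f2] at hin
  rw [← d1, ← d2, drop, drop, hin]
  refine Eq.trans ?_ hall.symm
  rw [genOn]
  congr 1
  funext u
  rw [htube]
  congr 1
  ring

end PlaneDrawing

/-! ### The action of the plane graph on the arrows to the base point -/

/-- Precomposition with an arrow, as an isomorphism of preorders. -/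
def precompIso {C : Type*} [Groupoid C] {x₀ q q' : C} {le : End x₀ → End x₀ → Prop}
    (hle : IsLeftTotalPreorder le) (c : q ⟶ q') :
    @OrderIso (q' ⟶ x₀) (q ⟶ x₀) (homPreorder hle q').toLE (homPreorder hle q).toLE :=
  letI := homPreorder hle q
  letI := homPreorder hle q'
  { toFun := fun h => c ≫ h
    invFun := fun h => Groupoid.inv c ≫ h
    left_inv := fun h => by simp
    right_inv := fun h => by simp
    map_rel_iff' := fun {h k} => comp_le_comp_iff hle c h k }

namespace PlaneDrawing

variable {V E : Type*} {D : PlaneDrawing V E} [Finite V] [Finite E]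

theorem IsMeridianLongitudePair.exists_vertex {v : V} {x₀ : D.exterior}
    {m l : FundamentalGroup D.exterior x₀} (h : D.IsMeridianLongitudePair (Sum.inl v) x₀ m l) :
    ∃ w : D.base ⟶ FundamentalGroupoid.mk x₀,
      m = (Groupoid.inv w ≫ (D.baseDrop true v ≫ Groupoid.inv (D.baseDrop false v)) ≫ w :
        FundamentalGroupoid.mk x₀ ⟶ _) ∧
      l = (Groupoid.inv w ≫ IsGood.crossProd D (D.darts v) ≫ w :
        FundamentalGroupoid.mk x₀ ⟶ _) := by
  obtain ⟨δ, hδ, hall⟩ := h.exists_gen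
  have hr := tubeRadius_pos (D := D) v
  set ε := min δ (D.tubeRadius v / 2)
  have h0 : 0 < ε := lt_min hδ (by linarith)
  have hε : ε < D.tubeRadius v := (min_le_right _ _).trans_lt (by linarith)
  have habs : |D.radius v - ε - D.radius v| < D.tubeRadius v := by
    rw [abs_of_neg] <;> linarith
  obtain ⟨w, hm, hl⟩ := (hall ε h0 (min_le_left _ _)).2 0 (D.baseAngle v / (2 * Real.pi)) (by
    rw [tube_inl, mul_zero, Real.cos_zero, mul_one, mul_div_cancel₀ _ Real.two_pi_pos.ne']
    exact free_of_notMem_proj _ _ fun h => h.elim (circ_baseAngle_notMem_arcs habs)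
      (circ_notMem_circles habs (by linarith) _))
  rw [meridian_vertex h0 hε] at hm
  rw [longitude_vertex h0 hε] at hl
  exact ⟨w, hm, hl⟩

theorem IsMeridianLongitudePair.exists_edge {e : E} {x₀ : D.exterior}
    {m l : FundamentalGroup D.exterior x₀} (h : D.IsMeridianLongitudePair (Sum.inr e) x₀ m l) :
    ∃ w : D.base ⟶ FundamentalGroupoid.mk x₀,
      m = (Groupoid.inv w ≫ D.cross (e, true) true ≫ w : FundamentalGroupoid.mk x₀ ⟶ _) ∧
      l = (Groupoid.inv w ≫ (D.baseDrop false (D.target e) ≫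
        Groupoid.inv (D.baseDrop false (D.source e))) ≫ w : FundamentalGroupoid.mk x₀ ⟶ _) := by
  obtain ⟨δ, hδ, hall⟩ := h.exists_gen
  obtain ⟨ε₁, h1, hmer⟩ := meridian_edge (D := D) e
  obtain ⟨ε₂, h2, hlon⟩ := longitude_edge (D := D) e
  set ε := min δ (min ε₁ ε₂)
  have h0 : 0 < ε := lt_min hδ (lt_min h1 h2)
  obtain ⟨hf, hmer⟩ := hmer ε h0 ((min_le_right _ _).trans (min_le_left _ _))
  obtain ⟨w, hm, hl⟩ := (hall ε h0 (min_le_left _ _)).2 _ _ hf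
  rw [hmer] at hm
  rw [hlon ε h0 ((min_le_right _ _).trans (min_le_right _ _))] at hl
  exact ⟨w, hm, hl⟩

theorem cross_comp_drop_sidePt (o : Bool) (b : E × Bool) :
    D.cross b true ≫ D.drop (D.sidePt o 1 b) = D.drop (D.sidePt o (-1) b) ≫ D.cross b false := by
  obtain ⟨-, ho, hg⟩ := isGood_basePt (D := D) o (D.tail b)
  obtain ⟨t, χ, ht, ht1, -, -, -, hcr⟩ := hg.cross b rfl
  have h := cross_comp_drop ht (by linarith [D.exT_pos (flip b)]) hcr fun _ _ => hg.circles _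
  obtain ⟨h1, h2⟩ := hg.conn_side rfl ho
  simp only [window_one, window_neg_one, ← sub_eq_add_neg] at h
  rwa [h1.drop_eq, h2.drop_eq] at h

/-- Shifting a comparison through a crossing. -/
theorem inv_drop_comp_cross (o : Bool) (b : E × Bool) {x₀ : FundamentalGroupoid D.exterior}
    (h : D.base ⟶ x₀) :
    Groupoid.inv (D.drop (D.sidePt o (-1) b)) ≫ D.cross b true ≫ h =
      D.cross b false ≫ Groupoid.inv (D.drop (D.sidePt o 1 b)) ≫ h := by
  have h1 := congrArg (fun a => Groupoid.inv (D.drop (D.sidePt o (-1) b)) ≫ a ≫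
    Groupoid.inv (D.drop (D.sidePt o 1 b)) ≫ h) (cross_comp_drop_sidePt (D := D) o b)
  simpa using h1

section actingMap

variable {x₀ : D.exterior} {le : FundamentalGroup D.exterior x₀ → FundamentalGroup D.exterior x₀ → Prop}
  (hle : IsLeftTotalPreorder le)

/-- The plane graph acts on the arrows from infinity to the base point. -/
def actingMap (hedge : ∀ e (h : D.base ⟶ FundamentalGroupoid.mk x₀),
    ((homPreorder hle _).le h (D.cross (e, true) true ≫ h) ↔ (homPreorder hle _).le h
      ((D.baseDrop false (D.target e) ≫ Groupoid.inv (D.baseDrop false (D.source e))) ≫ h)) ∧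
    ((homPreorder hle _).le (D.cross (e, true) true ≫ h) h ↔ (homPreorder hle _).le
      ((D.baseDrop false (D.target e) ≫ Groupoid.inv (D.baseDrop false (D.source e))) ≫ h) h)) :
    @ActingMap V (E × Bool) (D.base ⟶ FundamentalGroupoid.mk x₀)
      (D.base ⟶ FundamentalGroupoid.mk x₀) (homPreorder hle _) (homPreorder hle _) :=
  letI := homPreorder hle D.base
  { ν := D.rot
    α := flip
    vtx := D.tail
    X := fun b => precompIso hle (D.cross b true)
    pot := fun v h => Groupoid.inv (D.baseDrop false v) ≫ h
    lev := fun b h => Groupoid.inv (D.drop (D.sidePt true (-1) b)) ≫ h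
    α_α := flip_flip
    α_ne := flip_ne
    vtx_ν := D.tail_rot
    exists_iterate := fun _ _ h => exists_iterate_rot h
    X_α := fun b => by
      refine RelIso.ext fun h => ?_
      change D.cross (flip b) true ≫ h = Groupoid.inv (D.cross b true) ≫ h
      rw [cross_flip]
    lev_face := fun b => by
      funext h
      rw [← (conn_rot true (flip b)).drop_eq, sidePt_flip]
    pot_mono := fun v => (precompIso hle _).monotone
    lev_mono := fun b => (precompIso hle _).monotone
    -- Both drops on the right of `b` are moved past the crossing, where they become drops on its
    -- left after the lower crossing, which cancels. Inside the disk the two sides agree; outside,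
    -- the left side is the next corner.
    transport := fun b h => by
      change (homPreorder hle _).le _ _ ↔ (homPreorder hle _).le (_ ≫ D.cross b true ≫ h) (_ ≫ D.cross b true ≫ h)
      rw [← drop_sidePt b (Or.inr rfl), inv_drop_comp_cross, inv_drop_comp_cross,
        comp_le_comp_iff, (conn_inner b).drop_eq, (conn_rot true b).drop_eq]
    transport_ge := fun b h => by
      change (homPreorder hle _).le _ _ ↔ (homPreorder hle _).le (_ ≫ D.cross b true ≫ h) (_ ≫ D.cross b true ≫ h)
      rw [← drop_sidePt b (Or.inr rfl), inv_drop_comp_cross, inv_drop_comp_cross,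
        comp_le_comp_iff, (conn_inner b).drop_eq, (conn_rot true b).drop_eq]
    edge := by
      rintro ⟨e, i⟩ h
      -- The reversed dart has the inverse crossing, so it uses the reversed comparison of meridian
      -- and longitude.
      cases i
      · change (homPreorder hle _).le h (D.cross (flip (e, true)) true ≫ h) ↔
          (homPreorder hle _).le (Groupoid.inv (D.baseDrop false (D.source e)) ≫ h)
            (Groupoid.inv (D.baseDrop false (D.target e)) ≫ h)
        rw [cross_flip, le_inv_comp_iff, (hedge e h).2, le_inv_comp_iff, Category.assoc]
      · change (homPreorder hle _).le h (D.cross (e, true) true ≫ h) ↔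
          (homPreorder hle _).le (Groupoid.inv (D.baseDrop false (D.target e)) ≫ h)
            (Groupoid.inv (D.baseDrop false (D.source e)) ≫ h)
        rw [(hedge e h).1, inv_comp_le_iff, Category.assoc]
    planar := fun S b hS hb hl => not_cornerLinked hS hb hl }

end actingMap

end PlaneDrawing

namespace PlaneDrawing

variable {V E : Type*} {D : PlaneDrawing V E} [Finite V] [Finite E]

/-! ### Full turns as longitudes -/

section fullTurn

variable {O O' : Type*} [Preorder O] [Preorder O'] {M : ActingMap V (E × Bool) O O'}

omit [Finite V] in
theorem iterate_rot_symm {b : E × Bool} {L : List (E × Bool)} {v : V} (hL : D.darts v = b :: L)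
    {k : ℕ} (hk : k + 1 ≤ (D.darts v).length) : D.rot.symm^[k + 1] b =
      (D.darts v)[(D.darts v).length - (k + 1)]'(by omega) := by
  have h0 : (D.darts v)[0]'(by omega) = b := by simp [hL]
  have h1 := iterate_rot_getElem (D := D) (v := v) (i := (D.darts v).length - (k + 1))
    (by omega) (k + 1)
  have h2 : ((D.darts v).length - (k + 1) + (k + 1)) % (D.darts v).length = 0 := by
    rw [Nat.sub_add_cancel hk, Nat.mod_self]
  simp only [h2, h0] at h1
  rw [← h1]
  exact D.rot.leftInverse_symm.iterate (k + 1) _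

omit [Finite V] in
theorem deg_eq (hν : M.ν = D.rot) {b : E × Bool} {L : List (E × Bool)} {v : V}
    (hL : D.darts v = b :: L) : M.deg b = (D.darts v).length := by
  have hlen : (D.darts v).length = L.length + 1 := by rw [hL]; rfl
  have h0 : (D.darts v)[0]'(by omega) = b := by simp [hL]
  have hper : Function.IsPeriodicPt D.rot.symm (D.darts v).length b := by
    have := iterate_rot_symm hL (k := L.length) (by omega)
    change D.rot.symm^[(D.darts v).length] b = b
    conv_lhs => rw [hlen]
    refine this.trans (Eq.trans ?_ h0)
    simp only [← hlen, Nat.sub_self]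
  have hpos : 0 < M.deg b := M.deg_pos b
  have hle : M.deg b ≤ (D.darts v).length := by
    rw [ActingMap.deg, hν]
    exact hper.minimalPeriod_le (by omega)
  refine hle.antisymm (not_lt.1 fun hlt => ?_)
  obtain ⟨k, hk⟩ := Nat.exists_eq_succ_of_ne_zero hpos.ne'
  have h1 := iterate_rot_symm hL (k := k) (by omega)
  have h2 := M.iterate_deg b
  rw [hν, hk, h1] at h2
  have h3 := (nodup_darts v).getElem_inj_iff.1 (h2.trans h0.symm)
  omega

/-- A clockwise turn from the first dart meets the darts from the end of the list. Each new crossing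
is composed on the side of infinity, so the product so far is that of a suffix in the original
order. -/
theorem turnState_eq {x₀ : FundamentalGroupoid D.exterior} [Preorder (D.base ⟶ x₀)]
    {M : ActingMap V (E × Bool) (D.base ⟶ x₀) O'} (hν : M.ν = D.rot)
    (hX : ∀ b h, M.X b h = D.cross b true ≫ h) {b : E × Bool}
    {L : List (E × Bool)} {v : V} (hL : D.darts v = b :: L) (h : D.base ⟶ x₀) {k : ℕ}
    (hk : k ≤ (D.darts v).length) : M.turnState k b h =
      IsGood.crossProd D ((D.darts v).drop ((D.darts v).length - k)) ≫ h := by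
  induction k with
  | zero => simp [IsGood.crossProd, ActingMap.turnState]
  | succ k ih =>
    rw [ActingMap.turnState_succ, ih (by omega), hX, hν, iterate_rot_symm hL hk,
      List.drop_eq_getElem_cons (by omega : (D.darts v).length - (k + 1) < (D.darts v).length),
      show (D.darts v).length - (k + 1) + 1 = (D.darts v).length - k by omega]
    simp [IsGood.crossProd]

theorem fullTurn_eq {x₀ : FundamentalGroupoid D.exterior} [Preorder (D.base ⟶ x₀)]
    {M : ActingMap V (E × Bool) (D.base ⟶ x₀) O'} (hν : M.ν = D.rot)
    (hX : ∀ b h, M.X b h = D.cross b true ≫ h) {b : E × Bool}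
    {L : List (E × Bool)} {v : V} (hL : D.darts v = b :: L) (h : D.base ⟶ x₀) :
    M.fullTurn b h = IsGood.crossProd D (D.darts v) ≫ h := by
  rw [ActingMap.fullTurn, deg_eq hν hL, turnState_eq hν hX hL h le_rfl, Nat.sub_self, List.drop_zero]

end fullTurn

/-! ### Connected components -/

omit [Finite V] [Finite E] in
theorem exists_dart_of_adj {u v : V} (h : D.graph.Adj u v) :
    ∃ b, D.tail b = u ∧ D.tail (flip b) = v := by
  rw [graph, SimpleGraph.fromRel_adj] at h
  obtain ⟨-, ⟨e, rfl, rfl⟩ | ⟨e, rfl, rfl⟩⟩ := h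
  · exact ⟨(e, true), rfl, rfl⟩
  · exact ⟨(e, false), rfl, rfl⟩

omit [Finite V] [Finite E] in
theorem reachable_tail_flip (b : E × Bool) : D.graph.Reachable (D.tail b) (D.tail (flip b)) := by
  by_cases h : D.tail b = D.tail (flip b)
  · rw [h]
  · refine SimpleGraph.Adj.reachable ?_
    rw [graph, SimpleGraph.fromRel_adj]
    obtain ⟨e, i⟩ := b
    cases i
    · exact ⟨h, Or.inr ⟨e, rfl, rfl⟩⟩
    · exact ⟨h, Or.inl ⟨e, rfl, rfl⟩⟩

section component

variable {O O' : Type*} [Preorder O] [Preorder O'] {M : ActingMap V (E × Bool) O O'}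

omit [Finite V] in
theorem reachable_of_mem_component (hν : M.ν = D.rot) (hα : M.α = flip) {b x : E × Bool}
    (h : x ∈ M.component b) : D.graph.Reachable (D.tail b) (D.tail x) := by
  induction (show Relation.ReflTransGen M.Step b x from h) with
  | refl => rfl
  | tail _ hs ih =>
    refine (ih ‹_›).trans ?_
    rcases hs with h | h | h
    · rw [h, hν, tail_rot]
    · rw [h, hν, tail_rot]
    · rw [h, hα]; exact reachable_tail_flip _

omit [Finite V] [Finite E] in
theorem exists_mem_component (hα : M.α = flip) (hvtx : M.vtx = D.tail) {b : E × Bool} {v : V}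
    (h : D.graph.Reachable (D.tail b) v) : ∃ x ∈ M.component b, D.tail x = v := by
  rw [SimpleGraph.reachable_iff_reflTransGen] at h
  induction h with
  | refl => exact ⟨b, M.mem_component_self b, rfl⟩
  | tail _ hs ih =>
    obtain ⟨x, hx, hxv⟩ := ih
    obtain ⟨y, hy, hy'⟩ := exists_dart_of_adj hs
    exact ⟨flip y, ActingMap.mem_component_of_step (ActingMap.mem_component_of_vtx_eq
      (y := y) hx (by rw [hvtx, hxv, hy])) (Or.inr (Or.inr (by rw [hα]))), hy'⟩

omit [Finite V] in
theorem exists_darts_eq_cons {b : E × Bool} {v : V} (h : D.tail b = v) :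
    ∃ c L, D.darts v = c :: L ∧ D.tail c = v := by
  rcases hL : D.darts v with _ | ⟨c, L⟩
  · have := mem_darts.2 h
    rw [hL] at this
    exact absurd this List.not_mem_nil
  · exact ⟨c, L, rfl, mem_darts.1 (by rw [hL]; simp)⟩

end component

omit [Finite V] [Finite E] in
theorem exists_reachable_dart {u v : V} (h : D.graph.Reachable u v) (huv : u ≠ v) :
    ∃ b, D.tail b = u := by
  rw [SimpleGraph.reachable_iff_reflTransGen] at h
  rcases h.cases_head with h | ⟨w, hw, -⟩
  · exact absurd h huv
  · obtain ⟨b, hb, -⟩ := exists_dart_of_adj hw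
    exact ⟨b, hb⟩

/-! ### States fixed by all loops -/

/-- If all arcs and circles can be crossed without changing the class of `h₀`, then all loops
preserve it. -/
theorem equiv_of_cross {x₀ : FundamentalGroupoid D.exterior}
    [Preorder (D.base ⟶ x₀)] (hcomp : ∀ (c : D.base ⟶ D.base) (h k : D.base ⟶ x₀),
      c ≫ h ≤ c ≫ k ↔ h ≤ k) {h₀ : D.base ⟶ x₀}
    (hX : ∀ b, OrdEquiv (D.cross b true ≫ h₀) h₀)
    (hlev : ∀ b, OrdEquiv (Groupoid.inv (D.baseDrop false (D.tail b)) ≫ h₀)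
      (Groupoid.inv (D.drop (D.sidePt true (-1) b)) ≫ h₀))
    (hisolated : ∀ v, D.darts v = [] → OrdEquiv (Groupoid.inv (D.baseDrop false v) ≫ h₀)
      (Groupoid.inv (D.baseDrop true v) ≫ h₀)) (a : D.base ⟶ D.base) :
    OrdEquiv (a ≫ h₀) h₀ := by
  have hiff : ∀ (c : D.base ⟶ D.base) {h k : D.base ⟶ x₀}, OrdEquiv h k →
      OrdEquiv (c ≫ h) (c ≫ k) := fun c h k e => ⟨(hcomp c h k).2 e.1, (hcomp c k h).2 e.2⟩
  have hinv : ∀ a : D.base ⟶ D.base, OrdEquiv (a ≫ h₀) h₀ → OrdEquiv (Groupoid.inv a ≫ h₀) h₀ :=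
    fun a e => by simpa using (hiff (Groupoid.inv a) e).symm
  -- The equivalence class of `h₀` moved through `z` is the locally constant function to which
  -- `eq_of_sides` applies; at `D.bound + 1` the drop is trivial.
  set κ : ℂ → Set (D.base ⟶ x₀) := fun z => {k | OrdEquiv k (Groupoid.inv (D.drop z) ≫ h₀)}
  have hκ : ∀ z w, OrdEquiv (Groupoid.inv (D.drop z) ≫ h₀) (Groupoid.inv (D.drop w) ≫ h₀) →
      κ z = κ w := fun z w e => Set.ext fun k => ⟨fun h => h.trans e, fun h => h.trans e.symm⟩
  have hdrop : ∀ z, z ∉ D.proj → OrdEquiv (Groupoid.inv (D.drop z) ≫ h₀) h₀ := by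
    intro z hz
    have hb : D.bound < ‖((D.bound + 1 : ℝ) : ℂ)‖ := by
      have := bound_pos (D := D)
      rw [Complex.norm_real, Real.norm_eq_abs, abs_of_pos] <;> linarith
    have h1 : κ z = κ ((D.bound + 1 : ℝ) : ℂ) := by
      refine eq_of_sides (D := D) (fun z w h => by simp only [κ, h.drop_eq]) (fun b => ?_)
        (fun v => ?_) hz fun h => absurd (norm_le_bound_of_mem_proj h) (not_le.2 hb)
      · refine hκ _ _ ?_
        rw [(conn_rot true b).drop_eq]
        have := hlev (D.rot b)
        rw [tail_rot] at this
        exact this.symm.trans (hlev b)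
      · refine hκ _ _ ?_
        rcases hL : D.darts v with _ | ⟨b, L⟩
        · exact hisolated v hL
        · have hbv : D.tail b = v := mem_darts.1 (by rw [hL]; simp)
          have := hlev b
          obtain ⟨-, ho, hg⟩ := isGood_basePt (D := D) true v
          rw [hbv, ← (hg.conn_base hL ho).drop_eq] at this
          exact this
    have h2 : Groupoid.inv (D.drop z) ≫ h₀ ∈ κ z := OrdEquiv.refl _
    rw [h1] at h2
    refine h2.trans ?_
    have h3 : Groupoid.inv (D.drop ((D.bound + 1 : ℝ) : ℂ)) ≫ h₀ = h₀ := by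
      rw [drop_eq_one hb]; simp
    rw [h3]
    exact OrdEquiv.refl _
  have hstab : D.IsStab fun a => OrdEquiv (a ≫ h₀) h₀ :=
    { one := by rw [Category.id_comp]; exact OrdEquiv.refl _
      comp := fun a b ha hb => by rw [Category.assoc]; exact (hiff a hb).trans ha
      inv := hinv
      cross := hX
      drop := fun z hz => by simpa using hinv _ (hdrop z hz) }
  exact hstab.all a

end PlaneDrawing

end

/-! ### The theorem -/

theorem theorem2p6 {V E : Type*} [Finite V] [Finite E] (D : PlaneDrawing V E)
    (Vplus : Set V)
    (hVplus : ∀ C : D.graph.ConnectedComponent, ∃ v ∈ Vplus, D.graph.connectedComponentMk v = C)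
    (vo : V) (hvo : vo ∈ Vplus) (x₀ : D.exterior) :
    ¬ ∃ le : FundamentalGroup D.exterior x₀ → FundamentalGroup D.exterior x₀ → Prop,
      IsLeftTotalPreorder le ∧ IsProperRel le ∧
      (∀ e : E, ∃ m l, D.IsMeridianLongitudePair (Sum.inr e) x₀ m l ∧
        ∀ g, WeaklyDetectsNegative le (g * m * g⁻¹) (g * l * g⁻¹)) ∧
      (∀ v : V, v ∉ Vplus → ∃ m l, D.IsMeridianLongitudePair (Sum.inl v) x₀ m l ∧
        StronglyDetects le m l 0 1) ∧
      (∀ v ∈ Vplus, v ≠ vo → ∃ m l, D.IsMeridianLongitudePair (Sum.inl v) x₀ m l ∧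
        ∀ g, WeaklyDetectsPositive le (g * m * g⁻¹) (g * l * g⁻¹)) ∧
      (∃ m l, D.IsMeridianLongitudePair (Sum.inl vo) x₀ m l ∧
        WeaklyDetectsPositive le m l) := by
  rintro ⟨le, hle, hproper, ha, hb, hc, hd⟩
  let _ := homPreorder hle D.base
  have hcomp : ∀ (c : D.base ⟶ D.base) (h k : D.base ⟶ FundamentalGroupoid.mk x₀),
      c ≫ h ≤ c ≫ k ↔ h ≤ k := comp_le_comp_iff hle
  have htot : ∀ h k : D.base ⟶ FundamentalGroupoid.mk x₀, h ≤ k ∨ k ≤ h := homPreorder_total hle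
  let M := PlaneDrawing.actingMap hle fun e h => by
    obtain ⟨m, l, hml, hneg⟩ := ha e
    obtain ⟨w, hm, hl⟩ := hml.exists_edge
    obtain ⟨g, hg⟩ := exists_conj_eq w h
    exact (hneg g).comp_iff hle (hg m _ hm) (hg l _ hl)
  have hX : ∀ b h, M.X b h = D.cross b true ≫ h := fun b h => rfl
  -- the condition at a vertex that comes from a positive slope
  let P : V → (D.base ⟶ FundamentalGroupoid.mk x₀) → Prop := fun v h =>
    (h ≤ (D.baseDrop true v ≫ Groupoid.inv (D.baseDrop false v)) ≫ h ↔
      PlaneDrawing.IsGood.crossProd D (D.darts v) ≫ h ≤ h) ∧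
    ((D.baseDrop true v ≫ Groupoid.inv (D.baseDrop false v)) ≫ h ≤ h ↔
      h ≤ PlaneDrawing.IsGood.crossProd D (D.darts v) ≫ h)
  have hcP : ∀ v ∈ Vplus, v ≠ vo → ∀ h, P v h := by
    intro v hv hvo h
    obtain ⟨m, l, hml, hpos⟩ := hc v hv hvo
    obtain ⟨w, hm, hl⟩ := hml.exists_vertex
    obtain ⟨g, hg⟩ := exists_conj_eq w h
    exact (hpos g).comp_iff hle (hg m _ hm) (hg l _ hl)
  -- At `vo` only one conjugate is available, which gives the vertex condition at a single state;
  -- this is the state shown to be fixed.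
  obtain ⟨h₀, hP₀⟩ : ∃ h₀, P vo h₀ := by
    obtain ⟨m, l, hml, hpos⟩ := hd
    obtain ⟨w, hm, hl⟩ := hml.exists_vertex
    exact ⟨w, hpos.comp_iff hle hm hl⟩
  have hbal : ∀ {v b L} {h : D.base ⟶ FundamentalGroupoid.mk x₀}, D.darts v = b :: L → P v h →
      M.Balanced b h := by
    intro v b L h hL hP
    have hbv : D.tail b = v := PlaneDrawing.mem_darts.1 (by rw [hL]; simp)
    have hlev : M.lev b h = Groupoid.inv (D.baseDrop true v) ≫ h := by
      obtain ⟨-, ho, hg⟩ := PlaneDrawing.isGood_basePt (D := D) true v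
      rw [PlaneDrawing.baseDrop, PlaneDrawing.basePt, (hg.conn_base hL ho).drop_eq]
      rfl
    have hpot : M.pot (M.vtx b) h = Groupoid.inv (D.baseDrop false v) ≫ h := by
      rw [← hbv]; rfl
    rw [ActingMap.Balanced, ActingMap.Up, hlev, hpot, PlaneDrawing.fullTurn_eq rfl hX hL]
    refine ⟨?_, ?_⟩
    · rw [← hP.2, Category.assoc]
      exact le_inv_comp_iff hle _ _ _
    · rw [← hP.1, Category.assoc]
      exact inv_comp_le_iff hle _ _ _
  -- roots of the components
  have hroot : ∀ u, ∃ v, D.graph.Reachable u v ∧ P v h₀ ∧ (v = vo ∨ ¬ D.graph.Reachable u vo) := by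
    intro u
    by_cases hu : D.graph.Reachable u vo
    · exact ⟨vo, hu, hP₀, Or.inl rfl⟩
    · obtain ⟨v, hv, huv⟩ := hVplus (D.graph.connectedComponentMk u)
      have huv' := (SimpleGraph.ConnectedComponent.exact huv).symm
      exact ⟨v, huv', hcP v hv (fun h => hu (h ▸ huv')) h₀, Or.inr hu⟩
  have hrigid : ∀ b, OrdEquiv (M.X b h₀) h₀ ∧
      OrdEquiv (M.pot (M.vtx b) h₀) (M.lev b h₀) := by
    intro b
    obtain ⟨v, hv, hPv, hvo'⟩ := hroot (D.tail b)
    obtain ⟨x, hx, hxv⟩ := PlaneDrawing.exists_mem_component (M := M) rfl rfl hv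
    obtain ⟨c, L, hL, hcv⟩ := PlaneDrawing.exists_darts_eq_cons hxv
    have hcb : c ∈ M.component b :=
      ActingMap.mem_component_of_vtx_eq hx (hxv.trans hcv.symm : D.tail x = D.tail c)
    have := M.rigid_of_balanced htot htot (hbal hL hPv) (fun y hy hyc => ?_) b
      (ActingMap.mem_component_symm hcb)
    · exact ⟨this.1, this.2.2⟩
    · have hyc' : D.tail y ≠ v := fun h => hyc (h.trans hcv.symm)
      have hvy : D.graph.Reachable v (D.tail y) :=
        hcv ▸ PlaneDrawing.reachable_of_mem_component (M := M) rfl rfl hy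
      obtain ⟨z, L', hL', hz⟩ := PlaneDrawing.exists_darts_eq_cons (D := D) (rfl : D.tail y = _)
      refine ⟨z, hz, ?_⟩
      by_cases hyV : D.tail y ∈ Vplus
      · refine Or.inl fun h => hbal hL' (hcP _ hyV (fun h => ?_) h)
        rcases hvo' with h' | h'
        · exact hyc' (h.trans h'.symm)
        · exact h' (h ▸ hv.trans hvy)
      · refine Or.inr fun h => ?_
        obtain ⟨m, l, hml, hstr⟩ := hb _ hyV
        obtain ⟨w, -, hl⟩ := hml.exists_vertex
        rw [PlaneDrawing.fullTurn_eq rfl hX hL']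
        exact hstr.comp_iff hle hl h
  have hall := PlaneDrawing.equiv_of_cross hcomp (h₀ := h₀) (fun b => (hrigid b).1)
    (fun b => (hrigid b).2) fun v hv => by
      obtain ⟨u, hu, hPu, -⟩ := hroot v
      -- A vertex without darts is its own component, hence its own root. Its longitude is trivial,
      -- so the vertex condition makes the meridian act trivially on `h₀`.
      obtain rfl : v = u := by
        by_contra hne
        obtain ⟨b, hb⟩ := PlaneDrawing.exists_reachable_dart hu hne
        have := PlaneDrawing.mem_darts.2 hb
        rw [hv] at this
        exact List.not_mem_nil this
      have h1 : PlaneDrawing.IsGood.crossProd D (D.darts v) ≫ h₀ = h₀ := by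
        rw [hv]; exact Category.id_comp _
      have h2 := hPu.1.2 h1.le
      have h3 := hPu.2.2 h1.ge
      rw [Category.assoc] at h2 h3
      exact ⟨(le_inv_comp_iff hle _ _ _).2 h3, (inv_comp_le_iff hle _ _ _).2 h2⟩
  -- Each group element is the conjugate by `h₀` of a loop at infinity; that loop fixes the class of
  -- `h₀`, so the element is in the residue group.
  refine hproper (Set.eq_univ_of_forall fun g => ?_)
  have hg := hall (h₀ ≫ (g : FundamentalGroupoid.mk x₀ ⟶ _) ≫ Groupoid.inv h₀)
  have e : (g : FundamentalGroup D.exterior x₀) = (Groupoid.inv h₀ ≫ (h₀ ≫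
      (g : FundamentalGroupoid.mk x₀ ⟶ _) ≫ Groupoid.inv h₀) ≫ h₀ :
        FundamentalGroupoid.mk x₀ ⟶ _) := by simp
  rw [e]
  exact ⟨hg.2, (conj_le_one_iff hle _ _).2 hg.1⟩
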